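/- Let $p$ be a prime, $n\ge 1$, $q=p^n$ with $q\equiv 1 \pmod 4$. Let $\mathcal{H}_q$ be the Hermitian curve $X^{q+1}-Y^{q+1}-Z^{q+1}=0$ over $\mathbb{F}_{q^2}$, let $\mathrm{PGU}(3,q)\le \mathrm{PGL}(3,q^2)$ be the group of projectivities induced by the matrices preserving the associated Hermitian form, and let $\mathcal{M}_q$ be the stabilizer in $\mathrm{PGU}(3,q)$ of the point $P=(0:0:1)\notin\mathcal{H}_q$. The determinant of an element of $\mathcal{M}_q$ is the determinant of its representative matrix with entry $1$ in the third row and column. Let $\mathrm{SU}^{\pm}(2,q)$ be the subgroup of the elements of $\mathcal{M}_q$ of determinant $\pm1$, and let $H$ be the subgroup of the elements of determinant $1$. Then $H\cong \mathrm{SL}(2,q)$ and $\mathrm{SU}^{\pm}(2,q)=H\rtimes C_2$. The following is the complete list of subgroups $G$ of $\mathrm{SU}^{\pm}(2,q)$: every subgroup is contained in $H$ or is of one of the types 1--9 below. 1. Cyclic groups of order $2$. 2. Groups $\mathrm{SL}(2,3)\rtimes C_2\cong \mathrm{SmallGroup}(48,29)\cong \mathrm{GL}(2,3)$, when $p\ge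 5$ and $8\nmid (q-1)$. 3. Cyclic groups of order $2d>2$, where either $d\mid (q-1)$ and $d\nmid\frac{q-1}{2}$, or $d\mid (q+1)$ and $d$ is odd. 4. Abelian groups $C_d\times C_2$, where $d\mid (q+1)$ and $d$ is even. 5. Dihedral groups of order $2d$, where $d\mid (q-1)$ or $d\mid (q+1)$. 6. Groups $\widehat{Dic}_m=\langle \alpha,\epsilon\mid \alpha^{4m}=1,\ \epsilon^2=\alpha^{2m},\ \epsilon^{-1}\alpha\epsilon=\alpha^{2m-1}\rangle$ of order $8m$ with $G\cap H\cong Dic_m$, where $m\mid\frac{q-1}{2}$ and $m\nmid\frac{q-1}{4}$. Here $Dic_m$ is the dicyclic group $\langle \delta,\epsilon\mid\delta^{2m}=1,\ \epsilon^2=\delta^m,\ \epsilon^{-1}\delta\epsilon=\delta^{-1}\rangle$ of order $4m$. 7. Groups $G=(G\cap H)\rtimes C_2$ of order $8m$ with $G\cap H\cong Dic_m$, where $1<m\mid\frac{q+1}{2}$. 8. Groups $E_{p^k}\rtimes C_{2d}$, where $1\le k\le n$, $d\mid\gcd(p^k-1,q-1)$, $d$ is even, $E_{p^k}$ is elementary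 abelian of order $p^k$, and $C_{2d}$ is cyclic of order $2d$. 9. Groups isomorphic to $\mathrm{SU}^{\pm}(2,p^k)$, where $k\mid n$ and $n/k$ is odd. Conversely, for all values of the parameters satisfying the stated conditions, $\mathrm{SU}^{\pm}(2,q)$ has a subgroup of the given type; this subgroup can be chosen not contained in $H$, except possibly in type 8 when $d\mid\frac{q-1}{2}$. -/

import Mathlib

open scoped MatrixGroups LinearAlgebra.Projectivization Matrix

namespace HermitianSU

/-! Throughout, `q = p ^ n` and `F` is a field of characteristic `p`, in the applications the field
with `q ^ 2` elements. The Hermitian curve is `X^(q+1) - Y^(q+1) - Z^(q+1) = 0`. -/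

section Groups

variable (F : Type*) [Field F] (p n : ℕ) [Fact p.Prime] [CharP F p]

/-- Gram matrix of the Hermitian form `X^(q+1) - Y^(q+1) - Z^(q+1)`. -/
def gram : Matrix (Fin 3) (Fin 3) F := Matrix.diagonal ![1, -1, -1]

/-- The unitary group `GU(3,q)`: the invertible matrices preserving the Hermitian form, that is
`Aᵀ J A^(q) = J`, where `A^(q)` is `A` with the `q`-Frobenius applied to every entry. -/
def GU3 : Subgroup (GL (Fin 3) F) where
  carrier := {A | (A : Matrix (Fin 3) (Fin 3) F)ᵀ * gram F *
    (A : Matrix (Fin 3) (Fin 3) F).map (iterateFrobenius F p n) = gram F}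
  one_mem' := by simp
  mul_mem' := by
    intro A B hA hB
    simp only [Set.mem_ofPred_eq, Units.val_mul, Matrix.transpose_mul, Matrix.map_mul] at *
    calc _ = (B : Matrix (Fin 3) (Fin 3) F)ᵀ * ((A : Matrix (Fin 3) (Fin 3) F)ᵀ * gram F *
          (A : Matrix (Fin 3) (Fin 3) F).map (iterateFrobenius F p n)) *
          (B : Matrix (Fin 3) (Fin 3) F).map (iterateFrobenius F p n) := by
          simp only [Matrix.mul_assoc]
      _ = _ := by rw [hA, hB]
  inv_mem' := by
    intro A hA
    simp only [Set.mem_ofPred_eq] at *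
    have h1 : ((A⁻¹ : GL (Fin 3) F) : Matrix (Fin 3) (Fin 3) F)ᵀ *
        (A : Matrix (Fin 3) (Fin 3) F)ᵀ = 1 := by
      rw [← Matrix.transpose_mul, ← Units.val_mul]; simp
    have h2 : (A : Matrix (Fin 3) (Fin 3) F).map (iterateFrobenius F p n) *
        ((A⁻¹ : GL (Fin 3) F) : Matrix (Fin 3) (Fin 3) F).map (iterateFrobenius F p n) = 1 := by
      rw [← Matrix.map_mul, ← Units.val_mul]; simp
    conv_lhs => rw [← hA]
    calc _ = (((A⁻¹ : GL (Fin 3) F) : Matrix (Fin 3) (Fin 3) F)ᵀ *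
        (A : Matrix (Fin 3) (Fin 3) F)ᵀ) * gram F *
        ((A : Matrix (Fin 3) (Fin 3) F).map (iterateFrobenius F p n) *
        ((A⁻¹ : GL (Fin 3) F) : Matrix (Fin 3) (Fin 3) F).map (iterateFrobenius F p n)) := by
          simp only [Matrix.mul_assoc]
      _ = _ := by rw [h1, h2]; simp

/-- `PGU(3,q)`, the group of projectivities of `PG(2,q^2)` preserving the Hermitian curve. -/
def PGU3 : Subgroup PGL(3, F) := (GU3 F p n).map Matrix.ProjGenLinGroup.mk

/-- The point `P = (0 : 0 : 1)`, which does not lie on the Hermitian curve. -/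
def ptP : ℙ F (Fin 3 → F) := Projectivization.mk F (Pi.single 2 1) (by simp)

/-- The maximal subgroup `M_q`: the stabilizer of `P` in `PGU(3,q)`. -/
def Mq : Subgroup PGL(3, F) := PGU3 F p n ⊓ MulAction.stabilizer PGL(3, F) (ptP F)

variable {F} in
lemma mulVec_of_stab {A : GL (Fin 3) F}
    (hA : Matrix.ProjGenLinGroup.mk A ∈ MulAction.stabilizer PGL(3, F) (ptP F))
    (h22 : A 2 2 = 1) :
    (A : Matrix (Fin 3) (Fin 3) F) *ᵥ Pi.single 2 1 = Pi.single 2 1 := by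
  rw [MulAction.mem_stabilizer_iff, ptP, Projectivization.PGL.mk_smul_mk,
    Projectivization.mk_eq_mk_iff'] at hA
  obtain ⟨c, hc⟩ := hA
  change _ = (A : Matrix (Fin 3) (Fin 3) F) *ᵥ Pi.single 2 1 at hc
  have := congrFun hc 2
  simp [h22] at this
  rw [← hc, this, one_smul]

/-- The elements of `M_q` whose determinant lies in `D`; the determinant of an element of `M_q` is
that of its representative matrix with entry `1` in the third row and column. -/
def detSubgroup (D : Subgroup Fˣ) : Subgroup PGL(3, F) where
  carrier := {g | g ∈ Mq F p n ∧ ∃ A : GL (Fin 3) F, Matrix.ProjGenLinGroup.mk A = g ∧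
    A 2 2 = 1 ∧ Matrix.GeneralLinearGroup.det A ∈ D}
  one_mem' := ⟨one_mem _, 1, by simp, by simp, by simp [D.one_mem]⟩
  mul_mem' := by
    rintro _ _ ⟨hg, A, rfl, hA, hA'⟩ ⟨hh, B, rfl, hB, hB'⟩
    refine ⟨mul_mem hg hh, A * B, map_mul _ _ _, ?_, by rw [map_mul]; exact mul_mem hA' hB'⟩
    have h1 := mulVec_of_stab hg.2 hA
    have h2 := mulVec_of_stab hh.2 hB
    have h3 : ((A * B : GL (Fin 3) F) : Matrix (Fin 3) (Fin 3) F) *ᵥ Pi.single 2 1 =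
        Pi.single 2 1 := by
      rw [Units.val_mul, ← Matrix.mulVec_mulVec, h2, h1]
    simpa using congrFun h3 2
  inv_mem' := by
    rintro _ ⟨hg, A, rfl, hA, hA'⟩
    refine ⟨inv_mem hg, A⁻¹, map_inv _ _, ?_, by rw [map_inv]; exact inv_mem hA'⟩
    have h1 := mulVec_of_stab hg.2 hA
    have h3 : ((A⁻¹ : GL (Fin 3) F) : Matrix (Fin 3) (Fin 3) F) *ᵥ Pi.single 2 1 =
        Pi.single 2 1 := by
      conv_lhs => rw [← h1]
      rw [Matrix.mulVec_mulVec, ← Units.val_mul, inv_mul_cancel, Units.val_one, Matrix.one_mulVec]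
    simpa using congrFun h3 2

/-- `SU^±(2,q)`: the elements of `M_q` of determinant `1` or `-1`. -/
def SUpm : Subgroup PGL(3, F) := detSubgroup F p n (Subgroup.zpowers (-1))

/-- The subgroup `H` of `M_q`, isomorphic to `SL(2,q)`: the elements of `M_q` of
determinant `1`. -/
def SUone : Subgroup PGL(3, F) := detSubgroup F p n ⊥

lemma mem_SUpm {g : PGL(3, F)} : g ∈ SUpm F p n ↔ g ∈ Mq F p n ∧
    ∃ A : GL (Fin 3) F, Matrix.ProjGenLinGroup.mk A = g ∧ A 2 2 = 1 ∧
      (Matrix.GeneralLinearGroup.det A = 1 ∨ Matrix.GeneralLinearGroup.det A = -1) := by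
  have key : ∀ u : Fˣ, u ∈ Subgroup.zpowers (-1 : Fˣ) ↔ u = 1 ∨ u = -1 := by
    intro u
    rw [Subgroup.mem_zpowers_iff]
    constructor
    · rintro ⟨k, rfl⟩
      rcases Int.even_or_odd k with h | h
      · exact Or.inl h.neg_one_zpow
      · exact Or.inr h.neg_one_zpow
    · rintro (rfl | rfl)
      · exact ⟨0, by simp⟩
      · exact ⟨1, by simp⟩
  simp only [SUpm, detSubgroup, ← key]
  rfl

lemma mem_SUone {g : PGL(3, F)} : g ∈ SUone F p n ↔ g ∈ Mq F p n ∧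
    ∃ A : GL (Fin 3) F, Matrix.ProjGenLinGroup.mk A = g ∧ A 2 2 = 1 ∧
      Matrix.GeneralLinearGroup.det A = 1 := by
  simp only [SUone, detSubgroup, ← Subgroup.mem_bot]
  rfl

end Groups

/-- `G` is the internal semidirect product `N ⋊ K`. -/
structure IsSemidirect {X : Type*} [Group X] (N K G : Subgroup X) : Prop where
  le_normalizer : G ≤ Subgroup.normalizer (N : Set X)
  disjoint : N ⊓ K = ⊥
  sup_eq : N ⊔ K = G

/-- The relators of `\hat{Dic}_m`, with `α` the generator `0` and `ε` the generator `1`. -/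
def hatDicRels (m : ℕ) : Set (FreeGroup (Fin 2)) :=
  let α := FreeGroup.of (0 : Fin 2)
  let ε := FreeGroup.of (1 : Fin 2)
  {α ^ (4 * m), ε ^ 2 * (α ^ (2 * m))⁻¹, ε⁻¹ * α * ε * (α ^ (2 * m - 1))⁻¹}

/-- `\hat{Dic}_m = ⟨α, ε ∣ α^(4m) = 1, ε^2 = α^(2m), ε⁻¹ α ε = α^(2m-1)⟩`. -/
abbrev HatDic (m : ℕ) : Type := PresentedGroup (hatDicRels m)

/-- The types of groups in the list. -/
inductive GroupKind : Type
  /-- the cyclic group of order `2` -/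
  | two
  /-- `SL(2,3) ⋊ C_2 = SmallGroup(48,29)` -/
  | sl23
  /-- the cyclic group of order `2d` -/
  | cyclic (d : ℕ)
  /-- the abelian group `C_d × C_2` -/
  | abelian (d : ℕ)
  /-- the dihedral group of order `2d` -/
  | dihedral (d : ℕ)
  /-- the group `\hat{Dic}_m`, extending `Dic_m` -/
  | hatDic (m : ℕ)
  /-- a group `Dic_m ⋊ C_2`, extending `Dic_m` -/
  | dicSemi (m : ℕ)
  /-- a group `E_{p^k} ⋊ C_{2d}` -/
  | elemAb (k d : ℕ)
  /-- the group `SU^±(2,p^k)` -/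
  | su (k : ℕ)

/-- The numerical conditions under which each type occurs in the list, for `q = p ^ n`. -/
def Admissible (p n : ℕ) : GroupKind → Prop
  | .two => True
  | .sl23 => 5 ≤ p ∧ ¬ 8 ∣ p ^ n - 1
  | .cyclic d => 2 < 2 * d ∧
      ((d ∣ p ^ n - 1 ∧ ¬ d ∣ (p ^ n - 1) / 2) ∨ (d ∣ p ^ n + 1 ∧ Odd d))
  | .abelian d => d ∣ p ^ n + 1 ∧ Even d
  | .dihedral d => d ∣ p ^ n - 1 ∨ d ∣ p ^ n + 1
  | .hatDic m => m ∣ (p ^ n - 1) / 2 ∧ ¬ m ∣ (p ^ n - 1) / 4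
  | .dicSemi m => 1 < m ∧ m ∣ (p ^ n + 1) / 2
  | .elemAb k d => 1 ≤ k ∧ k ≤ n ∧ d ∣ Nat.gcd (p ^ k - 1) (p ^ n - 1) ∧ Even d
  | .su k => k ∣ n ∧ Odd (n / k)

section Kinds

variable (F : Type*) [Field F] (p n : ℕ) [Fact p.Prime] [CharP F p]

/-- The subgroup `G` of `SU^±(2,q)` is of the given type. The dicyclic group `Dic_m` is
Mathlib's `QuaternionGroup m`, and `SmallGroup(48,29)` is `GL(2,3)`. -/
def HasKind (G : Subgroup PGL(3, F)) : GroupKind → Prop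
  | .two => IsCyclic G ∧ Nat.card G = 2
  | .sl23 => Nonempty (G ≃* GL (Fin 2) (ZMod 3))
  | .cyclic d => IsCyclic G ∧ Nat.card G = 2 * d
  | .abelian d => Nonempty (G ≃* Multiplicative (ZMod d) × Multiplicative (ZMod 2))
  | .dihedral d => Nonempty (G ≃* DihedralGroup d)
  | .hatDic m => Nat.card G = 8 * m ∧ Nonempty (G ≃* HatDic m) ∧
      Nonempty (↥(G ⊓ SUone F p n) ≃* QuaternionGroup m)
  | .dicSemi m => Nat.card G = 8 * m ∧
      Nonempty (↥(G ⊓ SUone F p n) ≃* QuaternionGroup m) ∧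
      ∃ K : Subgroup PGL(3, F), Nat.card K = 2 ∧ IsSemidirect (G ⊓ SUone F p n) K G
  | .elemAb k d => ∃ E K : Subgroup PGL(3, F),
      (Nat.card E = p ^ k ∧ (∀ x ∈ E, ∀ y ∈ E, x * y = y * x) ∧ ∀ x ∈ E, x ^ p = 1) ∧
      (IsCyclic K ∧ Nat.card K = 2 * d) ∧ IsSemidirect E K G
  | .su k => Nonempty (G ≃* SUpm (GaloisField p (2 * k)) p k)

end Kinds

end HermitianSU

open HermitianSU

/-! An element of `SU^±(2,q)` is block diagonal, so it is a 2×2 matrix `B` of determinant ±1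
preserving X^(q+1) - Y^(q+1). For δ in F with δ^q = -δ, a change of basis (`modelSU_map_toPGL3`)
turns this condition into A^(q) = det A • A, which defines `modelSU`: it consists of SL(2,q) and of
matrices of determinant -1 with entries in δ F_q. This gives H ≅ SL(2,q), and an involution of
determinant -1 gives the splitting.

Let `G` be a subgroup of the model that is not contained in SL(2,F), acting on the projective line
over F. The discriminants of its elements lie in F_q, hence are squares in F, so every nonscalar
element fixes two points, or one point when it is a scalar times a unipotent. Counting fixed points,
with a unique one counted twice, gives Dickson's orbit equation ∑ (1 + (u - 2)/s) = 2 - 2/g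
(`orbit_equation`). Here g is the order of the image of `G` in PGL(2,F), s runs over the nontrivial
point stabilizers in this image, one for each orbit, and u is the number of unipotents fixing the
point. Because q ≡ 1 mod 4, the scalars of `G` have determinant 1, so `G ∩ SL(2,F)` has index two in
the projective image as well; the same count for it yields the inequality `IsOuter.pair_lt`, which
removes the configurations that have no suitable subgroup of index two, such as A_4 and A_5.

Without unipotents (`IsOuter.semisimpleCases`) there remain a fixed point, a stabilizer of index
two, or the octahedral configuration. In the first two cases `G` is diagonal or monomial in suitable
coordinates. Its diagonal part lies in a split or in a nonsplit torus (`split_or_nonsplit`), and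
`split_torus`, `nonsplit_torus` and `exists_kind_of_monomial` read off the types. In the octahedral
case traces and determinants force the relations of GL(2,3) (`octRel_of_ring`).

With unipotents, all points fixed by a nontrivial unipotent form one orbit
(`IsOuter.equiv_of_unip`). If it is a single point, `G` is triangular and of type E ⋊ C
(`exists_kind_of_borel`). Otherwise `unipotent_arith` leaves only an orbit of Q + 1 points, Q being
the number of unipotents at each of them; it is a projective line over a subfield, and `G` is
conjugate to a smaller model (`exists_eq_modelSU`).

For the converse, generators are written as explicit diagonal, antidiagonal or unitriangular
matrices. Isomorphism types are recognized by bounding the order from above through relations and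
from below through orders of elements. -/

namespace HermitianSU
-- Recognizing groups from two generators and their relations.
section GroupTheory

variable {X Y : Type*} [Group X] [Group Y]

/-- Adjoining an element that normalizes `K` and whose `m`-th power lies in `K` multiplies the order
by at most `m`. -/
lemma card_sup_zpowers_le (K : Subgroup X) [Finite K] (x : X) (m : ℕ) (hm : 0 < m)
    (hx : x ∈ Subgroup.normalizer (K : Set X)) (hxm : x ^ m ∈ K) :
    Finite ↥(K ⊔ Subgroup.zpowers x) ∧
      Nat.card ↥(K ⊔ Subgroup.zpowers x) ≤ Nat.card K * m := by
  have hle : Subgroup.zpowers x ≤ Subgroup.normalizer (K : Set X) := by simpa using hx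
  let f : K × Fin m → ↥(K ⊔ Subgroup.zpowers x) := fun y =>
    ⟨y.1 * x ^ (y.2 : ℕ), Subgroup.mul_mem_sup y.1.2 (Subgroup.npow_mem_zpowers x _)⟩
  have hf : Function.Surjective f := by
    rintro ⟨y, hy⟩
    have hy' : y ∈ (↑(K ⊔ Subgroup.zpowers x) : Set X) := hy
    rw [sup_comm, Subgroup.coe_mul_of_left_le_normalizer_right _ _ hle] at hy'
    obtain ⟨_, ⟨i, rfl⟩, k, hk, rfl⟩ := hy'
    have h1 : x ^ i = x ^ (i % (m : ℤ)).toNat * (x ^ m) ^ (i / (m : ℤ)) := by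
      have h0 : ((i % (m : ℤ)).toNat : ℤ) = i % m :=
        Int.toNat_of_nonneg (Int.emod_nonneg _ (by omega))
      rw [← zpow_natCast x m, ← zpow_mul, ← zpow_natCast x, h0, ← zpow_add, Int.emod_add_mul_ediv]
    have h2 : (i % (m : ℤ)).toNat < m := by
      have := Int.emod_lt_of_pos i (b := (m : ℤ)) (by omega)
      have := Int.emod_nonneg i (b := (m : ℤ)) (by omega)
      omega
    have h3 : (x ^ m) ^ (i / (m : ℤ)) * k ∈ K := K.mul_mem (K.zpow_mem hxm _) hk
    have h4 := (Subgroup.mem_normalizer_iff.mp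
      (Subgroup.pow_mem _ hx (i % (m : ℤ)).toNat) _).mp h3
    refine ⟨(⟨_, h4⟩, ⟨_, h2⟩), ?_⟩
    apply Subtype.ext
    simp only [f]
    rw [h1]
    group
  refine ⟨Finite.of_surjective f hf, ?_⟩
  calc _ ≤ Nat.card (K × Fin m) := Nat.card_le_card_of_surjective f hf
    _ = _ := by simp

lemma two_mul_card_le_of_lt {K L : Subgroup X} [Finite L] (h : K < L) :
    2 * Nat.card K ≤ Nat.card L := by
  obtain ⟨c, hc⟩ := Subgroup.card_dvd_of_le h.le
  have hpos : 0 < Nat.card L := Nat.card_pos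
  have hne : c ≠ 1 := by
    rintro rfl
    exact h.ne (Subgroup.eq_of_le_of_card_ge h.le (by omega))
  have : c ≠ 0 := by rintro rfl; omega
  have : 2 ≤ c := by omega
  rw [hc]; nlinarith

lemma two_mul_card_le_sup (K : Subgroup X) (x : X) (hx : x ∉ K)
    [Finite ↥(K ⊔ Subgroup.zpowers x)] :
    2 * Nat.card K ≤ Nat.card ↥(K ⊔ Subgroup.zpowers x) := by
  refine two_mul_card_le_of_lt (lt_of_le_of_ne le_sup_left fun h => hx ?_)
  rw [h]
  exact Subgroup.mem_sup_right (Subgroup.mem_zpowers x)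

/-- Two groups of order at least `m` are isomorphic if they are both quotients of a group of order
at most `m`. -/
lemma nonempty_mulEquiv_of_graph (D : Subgroup (X × Y)) [Finite D] (G : Subgroup X) (m : ℕ)
    (hD : Nat.card D ≤ m) (hG : m ≤ Nat.card G) (hY : m ≤ Nat.card Y)
    (h1 : D.map (MonoidHom.fst X Y) = G) (h2 : D.map (MonoidHom.snd X Y) = ⊤) :
    Nonempty (G ≃* Y) := by
  subst h1
  let f := (MonoidHom.fst X Y).subgroupMap D
  let f' : D →* Y := (MonoidHom.snd X Y).comp D.subtype
  have hf : Function.Surjective f := (MonoidHom.fst X Y).subgroupMap_surjective D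
  have hf' : Function.Surjective f' := by
    intro y
    have : y ∈ D.map (MonoidHom.snd X Y) := by rw [h2]; trivial
    obtain ⟨d, hd, rfl⟩ := this
    exact ⟨⟨d, hd⟩, rfl⟩
  have hfin : Finite ↥(D.map (MonoidHom.fst X Y)) := Finite.of_surjective f hf
  have hfin' : Finite Y := Finite.of_surjective f' hf'
  have c1 : Nat.card D = Nat.card ↥(D.map (MonoidHom.fst X Y)) :=
    le_antisymm (hD.trans hG) (Nat.card_le_card_of_surjective f hf)
  have c2 : Nat.card D = Nat.card Y :=
    le_antisymm (hD.trans hY) (Nat.card_le_card_of_surjective f' hf')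
  have b1 : Function.Bijective f := (Nat.bijective_iff_surjective_and_card f).mpr ⟨hf, c1⟩
  have b2 : Function.Bijective f' := (Nat.bijective_iff_surjective_and_card f').mpr ⟨hf', c2⟩
  exact ⟨(MulEquiv.ofBijective f b1).symm.trans (MulEquiv.ofBijective f' b2)⟩

lemma mem_normalizer_zpowers {a x : X} (k l : ℤ) (h : x * a * x⁻¹ = a ^ k)
    (h' : x⁻¹ * a * x = a ^ l) : x ∈ Subgroup.normalizer (Subgroup.zpowers a : Set X) := by
  rw [Subgroup.mem_normalizer_iff]
  intro y
  constructor
  · rintro ⟨i, rfl⟩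
    refine ⟨k * i, ?_⟩
    simp only
    rw [zpow_mul, ← h, conj_zpow]
  · rintro ⟨i, hi⟩
    refine ⟨l * i, ?_⟩
    simp only at hi ⊢
    have h2 : y = x⁻¹ * a ^ i * x⁻¹⁻¹ := by rw [hi]; group
    rw [zpow_mul, ← h', h2, ← conj_zpow]
    simp

lemma mem_normalizer_of_conj_inv {a x : X} (h : x * a * x⁻¹ = a⁻¹) :
    x ∈ Subgroup.normalizer (Subgroup.zpowers a : Set X) := by
  refine mem_normalizer_zpowers (-1) (-1) (by simpa using h) ?_
  have h2 : a = x⁻¹ * a⁻¹ * x := by rw [← h]; group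
  have h3 : a⁻¹ = x⁻¹ * a * x := by
    calc a⁻¹ = (x⁻¹ * a⁻¹ * x)⁻¹ := by rw [← h2]
      _ = _ := by group
  rw [← h3]; simp

lemma map_sup_zpowers (f : X →* Y) (a x : X) :
    (Subgroup.zpowers a ⊔ Subgroup.zpowers x).map f =
      Subgroup.zpowers (f a) ⊔ Subgroup.zpowers (f x) := by
  rw [Subgroup.map_sup, MonoidHom.map_zpowers, MonoidHom.map_zpowers]

/-- In place of a homomorphism this builds its graph, the subgroup of `X × Y` generated by `(a, b)`
and `(x, y)`. The relations bound its order by `c * m`, and both projections have images of at least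
this order, so both are bijective. -/
lemma nonempty_mulEquiv_of_pair {a x : X} {b y : Y} {c m : ℕ} (hm : 0 < m)
    (hc : 0 < c) (ha : orderOf a = c) (hb : orderOf b = c)
    (hab : (x, y) ∈ Subgroup.normalizer (Subgroup.zpowers (a, b) : Set (X × Y)))
    (hxm : (x, y) ^ m ∈ Subgroup.zpowers (a, b))
    (hgen : Subgroup.zpowers b ⊔ Subgroup.zpowers y = ⊤) (hY : c * m ≤ Nat.card Y)
    (hX : c * m ≤ Nat.card ↥(Subgroup.zpowers a ⊔ Subgroup.zpowers x)) :
    Nonempty (↥(Subgroup.zpowers a ⊔ Subgroup.zpowers x) ≃* Y) := by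
  have ho : orderOf (a, b) = c := by rw [Prod.orderOf, ha, hb, Nat.lcm_self]
  have : Finite (Subgroup.zpowers (a, b)) := by
    apply Nat.finite_of_card_ne_zero
    rw [Nat.card_zpowers, ho]; omega
  obtain ⟨hfin, hcard⟩ := card_sup_zpowers_le (Subgroup.zpowers (a, b)) (x, y) m hm hab hxm
  rw [Nat.card_zpowers, ho] at hcard
  exact nonempty_mulEquiv_of_graph _ _ (c * m) hcard hX hY (map_sup_zpowers _ _ _)
    ((map_sup_zpowers _ _ _).trans hgen)

lemma card_sup_of_conj_inv {a x : X} {d m : ℕ} (hd : 0 < d) (hm : 0 < m) (ha : orderOf a = d)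
    (hx : x ∉ Subgroup.zpowers a) (hxm : x ^ m ∈ Subgroup.zpowers a)
    (h : x * a * x⁻¹ = a⁻¹) : d * 2 ≤ Nat.card ↥(Subgroup.zpowers a ⊔ Subgroup.zpowers x) := by
  have : Finite (Subgroup.zpowers a) := by
    apply Nat.finite_of_card_ne_zero
    rw [Nat.card_zpowers, ha]; omega
  obtain ⟨hfin, -⟩ := card_sup_zpowers_le (Subgroup.zpowers a) x m hm
    (mem_normalizer_of_conj_inv h) hxm
  have := two_mul_card_le_sup _ _ hx
  rw [Nat.card_zpowers, ha] at this
  omega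

lemma nonempty_mulEquiv_dihedralGroup {a x : X} {d : ℕ} (hd : 0 < d) (ha : orderOf a = d)
    (hx : x ∉ Subgroup.zpowers a) (hx2 : x ^ 2 = 1) (h : x * a * x⁻¹ = a⁻¹) :
    Nonempty (↥(Subgroup.zpowers a ⊔ Subgroup.zpowers x) ≃* DihedralGroup d) := by
  have : NeZero d := ⟨hd.ne'⟩
  refine nonempty_mulEquiv_of_pair (b := DihedralGroup.r 1) (y := DihedralGroup.sr 0) (m := 2)
    two_pos hd ha DihedralGroup.orderOf_r_one ?_ ?_ ?_ ?_ ?_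
  · apply mem_normalizer_of_conj_inv
    ext1
    · exact h
    · simp
  · have : ((x, DihedralGroup.sr 0) : X × DihedralGroup d) ^ 2 = 1 := by
      ext1
      · exact hx2
      · simp [sq]
    rw [this]; exact one_mem _
  · rw [eq_top_iff]
    rintro (i | i) -
    · refine Subgroup.mem_sup_left ⟨(i.val : ℤ), ?_⟩
      simp
    · have : DihedralGroup.sr i = DihedralGroup.sr 0 * (DihedralGroup.r (1 : ZMod d)) ^ i.val := by
        simp
      rw [this]
      exact mul_mem (Subgroup.mem_sup_right (Subgroup.mem_zpowers _))
        (Subgroup.mem_sup_left (Subgroup.npow_mem_zpowers _ _))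
  · rw [DihedralGroup.nat_card]; omega
  · exact card_sup_of_conj_inv hd two_pos ha hx (by rw [hx2]; exact one_mem _) h

lemma nonempty_mulEquiv_quaternionGroup {a x : X} {m : ℕ} (hm : 0 < m) (ha : orderOf a = 2 * m)
    (hx : x ∉ Subgroup.zpowers a) (hx2 : x ^ 2 = a ^ m) (h : x * a * x⁻¹ = a⁻¹) :
    Nonempty (↥(Subgroup.zpowers a ⊔ Subgroup.zpowers x) ≃* QuaternionGroup m) := by
  have : NeZero m := ⟨hm.ne'⟩
  have hxa : x ^ 2 ∈ Subgroup.zpowers a := by rw [hx2]; exact Subgroup.npow_mem_zpowers _ _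
  refine nonempty_mulEquiv_of_pair (b := QuaternionGroup.a 1) (y := QuaternionGroup.xa 0) (m := 2)
    two_pos (by omega) ha QuaternionGroup.orderOf_a_one ?_ ?_ ?_ ?_ ?_
  · apply mem_normalizer_of_conj_inv
    ext1
    · exact h
    · change QuaternionGroup.xa 0 * QuaternionGroup.a 1 * (QuaternionGroup.xa 0)⁻¹ =
        (QuaternionGroup.a (1 : ZMod (2 * m)))⁻¹
      rw [mul_inv_eq_iff_eq_mul, eq_inv_mul_iff_mul_eq]
      simp
  · have : ((x, QuaternionGroup.xa 0) : X × QuaternionGroup m) ^ 2 =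
        (a, QuaternionGroup.a 1) ^ m := by
      ext1
      · exact hx2
      · simp
    rw [this]; exact Subgroup.npow_mem_zpowers _ _
  · rw [eq_top_iff]
    rintro (i | i) -
    · refine Subgroup.mem_sup_left ⟨((i.val : ℕ) : ℤ), ?_⟩
      simp only [zpow_natCast, QuaternionGroup.a_one_pow, ZMod.natCast_zmod_val]
    · have : QuaternionGroup.xa i =
          QuaternionGroup.xa 0 * (QuaternionGroup.a (1 : ZMod (2 * m))) ^ i.val := by
        simp
      rw [this]
      exact mul_mem (Subgroup.mem_sup_right (Subgroup.mem_zpowers _))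
        (Subgroup.mem_sup_left (Subgroup.npow_mem_zpowers _ _))
  · rw [Nat.card_eq_fintype_card, QuaternionGroup.card]; omega
  · exact card_sup_of_conj_inv (by omega) two_pos ha hx hxa h

lemma hatDic_relations (m : ℕ) :
    (PresentedGroup.of 0 : HatDic m) ^ (4 * m) = 1 ∧
    (PresentedGroup.of 1 : HatDic m) ^ 2 = (PresentedGroup.of 0) ^ (2 * m) ∧
    (PresentedGroup.of 1 : HatDic m)⁻¹ * PresentedGroup.of 0 * PresentedGroup.of 1 =
      (PresentedGroup.of 0) ^ (2 * m - 1) := by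
  refine ⟨?_, ?_, ?_⟩
  · have := PresentedGroup.one_of_mem (rels := hatDicRels m)
      (x := FreeGroup.of (0 : Fin 2) ^ (4 * m)) (by simp [hatDicRels])
    rwa [map_pow] at this
  · have := PresentedGroup.one_of_mem (rels := hatDicRels m)
      (x := FreeGroup.of (1 : Fin 2) ^ 2 * (FreeGroup.of (0 : Fin 2) ^ (2 * m))⁻¹)
      (by simp [hatDicRels])
    rwa [map_mul, map_inv, map_pow, map_pow, mul_inv_eq_one] at this
  · have := PresentedGroup.one_of_mem (rels := hatDicRels m)
      (x := (FreeGroup.of (1 : Fin 2))⁻¹ * FreeGroup.of (0 : Fin 2) * FreeGroup.of (1 : Fin 2) *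
        (FreeGroup.of (0 : Fin 2) ^ (2 * m - 1))⁻¹) (by simp [hatDicRels])
    rwa [map_mul, map_inv, map_pow, mul_inv_eq_one, map_mul, map_mul, map_inv] at this

/-- Since `ε ^ 2` is a power of `α`, it centralizes `α`; so conjugation by `ε` and by its inverse
agree on `α`, and the single relation gives both inclusions. -/
lemma mem_normalizer_of_sq {α ε : X} {k l : ℕ} (r2 : ε ^ 2 = α ^ k) (r3 : ε⁻¹ * α * ε = α ^ l) :
    ε ∈ Subgroup.normalizer (Subgroup.zpowers α : Set X) := by
  refine mem_normalizer_zpowers l l ?_ ?_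
  · rw [zpow_natCast, ← r3]
    have hc : ε ^ 2 * α = α * ε ^ 2 := by rw [r2, ← pow_succ, ← pow_succ']
    calc ε * α * ε⁻¹ = ε⁻¹ * (ε ^ 2 * α) * ε⁻¹ := by group
      _ = _ := by rw [hc]; group
  · rw [zpow_natCast, r3]

/-- The order of the presented group is not known beforehand. Its relations bound it by `8 * m`, and
the canonical map onto the subgroup of `X`, which has exactly `8 * m` elements, must then be
bijective. -/
lemma nonempty_mulEquiv_hatDic {a x : X} {m : ℕ} (hm : 0 < m) (ha : orderOf a = 4 * m)
    (hx : x ∉ Subgroup.zpowers a) (hx2 : x ^ 2 = a ^ (2 * m))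
    (h : x⁻¹ * a * x = a ^ (2 * m - 1)) :
    Nat.card ↥(Subgroup.zpowers a ⊔ Subgroup.zpowers x) = 8 * m ∧
    Nonempty (↥(Subgroup.zpowers a ⊔ Subgroup.zpowers x) ≃* HatDic m) := by
  obtain ⟨r1, r2, r3⟩ := hatDic_relations m
  set α : HatDic m := PresentedGroup.of 0
  set ε : HatDic m := PresentedGroup.of 1
  have htop : Subgroup.zpowers α ⊔ Subgroup.zpowers ε = ⊤ := by
    rw [eq_top_iff, ← PresentedGroup.closure_range_of (hatDicRels m), Subgroup.closure_le]
    rintro _ ⟨i, rfl⟩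
    fin_cases i
    · exact Subgroup.mem_sup_left (Subgroup.mem_zpowers _)
    · exact Subgroup.mem_sup_right (Subgroup.mem_zpowers _)
  have hfα : Finite (Subgroup.zpowers α) :=
    Nat.finite_of_card_ne_zero (by
      rw [Nat.card_zpowers]
      exact (isOfFinOrder_iff_pow_eq_one.mpr ⟨4 * m, by omega, r1⟩).orderOf_pos.ne')
  obtain ⟨hfin, hcard⟩ := card_sup_zpowers_le (Subgroup.zpowers α) ε 2 two_pos
    (mem_normalizer_of_sq r2 r3) (by rw [r2]; exact Subgroup.npow_mem_zpowers _ _)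
  rw [htop] at hfin hcard
  have hα : Nat.card (Subgroup.zpowers α) ≤ 4 * m := by
    rw [Nat.card_zpowers]
    exact orderOf_le_of_pow_eq_one (by omega) r1
  have hcard' : Nat.card (⊤ : Subgroup (HatDic m)) ≤ 8 * m := by omega
  have hfa : Finite (Subgroup.zpowers a) := by
    apply Nat.finite_of_card_ne_zero
    rw [Nat.card_zpowers, ha]; omega
  obtain ⟨hfinG, hcardG⟩ := card_sup_zpowers_le (Subgroup.zpowers a) x 2 two_pos
    (mem_normalizer_of_sq hx2 h)
    (by rw [hx2]; exact Subgroup.npow_mem_zpowers _ _)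
  have hGle := two_mul_card_le_sup _ _ hx
  rw [Nat.card_zpowers, ha] at hcardG hGle
  have hG : Nat.card ↥(Subgroup.zpowers a ⊔ Subgroup.zpowers x) = 8 * m := by omega
  refine ⟨hG, ?_⟩
  let g : Fin 2 → X := ![a, x]
  let f : HatDic m →* X := PresentedGroup.toGroup (f := g) (by
    intro r hr
    simp only [hatDicRels, Set.mem_insert_iff, Set.mem_singleton_iff] at hr
    rcases hr with rfl | rfl | rfl
    · simp [g, ← ha, pow_orderOf_eq_one]
    · simp [g, hx2]
    · simp [g, h])
  have hf0 : f α = a := by simp [f, α, g]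
  have hf1 : f ε = x := by simp [f, ε, g]
  have hrange : (⊤ : Subgroup (HatDic m)).map f = Subgroup.zpowers a ⊔ Subgroup.zpowers x := by
    rw [← htop, map_sup_zpowers, hf0, hf1]
  let f' := f.subgroupMap ⊤
  have hs := f.subgroupMap_surjective ⊤
  have hb : Function.Bijective f' := (Nat.bijective_iff_surjective_and_card f').mpr
    ⟨hs, le_antisymm (hcard'.trans (by rw [hrange, hG])) (Nat.card_le_card_of_surjective _ hs)⟩
  rw [← hrange]
  exact ⟨(MulEquiv.ofBijective f' hb).symm.trans Subgroup.topEquiv⟩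

end GroupTheory

/-! ### The types of the list in an arbitrary group, and their transport along embeddings. -/

section Kinds

variable {X Y : Type*} [Group X] [Group Y] (p : ℕ) [Fact p.Prime]

/-- The subgroup `G` of a group `X` is of the given type relative to the subgroup `N` of `X`. -/
def IsKind (N G : Subgroup X) : GroupKind → Prop
  | .two => IsCyclic G ∧ Nat.card G = 2
  | .sl23 => Nonempty (G ≃* GL (Fin 2) (ZMod 3))
  | .cyclic d => IsCyclic G ∧ Nat.card G = 2 * d
  | .abelian d => Nonempty (G ≃* Multiplicative (ZMod d) × Multiplicative (ZMod 2))
  | .dihedral d => Nonempty (G ≃* DihedralGroup d)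
  | .hatDic m => Nat.card G = 8 * m ∧ Nonempty (G ≃* HatDic m) ∧
      Nonempty (↥(G ⊓ N) ≃* QuaternionGroup m)
  | .dicSemi m => Nat.card G = 8 * m ∧
      Nonempty (↥(G ⊓ N) ≃* QuaternionGroup m) ∧
      ∃ K : Subgroup X, Nat.card K = 2 ∧ IsSemidirect (G ⊓ N) K G
  | .elemAb k d => ∃ E K : Subgroup X,
      (Nat.card E = p ^ k ∧ (∀ x ∈ E, ∀ y ∈ E, x * y = y * x) ∧ ∀ x ∈ E, x ^ p = 1) ∧
      (IsCyclic K ∧ Nat.card K = 2 * d) ∧ IsSemidirect E K G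
  | .su k => Nonempty (G ≃* SUpm (GaloisField p (2 * k)) p k)

variable {p}

lemma hasKind_iff (F : Type*) [Field F] (n : ℕ) [CharP F p] (G : Subgroup PGL(3, F))
    (t : GroupKind) : HasKind F p n G t ↔ IsKind p (SUone F p n) G t := by
  cases t <;> rfl

lemma IsSemidirect.map {N K G : Subgroup X} (h : IsSemidirect N K G) (f : X →* Y)
    (hf : Function.Injective f) : IsSemidirect (N.map f) (K.map f) (G.map f) where
  le_normalizer := by
    rintro _ ⟨g, hg, rfl⟩
    have h1 := Subgroup.mem_normalizer_iff.mp (h.le_normalizer hg)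
    rw [Subgroup.mem_normalizer_iff]
    intro y
    constructor
    · rintro ⟨x, hx, rfl⟩
      exact ⟨g * x * g⁻¹, (h1 x).mp hx, by simp⟩
    · rintro ⟨x, hx, hxy⟩
      refine ⟨g⁻¹ * x * g, (h1 _).mpr (by rwa [show g * (g⁻¹ * x * g) * g⁻¹ = x by group]), ?_⟩
      simp [hxy]
      group
  disjoint := by rw [← Subgroup.map_inf_eq _ _ _ hf, h.disjoint, Subgroup.map_bot]
  sup_eq := by rw [← Subgroup.map_sup, h.sup_eq]

lemma IsKind.map {N G : Subgroup X} {t : GroupKind} (h : IsKind p N G t) (f : X →* Y)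
    (hf : Function.Injective f) : IsKind p (N.map f) (G.map f) t := by
  have e : ∀ K : Subgroup X, K ≃* K.map f := fun K => K.equivMapOfInjective f hf
  have hcyc : ∀ K : Subgroup X, IsCyclic K → IsCyclic (K.map f) := fun K hK =>
    isCyclic_of_surjective (e K) (e K).surjective
  have hcard : ∀ K : Subgroup X, Nat.card (K.map f) = Nat.card K := fun K =>
    (Nat.card_congr (e K).toEquiv).symm
  have hiso : ∀ (K : Subgroup X) {Z : Type _} [Group Z], Nonempty (K ≃* Z) →
      Nonempty (K.map f ≃* Z) := fun K Z _ ⟨i⟩ => ⟨(e K).symm.trans i⟩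
  have hinf := Subgroup.map_inf_eq G N f hf
  cases t with
  | two => exact ⟨hcyc _ h.1, (hcard _).trans h.2⟩
  | sl23 => exact hiso _ h
  | cyclic d => exact ⟨hcyc _ h.1, (hcard _).trans h.2⟩
  | abelian d => exact hiso _ h
  | dihedral d => exact hiso _ h
  | hatDic m =>
    refine ⟨(hcard _).trans h.1, hiso _ h.2.1, ?_⟩
    rw [← hinf]
    exact hiso _ h.2.2
  | dicSemi m =>
    obtain ⟨h1, h2, K, hK, hs⟩ := h
    refine ⟨(hcard _).trans h1, ?_, K.map f, (hcard _).trans hK, ?_⟩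
    · rw [← hinf]
      exact hiso _ h2
    · rw [← hinf]
      exact hs.map f hf
  | elemAb k d =>
    obtain ⟨E, K, ⟨h1, h2, h3⟩, ⟨h4, h5⟩, hs⟩ := h
    refine ⟨E.map f, K.map f, ⟨(hcard _).trans h1, ?_, ?_⟩, ⟨hcyc _ h4, (hcard _).trans h5⟩,
      hs.map f hf⟩
    · rintro _ ⟨x, hx, rfl⟩ _ ⟨y, hy, rfl⟩
      rw [← map_mul, h2 x hx y hy, map_mul]
    · rintro _ ⟨x, hx, rfl⟩
      rw [← map_pow, h3 x hx, map_one]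
  | su k => exact hiso _ h

/-- The subgroup `N` matters only through `G ⊓ N`. This is needed because the image of `detOne F` in
PGL(3,F) need not be `SUone`, although it meets the image of any subgroup of the model in the same
elements. -/
lemma IsKind.congr {N N' G : Subgroup X} {t : GroupKind} (h : IsKind p N G t)
    (hN : G ⊓ N = G ⊓ N') : IsKind p N' G t := by
  cases t <;> first
    | exact h
    | (simp only [IsKind] at h ⊢; rw [← hN]; exact h)

end Kinds

/-! ### Eigenlines of 2×2 matrices and fixed points on the projective line. -/

section Lines

variable {F : Type*} [Field F]

lemma smul_eq_self_iff (x : GL (Fin 2) F) (v : Fin 2 → F) (hv : v ≠ 0) :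
    x • Projectivization.mk F v hv = Projectivization.mk F v hv ↔
      ∃ c : F, (x : Matrix (Fin 2) (Fin 2) F) *ᵥ v = c • v := by
  rw [Projectivization.smul_mk, Projectivization.mk_eq_mk_iff']
  constructor
  · rintro ⟨c, hc⟩
    exact ⟨c, hc.symm⟩
  · rintro ⟨c, hc⟩
    exact ⟨c, hc.symm⟩

lemma smul_mk_eq_iff (x : GL (Fin 2) F) (v w : Fin 2 → F) (hv : v ≠ 0) (hw : w ≠ 0) :
    x • Projectivization.mk F v hv = Projectivization.mk F w hw ↔
      ∃ c : F, (x : Matrix (Fin 2) (Fin 2) F) *ᵥ v = c • w := by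
  rw [Projectivization.smul_mk, Projectivization.mk_eq_mk_iff']
  constructor
  · rintro ⟨c, hc⟩
    exact ⟨c, hc.symm⟩
  · rintro ⟨c, hc⟩
    exact ⟨c, hc.symm⟩

lemma det_ne_zero_of_mk_ne {v w : Fin 2 → F} (hv : v ≠ 0) (hw : w ≠ 0)
    (h : Projectivization.mk F v hv ≠ Projectivization.mk F w hw) :
    v 0 * w 1 - w 0 * v 1 ≠ 0 := by
  intro h0
  apply h
  rw [Projectivization.mk_eq_mk_iff']
  by_cases hw0 : w 0 = 0
  · have hw1 : w 1 ≠ 0 := by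
      intro h1
      exact hw (by ext i; fin_cases i <;> simp [hw0, h1])
    rw [hw0] at h0
    have hv0 : v 0 = 0 := by
      have : v 0 * w 1 = 0 := by linear_combination h0
      exact (mul_eq_zero.mp this).resolve_right hw1
    refine ⟨v 1 / w 1, ?_⟩
    ext i
    fin_cases i
    · simp [hw0, hv0]
    · simp [hw1]
  · refine ⟨v 0 / w 0, ?_⟩
    ext i
    fin_cases i
    · simp [hw0]
    · simp only [Pi.smul_apply, smul_eq_mul, Fin.mk_one]
      field_simp
      linear_combination h0

/-- The matrix with columns spanning two distinct lines. -/
def basisGL {v w : Fin 2 → F} (h : v 0 * w 1 - w 0 * v 1 ≠ 0) : GL (Fin 2) F :=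
  Matrix.GeneralLinearGroup.mkOfDetNeZero !![v 0, w 0; v 1, w 1] (by
    rwa [Matrix.det_fin_two_of])

lemma coe_basisGL {v w : Fin 2 → F} (h : v 0 * w 1 - w 0 * v 1 ≠ 0) :
    (basisGL h : Matrix (Fin 2) (Fin 2) F) = !![v 0, w 0; v 1, w 1] := rfl

lemma mul_basisGL {v w : Fin 2 → F} (h : v 0 * w 1 - w 0 * v 1 ≠ 0)
    (M N : Matrix (Fin 2) (Fin 2) F) (hv : M *ᵥ v = N 0 0 • v + N 1 0 • w)
    (hw : M *ᵥ w = N 0 1 • v + N 1 1 • w) :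
    M * (basisGL h : Matrix (Fin 2) (Fin 2) F) = (basisGL h : Matrix (Fin 2) (Fin 2) F) * N := by
  have a0 := congrFun hv 0
  have a1 := congrFun hv 1
  have b0 := congrFun hw 0
  have b1 := congrFun hw 1
  simp only [Matrix.mulVec, dotProduct, Fin.sum_univ_two, Pi.add_apply, Pi.smul_apply,
    smul_eq_mul] at a0 a1 b0 b1
  rw [coe_basisGL]
  ext i j
  fin_cases i <;> fin_cases j <;>
    simp only [Matrix.mul_apply, Fin.sum_univ_two, Matrix.of_apply, Matrix.cons_val', Matrix.cons_val_zero,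
      Matrix.cons_val_one, Matrix.cons_val_fin_one, Fin.zero_eta, Fin.mk_one, Fin.isValue]
  · linear_combination a0
  · linear_combination b0
  · linear_combination a1
  · linear_combination b1

lemma conj_basisGL {v w : Fin 2 → F} (h : v 0 * w 1 - w 0 * v 1 ≠ 0)
    (x : GL (Fin 2) F) (N : Matrix (Fin 2) (Fin 2) F)
    (hv : (x : Matrix (Fin 2) (Fin 2) F) *ᵥ v = N 0 0 • v + N 1 0 • w)
    (hw : (x : Matrix (Fin 2) (Fin 2) F) *ᵥ w = N 0 1 • v + N 1 1 • w) :
    (((basisGL h)⁻¹ * x * basisGL h : GL (Fin 2) F) : Matrix (Fin 2) (Fin 2) F) = N := by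
  rw [mul_assoc, Units.val_mul, Units.val_mul, mul_basisGL h _ N hv hw, ← mul_assoc,
    ← Units.val_mul, inv_mul_cancel, Units.val_one, one_mul]

lemma eq_scalar_of_two_lines {M : Matrix (Fin 2) (Fin 2) F} {v w : Fin 2 → F} {c : F}
    (h : v 0 * w 1 - w 0 * v 1 ≠ 0) (hv : M *ᵥ v = c • v) (hw : M *ᵥ w = c • w) :
    M = c • 1 := by
  have h1 := mul_basisGL h M (c • 1) (by simpa using hv) (by simpa using hw)
  have h2 : M * (basisGL h : Matrix (Fin 2) (Fin 2) F) =
      (c • 1) * (basisGL h : Matrix (Fin 2) (Fin 2) F) := by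
    rw [h1]; simp
  have h3 := congrArg (· * ((basisGL h)⁻¹ : GL (Fin 2) F).val) h2
  simpa only [mul_assoc, ← Units.val_mul, mul_inv_cancel, Units.val_one, mul_one] using h3

lemma charpoly_root {M : Matrix (Fin 2) (Fin 2) F} {v : Fin 2 → F} (hv : v ≠ 0) {c : F}
    (h : M *ᵥ v = c • v) : c ^ 2 - M.trace * c + M.det = 0 := by
  have h0 : (M - c • 1).det = 0 := by
    rw [← Matrix.exists_mulVec_eq_zero_iff]
    refine ⟨v, hv, ?_⟩
    rw [Matrix.sub_mulVec, h, Matrix.smul_mulVec, Matrix.one_mulVec, sub_self]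
  rw [Matrix.det_fin_two] at h0
  simp at h0
  rw [Matrix.trace_fin_two, Matrix.det_fin_two]
  linear_combination h0

lemma exists_eigenvector {M : Matrix (Fin 2) (Fin 2) F} {c : F}
    (h : c ^ 2 - M.trace * c + M.det = 0) : ∃ v : Fin 2 → F, v ≠ 0 ∧ M *ᵥ v = c • v := by
  have h0 : (M - c • 1).det = 0 := by
    rw [Matrix.trace_fin_two, Matrix.det_fin_two] at h
    rw [Matrix.det_fin_two]
    simp
    linear_combination h
  rw [← Matrix.exists_mulVec_eq_zero_iff] at h0
  obtain ⟨v, hv, h1⟩ := h0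
  refine ⟨v, hv, ?_⟩
  rwa [Matrix.sub_mulVec, Matrix.smul_mulVec, Matrix.one_mulVec, sub_eq_zero] at h1

lemma discr_eq (M : Matrix (Fin 2) (Fin 2) F) : M.discr = M.trace ^ 2 - 4 * M.det :=
  Matrix.discr_fin_two M

lemma mem_center_iff (x : GL (Fin 2) F) : x ∈ Subgroup.center (GL (Fin 2) F) ↔
    ∃ c : F, (x : Matrix (Fin 2) (Fin 2) F) = c • 1 := by
  rw [Matrix.GeneralLinearGroup.mem_center_iff_val_mem_range_scalar]
  simp only [Set.mem_range, Matrix.scalar_apply, ← Matrix.smul_one_eq_diagonal]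
  exact exists_congr fun c => eq_comm

lemma smul_eq_of_mem_center {x : GL (Fin 2) F} (hx : x ∈ Subgroup.center (GL (Fin 2) F))
    (P : ℙ F (Fin 2 → F)) : x • P = P := by
  obtain ⟨c, hc⟩ := (mem_center_iff x).mp hx
  induction P with
  | h v hv =>
    rw [smul_eq_self_iff]
    exact ⟨c, by rw [hc, Matrix.smul_mulVec, Matrix.one_mulVec]⟩

lemma discr_eq_zero_of_mem_center {x : GL (Fin 2) F}
    (hx : x ∈ Subgroup.center (GL (Fin 2) F)) :
    (x : Matrix (Fin 2) (Fin 2) F).discr = 0 := by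
  obtain ⟨c, hc⟩ := (mem_center_iff x).mp hx
  rw [hc, discr_eq, Matrix.trace_fin_two, Matrix.det_fin_two]
  simp
  ring

/-- A nonscalar element fixes exactly two lines if its discriminant is a nonzero square. -/
lemma exists_two_fixed (h2 : (2 : F) ≠ 0) {x : GL (Fin 2) F}
    (hsq : IsSquare (x : Matrix (Fin 2) (Fin 2) F).discr)
    (hd : (x : Matrix (Fin 2) (Fin 2) F).discr ≠ 0) :
    ∃ P Q : ℙ F (Fin 2 → F), P ≠ Q ∧ ∀ R, x • R = R ↔ R = P ∨ R = Q := by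
  set M := (x : Matrix (Fin 2) (Fin 2) F)
  obtain ⟨d, hd'⟩ := hsq
  have hd0 : d ≠ 0 := by rintro rfl; exact hd (by simpa using hd')
  rw [discr_eq] at hd'
  have r1 : ((M.trace + d) / 2) ^ 2 - M.trace * ((M.trace + d) / 2) + M.det = 0 := by
    field_simp
    linear_combination -hd'
  have r2 : ((M.trace - d) / 2) ^ 2 - M.trace * ((M.trace - d) / 2) + M.det = 0 := by
    field_simp
    linear_combination -hd'
  obtain ⟨v, hv, hv'⟩ := exists_eigenvector r1
  obtain ⟨w, hw, hw'⟩ := exists_eigenvector r2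
  set a := (M.trace + d) / 2 with ha
  set b := (M.trace - d) / 2 with hb
  have hne : a ≠ b := by
    intro h
    apply hd0
    have h3 : (a - b) = d := by rw [ha, hb]; field_simp; ring
    rw [← h3, h, sub_self]
  have hpol : ∀ c, c ^ 2 - M.trace * c + M.det = 0 → c = a ∨ c = b := by
    intro c hc
    have h3 : (c - a) * (c - b) = 0 := by
      have e1 : a + b = M.trace := by rw [ha, hb]; field_simp; ring
      have e2 : a * b = M.det := by linear_combination a * e1 - r1
      linear_combination hc - c * e1 + e2
    rcases mul_eq_zero.mp h3 with h | h
    · exact Or.inl (sub_eq_zero.mp h)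
    · exact Or.inr (sub_eq_zero.mp h)
  have hnscal : ∀ c : F, M ≠ c • 1 := by
    intro c hc
    apply hd
    exact discr_eq_zero_of_mem_center ((mem_center_iff x).mpr ⟨c, hc⟩)
  have huniq : ∀ {v w : Fin 2 → F} (hv : v ≠ 0) (hw : w ≠ 0) (c : F), M *ᵥ v = c • v →
      M *ᵥ w = c • w → Projectivization.mk F v hv = Projectivization.mk F w hw := by
    intro v w hv hw c h3 h4
    by_contra h5
    exact hnscal c (eq_scalar_of_two_lines (det_ne_zero_of_mk_ne hv hw h5) h3 h4)
  refine ⟨Projectivization.mk F v hv, Projectivization.mk F w hw, ?_, fun R => ?_⟩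
  · intro h
    rw [Projectivization.mk_eq_mk_iff'] at h
    obtain ⟨t, rfl⟩ := h
    rw [Matrix.mulVec_smul, hw', smul_comm] at hv'
    have : (b - a) • (t • w) = 0 := by rw [sub_smul, sub_eq_zero, hv']
    rcases smul_eq_zero.mp this with h | h
    · exact hne (sub_eq_zero.mp h).symm
    · exact hv h
  · constructor
    · induction R with
      | h r hr =>
        rw [smul_eq_self_iff]
        rintro ⟨c, hc⟩
        rcases hpol c (charpoly_root hr hc) with rfl | rfl
        · exact Or.inl (huniq hr hv _ hc hv')
        · exact Or.inr (huniq hr hw _ hc hw')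
    · rintro (rfl | rfl)
      · exact (smul_eq_self_iff _ _ _).mpr ⟨_, hv'⟩
      · exact (smul_eq_self_iff _ _ _).mpr ⟨_, hw'⟩

lemma exists_one_fixed (h2 : (2 : F) ≠ 0) {x : GL (Fin 2) F}
    (hx : x ∉ Subgroup.center (GL (Fin 2) F))
    (hd : (x : Matrix (Fin 2) (Fin 2) F).discr = 0) :
    ∃ P : ℙ F (Fin 2 → F), ∀ R, x • R = R ↔ R = P := by
  set M := (x : Matrix (Fin 2) (Fin 2) F)
  rw [discr_eq] at hd
  have r1 : (M.trace / 2) ^ 2 - M.trace * (M.trace / 2) + M.det = 0 := by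
    field_simp
    linear_combination -hd
  obtain ⟨v, hv, hv'⟩ := exists_eigenvector r1
  refine ⟨Projectivization.mk F v hv, fun R => ⟨?_, ?_⟩⟩
  · induction R with
    | h r hr =>
      rw [smul_eq_self_iff]
      rintro ⟨c, hc⟩
      have h3 := charpoly_root hr hc
      have h4 : c = M.trace / 2 := by
        have : (c - M.trace / 2) ^ 2 = 0 := by
          have h6 : M.trace ^ 2 = 4 * M.det := by linear_combination hd
          field_simp
          linear_combination 4 * h3 + h6
        exact sub_eq_zero.mp (pow_eq_zero_iff two_ne_zero |>.mp this)
      by_contra h5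
      apply hx
      rw [mem_center_iff]
      rw [h4] at hc
      exact ⟨_, eq_scalar_of_two_lines (det_ne_zero_of_mk_ne hr hv h5) hc hv'⟩
  · rintro rfl
    exact (smul_eq_self_iff _ _ _).mpr ⟨_, hv'⟩

end Lines

/-! ### Point stabilizers, scalars and unipotents of a linear group. -/

section Counting

variable {F : Type*} [Field F]

/-- A matrix with a double eigenvalue `c` has `|F|`-th power `c`. -/
lemma pow_card_of_sq_eq_zero [Finite F] (M : Matrix (Fin 2) (Fin 2) F) (c : F)
    (h : (M - c • 1) ^ 2 = 0) : M ^ Nat.card F = c • 1 := by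
  have := Fintype.ofFinite F
  obtain ⟨p, hp⟩ := CharP.exists F
  have hpp : Fact p.Prime := ⟨CharP.char_is_prime F p⟩
  obtain ⟨k, -, hk⟩ := FiniteField.card F p
  rw [← Nat.card_eq_fintype_card] at hk
  have hpow : c ^ Nat.card F = c := by
    rw [Nat.card_eq_fintype_card]
    exact FiniteField.pow_card c
  have h1 : (M - c • 1) ^ Nat.card F = 0 := by
    have h2 : 2 ≤ Nat.card F := Finite.one_lt_card
    rw [← Nat.sub_add_cancel h2, pow_add, h, mul_zero]
  have : CharP (Matrix (Fin 2) (Fin 2) F) p := inferInstance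
  -- The two summands commute, so raising to a power of the characteristic is additive on them; the
  -- nilpotent summand contributes nothing.
  have h3 : M = (M - c • 1) + c • 1 := by simp
  conv_lhs => rw [h3]
  rw [hk, add_pow_char_pow_of_commute _ _ (Commute.smul_right (Commute.one_right _) c), ← hk, h1,
    zero_add, smul_pow, one_pow, hpow]

/-- The stabilizer of a line in a subgroup of `GL(2,F)`. -/
def fixer (G : Subgroup (GL (Fin 2) F)) (P : ℙ F (Fin 2 → F)) : Subgroup (GL (Fin 2) F) :=
  G ⊓ MulAction.stabilizer (GL (Fin 2) F) P

/-- The unipotent elements of `G` fixing the line `P`. -/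
def unip (G : Subgroup (GL (Fin 2) F)) (P : ℙ F (Fin 2 → F)) : Subgroup (GL (Fin 2) F) where
  carrier := {x | x ∈ G ∧ (x : Matrix (Fin 2) (Fin 2) F) *ᵥ P.rep = P.rep ∧
    (x : Matrix (Fin 2) (Fin 2) F).det = 1}
  one_mem' := ⟨one_mem _, by rw [Units.val_one, Matrix.one_mulVec], by simp⟩
  mul_mem' := by
    rintro x y ⟨h1, h2, h3⟩ ⟨h4, h5, h6⟩
    refine ⟨mul_mem h1 h4, ?_, ?_⟩
    · rw [Units.val_mul, ← Matrix.mulVec_mulVec, h5, h2]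
    · rw [Units.val_mul, Matrix.det_mul, h3, h6, one_mul]
  inv_mem' := by
    rintro x ⟨h1, h2, h3⟩
    refine ⟨inv_mem h1, ?_, ?_⟩
    · conv_lhs => rw [← h2]
      rw [Matrix.mulVec_mulVec, ← Units.val_mul, inv_mul_cancel, Units.val_one, Matrix.one_mulVec]
    · have : ((x⁻¹ : GL (Fin 2) F) : Matrix (Fin 2) (Fin 2) F).det *
          (x : Matrix (Fin 2) (Fin 2) F).det = 1 := by
        rw [← Matrix.det_mul, ← Units.val_mul, inv_mul_cancel, Units.val_one, Matrix.det_one]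
      rwa [h3, mul_one] at this

lemma mem_fixer {G : Subgroup (GL (Fin 2) F)} {P : ℙ F (Fin 2 → F)} {x : GL (Fin 2) F} :
    x ∈ fixer G P ↔ x ∈ G ∧ x • P = P := by
  rw [fixer, Subgroup.mem_inf, MulAction.mem_stabilizer_iff]

lemma smul_eq_self_iff_rep (x : GL (Fin 2) F) (P : ℙ F (Fin 2 → F)) :
    x • P = P ↔ ∃ c : F, (x : Matrix (Fin 2) (Fin 2) F) *ᵥ P.rep = c • P.rep := by
  conv_lhs => rw [← P.mk_rep]
  rw [smul_eq_self_iff]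

lemma unip_le_fixer (G : Subgroup (GL (Fin 2) F)) (P : ℙ F (Fin 2 → F)) :
    unip G P ≤ fixer G P := fun x hx =>
  mem_fixer.mpr ⟨hx.1, (smul_eq_self_iff_rep x P).mpr ⟨1, by rw [one_smul]; exact hx.2.1⟩⟩

lemma center_le_fixer (G : Subgroup (GL (Fin 2) F)) (P : ℙ F (Fin 2 → F)) :
    G ⊓ Subgroup.center (GL (Fin 2) F) ≤ fixer G P := fun _ hx =>
  mem_fixer.mpr ⟨hx.1, smul_eq_of_mem_center hx.2 P⟩

/-- The number of scalar matrices in `G`. -/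
noncomputable def numScalar (G : Subgroup (GL (Fin 2) F)) : ℕ :=
  Nat.card ↥(G ⊓ Subgroup.center (GL (Fin 2) F))

/-- The order of the image of `G` in `PGL(2,F)`. -/
noncomputable def projCard (G : Subgroup (GL (Fin 2) F)) : ℕ := Nat.card G / numScalar G

/-- The order of the stabilizer of `P` in the image of `G` in `PGL(2,F)`. -/
noncomputable def stabCard (G : Subgroup (GL (Fin 2) F)) (P : ℙ F (Fin 2 → F)) : ℕ :=
  Nat.card (fixer G P) / numScalar G

/-- The number of unipotent elements of `G` fixing `P`. -/
noncomputable def unipCard (G : Subgroup (GL (Fin 2) F)) (P : ℙ F (Fin 2 → F)) : ℕ :=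
  Nat.card (unip G P)

lemma numScalar_mul_projCard (G : Subgroup (GL (Fin 2) F)) :
    numScalar G * projCard G = Nat.card G :=
  Nat.mul_div_cancel' (Subgroup.card_dvd_of_le inf_le_left)

lemma numScalar_mul_stabCard (G : Subgroup (GL (Fin 2) F)) (P : ℙ F (Fin 2 → F)) :
    numScalar G * stabCard G P = Nat.card (fixer G P) :=
  Nat.mul_div_cancel' (Subgroup.card_dvd_of_le (center_le_fixer G P))

variable [Finite F]

lemma numScalar_pos (G : Subgroup (GL (Fin 2) F)) : 0 < numScalar G := Nat.card_pos

lemma unipCard_pos (G : Subgroup (GL (Fin 2) F)) (P : ℙ F (Fin 2 → F)) : 0 < unipCard G P :=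
  Nat.card_pos

lemma projCard_pos (G : Subgroup (GL (Fin 2) F)) : 0 < projCard G := by
  have h := numScalar_mul_projCard G
  have : 0 < Nat.card G := Nat.card_pos
  exact Nat.pos_of_ne_zero fun h0 => by rw [h0, mul_zero] at h; omega

lemma stabCard_pos (G : Subgroup (GL (Fin 2) F)) (P : ℙ F (Fin 2 → F)) : 0 < stabCard G P := by
  have h := numScalar_mul_stabCard G P
  have : 0 < Nat.card (fixer G P) := Nat.card_pos
  exact Nat.pos_of_ne_zero fun h0 => by rw [h0, mul_zero] at h; omega

end Counting

/-! ### Double counting of fixed points. -/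

section Counting

variable {F : Type*} [Field F]

/-- The other eigenvalue is `det / c`, and the discriminant is the square of the difference of the
eigenvalues. -/
lemma discr_eq_zero_iff_exists {x : GL (Fin 2) F} {v : Fin 2 → F} (hv : v ≠ 0)
    {c : F} (hc : (x : Matrix (Fin 2) (Fin 2) F) *ᵥ v = c • v) :
    (x : Matrix (Fin 2) (Fin 2) F).discr = 0 ↔ (x : Matrix (Fin 2) (Fin 2) F).det = c ^ 2 := by
  have h := charpoly_root hv hc
  have hdet : (x : Matrix (Fin 2) (Fin 2) F).det ≠ 0 :=
    (Matrix.isUnit_iff_isUnit_det _).mp x.isUnit |>.ne_zero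
  have hc0 : c ≠ 0 := by rintro rfl; apply hdet; linear_combination h
  rw [discr_eq]
  set t := (x : Matrix (Fin 2) (Fin 2) F).trace
  set d := (x : Matrix (Fin 2) (Fin 2) F).det
  constructor
  · intro h0
    have h1 : (t - 2 * c) ^ 2 = 0 := by linear_combination h0 + 4 * h
    have h3 : t = 2 * c := sub_eq_zero.mp (pow_eq_zero_iff two_ne_zero |>.mp h1)
    rw [h3] at h
    linear_combination h
  · intro h0
    have h1 : c * (2 * c - t) = 0 := by linear_combination h - h0
    have h3 := (mul_eq_zero.mp h1).resolve_left hc0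
    linear_combination -4 * h0 - (2 * c + t) * h3

lemma sub_smul_sq_eq_zero {M : Matrix (Fin 2) (Fin 2) F} {c : F} (ht : M.trace = 2 * c)
    (hd : M.det = c ^ 2) : (M - c • 1) ^ 2 = 0 := by
  rw [Matrix.trace_fin_two] at ht
  rw [Matrix.det_fin_two] at hd
  rw [sq]
  ext i j
  fin_cases i <;> fin_cases j <;> simp [Matrix.mul_apply, Fin.sum_univ_two]
  · linear_combination M 0 0 * ht - hd
  · linear_combination M 0 1 * ht
  · linear_combination M 1 0 * ht
  · linear_combination M 1 1 * ht - hd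

lemma trace_of_discr_eq_zero {M : Matrix (Fin 2) (Fin 2) F} {v : Fin 2 → F} (hv : v ≠ 0)
    {c : F} (hc0 : c ≠ 0) (hc : M *ᵥ v = c • v) (hd : M.det = c ^ 2) : M.trace = 2 * c := by
  have h := charpoly_root hv hc
  have h1 : c * (2 * c - M.trace) = 0 := by linear_combination h - hd
  have h3 := (mul_eq_zero.mp h1).resolve_left hc0
  linear_combination -h3

lemma scalar_mul_unip_injective {G : Subgroup (GL (Fin 2) F)} {P : ℙ F (Fin 2 → F)}
    {s s' u u' : GL (Fin 2) F} (hs : s ∈ Subgroup.center (GL (Fin 2) F))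
    (hs' : s' ∈ Subgroup.center (GL (Fin 2) F)) (hu : u ∈ unip G P) (hu' : u' ∈ unip G P)
    (h : s * u = s' * u') : s = s' ∧ u = u' := by
  obtain ⟨c, hc⟩ := (mem_center_iff s).mp hs
  obtain ⟨c', hc'⟩ := (mem_center_iff s').mp hs'
  have h1 := congrArg (fun y : GL (Fin 2) F => (y : Matrix (Fin 2) (Fin 2) F) *ᵥ P.rep) h
  simp only [Units.val_mul, ← Matrix.mulVec_mulVec] at h1
  rw [hu.2.1, hu'.2.1, hc, hc', Matrix.smul_mulVec, Matrix.smul_mulVec, Matrix.one_mulVec] at h1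
  have h3 : c = c' := by
    have : (c - c') • P.rep = 0 := by rw [sub_smul, h1, sub_self]
    exact sub_eq_zero.mp ((smul_eq_zero.mp this).resolve_right P.rep_nonzero)
  have h4 : s = s' := Units.ext (by rw [hc, hc', h3])
  exact ⟨h4, by rw [h4] at h; exact mul_left_cancel h⟩

variable [Finite F]

/-- An element of the stabilizer of `P` with vanishing discriminant is the product of a scalar and
a unipotent element of the same group. -/
lemma exists_scalar_mul_unip {G : Subgroup (GL (Fin 2) F)}
    {P : ℙ F (Fin 2 → F)} {x : GL (Fin 2) F} (hx : x ∈ fixer G P)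
    (hd : (x : Matrix (Fin 2) (Fin 2) F).discr = 0) :
    ∃ s ∈ G ⊓ Subgroup.center (GL (Fin 2) F), ∃ u ∈ unip G P, s * u = x := by
  obtain ⟨hxG, hxP⟩ := mem_fixer.mp hx
  obtain ⟨c, hc⟩ := (smul_eq_self_iff_rep x P).mp hxP
  have hdet : (x : Matrix (Fin 2) (Fin 2) F).det ≠ 0 :=
    (Matrix.isUnit_iff_isUnit_det _).mp x.isUnit |>.ne_zero
  have hd' := (discr_eq_zero_iff_exists P.rep_nonzero hc).mp hd
  have hc0 : c ≠ 0 := by rintro rfl; apply hdet; rw [hd']; simp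
  have ht := trace_of_discr_eq_zero P.rep_nonzero hc0 hc hd'
  have hpow := pow_card_of_sq_eq_zero _ c (sub_smul_sq_eq_zero ht hd')
  have hs : ((x ^ Nat.card F : GL (Fin 2) F) : Matrix (Fin 2) (Fin 2) F) = c • 1 := by
    rw [Units.val_pow_eq_pow_val, hpow]
  -- The scalar part of `x` is its power with exponent `|F|`, so it already lies in `G`, and so does
  -- the unipotent part.
  refine ⟨x ^ Nat.card F, ⟨pow_mem hxG _, (mem_center_iff _).mpr ⟨c, hs⟩⟩,
    (x ^ Nat.card F)⁻¹ * x, ⟨mul_mem (inv_mem (pow_mem hxG _)) hxG, ?_, ?_⟩, by group⟩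
  · have h1 : ((x ^ Nat.card F : GL (Fin 2) F) : Matrix (Fin 2) (Fin 2) F) *ᵥ P.rep =
        (x : Matrix (Fin 2) (Fin 2) F) *ᵥ P.rep := by
      rw [hs, hc, Matrix.smul_mulVec, Matrix.one_mulVec]
    rw [Units.val_mul, ← Matrix.mulVec_mulVec, ← h1, Matrix.mulVec_mulVec, ← Units.val_mul,
      inv_mul_cancel, Units.val_one, Matrix.one_mulVec]
  · have h1 : ((x ^ Nat.card F : GL (Fin 2) F) : Matrix (Fin 2) (Fin 2) F).det = c ^ 2 := by
      rw [hs, Matrix.det_smul, Matrix.det_one, mul_one, Fintype.card_fin]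
    have h3 : x = x ^ Nat.card F * ((x ^ Nat.card F)⁻¹ * x) := by group
    have h4 := congrArg (fun y : GL (Fin 2) F => (y : Matrix (Fin 2) (Fin 2) F).det) h3
    simp only [Units.val_mul, Matrix.det_mul] at h4
    rw [h1, ← hd'] at h4
    rw [Units.val_mul, Matrix.det_mul]
    exact mul_left_cancel₀ hdet (by rw [← h4, mul_one])

/-- Every such element is uniquely a scalar of `G` times a unipotent of `G` fixing `P`, its Jordan
decomposition. -/
lemma card_discr_eq_zero (G : Subgroup (GL (Fin 2) F))
    (P : ℙ F (Fin 2 → F)) :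
    Nat.card {x : G // (x : GL (Fin 2) F) • P = P ∧
      ((x : GL (Fin 2) F) : Matrix (Fin 2) (Fin 2) F).discr = 0} =
      numScalar G * unipCard G P := by
  rw [numScalar, unipCard, ← Nat.card_prod]
  symm
  refine Nat.card_eq_of_bijective (fun y => ⟨⟨y.1.1 * y.2.1, mul_mem y.1.2.1 y.2.2.1⟩, ?_, ?_⟩)
    ⟨?_, ?_⟩
  · exact (mem_fixer.mp (mul_mem (center_le_fixer G P y.1.2) (unip_le_fixer G P y.2.2))).2
  · obtain ⟨c, hc⟩ := (mem_center_iff _).mp y.1.2.2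
    have hv : ((y.1.1 * y.2.1 : GL (Fin 2) F) : Matrix (Fin 2) (Fin 2) F) *ᵥ P.rep =
        c • P.rep := by
      rw [Units.val_mul, ← Matrix.mulVec_mulVec, y.2.2.2.1, hc, Matrix.smul_mulVec,
        Matrix.one_mulVec]
    rw [discr_eq_zero_iff_exists P.rep_nonzero hv, Units.val_mul, Matrix.det_mul, y.2.2.2.2, hc,
      Matrix.det_smul, Matrix.det_one, Fintype.card_fin, mul_one, mul_one]
  · rintro ⟨⟨s, hs⟩, ⟨u, hu⟩⟩ ⟨⟨s', hs'⟩, ⟨u', hu'⟩⟩ h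
    simp only [Subtype.mk.injEq] at h
    obtain ⟨rfl, rfl⟩ := scalar_mul_unip_injective hs.2 hs'.2 hu hu' h
    rfl
  · rintro ⟨⟨x, hx⟩, hxP, hd⟩
    obtain ⟨s, hs, u, hu, rfl⟩ := exists_scalar_mul_unip (mem_fixer.mpr ⟨hx, hxP⟩) hd
    exact ⟨(⟨s, hs⟩, ⟨u, hu⟩), rfl⟩

/-- Double counting of the pairs of a nonscalar element and a fixed line, the elements with a single
fixed line being counted twice. -/
lemma sum_fixer_card (h2 : (2 : F) ≠ 0) (G : Subgroup (GL (Fin 2) F)) [Fintype (ℙ F (Fin 2 → F))]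
    (hG : ∀ x ∈ G, IsSquare (x : Matrix (Fin 2) (Fin 2) F).discr) :
    ∑ P : ℙ F (Fin 2 → F), ((stabCard G P : ℚ) + unipCard G P - 2) = 2 * projCard G - 2 := by
  classical
  have := Fintype.ofFinite F
  have : Fintype G := Fintype.ofFinite G
  let X := ℙ F (Fin 2 → F)
  -- A fixed line has weight 1, and weight 2 if the discriminant vanishes. Every nonscalar element
  -- then has total weight 2, whether it fixes one line or two.
  let w : G → X → ℚ := fun x P => (if (x : GL (Fin 2) F) • P = P then 1 else 0) +
    (if (x : GL (Fin 2) F) • P = P ∧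
      ((x : GL (Fin 2) F) : Matrix (Fin 2) (Fin 2) F).discr = 0 then 1 else 0)
  have hz : (numScalar G : ℚ) ≠ 0 := by exact_mod_cast (numScalar_pos G).ne'
  have hP : ∀ P : X, ∑ x : G, w x P = numScalar G * (stabCard G P + unipCard G P) := by
    intro P
    rw [Finset.sum_add_distrib, mul_add]
    congr 1
    · rw [Finset.sum_boole, ← Nat.cast_mul, numScalar_mul_stabCard, Nat.cast_inj,
        ← Fintype.card_subtype, ← Nat.card_eq_fintype_card]
      refine Nat.card_congr ⟨fun x => ⟨x.1.1, mem_fixer.mpr ⟨x.1.2, x.2⟩⟩,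
        fun x => ⟨⟨x.1, (mem_fixer.mp x.2).1⟩, (mem_fixer.mp x.2).2⟩, fun x => rfl, fun x => rfl⟩
    · rw [Finset.sum_boole, ← Nat.cast_mul, ← card_discr_eq_zero, Nat.cast_inj,
        ← Fintype.card_subtype, ← Nat.card_eq_fintype_card]
  have hx : ∀ x : G, ∑ P : X, w x P =
      if (x : GL (Fin 2) F) ∈ Subgroup.center (GL (Fin 2) F) then 2 * (Fintype.card X : ℚ)
        else 2 := by
    intro x
    split_ifs with hc
    · have h1 : ∀ P : X, w x P = 2 := by
        intro P
        have e1 := smul_eq_of_mem_center hc P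
        have e2 := discr_eq_zero_of_mem_center hc
        simp only [w, e1, e2, if_true, and_self]
        norm_num
      rw [Finset.sum_congr rfl fun P _ => h1 P, Finset.sum_const, Finset.card_univ, nsmul_eq_mul,
        mul_comm]
    · by_cases hd : ((x : GL (Fin 2) F) : Matrix (Fin 2) (Fin 2) F).discr = 0
      · obtain ⟨P, hP⟩ := exists_one_fixed h2 hc hd
        have h1 : ∀ R : X, w x R = if R = P then 2 else 0 := by
          intro R
          simp only [w, hP, hd, and_true]
          split_ifs <;> norm_num
        rw [Finset.sum_congr rfl fun P _ => h1 P, Finset.sum_ite_eq' Finset.univ P]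
        simp
      · obtain ⟨P, Q, hPQ, h⟩ := exists_two_fixed h2 (hG x x.2) hd
        have h1 : ∀ R : X, w x R = (if R = P then 1 else 0) + (if R = Q then 1 else 0) := by
          intro R
          simp only [w, h, hd, and_false, if_false, add_zero]
          by_cases e1 : R = P
          · have e2 : R ≠ Q := by rw [e1]; exact hPQ
            simp [e1, hPQ]
          · simp [e1]
        rw [Finset.sum_congr rfl fun P _ => h1 P, Finset.sum_add_distrib,
          Finset.sum_ite_eq' Finset.univ P, Finset.sum_ite_eq' Finset.univ Q]
        simp
        norm_num
  -- The scalars contribute twice the number of lines each; this cancels against the `- 2` summed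
  -- over all lines.
  have hsum : ∑ x : G, ∑ P : X, w x P = numScalar G * (2 * Fintype.card X) +
      numScalar G * (projCard G - 1) * 2 := by
    rw [Finset.sum_congr rfl fun x _ => hx x, Finset.sum_ite, Finset.sum_const, Finset.sum_const]
    have h1 : (Finset.univ.filter
        fun x : G => (x : GL (Fin 2) F) ∈ Subgroup.center (GL (Fin 2) F)).card = numScalar G := by
      rw [← Fintype.card_subtype, ← Nat.card_eq_fintype_card]
      refine Nat.card_congr ⟨fun x => ⟨x.1.1, x.1.2, x.2⟩, fun x => ⟨⟨x.1, x.2.1⟩, x.2.2⟩,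
        fun x => rfl, fun x => rfl⟩
    have h3 : ((Finset.univ.filter
        fun x : G => ¬ (x : GL (Fin 2) F) ∈ Subgroup.center (GL (Fin 2) F)).card : ℚ) =
        numScalar G * (projCard G - 1) := by
      have h4 := Finset.card_filter_add_card_filter_not (s := (Finset.univ : Finset G))
        (fun x : G => (x : GL (Fin 2) F) ∈ Subgroup.center (GL (Fin 2) F))
      rw [h1, Finset.card_univ, ← Nat.card_eq_fintype_card, ← numScalar_mul_projCard G] at h4
      have h5 := congrArg (Nat.cast : ℕ → ℚ) h4
      push_cast at h5
      linear_combination h5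
    rw [h1, nsmul_eq_mul, nsmul_eq_mul, h3]
  rw [Finset.sum_comm, Finset.sum_congr rfl fun P _ => hP P, ← Finset.mul_sum] at hsum
  rw [Finset.sum_sub_distrib, Finset.sum_const, Finset.card_univ, nsmul_eq_mul]
  apply mul_left_cancel₀ hz
  linear_combination hsum

end Counting

/-! ### Orbits on the projective line and the orbit equation. -/

section Orbits

variable {F : Type*} [Field F]

lemma mem_unip_mk {G : Subgroup (GL (Fin 2) F)} {v : Fin 2 → F} (hv : v ≠ 0)
    {x : GL (Fin 2) F} : x ∈ unip G (Projectivization.mk F v hv) ↔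
      x ∈ G ∧ (x : Matrix (Fin 2) (Fin 2) F) *ᵥ v = v ∧
        (x : Matrix (Fin 2) (Fin 2) F).det = 1 := by
  obtain ⟨a, ha⟩ := Projectivization.exists_smul_eq_mk_rep F v hv
  have : (x : Matrix (Fin 2) (Fin 2) F) *ᵥ (Projectivization.mk F v hv).rep =
      (Projectivization.mk F v hv).rep ↔ (x : Matrix (Fin 2) (Fin 2) F) *ᵥ v = v := by
    rw [← ha, Units.smul_def, Matrix.mulVec_smul]
    exact smul_right_inj a.ne_zero
  change (_ ∧ _ ∧ _) ↔ _
  rw [this]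

lemma conj_mem_unip {G : Subgroup (GL (Fin 2) F)} {P : ℙ F (Fin 2 → F)} {x u : GL (Fin 2) F}
    (hx : x ∈ G) (hu : u ∈ unip G P) : x * u * x⁻¹ ∈ unip G (x • P) := by
  induction P with
  | h v hv =>
    rw [mem_unip_mk] at hu
    rw [Projectivization.smul_mk, mem_unip_mk]
    refine ⟨mul_mem (mul_mem hx hu.1) (inv_mem hx), ?_, ?_⟩
    · change _ *ᵥ ((x : Matrix (Fin 2) (Fin 2) F) *ᵥ v) = (x : Matrix (Fin 2) (Fin 2) F) *ᵥ v
      rw [Matrix.mulVec_mulVec, ← Units.val_mul, inv_mul_cancel_right, Units.val_mul,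
        ← Matrix.mulVec_mulVec, hu.2.1]
    · have h1 : x * u * x⁻¹ * x = x * u := inv_mul_cancel_right _ _
      have h4 := congrArg (fun y : GL (Fin 2) F => (y : Matrix (Fin 2) (Fin 2) F).det) h1
      rw [Units.val_mul _ x, Units.val_mul x u, Matrix.det_mul, Matrix.det_mul, hu.2.2,
        mul_one] at h4
      have hdet : (x : Matrix (Fin 2) (Fin 2) F).det ≠ 0 :=
        (Matrix.isUnit_iff_isUnit_det _).mp x.isUnit |>.ne_zero
      exact mul_right_cancel₀ hdet (by rw [h4, one_mul])

lemma conj_mem_fixer {G : Subgroup (GL (Fin 2) F)} {P : ℙ F (Fin 2 → F)} {x u : GL (Fin 2) F}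
    (hx : x ∈ G) (hu : u ∈ fixer G P) : x * u * x⁻¹ ∈ fixer G (x • P) := by
  rw [mem_fixer] at hu ⊢
  refine ⟨mul_mem (mul_mem hx hu.1) (inv_mem hx), ?_⟩
  rw [mul_smul, mul_smul, inv_smul_smul, hu.2]

lemma card_eq_of_conj (A : ℙ F (Fin 2 → F) → Subgroup (GL (Fin 2) F))
    (G : Subgroup (GL (Fin 2) F))
    (hA : ∀ P, ∀ x ∈ G, ∀ u ∈ A P, x * u * x⁻¹ ∈ A (x • P)) (P : ℙ F (Fin 2 → F))
    {x : GL (Fin 2) F} (hx : x ∈ G) : Nat.card (A (x • P)) = Nat.card (A P) := by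
  refine Nat.card_congr ⟨fun u => ⟨x⁻¹ * u * x, ?_⟩, fun u => ⟨x * u * x⁻¹, hA P x hx u u.2⟩,
    fun u => Subtype.ext ?_, fun u => Subtype.ext ?_⟩
  · have := hA (x • P) x⁻¹ (inv_mem hx) u u.2
    rwa [inv_smul_smul, inv_inv] at this
  · simp only; group
  · simp only; group

lemma unipCard_smul (G : Subgroup (GL (Fin 2) F)) (P : ℙ F (Fin 2 → F)) {x : GL (Fin 2) F}
    (hx : x ∈ G) : unipCard G (x • P) = unipCard G P :=
  card_eq_of_conj (unip G) G (fun _ _ h _ => conj_mem_unip h) P hx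

lemma card_fixer_smul (G : Subgroup (GL (Fin 2) F)) (P : ℙ F (Fin 2 → F)) {x : GL (Fin 2) F}
    (hx : x ∈ G) : Nat.card (fixer G (x • P)) = Nat.card (fixer G P) :=
  card_eq_of_conj (fixer G) G (fun _ _ h _ => conj_mem_fixer h) P hx

lemma stabCard_smul (G : Subgroup (GL (Fin 2) F)) (P : ℙ F (Fin 2 → F)) {x : GL (Fin 2) F}
    (hx : x ∈ G) : stabCard G (x • P) = stabCard G P := by
  rw [stabCard, stabCard, card_fixer_smul G P hx]

variable [Finite F]

lemma card_orbit_mul_stabCard (G : Subgroup (GL (Fin 2) F)) (P : ℙ F (Fin 2 → F)) :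
    Nat.card (MulAction.orbit G P) * stabCard G P = projCard G := by
  have h1 : Nat.card (MulAction.orbit G P) * Nat.card (fixer G P) = Nat.card G := by
    have e : Nat.card (fixer G P) = Nat.card (MulAction.stabilizer G P) :=
      Nat.card_congr ⟨fun x => ⟨⟨x.1, (mem_fixer.mp x.2).1⟩, (mem_fixer.mp x.2).2⟩,
        fun x => ⟨x.1.1, mem_fixer.mpr ⟨x.1.2, x.2⟩⟩, fun x => rfl, fun x => rfl⟩
    rw [e, ← Nat.card_prod]
    exact Nat.card_congr (MulAction.orbitProdStabilizerEquivGroup G P)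
  apply Nat.eq_of_mul_eq_mul_left (numScalar_pos G)
  rw [numScalar_mul_projCard, ← h1, ← numScalar_mul_stabCard]
  ring

lemma unipCard_le_stabCard (G : Subgroup (GL (Fin 2) F)) (P : ℙ F (Fin 2 → F)) :
    unipCard G P ≤ stabCard G P := by
  apply Nat.le_of_mul_le_mul_left _ (numScalar_pos G)
  rw [numScalar_mul_stabCard, ← card_discr_eq_zero]
  exact Nat.card_le_card_of_injective
    (fun x => (⟨x.1.1, mem_fixer.mpr ⟨x.1.2, x.2.1⟩⟩ : fixer G P))
    (fun x y h => Subtype.ext (Subtype.ext (congrArg (fun z : fixer G P => (z : GL (Fin 2) F)) h)))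

/-- The orbit equation for the action of a subgroup of `GL(2,F)` on the projective line. -/
lemma orbit_equation (h2 : (2 : F) ≠ 0) (G : Subgroup (GL (Fin 2) F))
    (hG : ∀ x ∈ G, IsSquare (x : Matrix (Fin 2) (Fin 2) F).discr) :
    ∃ T : Finset (ℙ F (Fin 2 → F)), (∀ P ∈ T, 2 ≤ stabCard G P) ∧
      (∀ P ∈ T, ∀ Q ∈ T, ∀ x ∈ G, x • P = Q → P = Q) ∧
      (∀ P, 2 ≤ stabCard G P → ∃ Q ∈ T, ∃ x ∈ G, x • Q = P) ∧
      ∑ P ∈ T, (1 + ((unipCard G P : ℚ) - 2) / stabCard G P) = 2 - 2 / projCard G := by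
  classical
  have : Fintype (ℙ F (Fin 2 → F)) := Fintype.ofFinite _
  let X := ℙ F (Fin 2 → F)
  let Ω := MulAction.orbitRel.Quotient G X
  have : Fintype Ω := Fintype.ofFinite Ω
  let π : X → Ω := Quotient.mk _
  have hπ : ∀ P Q : X, π P = π Q ↔ P ∈ MulAction.orbit G Q := fun P Q =>
    Quotient.eq.trans MulAction.orbitRel_apply
  have hout : ∀ ω : Ω, π ω.out = ω := fun ω => Quotient.out_eq ω
  have hinj : Function.Injective (fun ω : Ω => (ω.out : X)) := fun a b h => by
    rw [← hout a, ← hout b]; exact congrArg π h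
  have hg0 : (projCard G : ℚ) ≠ 0 := by exact_mod_cast (projCard_pos G).ne'
  let f : X → ℚ := fun P => (stabCard G P : ℚ) + unipCard G P - 2
  have hf : ∀ P Q : X, π P = π Q → f P = f Q := by
    intro P Q h
    obtain ⟨x, rfl⟩ := (hπ P Q).mp h
    simp only [f]
    change (stabCard G ((x : GL (Fin 2) F) • Q) : ℚ) + unipCard G ((x : GL (Fin 2) F) • Q) - 2 = _
    rw [stabCard_smul G Q x.2, unipCard_smul G Q x.2]
  let T := (Finset.univ.filter fun ω : Ω => 2 ≤ stabCard G ω.out).image fun ω => (ω.out : X)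
  refine ⟨T, ?_, ?_, ?_, ?_⟩
  · intro P hP
    obtain ⟨ω, hω, rfl⟩ := Finset.mem_image.mp hP
    exact (Finset.mem_filter.mp hω).2
  · intro P hP Q hQ x hx hxP
    obtain ⟨ω, hω, rfl⟩ := Finset.mem_image.mp hP
    obtain ⟨ω', hω', rfl⟩ := Finset.mem_image.mp hQ
    have : π ω'.out = π ω.out := (hπ _ _).mpr ⟨⟨x, hx⟩, hxP⟩
    rw [hout, hout] at this
    rw [this]
  · intro P hP
    obtain ⟨x, hx⟩ := (hπ P (π P).out).mp (by rw [hout])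
    refine ⟨(π P).out, Finset.mem_image.mpr ⟨π P, ?_, rfl⟩, x, x.2, hx⟩
    rw [Finset.mem_filter]
    refine ⟨Finset.mem_univ _, ?_⟩
    rw [← hx] at hP
    change 2 ≤ stabCard G ((x : GL (Fin 2) F) • _) at hP
    rwa [stabCard_smul G _ x.2] at hP
  · rw [Finset.sum_image (fun a _ b _ h => hinj h)]
    -- Orbits with trivial projective stabilizer have both counts equal to 1, and their term 1 + (1
    -- - 2)/1 vanishes.
    have hall : ∑ ω ∈ Finset.univ.filter (fun ω : Ω => 2 ≤ stabCard G ω.out),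
        (1 + ((unipCard G (ω.out : X) : ℚ) - 2) / stabCard G (ω.out : X)) =
        ∑ ω : Ω, (1 + ((unipCard G (ω.out : X) : ℚ) - 2) / stabCard G (ω.out : X)) := by
      refine Finset.sum_subset (Finset.filter_subset _ _) fun ω _ hω => ?_
      have h1 : ¬ 2 ≤ stabCard G (ω.out : X) := fun h =>
        hω (Finset.mem_filter.mpr ⟨Finset.mem_univ _, h⟩)
      have h3 := stabCard_pos G (ω.out : X)
      have h4 := unipCard_le_stabCard G (ω.out : X)
      have h5 := unipCard_pos G (ω.out : X)
      have e1 : stabCard G (ω.out : X) = 1 := by omega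
      have e2 : unipCard G (ω.out : X) = 1 := by omega
      rw [e1, e2]
      norm_num
    rw [hall]
    have hsum := sum_fixer_card h2 G hG
    have hω : ∀ ω : Ω, ∑ P ∈ Finset.univ.filter (fun P : X => π P = ω), f P =
        projCard G * (1 + ((unipCard G (ω.out : X) : ℚ) - 2) / stabCard G (ω.out : X)) := by
      intro ω
      have h1 : ∀ P ∈ Finset.univ.filter (fun P : X => π P = ω), f P = f ω.out := fun P hP =>
        hf _ _ (by rw [hout]; exact (Finset.mem_filter.mp hP).2)
      rw [Finset.sum_congr rfl h1, Finset.sum_const, nsmul_eq_mul]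
      have h3 : (Finset.univ.filter (fun P : X => π P = ω)).card =
          Nat.card (MulAction.orbit G (ω.out : X)) := by
        rw [← Fintype.card_subtype, ← Nat.card_eq_fintype_card]
        refine Nat.card_congr (Equiv.subtypeEquivRight fun P => ?_)
        rw [← hπ, hout]
      have h4 : (stabCard G (ω.out : X) : ℚ) ≠ 0 := by exact_mod_cast (stabCard_pos G _).ne'
      rw [h3, ← card_orbit_mul_stabCard G (ω.out : X)]
      simp only [f]
      push_cast
      field_simp
      ring
    rw [← Finset.sum_fiberwise Finset.univ π, Finset.sum_congr rfl fun ω _ => hω ω,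
      ← Finset.mul_sum] at hsum
    field_simp
    linear_combination hsum

end Orbits

/-! ### The index-two subgroup of elements of determinant one. -/

section DetOne

variable (F : Type*) [Field F]

/-- The matrices of determinant `1` in `GL(2,F)`. -/
def detOne : Subgroup (GL (Fin 2) F) := (Matrix.GeneralLinearGroup.det (n := Fin 2) (R := F)).ker

variable {F}

lemma mem_detOne {x : GL (Fin 2) F} : x ∈ detOne F ↔ (x : Matrix (Fin 2) (Fin 2) F).det = 1 := by
  rw [detOne, MonoidHom.mem_ker, Units.ext_iff]
  rfl

lemma det_ne_zero (x : GL (Fin 2) F) : (x : Matrix (Fin 2) (Fin 2) F).det ≠ 0 :=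
  (Matrix.isUnit_iff_isUnit_det _).mp x.isUnit |>.ne_zero

lemma det_mul' (x y : GL (Fin 2) F) : ((x * y : GL (Fin 2) F) : Matrix (Fin 2) (Fin 2) F).det =
    (x : Matrix (Fin 2) (Fin 2) F).det * (y : Matrix (Fin 2) (Fin 2) F).det := by
  rw [Units.val_mul, Matrix.det_mul]

lemma det_inv' (x : GL (Fin 2) F) : ((x⁻¹ : GL (Fin 2) F) : Matrix (Fin 2) (Fin 2) F).det =
    ((x : Matrix (Fin 2) (Fin 2) F).det)⁻¹ := by
  apply eq_inv_of_mul_eq_one_left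
  rw [← det_mul', inv_mul_cancel, Units.val_one, Matrix.det_one]

lemma conj_mem_detOne {x y : GL (Fin 2) F} (hy : y ∈ detOne F) : x * y * x⁻¹ ∈ detOne F := by
  rw [mem_detOne] at hy ⊢
  rw [det_mul', det_mul', hy, det_inv', mul_one, mul_inv_cancel₀ (det_ne_zero x)]

lemma unip_inf_detOne (G : Subgroup (GL (Fin 2) F)) (P : ℙ F (Fin 2 → F)) :
    unip (G ⊓ detOne F) P = unip G P := by
  ext x
  constructor
  · rintro ⟨h1, h2⟩
    exact ⟨h1.1, h2⟩
  · rintro ⟨h1, h2⟩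
    exact ⟨⟨h1, mem_detOne.mpr h2.2⟩, h2⟩

lemma unipCard_inf_detOne (G : Subgroup (GL (Fin 2) F)) (P : ℙ F (Fin 2 → F)) :
    unipCard (G ⊓ detOne F) P = unipCard G P := by
  rw [unipCard, unip_inf_detOne, unipCard]

lemma fixer_inf_detOne (G : Subgroup (GL (Fin 2) F)) (P : ℙ F (Fin 2 → F)) :
    fixer (G ⊓ detOne F) P = fixer G P ⊓ detOne F := by
  rw [fixer, fixer, inf_right_comm]

/-- The standing assumptions on `G`: a subgroup of `GL(2,F)` with determinants `±1`, square
discriminants, scalars of determinant `1`, and not contained in `SL(2,F)`. -/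
structure IsOuter (G : Subgroup (GL (Fin 2) F)) : Prop where
  isSquare_discr : ∀ x ∈ G, IsSquare (x : Matrix (Fin 2) (Fin 2) F).discr
  det_sq : ∀ x ∈ G, (x : Matrix (Fin 2) (Fin 2) F).det ^ 2 = 1
  scalar : ∀ x ∈ G, x ∈ Subgroup.center (GL (Fin 2) F) → x ∈ detOne F
  not_le : ¬ G ≤ detOne F

lemma det_eq_neg_one {x : GL (Fin 2) F} (h : (x : Matrix (Fin 2) (Fin 2) F).det ^ 2 = 1)
    (hx : x ∉ detOne F) : (x : Matrix (Fin 2) (Fin 2) F).det = -1 :=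
  ((mul_self_eq_one_iff (a := (x : Matrix (Fin 2) (Fin 2) F).det)).mp (by rw [← sq, h])).resolve_left
    fun h => hx (mem_detOne.mpr h)

lemma mul_mem_detOne {x y : GL (Fin 2) F} (h : (x : Matrix (Fin 2) (Fin 2) F).det ^ 2 = 1)
    (h' : (y : Matrix (Fin 2) (Fin 2) F).det ^ 2 = 1) (hx : x ∉ detOne F) (hy : y ∉ detOne F) :
    x * y ∈ detOne F := by
  rw [mem_detOne, det_mul', det_eq_neg_one h hx, det_eq_neg_one h' hy, neg_mul_neg, one_mul]

/-- A group of matrices of determinant `±1`, one of them with determinant `-1`, has twice as many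
elements as its subgroup of elements of determinant `1`. -/
lemma card_eq_two_mul {K : Subgroup (GL (Fin 2) F)}
    (hK : ∀ x ∈ K, (x : Matrix (Fin 2) (Fin 2) F).det ^ 2 = 1) {a : GL (Fin 2) F} (ha : a ∈ K)
    (ha' : a ∉ detOne F) : Nat.card K = 2 * Nat.card ↥(K ⊓ detOne F) := by
  classical
  have e : ↥(K ⊓ detOne F) ⊕ ↥(K ⊓ detOne F) ≃ K := by
    refine Equiv.ofBijective (Sum.elim (fun x => ⟨x, x.2.1⟩) (fun x => ⟨a * x, mul_mem ha x.2.1⟩))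
      ⟨?_, ?_⟩
    · have key : ∀ x y : ↥(K ⊓ detOne F), (x : GL (Fin 2) F) ≠ a * y := by
        intro x y h
        apply ha'
        have : a = x * (y : GL (Fin 2) F)⁻¹ := by rw [h]; group
        rw [this]
        exact (detOne F).mul_mem x.2.2 ((detOne F).inv_mem y.2.2)
      rintro (x | x) (y | y) h
      · exact congrArg Sum.inl (Subtype.ext (congrArg (fun z : K => (z : GL (Fin 2) F)) h))
      · exact absurd (congrArg (fun z : K => (z : GL (Fin 2) F)) h) (key x y)
      · exact absurd (congrArg (fun z : K => (z : GL (Fin 2) F)) h).symm (key y x)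
      · exact congrArg Sum.inr (Subtype.ext
          (mul_left_cancel (congrArg (fun z : K => (z : GL (Fin 2) F)) h)))
    · rintro ⟨x, hx⟩
      by_cases h : x ∈ detOne F
      · exact ⟨Sum.inl ⟨x, hx, h⟩, rfl⟩
      · refine ⟨Sum.inr ⟨a⁻¹ * x, K.mul_mem (K.inv_mem ha) hx, ?_⟩, ?_⟩
        · exact mul_mem_detOne (hK _ (K.inv_mem ha)) (hK _ hx)
            (fun h => ha' ((detOne F).inv_mem_iff.mp h)) h
        · exact Subtype.ext (mul_inv_cancel_left a x)
  rcases finite_or_infinite ↥(K ⊓ detOne F) with hfin | hinf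
  · rw [← Nat.card_congr e, Nat.card_sum]; ring
  · have : Infinite K := Infinite.of_injective (fun x : ↥(K ⊓ detOne F) => (⟨x, x.2.1⟩ : K))
      (fun x y h => Subtype.ext (congrArg (fun z : K => (z : GL (Fin 2) F)) h))
    rw [Nat.card_eq_zero_of_infinite, Nat.card_eq_zero_of_infinite]

variable {G : Subgroup (GL (Fin 2) F)}

lemma IsOuter.card_eq (hG : IsOuter G) : Nat.card G = 2 * Nat.card ↥(G ⊓ detOne F) := by
  obtain ⟨a, ha, ha'⟩ := SetLike.not_le_iff_exists.mp hG.not_le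
  exact card_eq_two_mul hG.det_sq ha ha'

lemma IsOuter.numScalar_inf (hG : IsOuter G) : numScalar (G ⊓ detOne F) = numScalar G := by
  rw [numScalar, numScalar]
  congr 2
  ext x
  exact ⟨fun h => ⟨h.1.1, h.2⟩, fun h => ⟨⟨h.1, hG.scalar x h.1 h.2⟩, h.2⟩⟩

lemma IsOuter.stabCard_inf_of_le (hG : IsOuter G) {P : ℙ F (Fin 2 → F)}
    (h : fixer G P ≤ detOne F) : stabCard (G ⊓ detOne F) P = stabCard G P := by
  rw [stabCard, stabCard, hG.numScalar_inf, fixer_inf_detOne, inf_eq_left.mpr h]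

variable [Finite F]

lemma IsOuter.projCard_eq (hG : IsOuter G) : projCard G = 2 * projCard (G ⊓ detOne F) := by
  apply Nat.eq_of_mul_eq_mul_left (numScalar_pos G)
  rw [numScalar_mul_projCard, hG.card_eq, ← numScalar_mul_projCard (G ⊓ detOne F),
    hG.numScalar_inf]
  ring

/-- The `k`-th power of an element of the stabilizer of `P` is scalar for `k` the order of this
stabilizer in `PGL(2,F)`. -/
lemma pow_stabCard_mem_center {P : ℙ F (Fin 2 → F)} {x : GL (Fin 2) F} (hx : x ∈ fixer G P) :
    x ^ stabCard G P ∈ Subgroup.center (GL (Fin 2) F) := by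
  let Z : Subgroup (fixer G P) := (Subgroup.center (GL (Fin 2) F)).subgroupOf (fixer G P)
  have hZ : Nat.card Z = numScalar G := by
    refine Nat.card_congr ⟨fun y => ⟨y.1.1, (mem_fixer.mp y.1.2).1, y.2⟩,
      fun y => ⟨⟨y.1, center_le_fixer G P y.2⟩, y.2.2⟩, fun y => rfl, fun y => rfl⟩
  have hidx : Z.index = stabCard G P := by
    apply Nat.eq_of_mul_eq_mul_left (numScalar_pos G)
    rw [numScalar_mul_stabCard, ← hZ, Subgroup.card_mul_index]
  have : (⟨x, hx⟩ : fixer G P) ^ Z.index ∈ Z := Subgroup.pow_index_mem Z _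
  rw [hidx] at this
  exact this

/-- For `s = stabCard G P` the power `x ^ s` is scalar, hence of determinant 1. When `s` is odd and
`det x = ±1`, this power has the same determinant as `x`. -/
lemma IsOuter.fixer_le_of_odd (hG : IsOuter G) {P : ℙ F (Fin 2 → F)}
    (h : Odd (stabCard G P)) : fixer G P ≤ detOne F := by
  intro x hx
  have hxG := (mem_fixer.mp hx).1
  have h1 := hG.scalar _ (pow_mem hxG _) (pow_stabCard_mem_center hx)
  obtain ⟨k, hk⟩ := h
  rw [mem_detOne, Units.val_pow_eq_pow_val, Matrix.det_pow, hk, pow_succ, pow_mul,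
    hG.det_sq x hxG, one_pow, one_mul] at h1
  exact mem_detOne.mpr h1

/-- The points of a set of `G`-inequivalent lines contribute to the orbit equation of
`G ∩ SL(2,F)`. -/
lemma IsOuter.sum_le (hG : IsOuter G) (h2 : (2 : F) ≠ 0) (T : Finset (ℙ F (Fin 2 → F)))
    (hT : ∀ P ∈ T, ∀ Q ∈ T, ∀ x ∈ G, x • P = Q → P = Q) :
    ∑ P ∈ T, (((stabCard (G ⊓ detOne F) P : ℚ) + unipCard G P - 2) / stabCard G P) ≤
      1 - 2 / projCard G := by
  classical
  have : Fintype (ℙ F (Fin 2 → F)) := Fintype.ofFinite _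
  let X := ℙ F (Fin 2 → F)
  let f : X → ℚ := fun P => (stabCard (G ⊓ detOne F) P : ℚ) + unipCard (G ⊓ detOne F) P - 2
  have hg0 : (projCard G : ℚ) ≠ 0 := by exact_mod_cast (projCard_pos G).ne'
  have hf0 : ∀ P, 0 ≤ f P := by
    intro P
    have h1 : (1 : ℚ) ≤ stabCard (G ⊓ detOne F) P := by exact_mod_cast stabCard_pos _ P
    have h3 : (1 : ℚ) ≤ unipCard (G ⊓ detOne F) P := by exact_mod_cast unipCard_pos _ P
    simp only [f]
    linarith
  have hinv : ∀ P, ∀ x ∈ G, f (x • P) = f P := by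
    intro P x hx
    have h1 : Nat.card (fixer (G ⊓ detOne F) (x • P)) = Nat.card (fixer (G ⊓ detOne F) P) := by
      refine card_eq_of_conj (fixer (G ⊓ detOne F)) G (fun P x hx u hu => ?_) P hx
      rw [fixer_inf_detOne] at hu ⊢
      exact ⟨conj_mem_fixer hx hu.1, conj_mem_detOne hu.2⟩
    simp only [f, stabCard, unipCard_inf_detOne, h1, unipCard_smul G P hx]
  let O : X → Finset X := fun P => Finset.univ.filter fun R => R ∈ MulAction.orbit G P
  have hO : ∀ P, ∑ R ∈ O P, f R =
      projCard G * (((stabCard (G ⊓ detOne F) P : ℚ) + unipCard G P - 2) / stabCard G P) := by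
    intro P
    have h1 : ∀ R ∈ O P, f R = f P := by
      intro R hR
      obtain ⟨x, rfl⟩ := (Finset.mem_filter.mp hR).2
      exact hinv P x x.2
    have h3 : (O P).card = Nat.card (MulAction.orbit G P) := by
      rw [← Fintype.card_subtype, ← Nat.card_eq_fintype_card]
    have h4 : (stabCard G P : ℚ) ≠ 0 := by exact_mod_cast (stabCard_pos G _).ne'
    rw [Finset.sum_congr rfl h1, Finset.sum_const, nsmul_eq_mul, h3,
      ← card_orbit_mul_stabCard G P]
    simp only [f, unipCard_inf_detOne]
    push_cast
    field_simp
  have hdisj : (T : Set X).PairwiseDisjoint O := by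
    intro P hP Q hQ hPQ
    rw [Function.onFun, Finset.disjoint_left]
    intro R hR hR'
    apply hPQ
    obtain ⟨x, hx⟩ := (Finset.mem_filter.mp hR).2
    obtain ⟨y, hy⟩ := (Finset.mem_filter.mp hR').2
    refine hT P hP Q hQ (y⁻¹ * x : G) (y⁻¹ * x).2 ?_
    change (y⁻¹ * x) • P = Q
    rw [mul_smul, inv_smul_eq_iff]
    exact hx.trans hy.symm
  have htot : ∑ R ∈ T.biUnion O, f R ≤ ∑ R, f R :=
    Finset.sum_le_sum_of_subset_of_nonneg (Finset.subset_univ _) (fun R _ _ => hf0 R)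
  rw [Finset.sum_biUnion hdisj, Finset.sum_congr rfl fun P _ => hO P, ← Finset.mul_sum,
    sum_fixer_card h2 _ (fun x hx => hG.isSquare_discr x (Subgroup.mem_inf.mp hx).1)] at htot
  -- Twice the projective order of `G ⊓ detOne F` is `projCard G`, so the total for the subgroup is
  -- `projCard G - 2`.
  have hp := hG.projCard_eq
  have hpos : (0 : ℚ) < projCard G := by exact_mod_cast projCard_pos G
  have e : (2 : ℚ) * projCard (G ⊓ detOne F) - 2 = projCard G * (1 - 2 / projCard G) := by
    rw [mul_sub, mul_div_cancel₀ _ hg0, hp]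
    push_cast
    ring
  rw [e] at htot
  exact le_of_mul_le_mul_left htot hpos

end DetOne

/-! ### Arithmetic of the orbit equation. -/

section Numeric

variable {F : Type*} [Field F] [Finite F] {G : Subgroup (GL (Fin 2) F)}

lemma IsOuter.two_dvd_projCard (hG : IsOuter G) : ∃ k, 0 < k ∧ projCard G = 2 * k :=
  ⟨_, projCard_pos _, hG.projCard_eq⟩

lemma stabCard_dvd (G : Subgroup (GL (Fin 2) F)) (P : ℙ F (Fin 2 → F)) :
    stabCard G P ∣ projCard G := ⟨_, by rw [mul_comm]; exact (card_orbit_mul_stabCard G P).symm⟩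

/-- The inequality that eliminates configurations: two inequivalent points cannot both keep most of
their stabilizers inside SL(2,F). It is strict because of the term `2 / projCard G`. -/
lemma IsOuter.pair_lt (hG : IsOuter G) (h2 : (2 : F) ≠ 0) {P Q : ℙ F (Fin 2 → F)}
    (hPQ : ∀ x ∈ G, x • P ≠ Q) :
    ((stabCard (G ⊓ detOne F) P : ℚ) + unipCard G P - 2) / stabCard G P +
      ((stabCard (G ⊓ detOne F) Q : ℚ) + unipCard G Q - 2) / stabCard G Q < 1 := by
  classical
  have hne : P ≠ Q := fun h => hPQ 1 (one_mem _) (by rw [one_smul, h])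
  have h := hG.sum_le h2 {P, Q} (by
    intro A hA B hB x hx hxA
    simp only [Finset.mem_insert, Finset.mem_singleton] at hA hB
    rcases hA with rfl | rfl <;> rcases hB with rfl | rfl
    · rfl
    · exact absurd hxA (hPQ x hx)
    · exact absurd (by rw [← hxA, inv_smul_smul]) (hPQ x⁻¹ (inv_mem hx))
    · rfl)
  rw [Finset.sum_pair hne] at h
  have hpos : (0 : ℚ) < projCard G := by exact_mod_cast projCard_pos G
  have : (0 : ℚ) < 2 / projCard G := by positivity
  linarith

/-- The equation of the Platonic groups. The left side must exceed 1, whereas it is at most 1 if `a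
≥ 3`, or `a = 2` and `b ≥ 4`, or `a = 2`, `b = 3` and `c ≥ 6`. -/
lemma inv_sum_three {a b c g : ℕ} (ha : 2 ≤ a) (hab : a ≤ b) (hbc : b ≤ c) (hg : 0 < g)
    (h : (1 : ℚ) / a + 1 / b + 1 / c = 1 + 2 / g) :
    (a = 2 ∧ b = 2 ∧ 2 * c = g) ∨ (a = 2 ∧ b = 3 ∧ c = 3) ∨ (a = 2 ∧ b = 3 ∧ c = 4 ∧ g = 24) ∨
      (a = 2 ∧ b = 3 ∧ c = 5) := by
  have hg' : (0 : ℚ) < g := by exact_mod_cast hg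
  have hgp : (0 : ℚ) < 2 / g := by positivity
  have ha' : (2 : ℚ) ≤ a := by exact_mod_cast ha
  have hab' : (a : ℚ) ≤ b := by exact_mod_cast hab
  have hbc' : (b : ℚ) ≤ c := by exact_mod_cast hbc
  have a2 : a = 2 := by
    by_contra hne
    have h3 : (3 : ℚ) ≤ a := by exact_mod_cast (by omega : 3 ≤ a)
    have e1 : (1 : ℚ) / a ≤ 1 / 3 := one_div_le_one_div_of_le (by norm_num) h3
    have e2 : (1 : ℚ) / b ≤ 1 / 3 := one_div_le_one_div_of_le (by norm_num) (by linarith)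
    have e3 : (1 : ℚ) / c ≤ 1 / 3 := one_div_le_one_div_of_le (by norm_num) (by linarith)
    linarith
  subst a2
  have b3 : b = 2 ∨ b = 3 := by
    by_contra hne
    have h3 : (4 : ℚ) ≤ b := by exact_mod_cast (by omega : 4 ≤ b)
    have e2 : (1 : ℚ) / b ≤ 1 / 4 := one_div_le_one_div_of_le (by norm_num) (by linarith)
    have e3 : (1 : ℚ) / c ≤ 1 / 4 := one_div_le_one_div_of_le (by norm_num) (by linarith)
    push_cast at h
    linarith
  rcases b3 with rfl | rfl
  · left
    refine ⟨rfl, rfl, ?_⟩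
    have hc : (0 : ℚ) < c := by linarith
    push_cast at h
    have h3 : (1 : ℚ) / c = 2 / g := by linarith
    rw [div_eq_div_iff hc.ne' hg'.ne'] at h3
    have h4 : ((2 * c : ℕ) : ℚ) = g := by push_cast; linarith
    exact_mod_cast h4
  · right
    have hc5 : c < 6 := by
      by_contra hne
      have h3 : (6 : ℚ) ≤ c := by exact_mod_cast (by omega : 6 ≤ c)
      have e3 : (1 : ℚ) / c ≤ 1 / 6 := one_div_le_one_div_of_le (by norm_num) (by linarith)
      push_cast at h
      linarith
    interval_cases c
    · exact Or.inl ⟨rfl, rfl, rfl⟩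
    · refine Or.inr (Or.inl ⟨rfl, rfl, rfl, ?_⟩)
      push_cast at h
      have h3 : (2 : ℚ) / g = 1 / 12 := by linarith
      rw [div_eq_div_iff hg'.ne' (by norm_num)] at h3
      have h4 : (g : ℚ) = (24 : ℕ) := by push_cast; linarith
      exact_mod_cast h4
    · exact Or.inr (Or.inr ⟨rfl, rfl, rfl⟩)

/-- The possibilities for the orbits of nontrivial stabilizers. -/
def SemisimpleCases (G : Subgroup (GL (Fin 2) F)) : Prop :=
  (∃ P, stabCard G P = projCard G) ∨ (∃ P, 2 ≤ stabCard G P ∧ 2 * stabCard G P = projCard G) ∨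
    (projCard G = 24 ∧ (∃ P, stabCard G P = 4 ∧ ¬ fixer G P ≤ detOne F) ∧
      (∃ P, stabCard G P = 3) ∧
      ∀ P, stabCard G P = 1 ∨ stabCard G P = 2 ∨ stabCard G P = 3 ∨ stabCard G P = 4)

/-- A stabilizer of order `s` contained in SL(2,F) contributes `(s - 1) / s` to `IsOuter.pair_lt`,
and stabilizers of odd order are so contained. Thus (2,3,3) and (2,3,5) fail because 2/3 + 2/3 and
2/3 + 4/5 exceed 1, and in (2,3,4) the stabilizer of order 4 must leave SL(2,F) because 2/3 + 3/4
exceeds 1. -/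
lemma IsOuter.three_orbits (hG : IsOuter G) (h2 : (2 : F) ≠ 0) (hU : ∀ P, unipCard G P = 1)
    {P Q R : ℙ F (Fin 2 → F)} (hPQ : P ≠ Q) (hPR : P ≠ R) (hQR : Q ≠ R)
    {T : Finset (ℙ F (Fin 2 → F))} (hT : ∀ A, A ∈ T ↔ A = P ∨ A = Q ∨ A = R)
    (hT2 : ∀ P ∈ T, 2 ≤ stabCard G P)
    (hTinj : ∀ P ∈ T, ∀ Q ∈ T, ∀ x ∈ G, x • P = Q → P = Q)
    (hTsurj : ∀ P, 2 ≤ stabCard G P → ∃ Q ∈ T, ∃ x ∈ G, x • Q = P)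
    (hsum : (1 : ℚ) / stabCard G P + 1 / stabCard G Q + 1 / stabCard G R = 1 + 2 / projCard G)
    (h1 : stabCard G P ≤ stabCard G Q) (h3 : stabCard G Q ≤ stabCard G R) :
    SemisimpleCases G := by
  have hPT : P ∈ T := (hT P).mpr (Or.inl rfl)
  have hQT : Q ∈ T := (hT Q).mpr (Or.inr (Or.inl rfl))
  have hRT : R ∈ T := (hT R).mpr (Or.inr (Or.inr rfl))
  have hlt := hG.pair_lt h2 (P := Q) (Q := R) (fun x hx h => hQR (hTinj Q hQT R hRT x hx h))
  rw [hU, hU] at hlt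
  rcases inv_sum_three (hT2 P hPT) h1 h3 (projCard_pos G) hsum with
    ⟨ha, hb, hc⟩ | ⟨ha, hb, hc⟩ | ⟨ha, hb, hc, hg⟩ | ⟨ha, hb, hc⟩
  · exact Or.inr (Or.inl ⟨R, hT2 R hRT, hc⟩)
  · exfalso
    rw [hG.stabCard_inf_of_le (hG.fixer_le_of_odd (by rw [hb]; decide)),
      hG.stabCard_inf_of_le (hG.fixer_le_of_odd (by rw [hc]; decide)), hb, hc] at hlt
    norm_num at hlt
  · refine Or.inr (Or.inr ⟨hg, ⟨R, hc, fun hle => ?_⟩, ⟨Q, hb⟩, fun A => ?_⟩)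
    · rw [hG.stabCard_inf_of_le (hG.fixer_le_of_odd (by rw [hb]; decide)),
        hG.stabCard_inf_of_le hle, hb, hc] at hlt
      norm_num at hlt
    · by_cases hA : 2 ≤ stabCard G A
      · obtain ⟨B, hB, x, hx, rfl⟩ := hTsurj A hA
        rw [stabCard_smul G B hx]
        rcases (hT B).mp hB with rfl | rfl | rfl
        · exact Or.inr (Or.inl ha)
        · exact Or.inr (Or.inr (Or.inl hb))
        · exact Or.inr (Or.inr (Or.inr hc))
      · have := stabCard_pos G A
        omega
  · exfalso
    rw [hG.stabCard_inf_of_le (hG.fixer_le_of_odd (by rw [hb]; decide)),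
      hG.stabCard_inf_of_le (hG.fixer_le_of_odd (by rw [hc]; decide)), hb, hc] at hlt
    norm_num at hlt

lemma IsOuter.semisimpleCases (hG : IsOuter G) (h2 : (2 : F) ≠ 0)
    (hU : ∀ P, unipCard G P = 1) : SemisimpleCases G := by
  classical
  obtain ⟨T, hT2, hTinj, hTsurj, hsum⟩ := orbit_equation h2 G hG.isSquare_discr
  obtain ⟨k, hk, hg⟩ := hG.two_dvd_projCard
  have hg0 : (0 : ℚ) < projCard G := by exact_mod_cast projCard_pos G
  have hgle : (2 : ℚ) / projCard G ≤ 1 := by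
    rw [div_le_one hg0]; exact_mod_cast (by omega : 2 ≤ projCard G)
  have hgpos : (0 : ℚ) < 2 / projCard G := by positivity
  have hterm : ∀ P, (1 + ((unipCard G P : ℚ) - 2) / stabCard G P) = 1 - 1 / stabCard G P := by
    intro P
    rw [hU]
    push_cast
    ring
  rw [Finset.sum_congr rfl fun P _ => hterm P] at hsum
  -- Each term is at least 1/2 and the sum is less than 2.
  have hcard : T.card ≤ 3 := by
    by_contra hne
    have h4 : (4 : ℚ) ≤ T.card := by exact_mod_cast (by omega : 4 ≤ T.card)
    have h5 : ∑ P ∈ T, (1 / 2 : ℚ) ≤ ∑ P ∈ T, (1 - 1 / (stabCard G P : ℚ)) := by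
      refine Finset.sum_le_sum fun P hP => ?_
      have h6 : (2 : ℚ) ≤ stabCard G P := by exact_mod_cast hT2 P hP
      have h7 := one_div_le_one_div_of_le (by norm_num) h6
      linarith
    rw [Finset.sum_const, nsmul_eq_mul, hsum] at h5
    linarith
  have hinv : ∀ P, (0 : ℚ) < 1 / stabCard G P := by
    intro P
    have : (0 : ℚ) < stabCard G P := by exact_mod_cast stabCard_pos G P
    positivity
  -- The sum is at least 1 because `projCard G` is even, while each term is below 1; so there are at
  -- least two orbits.
  interval_cases hc : T.card
  · rw [Finset.card_eq_zero] at hc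
    rw [hc, Finset.sum_empty] at hsum
    linarith
  · obtain ⟨P, rfl⟩ := Finset.card_eq_one.mp hc
    rw [Finset.sum_singleton] at hsum
    have := hinv P
    linarith
  · obtain ⟨P, Q, hPQ, rfl⟩ := Finset.card_eq_two.mp hc
    rw [Finset.sum_pair hPQ] at hsum
    -- Two reciprocals, each at least `1 / projCard G`, add up to `2 / projCard G`: both points are
    -- fixed by all of `G`.
    have hle : ∀ R, (1 : ℚ) / projCard G ≤ 1 / stabCard G R := by
      intro R
      apply one_div_le_one_div_of_le
      · exact_mod_cast stabCard_pos G R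
      · exact_mod_cast Nat.le_of_dvd (projCard_pos G) (stabCard_dvd G R)
    have h3 := hle P
    have h4 := hle Q
    have h5 : (1 : ℚ) / stabCard G P = 1 / projCard G := by
      have : (2 : ℚ) / projCard G = 1 / projCard G + 1 / projCard G := by ring
      linarith
    left
    refine ⟨P, ?_⟩
    rw [one_div, one_div, inv_inj] at h5
    exact_mod_cast h5
  · obtain ⟨P, Q, R, hPQ, hPR, hQR, rfl⟩ := Finset.card_eq_three.mp hc
    rw [Finset.sum_insert (by simp [hPQ, hPR]), Finset.sum_pair hQR] at hsum
    have hs : (1 : ℚ) / stabCard G P + 1 / stabCard G Q + 1 / stabCard G R =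
      1 + 2 / projCard G := by linarith
    have key := fun {A B C : ℙ F (Fin 2 → F)} (h1 : A ≠ B) (h3 : A ≠ C) (h4 : B ≠ C)
      (h5 : ∀ D, D ∈ ({P, Q, R} : Finset (ℙ F (Fin 2 → F))) ↔ D = A ∨ D = B ∨ D = C) =>
      hG.three_orbits h2 hU h1 h3 h4 h5 hT2 hTinj hTsurj
    have hmem : ∀ D, D ∈ ({P, Q, R} : Finset (ℙ F (Fin 2 → F))) ↔ D = P ∨ D = Q ∨ D = R := by
      intro D; simp
    rcases le_total (stabCard G P) (stabCard G Q) with h1 | h1 <;>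
      rcases le_total (stabCard G Q) (stabCard G R) with h3 | h3 <;>
      rcases le_total (stabCard G P) (stabCard G R) with h4 | h4
    · exact key hPQ hPR hQR (fun D => by rw [hmem]) (by linarith) h1 h3
    · exact key hPQ hPR hQR (fun D => by rw [hmem]) (by linarith) h1 h3
    · exact key hPR hPQ hQR.symm (fun D => by rw [hmem]; tauto) (by linarith) h4 h3
    · exact key hPR.symm hQR.symm hPQ (fun D => by rw [hmem]; tauto) (by linarith) h4 h1
    · exact key hPQ.symm hQR hPR (fun D => by rw [hmem]; tauto) (by linarith) h1 h4
    · exact key hQR hPQ.symm hPR.symm (fun D => by rw [hmem]; tauto) (by linarith) h3 h4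
    · exact key hPQ.symm hQR hPR (fun D => by rw [hmem]; tauto) (by linarith) h1 h4
    · exact key hQR.symm hPR.symm hPQ.symm (fun D => by rw [hmem]; tauto) (by linarith) h3 h1

/-- The arithmetic of the orbit equation in the presence of unipotent elements: `Q` is the number of
unipotent elements with a given fixed line, `Q * e` the order of the stabilizer of this line,
`Q * u + 1` the number of such lines and `a` the order of the remaining nontrivial stabilizer. -/
lemma unipotent_arith {Q e u a : ℕ} (hQ : 3 ≤ Q) (he : 0 < e) (heQ : e ≤ Q - 1) (hu : 0 < u)
    (h : a * (1 + (Q - 2) * u) = e * (1 + Q * u)) :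
    (u = 1 ∧ Q - 1 ≤ 2 * e) ∨ (Q = 3 ∧ u = 3 ∧ e = 2 ∧ a = 5) := by
  obtain ⟨Q, rfl⟩ : ∃ Q', Q = Q' + 3 := ⟨Q - 3, by omega⟩
  have e1 : Q + 3 - 2 = Q + 1 := by omega
  have e2 : Q + 3 - 1 = Q + 2 := by omega
  rw [e1] at h
  rw [e2] at heQ ⊢
  -- With `Q + 3` in place of `Q` the equation reads `a * D = e * (D + 2 * u)`. As `D` is prime to
  -- `u`, it divides `2 * e`, which is at most `2 * (Q + 2)`.
  set D := 1 + (Q + 1) * u with hD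
  have h3 : 1 + (Q + 3) * u = D + 2 * u := by rw [hD]; ring
  rw [h3] at h
  have hdvd : D ∣ 2 * e * u := by
    have : D ∣ e * D + 2 * e * u := ⟨a, by linarith⟩
    exact (Nat.dvd_add_right (Dvd.intro_left e rfl)).mp this
  have hcop : Nat.Coprime D u := by
    rw [hD, Nat.coprime_comm]
    simp
  have hd2 : D ∣ 2 * e := hcop.dvd_of_dvd_mul_right hdvd
  obtain ⟨c, hc⟩ := hd2
  have hcpos : 0 < c := by
    rcases Nat.eq_zero_or_pos c with rfl | h
    · omega
    · exact h
  have hDle : D ≤ 2 * e := hc ▸ Nat.le_mul_of_pos_right D hcpos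
  rcases Nat.lt_or_ge u 2 with h4 | h4
  · left
    have : u = 1 := by omega
    subst this
    exact ⟨rfl, by omega⟩
  rcases Nat.lt_or_ge u 3 with h5 | h5
  -- For `u = 2` the divisor `D = 2 * Q + 3` is odd, so it is not `2 * e`, and twice it is already
  -- larger than `2 * e`.
  · exfalso
    have : u = 2 := by omega
    subst this
    have hDv : D = 2 * Q + 3 := by rw [hD]; ring
    rcases Nat.lt_or_ge c 2 with h6 | h6
    · have : c = 1 := by omega
      subst this
      omega
    · nlinarith
  · right
    -- Now `3 * Q + 4 ≤ 2 * e ≤ 2 * Q + 4`, which leaves only the shifted value `Q = 0`.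
    have h6 : 1 + 3 * (Q + 1) ≤ D := by rw [hD]; nlinarith
    have hQ0 : Q = 0 := by omega
    subst hQ0
    have hu3 : u = 3 := by omega
    subst hu3
    have : e = 2 := by omega
    subst this
    omega

end Numeric

/-! ### Abstract criteria for the abelian, dihedral and dicyclic types. -/

section GroupKinds

variable {X : Type*} [Group X] {p : ℕ} [Fact p.Prime] {N : Subgroup X}

/-- An element of the join is `k * b ^ i` with `k ∈ K`. It lies in `K` if `i` is even; for odd `i`,
lying in `N` would put `b` into `N`. -/
lemma sup_zpowers_inf_eq {K : Subgroup X} {b : X} (hK : K ≤ N)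
    (hb : b ∈ Subgroup.normalizer (K : Set X)) (hbN : b ∉ N) (hb2 : b ^ 2 ∈ K) :
    (K ⊔ Subgroup.zpowers b) ⊓ N = K := by
  apply le_antisymm
  · rintro y ⟨hy, hyN⟩
    have hle : Subgroup.zpowers b ≤ Subgroup.normalizer (K : Set X) := by simpa using hb
    have hy' : y ∈ (↑(K ⊔ Subgroup.zpowers b) : Set X) := hy
    rw [Subgroup.coe_mul_of_right_le_normalizer_left _ _ hle] at hy'
    obtain ⟨k, hk, _, ⟨i, rfl⟩, rfl⟩ := hy'
    have hpow : ∀ j : ℤ, b ^ (2 * j) ∈ K := fun j => by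
      rw [zpow_mul]
      exact K.zpow_mem (by exact_mod_cast hb2) j
    rcases Int.even_or_odd' i with ⟨j, rfl | rfl⟩
    · exact K.mul_mem hk (hpow j)
    · exfalso
      apply hbN
      have h1 : b = (k * b ^ (2 * j))⁻¹ * (k * b ^ (2 * j + 1)) := by
        rw [zpow_add_one]; group
      rw [h1]
      exact N.mul_mem (N.inv_mem (hK (K.mul_mem hk (hpow j)))) hyN
  · exact le_inf le_sup_left hK

lemma mem_normalizer_of_commute {a b : X} (h : Commute a b) :
    b ∈ Subgroup.normalizer (Subgroup.zpowers a : Set X) := by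
  refine mem_normalizer_zpowers 1 1 ?_ ?_
  · rw [zpow_one, ← h.eq, mul_inv_cancel_right]
  · rw [zpow_one, mul_assoc, h.eq, inv_mul_cancel_left]

lemma card_sup_eq_two_mul {K : Subgroup X} [Finite K] {b : X}
    (hb : b ∈ Subgroup.normalizer (K : Set X)) (hbK : b ∉ K) (hb2 : b ^ 2 ∈ K) :
    Nat.card ↥(K ⊔ Subgroup.zpowers b) = 2 * Nat.card K := by
  obtain ⟨hfin, hcard⟩ := card_sup_zpowers_le K b 2 two_pos hb hb2
  exact le_antisymm (by omega) (two_mul_card_le_sup K b hbK)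

lemma finite_zpowers_of_orderOf {a : X} {c : ℕ} (hc : 0 < c) (ha : orderOf a = c) :
    Finite (Subgroup.zpowers a) :=
  Nat.finite_of_card_ne_zero (by rw [Nat.card_zpowers, ha]; omega)

lemma mem_normalizer_sup_zpowers {a b x : X}
    [Finite ↥(Subgroup.zpowers a ⊔ Subgroup.zpowers b)]
    (ha : x * a * x⁻¹ ∈ Subgroup.zpowers a ⊔ Subgroup.zpowers b)
    (hb : x * b * x⁻¹ ∈ Subgroup.zpowers a ⊔ Subgroup.zpowers b) :
    x ∈ Subgroup.normalizer ((Subgroup.zpowers a ⊔ Subgroup.zpowers b : Subgroup X) : Set X) := by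
  have : Subgroup.zpowers a ⊔ Subgroup.zpowers b ≤
      (Subgroup.zpowers a ⊔ Subgroup.zpowers b).comap (MulAut.conj x).toMonoidHom := by
    rw [sup_le_iff, Subgroup.zpowers_le, Subgroup.zpowers_le]
    exact ⟨ha, hb⟩
  have hfin : Finite ((Subgroup.zpowers a ⊔ Subgroup.zpowers b : Subgroup X) : Set X) := ‹_›
  exact Subgroup.mem_normalizer_fintype this

lemma nonempty_mulEquiv_prod {a b : X} {c : ℕ} (hc : 0 < c) (ha : orderOf a = c)
    (hb : b ∉ Subgroup.zpowers a) (hb2 : b ^ 2 = 1) (h : Commute a b) :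
    Nonempty (↥(Subgroup.zpowers a ⊔ Subgroup.zpowers b) ≃*
      Multiplicative (ZMod c) × Multiplicative (ZMod 2)) := by
  have : NeZero c := ⟨hc.ne'⟩
  have hfin := finite_zpowers_of_orderOf hc ha
  refine nonempty_mulEquiv_of_pair (b := (Multiplicative.ofAdd (1 : ZMod c), 1))
    (y := (1, Multiplicative.ofAdd (1 : ZMod 2))) (m := 2) two_pos hc ha ?_ ?_ ?_ ?_ ?_ ?_
  · rw [Prod.orderOf, orderOf_one, Nat.lcm_one_right, orderOf_ofAdd_eq_addOrderOf,
      ZMod.addOrderOf_one]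
  · exact mem_normalizer_of_commute (Prod.ext h.eq (by simp))
  · have : ((b, (1, Multiplicative.ofAdd (1 : ZMod 2))) :
        X × (Multiplicative (ZMod c) × Multiplicative (ZMod 2))) ^ 2 = 1 := by
      refine Prod.ext hb2 (Prod.ext (one_pow 2) ?_)
      change Multiplicative.ofAdd (1 : ZMod 2) ^ 2 = 1
      rw [← ofAdd_nsmul]
      decide
    rw [this]; exact one_mem _
  · rw [eq_top_iff]
    rintro ⟨i, j⟩ -
    have hi : ((i, j) : Multiplicative (ZMod c) × Multiplicative (ZMod 2)) =
        (Multiplicative.ofAdd (1 : ZMod c), 1) ^ (Multiplicative.toAdd i).val *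
        (1, Multiplicative.ofAdd (1 : ZMod 2)) ^ (Multiplicative.toAdd j).val := by
      refine Prod.ext ?_ ?_
      · simp only [Prod.fst_mul, Prod.pow_fst, one_pow, mul_one]
        rw [← ofAdd_nsmul, nsmul_one, ZMod.natCast_zmod_val, ofAdd_toAdd]
      · simp only [Prod.snd_mul, Prod.pow_snd, one_pow, one_mul]
        rw [← ofAdd_nsmul, nsmul_one, ZMod.natCast_zmod_val, ofAdd_toAdd]
    rw [hi]
    exact mul_mem (Subgroup.mem_sup_left (Subgroup.npow_mem_zpowers _ _))
      (Subgroup.mem_sup_right (Subgroup.npow_mem_zpowers _ _))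
  · rw [Nat.card_prod, Nat.card_eq_fintype_card, Nat.card_eq_fintype_card, Fintype.card_multiplicative,
      Fintype.card_multiplicative, ZMod.card, ZMod.card]
  · rw [card_sup_eq_two_mul (mem_normalizer_of_commute h) hb (by rw [hb2]; exact one_mem _),
      Nat.card_zpowers, ha, mul_comm]

lemma isKind_abelian {a b : X} {c : ℕ} (hc : 0 < c) (ha : orderOf a = c)
    (hb : b ∉ Subgroup.zpowers a) (hb2 : b ^ 2 = 1) (h : Commute a b) :
    IsKind p N (Subgroup.zpowers a ⊔ Subgroup.zpowers b) (.abelian c) :=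
  nonempty_mulEquiv_prod hc ha hb hb2 h

lemma isCyclic_of_odd {a b : X} {c : ℕ} (hc : Odd c) (ha : orderOf a = c)
    (hb : b ∉ Subgroup.zpowers a) (hb2 : b ^ 2 = 1) (h : Commute a b) :
    IsCyclic ↥(Subgroup.zpowers a ⊔ Subgroup.zpowers b) ∧
      Nat.card ↥(Subgroup.zpowers a ⊔ Subgroup.zpowers b) = 2 * c := by
  have hfin := finite_zpowers_of_orderOf hc.pos ha
  have hcard := card_sup_eq_two_mul (mem_normalizer_of_commute h) hb
    (by rw [hb2]; exact one_mem _)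
  have hfin' := (card_sup_zpowers_le _ b 2 two_pos (mem_normalizer_of_commute h)
    (by rw [hb2]; exact one_mem _)).1
  rw [Nat.card_zpowers, ha] at hcard
  refine ⟨?_, hcard⟩
  have hb1 : orderOf b = 2 := orderOf_eq_prime hb2 fun h1 => hb (h1 ▸ one_mem _)
  refine isCyclic_of_orderOf_eq_card (⟨a * b, mul_mem
    (Subgroup.mem_sup_left (Subgroup.mem_zpowers a))
    (Subgroup.mem_sup_right (Subgroup.mem_zpowers b))⟩ :
      ↥(Subgroup.zpowers a ⊔ Subgroup.zpowers b)) ?_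
  rw [hcard, Subgroup.orderOf_mk, h.orderOf_mul_eq_mul_orderOf_of_coprime, ha, hb1, mul_comm]
  rw [ha, hb1, Nat.coprime_comm]
  exact (Nat.coprime_two_left (n := c)).mpr hc

lemma isKind_dihedral {a x : X} {d : ℕ} (hd : 0 < d) (ha : orderOf a = d)
    (hx : x ∉ Subgroup.zpowers a) (hx2 : x ^ 2 = 1) (h : x * a * x⁻¹ = a⁻¹) :
    IsKind p N (Subgroup.zpowers a ⊔ Subgroup.zpowers x) (.dihedral d) :=
  nonempty_mulEquiv_dihedralGroup hd ha hx hx2 h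

/-- The generator `α` lies outside `N`, but `α ^ 2` and `ε` lie inside. These two generate a
dicyclic group normalized by `α`, and by `sup_zpowers_inf_eq` it is the whole intersection with `N`.
-/
lemma isKind_hatDic {α ε : X} {m : ℕ} (hm : 0 < m) (hα : orderOf α = 4 * m) (hαN : α ∉ N)
    (hα2 : α ^ 2 ∈ N) (hεN : ε ∈ N) (hε : ε ∉ Subgroup.zpowers α) (hε2 : ε ^ 2 = α ^ (2 * m))
    (h : ε⁻¹ * α * ε = α ^ (2 * m - 1)) :
    IsKind p N (Subgroup.zpowers α ⊔ Subgroup.zpowers ε) (.hatDic m) := by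
  obtain ⟨h1, h3⟩ := nonempty_mulEquiv_hatDic hm hα hε hε2 h
  refine ⟨h1, h3, ?_⟩
  have hαε : α * ε = ε * α ^ (2 * m - 1) := by rw [← h]; group
  have ho : orderOf (α ^ 2) = 2 * m := by
    rw [orderOf_pow_of_dvd two_ne_zero (by rw [hα]; exact ⟨2 * m, by ring⟩), hα]
    omega
  have hle : Subgroup.zpowers (α ^ 2) ≤ Subgroup.zpowers α := by
    rw [Subgroup.zpowers_le]
    exact Subgroup.npow_mem_zpowers _ _
  have hεn : ε * α ^ 2 * ε⁻¹ = (α ^ 2)⁻¹ := by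
    have e1 : (ε⁻¹ * α * ε) ^ 2 = (α ^ 2)⁻¹ := by
      rw [h, ← pow_mul, eq_inv_iff_mul_eq_one, ← pow_add,
        show (2 * m - 1) * 2 + 2 = 4 * m by omega, ← hα, pow_orderOf_eq_one]
    have e2 : ε⁻¹ * α ^ 2 * ε = (α ^ 2)⁻¹ := by
      rw [← e1, sq, sq]; group
    have e3 : ε * (ε⁻¹ * α ^ 2 * ε) * ε⁻¹ = α ^ 2 := by group
    rw [e2] at e3
    calc ε * α ^ 2 * ε⁻¹ = (ε * (α ^ 2)⁻¹ * ε⁻¹)⁻¹ := by group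
      _ = _ := by rw [e3]
  have hsup : Subgroup.zpowers α ⊔ Subgroup.zpowers ε =
      (Subgroup.zpowers (α ^ 2) ⊔ Subgroup.zpowers ε) ⊔ Subgroup.zpowers α := by
    rw [sup_right_comm, sup_eq_right.mpr hle]
  have hnorm : α ∈ Subgroup.normalizer
      ((Subgroup.zpowers (α ^ 2) ⊔ Subgroup.zpowers ε : Subgroup X) : Set X) := by
    have hfin : Finite ↥(Subgroup.zpowers (α ^ 2) ⊔ Subgroup.zpowers ε) := by
      have := finite_zpowers_of_orderOf (by omega : 0 < 2 * m) ho
      refine (card_sup_zpowers_le _ ε 2 two_pos (mem_normalizer_of_conj_inv hεn) ?_).1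
      rw [hε2, pow_mul]
      exact Subgroup.npow_mem_zpowers _ _
    apply mem_normalizer_sup_zpowers
    · rw [show α * α ^ 2 * α⁻¹ = α ^ 2 by group]
      exact Subgroup.mem_sup_left (Subgroup.mem_zpowers _)
    · rw [hαε, mul_assoc]
      refine mul_mem (Subgroup.mem_sup_right (Subgroup.mem_zpowers _))
        (Subgroup.mem_sup_left ⟨(m : ℤ) - 1, ?_⟩)
      simp only
      rw [← zpow_natCast, ← zpow_natCast, ← zpow_mul, ← zpow_sub_one]
      congr 1
      push_cast [show 1 ≤ 2 * m by omega]
      ring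
  rw [hsup, sup_zpowers_inf_eq _ hnorm hαN
    (Subgroup.mem_sup_left (Subgroup.mem_zpowers _))]
  · refine nonempty_mulEquiv_quaternionGroup hm ho (fun h => hε (hle h)) ?_ hεn
    rw [hε2, pow_mul]
  · rw [sup_le_iff, Subgroup.zpowers_le, Subgroup.zpowers_le]
    exact ⟨hα2, hεN⟩

/-- The involution `b` centralizes `a` and multiplies `ε` by the central involution `a ^ m`, so it
normalizes the dicyclic group; lying outside `N`, it generates a complement. -/
lemma isKind_dicSemi {a ε b : X} {m : ℕ} (hm : 0 < m) (ha : orderOf a = 2 * m) (haN : a ∈ N)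
    (hεN : ε ∈ N) (hε : ε ∉ Subgroup.zpowers a) (hε2 : ε ^ 2 = a ^ m)
    (hεa : ε * a * ε⁻¹ = a⁻¹) (hbN : b ∉ N) (hb2 : b ^ 2 = 1) (hba : Commute a b)
    (hbε : b * ε * b⁻¹ = a ^ m * ε) :
    IsKind p N ((Subgroup.zpowers a ⊔ Subgroup.zpowers ε) ⊔ Subgroup.zpowers b)
      (.dicSemi m) := by
  set K := Subgroup.zpowers a ⊔ Subgroup.zpowers ε with hK
  have hKN : K ≤ N := by
    rw [hK, sup_le_iff, Subgroup.zpowers_le, Subgroup.zpowers_le]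
    exact ⟨haN, hεN⟩
  have hfa := finite_zpowers_of_orderOf (by omega : 0 < 2 * m) ha
  have hε2' : ε ^ 2 ∈ Subgroup.zpowers a := by rw [hε2]; exact Subgroup.npow_mem_zpowers _ _
  have hfK : Finite K := (card_sup_zpowers_le _ ε 2 two_pos (mem_normalizer_of_conj_inv hεa) hε2').1
  have hcardK : Nat.card K = 4 * m := by
    rw [hK, card_sup_eq_two_mul (mem_normalizer_of_conj_inv hεa) hε hε2', Nat.card_zpowers, ha]
    ring
  have hnorm : b ∈ Subgroup.normalizer (K : Set X) := by
    apply mem_normalizer_sup_zpowers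
    · rw [← hba.eq, mul_inv_cancel_right]
      exact Subgroup.mem_sup_left (Subgroup.mem_zpowers _)
    · rw [hbε]
      exact mul_mem (Subgroup.mem_sup_left (Subgroup.npow_mem_zpowers _ _))
        (Subgroup.mem_sup_right (Subgroup.mem_zpowers _))
  have hb2K : b ^ 2 ∈ K := by rw [hb2]; exact one_mem _
  have hinf := sup_zpowers_inf_eq hKN hnorm hbN hb2K
  have hb1 : orderOf b = 2 := orderOf_eq_prime hb2 fun h1 => hbN (h1 ▸ one_mem _)
  refine ⟨?_, ?_, Subgroup.zpowers b, by rw [Nat.card_zpowers, hb1], ?_⟩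
  · rw [card_sup_eq_two_mul hnorm (fun h => hbN (hKN h)) hb2K, hcardK]
    ring
  · rw [hinf]
    exact nonempty_mulEquiv_quaternionGroup hm ha hε hε2 hεa
  · rw [hinf]
    refine ⟨?_, ?_, rfl⟩
    · rw [sup_le_iff, Subgroup.zpowers_le]
      exact ⟨Subgroup.le_normalizer, hnorm⟩
    · rw [eq_bot_iff]
      rintro y ⟨hyK, i, rfl⟩
      simp only at hyK ⊢
      have hz : b ^ i = 1 ∨ b ^ i = b := by
        rcases Int.even_or_odd' i with ⟨j, rfl | rfl⟩
        · left
          rw [zpow_mul]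
          have : b ^ (2 : ℤ) = 1 := by exact_mod_cast hb2
          rw [this, one_zpow]
        · right
          rw [zpow_add_one, zpow_mul]
          have : b ^ (2 : ℤ) = 1 := by exact_mod_cast hb2
          rw [this, one_zpow, one_mul]
      rcases hz with h | h
      · rw [h]; exact one_mem _
      · exact absurd (h ▸ hKN hyK) hbN

end GroupKinds

/-! ### Groups of diagonal matrices: split and nonsplit tori. -/

section Diagonal

variable {F : Type*} [Field F]

/-- The diagonal matrices in `GL(2,F)`. -/
def diagSub (F : Type*) [Field F] : Subgroup (GL (Fin 2) F) where
  carrier := {x | x.val 0 1 = 0 ∧ x.val 1 0 = 0}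
  one_mem' := by simp
  mul_mem' := by
    rintro x y ⟨h1, h2⟩ ⟨h3, h4⟩
    simp [Matrix.mul_apply, Fin.sum_univ_two, h1, h2, h3, h4]
  inv_mem' := by
    rintro x ⟨h1, h2⟩
    simp only [Set.mem_ofPred_eq, Matrix.coe_units_inv, Matrix.inv_def, Matrix.adjugate_fin_two]
    simp [h1, h2]

lemma mem_diagSub {x : GL (Fin 2) F} : x ∈ diagSub F ↔ x.val 0 1 = 0 ∧ x.val 1 0 = 0 := Iff.rfl

lemma det_of_diag {x : GL (Fin 2) F} (hx : x ∈ diagSub F) :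
    x.val.det = x.val 0 0 * x.val 1 1 := by
  rw [Matrix.det_fin_two, hx.1, zero_mul, sub_zero]

lemma diag_ext {x y : GL (Fin 2) F} (hx : x ∈ diagSub F) (hy : y ∈ diagSub F)
    (h0 : x.val 0 0 = y.val 0 0) (h1 : x.val 1 1 = y.val 1 1) : x = y := by
  apply Units.ext
  ext i j
  fin_cases i <;> fin_cases j
  · exact h0
  · exact hx.1.trans hy.1.symm
  · exact hx.2.trans hy.2.symm
  · exact h1

lemma diag_mul_00 {x y : GL (Fin 2) F} (hx : x ∈ diagSub F) :
    (x * y).val 0 0 = x.val 0 0 * y.val 0 0 := by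
  rw [Units.val_mul, Matrix.mul_apply, Fin.sum_univ_two, hx.1, zero_mul, add_zero]

lemma diag_mul_11 {x y : GL (Fin 2) F} (hx : x ∈ diagSub F) :
    (x * y).val 1 1 = x.val 1 1 * y.val 1 1 := by
  rw [Units.val_mul, Matrix.mul_apply, Fin.sum_univ_two, hx.2, zero_mul, zero_add]

lemma diag_pow_00 {x : GL (Fin 2) F} (hx : x ∈ diagSub F) (k : ℕ) :
    (x ^ k).val 0 0 = x.val 0 0 ^ k := by
  induction k with
  | zero => simp
  | succ k ih => rw [pow_succ', diag_mul_00 hx, ih, pow_succ']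

lemma diag_pow_11 {x : GL (Fin 2) F} (hx : x ∈ diagSub F) (k : ℕ) :
    (x ^ k).val 1 1 = x.val 1 1 ^ k := by
  induction k with
  | zero => simp
  | succ k ih => rw [pow_succ', diag_mul_11 hx, ih, pow_succ']

lemma diag_commute {x y : GL (Fin 2) F} (hx : x ∈ diagSub F) (hy : y ∈ diagSub F) :
    Commute x y := by
  refine diag_ext (mul_mem hx hy) (mul_mem hy hx) ?_ ?_
  · rw [diag_mul_00 hx, diag_mul_00 hy, mul_comm]
  · rw [diag_mul_11 hx, diag_mul_11 hy, mul_comm]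

lemma diag_ne_zero {x : GL (Fin 2) F} (hx : x ∈ diagSub F) : x.val 0 0 ≠ 0 := fun h =>
  det_ne_zero x (by rw [det_of_diag hx, h, zero_mul])

lemma diag_eq_one {x : GL (Fin 2) F} (hx : x ∈ diagSub F) (h : x.val 0 0 = 1)
    (hdet : x.val.det = 1) : x = 1 := by
  rw [det_of_diag hx, h, one_mul] at hdet
  exact diag_ext hx (one_mem _) (by simpa using h) (by simpa using hdet)

lemma det_pow' (x : GL (Fin 2) F) (k : ℕ) : (x ^ k).val.det = x.val.det ^ k := by
  rw [Units.val_pow_eq_pow_val, Matrix.det_pow]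

/-- A finite group of diagonal matrices is cyclic if its elements are determined by their first
entry. -/
lemma exists_diag_generator [Finite F] {C : Subgroup (GL (Fin 2) F)} (hC : C ≤ diagSub F)
    (hinj : ∀ x ∈ C, x.val 0 0 = 1 → x = 1) :
    ∃ a ∈ C, Subgroup.zpowers a = C ∧ ∀ k : ℕ, a.val 0 0 ^ k = 1 ↔ orderOf a ∣ k := by
  let f : C →* F :=
    { toFun := fun x => x.1.val 0 0
      map_one' := by simp
      map_mul' := fun x y => diag_mul_00 (hC x.2) }
  have hf : Function.Injective f := by
    intro x y hxy
    have h1 : f (x⁻¹ * y) = 1 := by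
      rw [map_mul, ← hxy, ← map_mul, inv_mul_cancel, map_one]
    have h2 := hinj _ (x⁻¹ * y).2 h1
    have h3 : x⁻¹ * y = 1 := Subtype.ext h2
    rw [inv_mul_eq_one] at h3
    exact h3
  have := isCyclic_of_injective_ringHom f hf
  obtain ⟨⟨a, ha⟩, hgen⟩ := IsCyclic.exists_generator (α := C)
  refine ⟨a, ha, ?_, fun k => ?_⟩
  · apply le_antisymm
    · rwa [Subgroup.zpowers_le]
    · intro x hx
      obtain ⟨i, hi⟩ := hgen ⟨x, hx⟩
      exact ⟨i, congrArg Subtype.val hi⟩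
  · rw [orderOf_dvd_iff_pow_eq_one, ← diag_pow_00 (hC ha)]
    exact ⟨hinj _ (pow_mem ha k), fun h => by rw [h]; simp⟩

lemma eq_inf_sup_zpowers {K : Subgroup (GL (Fin 2) F)}
    (hK : ∀ x ∈ K, x.val.det ^ 2 = 1) {b : GL (Fin 2) F} (hb : b ∈ K) (hb' : b ∉ detOne F) :
    K = K ⊓ detOne F ⊔ Subgroup.zpowers b := by
  apply le_antisymm
  · intro x hx
    by_cases h : x ∈ detOne F
    · exact Subgroup.mem_sup_left ⟨hx, h⟩
    · have h1 : x * b ∈ K ⊓ detOne F :=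
        ⟨mul_mem hx hb, mul_mem_detOne (hK x hx) (hK b hb) h hb'⟩
      have h2 : x = x * b * b⁻¹ := by group
      rw [h2]
      exact mul_mem (Subgroup.mem_sup_left h1)
        (Subgroup.mem_sup_right (inv_mem (Subgroup.mem_zpowers b)))
  · rw [sup_le_iff, Subgroup.zpowers_le]
    exact ⟨inf_le_left, hb⟩

/-- The antidiagonal matrices. -/
def IsAntidiag (x : GL (Fin 2) F) : Prop := x.val 0 0 = 0 ∧ x.val 1 1 = 0

lemma IsAntidiag.not_mem_diagSub {x : GL (Fin 2) F} (hx : IsAntidiag x) : x ∉ diagSub F := by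
  intro h
  apply det_ne_zero x
  rw [det_of_diag h, hx.1, zero_mul]

lemma val_sq_of_antidiag {x : GL (Fin 2) F} (hx : IsAntidiag x) :
    (x ^ 2).val = (-x.val.det) • 1 := by
  rw [Units.val_pow_eq_pow_val, sq, Matrix.det_fin_two, hx.1, hx.2]
  ext i j
  fin_cases i <;> fin_cases j <;>
    simp [Matrix.mul_apply, Fin.sum_univ_two, hx.1, hx.2, mul_comm]

lemma antidiag_mul_diag {x c : GL (Fin 2) F} (hx : IsAntidiag x) (hc : c ∈ diagSub F) :
    x.val * c.val = (c.val.det • (c⁻¹).val) * x.val := by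
  rw [Matrix.coe_units_inv, Matrix.inv_def, Ring.inverse_eq_inv', smul_smul,
    mul_inv_cancel₀ (det_ne_zero c), one_smul, Matrix.adjugate_fin_two]
  ext i j
  fin_cases i <;> fin_cases j <;>
    simp [Matrix.mul_apply, Fin.sum_univ_two, hx.1, hx.2, hc.1, hc.2, mul_comm]

variable [Finite F] {q : ℕ}

/-- The structure of a group of diagonal matrices contained in a split torus. -/
lemma split_torus (hq : q % 4 = 1) {C : Subgroup (GL (Fin 2) F)} (hC : C ≤ diagSub F)
    (hdet : ∀ x ∈ C, x.val.det ^ 2 = 1) (hs : ∀ x ∈ C, x.val 0 0 ^ q = x.val.det * x.val 0 0)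
    (hout : ¬ C ≤ detOne F) :
    ∃ α ∈ C, Subgroup.zpowers α = C ∧ α ∉ detOne F ∧ ∃ d, orderOf α = 2 * d ∧ 1 < d ∧
      d ∣ q - 1 ∧ ¬ d ∣ (q - 1) / 2 ∧ ∀ k, α.val 0 0 ^ k = 1 ↔ 2 * d ∣ k := by
  -- The determinant is a power of the first entry, so this entry determines the element. A
  -- generator has determinant -1, hence its order divides `2 * (q - 1)` but not `q - 1`.
  have hs' : ∀ x ∈ C, x.val 0 0 ^ (q - 1) = x.val.det := by
    intro x hx
    have h1 := hs x hx
    rw [show q = q - 1 + 1 by omega, pow_succ] at h1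
    exact mul_right_cancel₀ (diag_ne_zero (hC hx)) h1
  obtain ⟨α, hα, hgen, hord⟩ := exists_diag_generator hC fun x hx h =>
    diag_eq_one (hC hx) h (by rw [← hs' x hx, h, one_pow])
  have hα' : α ∉ detOne F := fun h => hout (by rw [← hgen, Subgroup.zpowers_le]; exact h)
  have hd := det_eq_neg_one (hdet α hα) hα'
  have hn : ¬ orderOf α ∣ q - 1 := by
    rw [← hord, hs' α hα, ← mem_detOne]
    exact hα'
  have hdvd : orderOf α ∣ 2 * (q - 1) := by
    rw [← hord, mul_comm, pow_mul, hs' α hα, hdet α hα]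
  have heven : Even (orderOf α) := by
    by_contra hodd
    rw [Nat.not_even_iff_odd] at hodd
    exact hn ((Nat.coprime_two_right.mpr hodd).dvd_of_dvd_mul_left hdvd)
  obtain ⟨d, hd2⟩ := heven
  rw [← two_mul] at hd2
  have hdq : d ∣ q - 1 := by
    rw [hd2] at hdvd
    exact Nat.dvd_of_mul_dvd_mul_left two_pos hdvd
  have hdq2 : ¬ d ∣ (q - 1) / 2 := by
    intro h
    apply hn
    rw [hd2, show q - 1 = 2 * ((q - 1) / 2) by omega]
    exact Nat.mul_dvd_mul_left 2 h
  refine ⟨α, hα, hgen, hα', d, hd2, ?_, hdq, hdq2, fun k => by rw [hord, hd2]⟩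
  rcases Nat.lt_or_ge 1 d with h | h
  · exact h
  · exfalso
    interval_cases d
    · exact hn (by rw [Nat.zero_dvd.mp hdq]; exact dvd_zero _)
    · exact hdq2 (one_dvd _)

/-- The structure of a group of diagonal matrices contained in a nonsplit torus. -/
lemma nonsplit_torus (hq : q % 4 = 1) {C : Subgroup (GL (Fin 2) F)} (hC : C ≤ diagSub F)
    (hdet : ∀ x ∈ C, x.val.det ^ 2 = 1) (hs : ∀ x ∈ C, x.val 0 0 ^ q = x.val.det * x.val 1 1)
    (hout : ¬ C ≤ detOne F) :
    ∃ a ∈ C, ∃ b ∈ C, Subgroup.zpowers a = C ⊓ detOne F ∧ orderOf a ∣ q + 1 ∧ b ∉ detOne F ∧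
      b ^ 2 = 1 ∧ C = Subgroup.zpowers a ⊔ Subgroup.zpowers b ∧
      ∀ k, a.val 0 0 ^ k = 1 ↔ orderOf a ∣ k := by
  have hs' : ∀ x ∈ C, x.val 0 0 ^ (q + 1) = 1 := by
    intro x hx
    rw [pow_succ, hs x hx, mul_assoc, mul_comm (x.val 1 1), ← det_of_diag (hC hx), ← sq, hdet x hx]
  have hpow : ∀ x ∈ C, x ^ (q + 1) = 1 := by
    intro x hx
    refine diag_eq_one (pow_mem (hC hx) _) (by rw [diag_pow_00 (hC hx), hs' x hx]) ?_
    rw [det_pow', show q + 1 = 2 * ((q + 1) / 2) by omega, pow_mul, hdet x hx, one_pow]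
  obtain ⟨a, ha, hgen, hord⟩ := exists_diag_generator (C := C ⊓ detOne F)
    (inf_le_left.trans hC) fun x hx h => diag_eq_one (hC hx.1) h (mem_detOne.mp hx.2)
  obtain ⟨y, hy, hy'⟩ := SetLike.not_le_iff_exists.mp hout
  -- As q ≡ 1 mod 4, the exponent `(q + 1) / 2` is odd: this power of `y` still has determinant -1,
  -- and it is an involution.
  have hb' : y ^ ((q + 1) / 2) ∉ detOne F := by
    rw [mem_detOne, det_pow', show (q + 1) / 2 = 2 * ((q - 1) / 4) + 1 by omega, pow_succ, pow_mul,
      hdet y hy, one_pow, one_mul, ← mem_detOne]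
    exact hy'
  refine ⟨a, ha.1, y ^ ((q + 1) / 2), pow_mem hy _, hgen, ?_, hb', ?_, ?_, hord⟩
  · rw [← hord, hs' a ha.1]
  · rw [← pow_mul, show (q + 1) / 2 * 2 = q + 1 by omega, hpow y hy]
  · rw [hgen]
    exact eq_inf_sup_zpowers hdet (pow_mem hy _) hb'

variable {p : ℕ} [Fact p.Prime] {n : ℕ}

lemma exists_kind_of_split (hq : p ^ n % 4 = 1) {C : Subgroup (GL (Fin 2) F)} (hC : C ≤ diagSub F)
    (hdet : ∀ x ∈ C, x.val.det ^ 2 = 1)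
    (hs : ∀ x ∈ C, x.val 0 0 ^ p ^ n = x.val.det * x.val 0 0) (hout : ¬ C ≤ detOne F) :
    ∃ t, Admissible p n t ∧ IsKind p (detOne F) C t := by
  obtain ⟨α, hα, hgen, hα', d, hd, h1, h2, h3, -⟩ := split_torus hq hC hdet hs hout
  refine ⟨.cyclic d, ⟨by omega, Or.inl ⟨h2, h3⟩⟩, ?_, ?_⟩
  · rw [← hgen]; infer_instance
  · rw [← hgen, Nat.card_zpowers, hd]

lemma exists_kind_of_nonsplit (hq : p ^ n % 4 = 1) {C : Subgroup (GL (Fin 2) F)}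
    (hC : C ≤ diagSub F) (hdet : ∀ x ∈ C, x.val.det ^ 2 = 1)
    (hs : ∀ x ∈ C, x.val 0 0 ^ p ^ n = x.val.det * x.val 1 1) (hout : ¬ C ≤ detOne F) :
    ∃ t, Admissible p n t ∧ IsKind p (detOne F) C t := by
  obtain ⟨a, ha, b, hb, hgen, hord, hb', hb2, hCab, -⟩ := nonsplit_torus hq hC hdet hs hout
  have hba : b ∉ Subgroup.zpowers a := fun h => hb' (by rw [hgen] at h; exact h.2)
  have hcomm := diag_commute (hC ha) (hC hb)
  have hpos : 0 < orderOf a := orderOf_pos a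
  rcases Nat.even_or_odd (orderOf a) with h | h
  · refine ⟨.abelian (orderOf a), ⟨hord, h⟩, ?_⟩
    rw [hCab]
    exact isKind_abelian hpos rfl hba hb2 hcomm
  · obtain ⟨h1, h2⟩ := isCyclic_of_odd h rfl hba hb2 hcomm
    rw [← hCab] at h1 h2
    by_cases hc : orderOf a = 1
    · exact ⟨.two, trivial, h1, by rw [h2, hc]⟩
    · exact ⟨.cyclic (orderOf a), ⟨by omega, Or.inr ⟨hord, h⟩⟩, h1, h2⟩

end Diagonal

/-! ### Groups of monomial matrices. -/

section Monomial

variable {F : Type*} [Field F]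

lemma sq_eq_of_antidiag {x : GL (Fin 2) F} (hx : IsAntidiag x) (h : x.val.det = -1) :
    x ^ 2 = 1 := Units.ext (by rw [val_sq_of_antidiag hx, h]; simp)

lemma sq_eq_of_antidiag' {x : GL (Fin 2) F} (hx : IsAntidiag x) (h : x.val.det = 1) :
    x ^ 2 = -1 := Units.ext (by rw [val_sq_of_antidiag hx, h]; simp)

lemma antidiag_conj {x c : GL (Fin 2) F} (hx : IsAntidiag x) (hc : c ∈ diagSub F)
    (h : c.val.det = 1) : x * c * x⁻¹ = c⁻¹ := by
  rw [mul_inv_eq_iff_eq_mul]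
  apply Units.ext
  rw [Units.val_mul, Units.val_mul, antidiag_mul_diag hx hc, h, one_smul]

lemma antidiag_conj' {x c : GL (Fin 2) F} (hx : IsAntidiag x) (hc : c ∈ diagSub F)
    (h : c.val.det = -1) : x * c * x⁻¹ = -c⁻¹ := by
  rw [mul_inv_eq_iff_eq_mul]
  apply Units.ext
  rw [Units.val_mul, Units.val_mul, antidiag_mul_diag hx hc, h, neg_one_smul]
  simp

lemma antidiag_mul_antidiag {x y : GL (Fin 2) F} (hx : IsAntidiag x) (hy : IsAntidiag y) :
    x * y ∈ diagSub F := by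
  constructor <;> simp [Matrix.mul_apply, Fin.sum_univ_two, hx.1, hx.2, hy.1, hy.2]

lemma eq_diag_sup_zpowers {K : Subgroup (GL (Fin 2) F)}
    (hK : ∀ x ∈ K, x ∈ diagSub F ∨ IsAntidiag x) {x : GL (Fin 2) F} (hx : x ∈ K)
    (hx' : IsAntidiag x) : K = K ⊓ diagSub F ⊔ Subgroup.zpowers x := by
  apply le_antisymm
  · intro y hy
    rcases hK y hy with h | h
    · exact Subgroup.mem_sup_left ⟨hy, h⟩
    · have h2 : y = y * x * x⁻¹ := by group
      rw [h2]
      exact mul_mem (Subgroup.mem_sup_left ⟨mul_mem hy hx, antidiag_mul_antidiag h hx'⟩)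
        (Subgroup.mem_sup_right (inv_mem (Subgroup.mem_zpowers x)))
  · rw [sup_le_iff, Subgroup.zpowers_le]
    exact ⟨inf_le_left, hx⟩

lemma diag_pow_eq_neg_one {a : GL (Fin 2) F} (ha : a ∈ diagSub F) {m : ℕ}
    (hdet : a.val.det ^ m = 1) (h1 : a.val 0 0 ^ m ≠ 1) (h2 : a.val 0 0 ^ (2 * m) = 1) :
    a ^ m = -1 := by
  have h3 : a.val 0 0 ^ m = -1 := by
    rw [mul_comm, pow_mul, sq, mul_self_eq_one_iff] at h2
    exact h2.resolve_left h1
  have hneg : (-1 : GL (Fin 2) F) ∈ diagSub F := by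
    constructor <;> simp
  refine diag_ext (pow_mem ha m) hneg ?_ ?_
  · rw [diag_pow_00 ha, h3]; simp
  · rw [diag_pow_11 ha]
    rw [det_of_diag ha, mul_pow, h3] at hdet
    simp only [Units.val_neg, Units.val_one, Matrix.neg_apply, Matrix.one_apply_eq]
    linear_combination -hdet

variable [Finite F] {p : ℕ} [Fact p.Prime] {n : ℕ}

/-- If the diagonal part has determinant 1, an antidiagonal element has determinant -1; it is then
an involution inverting the cyclic diagonal part, and the group is dihedral. Otherwise there is an
antidiagonal `ε` of determinant 1, with `ε ^ 2 = -1`, which inverts diagonal elements of determinant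
1 and sends those of determinant -1 to minus their inverses. A split diagonal part then gives
`HatDic`, a nonsplit one the extension of a dicyclic group by an involution. -/
lemma exists_kind_of_monomial (hq : p ^ n % 4 = 1) {K : Subgroup (GL (Fin 2) F)}
    (hdet : ∀ x ∈ K, x.val.det ^ 2 = 1) (hout : ¬ K ≤ detOne F)
    (hK : ∀ x ∈ K, x ∈ diagSub F ∨ IsAntidiag x) (hx : ∃ x ∈ K, IsAntidiag x)
    (hs : (∀ x ∈ K ⊓ diagSub F, x.val 0 0 ^ p ^ n = x.val.det * x.val 0 0) ∨
      (∀ x ∈ K ⊓ diagSub F, x.val 0 0 ^ p ^ n = x.val.det * x.val 1 1)) :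
    ∃ t, Admissible p n t ∧ IsKind p (detOne F) K t := by
  have hC : K ⊓ diagSub F ≤ diagSub F := inf_le_right
  have hCdet : ∀ x ∈ K ⊓ diagSub F, x.val.det ^ 2 = 1 := fun x hx => hdet x hx.1
  by_cases hCN : K ⊓ diagSub F ≤ detOne F
  · obtain ⟨x, hx, hx'⟩ := hx
    have hKx := eq_diag_sup_zpowers hK hx hx'
    have hxN : x ∉ detOne F := by
      intro h
      apply hout
      rw [hKx, sup_le_iff, Subgroup.zpowers_le]
      exact ⟨hCN, h⟩
    obtain ⟨a, ha, hgen, hord⟩ := exists_diag_generator hC fun y hy h =>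
      diag_eq_one (hC hy) h (mem_detOne.mp (hCN hy))
    have ha1 := mem_detOne.mp (hCN ha)
    refine ⟨.dihedral (orderOf a), ?_, ?_⟩
    · rcases hs with hs | hs
      · left
        rw [← hord]
        have h1 := hs a ha
        rw [show p ^ n = p ^ n - 1 + 1 by omega, pow_succ] at h1
        rw [mul_right_cancel₀ (diag_ne_zero (hC ha)) h1, ha1]
      · right
        rw [← hord, pow_succ, hs a ha, ha1, one_mul, mul_comm, ← det_of_diag (hC ha), ha1]
    · rw [hKx, ← hgen]
      refine isKind_dihedral (orderOf_pos a) rfl (fun h => ?_)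
        (sq_eq_of_antidiag hx' (det_eq_neg_one (hdet x hx) hxN)) (antidiag_conj hx' (hC ha) ha1)
      rw [hgen] at h
      exact hx'.not_mem_diagSub h.2
  -- An antidiagonal element of determinant -1 is corrected by a diagonal one of determinant -1.
  · obtain ⟨ε, hε, hε', hεN⟩ : ∃ ε ∈ K, IsAntidiag ε ∧ ε ∈ detOne F := by
      obtain ⟨x, hx, hx'⟩ := hx
      by_cases hxN : x ∈ detOne F
      · exact ⟨x, hx, hx', hxN⟩
      · obtain ⟨c, hc, hc'⟩ := SetLike.not_le_iff_exists.mp hCN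
        refine ⟨x * c, mul_mem hx hc.1, ?_, mul_mem_detOne (hdet x hx) (hdet c hc.1) hxN hc'⟩
        constructor <;> simp [Matrix.mul_apply, Fin.sum_univ_two, hx'.1, hx'.2, hc.2.1, hc.2.2]
    have hKε := eq_diag_sup_zpowers hK hε hε'
    have hε2 := sq_eq_of_antidiag' hε' (mem_detOne.mp hεN)
    have hnotdiag : ∀ y ∈ diagSub F, ε ∉ Subgroup.zpowers y := fun y hy h =>
      hε'.not_mem_diagSub ((Subgroup.zpowers_le.mpr hy) h)
    rcases hs with hs | hs
    · obtain ⟨α, hα, hgen, hαN, d, hd, hd1, hd2, hd3, hord⟩ := split_torus hq hC hCdet hs hCN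
      have hαdet := det_eq_neg_one (hCdet α hα) hαN
      have hdeven : Even d := by
        by_contra hodd
        rw [Nat.not_even_iff_odd] at hodd
        apply hd3
        rw [show p ^ n - 1 = 2 * ((p ^ n - 1) / 2) by omega] at hd2
        exact (Nat.coprime_two_right.mpr hodd).dvd_of_dvd_mul_left hd2
      obtain ⟨m, rfl⟩ := hdeven
      have hpow : α ^ (2 * m) = -1 := by
        refine diag_pow_eq_neg_one (hC hα) ?_ ?_ ?_
        · rw [pow_mul, hCdet α hα, one_pow]
        · rw [Ne, hord]
          intro h
          have := Nat.le_of_dvd (by omega) h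
          omega
        · rw [hord]; exact ⟨1, by ring⟩
      refine ⟨.hatDic m, ⟨?_, ?_⟩, ?_⟩
      · obtain ⟨k, hk⟩ := hd2
        exact ⟨k, by rw [hk, show (m + m) * k = 2 * (m * k) by ring]; omega⟩
      · rintro ⟨k, hk⟩
        apply hd3
        refine ⟨k, ?_⟩
        have : (p ^ n - 1) / 2 = 2 * ((p ^ n - 1) / 4) := by omega
        rw [this, hk]; ring
      · rw [hKε, ← hgen]
        refine isKind_hatDic (by omega) (by rw [hd]; ring) hαN ?_ hεN (hnotdiag α (hC hα))
          (by rw [hε2, hpow]) ?_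
        · rw [mem_detOne, det_pow', hCdet α hα]
        · have h1 := antidiag_conj' hε' (hC hα) hαdet
          have h3 : ε⁻¹ = -ε := by
            rw [inv_eq_iff_mul_eq_one, mul_neg, ← sq, hε2, neg_neg]
          have h4 : ε⁻¹ * α * ε = ε * α * ε⁻¹ := by
            rw [h3]; simp
          rw [h4, h1, ← mul_left_inj α, ← pow_succ, show 2 * m - 1 + 1 = 2 * m by omega, hpow,
            neg_mul, inv_mul_cancel]
    · obtain ⟨a, ha, b, hb, hgen, hord, hbN, hb2, hCab, hord'⟩ := nonsplit_torus hq hC hCdet hs hCN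
      have haN : a ∈ detOne F := by
        have := Subgroup.mem_zpowers a
        rw [hgen] at this
        exact this.2
      have ha1 := mem_detOne.mp haN
      have hab := diag_commute (hC ha) (hC hb)
      have hbdet := det_eq_neg_one (hCdet b hb) hbN
      have hneg : (-1 : GL (Fin 2) F) ∈ Subgroup.zpowers a := by
        rw [hgen]
        refine ⟨⟨?_, ?_, ?_⟩, ?_⟩
        · rw [← hε2]; exact pow_mem hε 2
        · simp
        · simp
        · rw [← hε2]; exact pow_mem hεN 2
      have h2 : (2 : F) ≠ 0 := by
        intro h
        apply hbN
        rw [mem_detOne, hbdet]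
        linear_combination -h
      have hne : (-1 : GL (Fin 2) F) ≠ 1 := by
        intro h
        have := congrArg (fun y : GL (Fin 2) F => y.val 0 0) h
        simp only [Units.val_neg, Units.val_one, Matrix.neg_apply, Matrix.one_apply_eq] at this
        exact h2 (by linear_combination -this)
      have heven : Even (orderOf a) := by
        have h1 : orderOf (-1 : GL (Fin 2) F) = 2 := orderOf_eq_prime (by simp) hne
        have h3 := orderOf_dvd_of_mem_zpowers hneg
        rw [h1] at h3
        exact even_iff_two_dvd.mpr h3
      obtain ⟨m, hm⟩ := heven
      have hmpos : 0 < m := by have := orderOf_pos a; omega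
      have hpow : a ^ m = -1 := by
        refine diag_pow_eq_neg_one (hC ha) (by rw [ha1, one_pow]) ?_ ?_
        · rw [Ne, hord', hm]
          intro h
          have := Nat.le_of_dvd hmpos h
          omega
        · rw [hord', hm, two_mul]
      have hbε : b * ε * b⁻¹ = a ^ m * ε := by
        have h1 := antidiag_conj' hε' (hC hb) hbdet
        rw [mul_inv_eq_iff_eq_mul] at h1 ⊢
        rw [hpow, neg_mul, one_mul, neg_mul, h1, neg_mul, neg_neg]
        rw [inv_mul_eq_iff_eq_mul.mpr]
        rw [← mul_assoc, ← sq, hb2, one_mul]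
      have hba : b⁻¹ = b := by rw [inv_eq_iff_mul_eq_one, ← sq, hb2]
      have hεa := antidiag_conj hε' (hC ha) ha1
      rcases Nat.lt_or_ge 1 m with hm1 | hm1
      · refine ⟨.dicSemi m, ⟨hm1, ?_⟩, ?_⟩
        · obtain ⟨k, hk⟩ := hord
          exact ⟨k, by rw [hk, hm, show (m + m) * k = 2 * (m * k) by ring]; omega⟩
        · rw [hKε, hCab, sup_right_comm]
          exact isKind_dicSemi hmpos (by rw [hm]; ring) haN hεN (hnotdiag a (hC ha))
            (by rw [hε2, hpow]) hεa hbN hb2 hab hbε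
      -- Here `a = -1 = ε ^ 2` is redundant, and `b` inverts `ε`, which has order 4: the group is
      -- dihedral of order 8, admissible because 4 divides `q - 1`.
      · have hm1' : m = 1 := by omega
        subst hm1'
        rw [pow_one] at hpow hbε
        have hε4 : orderOf ε = 4 := by
          refine orderOf_eq_prime_pow (p := 2) (n := 1) ?_ ?_
          · rw [pow_one, hε2]; exact hne
          · rw [show 2 ^ (1 + 1) = 2 * 2 by norm_num, pow_mul, hε2]; simp
        refine ⟨.dihedral 4, Or.inl (by omega), ?_⟩
        have hKeq : K = Subgroup.zpowers ε ⊔ Subgroup.zpowers b := by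
          rw [hKε, hCab, sup_right_comm]
          congr 1
          rw [sup_eq_right, Subgroup.zpowers_le, hpow, ← hε2]
          exact Subgroup.npow_mem_zpowers _ _
        rw [hKeq]
        refine isKind_dihedral (by norm_num) hε4 (fun h => hbN ?_) hb2 ?_
        · exact (Subgroup.zpowers_le.mpr hεN) h
        · rw [hbε, hpow, neg_mul, one_mul, eq_comm, inv_eq_iff_mul_eq_one, mul_neg, ← sq, hε2,
            neg_neg]

end Monomial

/-! ### A presentation of GL(2,3) and its order. -/

section BinaryOctahedral

variable {X Y : Type*} [Group X] [Group Y]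

/-- Relations satisfied by a pair of generators of `GL(2,3)`. -/
structure OctRel (A w : X) : Prop where
  pow_eight : A ^ 8 = 1
  conj_sq : (w * A ^ 2 * w⁻¹) * A ^ 2 * (w * A ^ 2 * w⁻¹)⁻¹ = (A ^ 2)⁻¹
  sq_eq : (w * A ^ 2 * w⁻¹) ^ 2 = (A ^ 2) ^ 2
  conj_w : w * (w * A ^ 2 * w⁻¹) * w⁻¹ = (w * A ^ 2 * w⁻¹) * A ^ 2
  pow_three : w ^ 3 = 1
  conj_A : A * (w * A ^ 2 * w⁻¹) * A⁻¹ = (w * A ^ 2 * w⁻¹) * A ^ 2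
  conj_A_w : A * w * A⁻¹ = w⁻¹ * (A ^ 2)⁻¹

/-- The quaternion group inside the group generated by `A` and `w`. -/
def octQ (A w : X) : Subgroup X := Subgroup.zpowers (A ^ 2) ⊔ Subgroup.zpowers (w * A ^ 2 * w⁻¹)

/-- The group generated by `A` and `w`. -/
def octGroup (A w : X) : Subgroup X := (octQ A w ⊔ Subgroup.zpowers w) ⊔ Subgroup.zpowers A

lemma octGroup_map (f : X →* Y) (A w : X) :
    (octGroup A w).map f = octGroup (f A) (f w) := by
  simp only [octGroup, octQ, Subgroup.map_sup, MonoidHom.map_zpowers, map_mul, map_pow, map_inv]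

lemma OctRel.prod {A w : X} {A' w' : Y} (h : OctRel A w) (h' : OctRel A' w') :
    OctRel (A, A') (w, w') where
  pow_eight := Prod.ext h.pow_eight h'.pow_eight
  conj_sq := Prod.ext h.conj_sq h'.conj_sq
  sq_eq := Prod.ext h.sq_eq h'.sq_eq
  conj_w := Prod.ext h.conj_w h'.conj_w
  pow_three := Prod.ext h.pow_three h'.pow_three
  conj_A := Prod.ext h.conj_A h'.conj_A
  conj_A_w := Prod.ext h.conj_A_w h'.conj_A_w

lemma mem_octQ_left (A w : X) : A ^ 2 ∈ octQ A w :=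
  Subgroup.mem_sup_left (Subgroup.mem_zpowers _)

lemma mem_octQ_right (A w : X) : w * A ^ 2 * w⁻¹ ∈ octQ A w :=
  Subgroup.mem_sup_right (Subgroup.mem_zpowers _)

/-- The elements `A ^ 2` and `w * A ^ 2 * w⁻¹` satisfy the relations of the quaternion group of
order 8. In the next two bounds `w`, with cube 1, normalizes this group and `A`, with square in it,
normalizes their join, giving the factors 3 and 2. -/
lemma OctRel.card_octQ_le {A w : X} (h : OctRel A w) :
    Finite (octQ A w) ∧ Nat.card (octQ A w) ≤ 8 := by
  have h4 : (A ^ 2) ^ 4 = 1 := by rw [← pow_mul, h.pow_eight]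
  have hfin : Finite (Subgroup.zpowers (A ^ 2)) := finite_zpowers_of_orderOf
    (isOfFinOrder_iff_pow_eq_one.mpr ⟨4, by norm_num, h4⟩).orderOf_pos rfl
  have hle := orderOf_le_of_pow_eq_one (by norm_num) h4
  obtain ⟨h1, h2⟩ := card_sup_zpowers_le (Subgroup.zpowers (A ^ 2)) (w * A ^ 2 * w⁻¹) 2 two_pos
    (mem_normalizer_of_conj_inv h.conj_sq) (by rw [h.sq_eq]; exact Subgroup.npow_mem_zpowers _ _)
  rw [Nat.card_zpowers] at h2
  exact ⟨h1, h2.trans (by omega)⟩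

lemma OctRel.card_octQ_sup_le {A w : X} (h : OctRel A w) :
    Finite ↥(octQ A w ⊔ Subgroup.zpowers w) ∧
      Nat.card ↥(octQ A w ⊔ Subgroup.zpowers w) ≤ 24 := by
  obtain ⟨hfin, hle⟩ := h.card_octQ_le
  have hn : w ∈ Subgroup.normalizer (octQ A w : Set X) := by
    have : Finite ↥(Subgroup.zpowers (A ^ 2) ⊔ Subgroup.zpowers (w * A ^ 2 * w⁻¹)) := hfin
    apply mem_normalizer_sup_zpowers
    · exact mem_octQ_right A w
    · rw [h.conj_w]
      exact mul_mem (mem_octQ_right A w) (mem_octQ_left A w)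
  obtain ⟨h1, h2⟩ := card_sup_zpowers_le (octQ A w) w 3 (by norm_num) hn
    (by rw [h.pow_three]; exact one_mem _)
  exact ⟨h1, h2.trans (by omega)⟩

lemma OctRel.card_octGroup_le {A w : X} (h : OctRel A w) :
    Finite (octGroup A w) ∧ Nat.card (octGroup A w) ≤ 48 := by
  obtain ⟨hfin, hle⟩ := h.card_octQ_sup_le
  have hn : A ∈ Subgroup.normalizer ((octQ A w ⊔ Subgroup.zpowers w : Subgroup X) : Set X) := by
    have hc : octQ A w ⊔ Subgroup.zpowers w ≤
        (octQ A w ⊔ Subgroup.zpowers w).comap (MulAut.conj A).toMonoidHom := by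
      rw [octQ, sup_le_iff, sup_le_iff, Subgroup.zpowers_le, Subgroup.zpowers_le,
        Subgroup.zpowers_le, ← octQ]
      refine ⟨⟨?_, ?_⟩, ?_⟩
      · change A * A ^ 2 * A⁻¹ ∈ octQ A w ⊔ Subgroup.zpowers w
        rw [show A * A ^ 2 * A⁻¹ = A ^ 2 by group]
        exact Subgroup.mem_sup_left (mem_octQ_left A w)
      · change A * (w * A ^ 2 * w⁻¹) * A⁻¹ ∈ octQ A w ⊔ Subgroup.zpowers w
        rw [h.conj_A]
        exact Subgroup.mem_sup_left (mul_mem (mem_octQ_right A w) (mem_octQ_left A w))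
      · change A * w * A⁻¹ ∈ octQ A w ⊔ Subgroup.zpowers w
        rw [h.conj_A_w]
        exact mul_mem (inv_mem (Subgroup.mem_sup_right (Subgroup.mem_zpowers w)))
          (inv_mem (Subgroup.mem_sup_left (mem_octQ_left A w)))
    have hfin' : Finite ((octQ A w ⊔ Subgroup.zpowers w : Subgroup X) : Set X) := hfin
    exact Subgroup.mem_normalizer_fintype hc
  obtain ⟨h1, h2⟩ := card_sup_zpowers_le (octQ A w ⊔ Subgroup.zpowers w) A 2 (by norm_num) hn
    (Subgroup.mem_sup_left (mem_octQ_left A w))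
  exact ⟨h1, h2.trans (by omega)⟩

/-- The upper bound is attained: an element of order 4 with a conjugate not commuting with it gives
8, the element `w` of order 3 gives 24, and `A`, lying outside `N`, doubles this. -/
lemma OctRel.card_octGroup {A w : X} (h : OctRel A w) {N : Subgroup X} (hA : A ∉ N)
    (hA2 : A ^ 2 ∈ N) (hwN : w ∈ N) (hA4 : A ^ 4 ≠ 1) (hw : w ≠ 1)
    (hcomm : ¬ Commute (A ^ 2) (w * A ^ 2 * w⁻¹)) : Nat.card (octGroup A w) = 48 := by
  obtain ⟨hfQ, hcQ⟩ := h.card_octQ_le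
  obtain ⟨hfL, hcL⟩ := h.card_octQ_sup_le
  obtain ⟨hfG, hcG⟩ := h.card_octGroup_le
  have ho : orderOf (A ^ 2) = 4 := by
    refine orderOf_eq_prime_pow (p := 2) (n := 1) ?_ ?_
    · rw [pow_one, ← pow_mul]; exact hA4
    · rw [← pow_mul]; exact h.pow_eight
  have hQ : 2 * 4 ≤ Nat.card (octQ A w) := by
    have : Finite ↥(Subgroup.zpowers (A ^ 2) ⊔ Subgroup.zpowers (w * A ^ 2 * w⁻¹)) := hfQ
    rw [← ho, ← Nat.card_zpowers]
    refine two_mul_card_le_sup _ _ fun hm => hcomm ?_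
    obtain ⟨i, hi⟩ := hm
    simp only at hi
    rw [← hi]
    exact (Commute.refl _).zpow_right i
  have hQ8 : Nat.card (octQ A w) = 8 := by omega
  have hL : 24 ∣ Nat.card ↥(octQ A w ⊔ Subgroup.zpowers w) := by
    have h1 : 8 ∣ Nat.card ↥(octQ A w ⊔ Subgroup.zpowers w) := by
      rw [← hQ8]; exact Subgroup.card_dvd_of_le le_sup_left
    have h2 : 3 ∣ Nat.card ↥(octQ A w ⊔ Subgroup.zpowers w) := by
      have : orderOf w = 3 := orderOf_eq_prime h.pow_three hw
      rw [← this, ← Nat.card_zpowers]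
      exact Subgroup.card_dvd_of_le le_sup_right
    exact Nat.Coprime.mul_dvd_of_dvd_of_dvd (by norm_num : Nat.Coprime 8 3) h1 h2
  have hLpos : 0 < Nat.card ↥(octQ A w ⊔ Subgroup.zpowers w) := Nat.card_pos
  have hL24 := Nat.le_of_dvd hLpos hL
  have hLN : octQ A w ⊔ Subgroup.zpowers w ≤ N := by
    rw [octQ, sup_le_iff, sup_le_iff, Subgroup.zpowers_le, Subgroup.zpowers_le,
      Subgroup.zpowers_le]
    exact ⟨⟨hA2, mul_mem (mul_mem hwN hA2) (inv_mem hwN)⟩, hwN⟩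
  have : Finite ↥(octQ A w ⊔ Subgroup.zpowers w ⊔ Subgroup.zpowers A) := hfG
  have h3 := two_mul_card_le_sup (octQ A w ⊔ Subgroup.zpowers w) A (fun h => hA (hLN h))
  change _ ≤ Nat.card (octGroup A w) at h3
  omega

lemma nonempty_mulEquiv_of_octRel {A w : X} {A' w' : Y} (h : OctRel A w) (h' : OctRel A' w')
    (hX : Nat.card (octGroup A w) = 48) (hY : Nat.card (octGroup A' w') = 48)
    (hcard : Nat.card Y = 48) : Nonempty (octGroup A w ≃* Y) := by
  obtain ⟨hfin, hle⟩ := (h.prod h').card_octGroup_le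
  have hfY : Finite Y := Nat.finite_of_card_ne_zero (by omega)
  refine nonempty_mulEquiv_of_graph (octGroup (A, A') (w, w')) _ 48 hle hX.ge hcard.ge
    (octGroup_map _ _ _) ?_
  rw [octGroup_map]
  exact Subgroup.eq_top_of_card_eq _ (hY.trans hcard.symm)

end BinaryOctahedral

/-! ### GL(2,3) generated by matrices with prescribed traces. -/

section Matrices

variable {F : Type*} [Field F]

lemma mul_self_eq (M : Matrix (Fin 2) (Fin 2) F) : M * M = M.trace • M - M.det • 1 := by
  rw [Matrix.trace_fin_two, Matrix.det_fin_two]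
  ext i j
  fin_cases i <;> fin_cases j <;> simp [Matrix.mul_apply, Fin.sum_univ_two] <;> ring

/-- Cayley–Hamilton turns the data into A² = θA + 1, w² = -w - 1 and (Aw)² = 1. With i = A² these
give i² = -1 and wi = -iw - i - 1, rules that bring every word in i and w to a normal form, so each
relation becomes a comparison of normal forms. -/
lemma octRel_of_ring {A w : GL (Fin 2) F} {θ : F} (h2 : (2 : F) ≠ 0) (hθ : θ ^ 2 = -2)
    (hAt : A.val.trace = θ) (hAd : A.val.det = -1) (hwt : w.val.trace = -1)
    (hwd : w.val.det = 1) (hAw : (A * w).val.trace = 0) :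
    OctRel A w ∧ A ^ 4 = -1 ∧ ¬ Commute (A ^ 2) (w * A ^ 2 * w⁻¹) := by
  have hA : A.val * A.val = θ • A.val + 1 := by rw [mul_self_eq, hAt, hAd]; simp
  have hw : w.val * w.val = -w.val - 1 := by rw [mul_self_eq, hwt, hwd]; simp
  have hAwd : (A * w).val.det = -1 := by rw [det_mul', hAd, hwd, mul_one]
  have hAw2 : (A * w) * (A * w) = 1 := Units.ext (by
    rw [Units.val_mul, mul_self_eq, hAw, hAwd]; simp)
  have hAinv : (A⁻¹).val = A.val - θ • 1 := by
    have h1 : A.val * (A.val - θ • 1) = 1 := by rw [mul_sub, hA]; simp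
    calc (A⁻¹).val = (A⁻¹).val * (A.val * (A.val - θ • 1)) := by rw [h1, mul_one]
      _ = _ := by rw [← mul_assoc, ← Units.val_mul, inv_mul_cancel, Units.val_one, one_mul]
  have hwinv : (w⁻¹).val = -w.val - 1 := by
    have h1 : w.val * (-w.val - 1) = 1 := by rw [mul_sub, mul_neg, hw]; simp
    calc (w⁻¹).val = (w⁻¹).val * (w.val * (-w.val - 1)) := by rw [h1, mul_one]
      _ = _ := by rw [← mul_assoc, ← Units.val_mul, inv_mul_cancel, Units.val_one, one_mul]
  set i : Matrix (Fin 2) (Fin 2) F := (A ^ 2).val with hi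
  have hi' : i = θ • A.val + 1 := by rw [hi, Units.val_pow_eq_pow_val, sq, hA]
  have hii : i * i = -1 := by
    rw [hi', add_mul, mul_add, mul_one, one_mul, smul_mul_smul_comm, hA, ← sq, hθ]
    module
  have hwA : w.val * A.val = (A.val - θ • 1) * (-w.val - 1) := by
    have : w * A = A⁻¹ * w⁻¹ := by
      have : A * (w * A) * w = 1 := by rw [← hAw2]; group
      calc w * A = A⁻¹ * (A * (w * A) * w) * w⁻¹ := by group
        _ = _ := by rw [this, mul_one]
    rw [← Units.val_mul, this, Units.val_mul, hAinv, hwinv]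
  have hwi : w.val * i = -(i * w.val) - i - 1 := by
    have h1 : θ • θ • (1 : Matrix (Fin 2) (Fin 2) F) = (-2 : F) • 1 := by
      rw [smul_smul, ← sq, hθ]
    have h2 : θ • θ • w.val = (-2 : F) • w.val := by rw [smul_smul, ← sq, hθ]
    rw [hi', mul_add, mul_one, mul_smul_comm, hwA, sub_mul, smul_mul_assoc, one_mul, smul_sub,
      smul_sub, smul_sub, smul_neg, smul_neg, h1, h2, add_mul, smul_mul_assoc, one_mul, mul_sub,
      mul_neg, mul_one]
    module
  have hw' : ∀ M, w.val * (w.val * M) = -(w.val * M) - M := fun M => by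
    rw [← mul_assoc, hw, sub_mul, neg_mul, one_mul]
  have hi2 : ∀ M, i * (i * M) = -M := fun M => by rw [← mul_assoc, hii, neg_one_mul]
  have hwi' : ∀ M, w.val * (i * M) = -(i * (w.val * M)) - i * M - M := fun M => by
    rw [← mul_assoc, hwi, sub_mul, sub_mul, neg_mul, one_mul, mul_assoc]
  obtain ⟨j, hj⟩ : ∃ j : GL (Fin 2) F, j = w * A ^ 2 * w⁻¹ := ⟨_, rfl⟩
  have hjv : j.val = i * w.val + w.val + 1 := by
    rw [hj, Units.val_mul, Units.val_mul, hwinv, ← hi, hwi, mul_sub, mul_neg, mul_one, sub_mul, sub_mul,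
      neg_mul, mul_assoc, hw, mul_sub, mul_neg, mul_one, one_mul]
    module
  -- From i = θA + 1 and θ² = -2, the matrix `A` is itself linear in `i`, so relations involving it
  -- are covered by the same rules.
  have hAi : A.val = (θ / 2) • (1 - i) := by
    have h3 : θ * (θ / 2) = -1 := by field_simp; linear_combination hθ
    have : (θ / 2) • (1 - i) = -((θ * (θ / 2)) • A.val) := by
      rw [hi']; module
    rw [this, h3]; simp
  have hji : j.val * i = -(i * j.val) := by
    rw [hjv]
    simp only [add_mul, mul_add, mul_assoc, mul_one, one_mul, mul_neg, neg_mul, mul_sub, sub_mul, hw, hw', hii, hi2,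
      hwi, hwi']
    module
  have hjj : j.val * j.val = -1 := by
    rw [hjv]
    simp only [add_mul, mul_add, mul_assoc, mul_one, one_mul, mul_neg, neg_mul, mul_sub, sub_mul, hw, hw', hii, hi2,
      hwi, hwi']
    module
  have hwj : w.val * j.val = j.val * i * w.val := by
    rw [hjv]
    simp only [add_mul, mul_add, mul_assoc, mul_one, one_mul, mul_neg, neg_mul, mul_sub, sub_mul, hw, hw', hii, hi2,
      hwi, hwi']
    module
  have hAj : A.val * j.val = j.val * i * A.val := by
    rw [hAi, hjv]
    simp only [smul_mul_assoc, mul_smul_comm]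
    congr 1
    simp only [add_mul, mul_add, mul_assoc, mul_one, one_mul, mul_neg, neg_mul, mul_sub, sub_mul, hw, hw',
      hii, hi2, hwi, hwi']
    module
  have hA4 : A ^ 4 = -1 := Units.ext (by
    rw [show A ^ 4 = A ^ 2 * A ^ 2 by rw [← pow_add], Units.val_mul, ← hi, hii]; simp)
  refine ⟨⟨?_, ?_, ?_, ?_, ?_, ?_, ?_⟩, hA4, ?_⟩ <;> try rw [← hj]
  · rw [show A ^ 8 = (A ^ 4) ^ 2 by rw [← pow_mul], hA4]; simp
  · rw [mul_inv_eq_iff_eq_mul, eq_inv_mul_iff_mul_eq]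
    apply Units.ext
    rw [Units.val_mul, Units.val_mul, ← hi, hji, mul_neg, hi2, neg_neg]
  · apply Units.ext
    rw [pow_two j, pow_two (A ^ 2), Units.val_mul, Units.val_mul, hjj, ← hi, hii]
  · rw [mul_inv_eq_iff_eq_mul]
    apply Units.ext
    rw [Units.val_mul, Units.val_mul, Units.val_mul, ← hi, hwj]
  · rw [show w ^ 3 = w * (w * w) by rw [pow_succ', sq]]
    apply Units.ext
    rw [Units.val_mul, Units.val_mul, hw, mul_sub, mul_neg, hw]
    simp
  · rw [mul_inv_eq_iff_eq_mul]
    apply Units.ext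
    rw [Units.val_mul, Units.val_mul, Units.val_mul, ← hi, hAj]
  · have : w * A * w = A⁻¹ := by
      calc w * A * w = A⁻¹ * ((A * w) * (A * w)) := by group
        _ = A⁻¹ := by rw [hAw2, mul_one]
    calc A * w * A⁻¹ = w⁻¹ * (w * A * w) * A⁻¹ := by group
      _ = w⁻¹ * (A ^ 2)⁻¹ := by rw [this]; group
  · intro hc
    have h1 := congrArg Units.val hc.eq
    rw [Units.val_mul, Units.val_mul, ← hi, hji] at h1
    have h3 : (2 : F) • (i * j.val) = 0 := by
      rw [two_smul]
      nth_rewrite 1 [h1]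
      simp
    have h4 := (smul_eq_zero.mp h3).resolve_left h2
    rw [hi, ← Units.val_mul] at h4
    exact (A ^ 2 * j).ne_zero h4

lemma card_octGroup_of_ring {A w : GL (Fin 2) F} {θ : F} (h2 : (2 : F) ≠ 0) (hθ : θ ^ 2 = -2)
    (hAt : A.val.trace = θ) (hAd : A.val.det = -1) (hwt : w.val.trace = -1)
    (hwd : w.val.det = 1) (hAw : (A * w).val.trace = 0) (hw : w ≠ 1) :
    OctRel A w ∧ Nat.card (octGroup A w) = 48 := by
  obtain ⟨h, hA4, hc⟩ := octRel_of_ring h2 hθ hAt hAd hwt hwd hAw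
  have hne : (-1 : F) ≠ 1 := fun h => h2 (by linear_combination -h)
  refine ⟨h, h.card_octGroup (N := detOne F) ?_ ?_ ?_ ?_ hw hc⟩
  · rw [mem_detOne, hAd]; exact hne
  · rw [mem_detOne, det_pow', hAd]; norm_num
  · rw [mem_detOne, hwd]
  · rw [hA4]
    intro h1
    have h3 := congrArg (fun x : GL (Fin 2) F => x.val 0 0) h1
    simp only [Units.val_neg, Units.val_one, Matrix.neg_apply, Matrix.one_apply_eq] at h3
    exact hne h3

lemma card_GL_two_three : Nat.card (GL (Fin 2) (ZMod 3)) = 48 := by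
  rw [Matrix.card_GL_field, Fin.prod_univ_two, ZMod.card]
  norm_num

lemma octGroup_equiv_GL {A w : GL (Fin 2) F} {θ : F} (h2 : (2 : F) ≠ 0) (h3 : (3 : F) ≠ 0)
    (hθ : θ ^ 2 = -2) (hAt : A.val.trace = θ) (hAd : A.val.det = -1) (hwt : w.val.trace = -1)
    (hwd : w.val.det = 1) (hAw : (A * w).val.trace = 0) :
    Nat.card (octGroup A w) = 48 ∧ Nonempty (octGroup A w ≃* GL (Fin 2) (ZMod 3)) := by
  -- The identity has trace 2, which is not -1 because `3 ≠ 0`.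
  have hw : w ≠ 1 := by
    rintro rfl
    apply h3
    simp at hwt
    linear_combination hwt
  obtain ⟨h, hc⟩ := card_octGroup_of_ring h2 hθ hAt hAd hwt hwd hAw hw
  -- Over the field with three elements 1² = -2, so θ = 1 serves. There 2 = -1, the trace does not
  -- exclude the identity, and `w' ≠ 1` is checked on an entry.
  let A' : GL (Fin 2) (ZMod 3) := ⟨!![0, 1; 1, 1], !![-1, 1; 1, 0], by decide, by decide⟩
  let w' : GL (Fin 2) (ZMod 3) := ⟨!![1, -1; 0, 1], !![1, 1; 0, 1], by decide, by decide⟩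
  have hw' : w' ≠ 1 := fun h =>
    absurd (congrArg (fun x : GL (Fin 2) (ZMod 3) => x.val 0 1) h) (by decide)
  obtain ⟨h', hc'⟩ := card_octGroup_of_ring (A := A') (w := w') (θ := 1) (by decide) (by decide)
    (by decide) (by decide) (by decide) (by decide) (by decide) hw'
  exact ⟨hc, nonempty_mulEquiv_of_octRel h h' hc hc' card_GL_two_three⟩

end Matrices

/-! ### Conjugation inside GL(2,F). -/

section ConjugateKinds

variable {F : Type*} [Field F]

/-- The conjugate `g * K * g⁻¹`. -/
abbrev conjSub (g : GL (Fin 2) F) (K : Subgroup (GL (Fin 2) F)) : Subgroup (GL (Fin 2) F) :=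
  K.map (MulAut.conj g).toMonoidHom

lemma mem_conjSub {g x : GL (Fin 2) F} {K : Subgroup (GL (Fin 2) F)} :
    x ∈ conjSub g K ↔ g⁻¹ * x * g ∈ K := by
  constructor
  · rintro ⟨y, hy, rfl⟩
    simpa [mul_assoc] using hy
  · intro h
    exact ⟨_, h, by simp [mul_assoc]⟩

lemma conj_mem_conjSub {g x : GL (Fin 2) F} {K : Subgroup (GL (Fin 2) F)} (hx : x ∈ K) :
    g * x * g⁻¹ ∈ conjSub g K := ⟨x, hx, rfl⟩

lemma conjSub_conjSub (g h : GL (Fin 2) F) (K : Subgroup (GL (Fin 2) F)) :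
    conjSub g (conjSub h K) = conjSub (g * h) K := by
  ext x
  rw [mem_conjSub, mem_conjSub, mem_conjSub]
  simp [mul_assoc]

lemma conjSub_one (K : Subgroup (GL (Fin 2) F)) : conjSub 1 K = K := by
  ext x
  rw [mem_conjSub]
  simp

lemma conjSub_detOne (g : GL (Fin 2) F) : conjSub g (detOne F) = detOne F := by
  ext x
  rw [mem_conjSub]
  constructor
  · intro h
    have := conj_mem_detOne (x := g) h
    simpa [mul_assoc] using this
  · intro h
    have := conj_mem_detOne (x := g⁻¹) h
    simpa [mul_assoc] using this

lemma det_conj (g x : GL (Fin 2) F) : (g * x * g⁻¹).val.det = x.val.det := by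
  rw [det_mul', det_mul', det_inv', mul_right_comm, mul_inv_cancel₀ (det_ne_zero g), one_mul]

lemma conjSub_le_detOne_iff {g : GL (Fin 2) F} {K : Subgroup (GL (Fin 2) F)} :
    conjSub g K ≤ detOne F ↔ K ≤ detOne F := by
  constructor
  · intro h x hx
    have := h (conj_mem_conjSub (g := g) hx)
    rw [mem_detOne, det_conj] at this
    rwa [mem_detOne]
  · rintro h _ ⟨x, hx, rfl⟩
    exact conj_mem_detOne (h hx)

lemma IsKind.of_conjSub {p : ℕ} [Fact p.Prime] {g : GL (Fin 2) F} {K : Subgroup (GL (Fin 2) F)}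
    {t : GroupKind} (h : IsKind p (detOne F) (conjSub g K) t) : IsKind p (detOne F) K t := by
  have h1 := h.map (MulAut.conj g⁻¹).toMonoidHom (MulAut.conj g⁻¹).injective
  change IsKind p (conjSub g⁻¹ (detOne F)) (conjSub g⁻¹ (conjSub g K)) t at h1
  rwa [conjSub_conjSub, inv_mul_cancel, conjSub_one, conjSub_detOne] at h1

end ConjugateKinds

/-! ### The model of SU^±(2,q) and its first properties. -/

section ModelGroup

variable (F : Type*) [Field F] (p n : ℕ) [Fact p.Prime] [CharP F p]

/-- A model of `SU^±(2,q)`: the matrices `A` of determinant `±1` with `A^(q) = det A • A`. -/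
def modelSU : Subgroup (GL (Fin 2) F) where
  carrier := {A | A.val.map (iterateFrobenius F p n) = A.val.det • A.val ∧ A.val.det ^ 2 = 1}
  one_mem' := by simp
  mul_mem' := by
    rintro A B ⟨hA, hA'⟩ ⟨hB, hB'⟩
    refine ⟨?_, by rw [det_mul', mul_pow, hA', hB', one_mul]⟩
    rw [Units.val_mul, Matrix.map_mul, hA, hB, Matrix.det_mul, smul_mul_smul_comm]
  inv_mem' := by
    rintro A ⟨hA, hA'⟩
    refine ⟨?_, by rw [det_inv', inv_pow, hA', inv_one]⟩
    have h1 : A.val.map (iterateFrobenius F p n) * A⁻¹.val.map (iterateFrobenius F p n) = 1 := by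
      rw [← Matrix.map_mul, ← Units.val_mul, mul_inv_cancel]; simp
    rw [hA, smul_mul_assoc] at h1
    have h2 : A⁻¹.val * (A.val.det • (A.val * A⁻¹.val.map (iterateFrobenius F p n))) =
        A⁻¹.val := by rw [h1, mul_one]
    rw [mul_smul_comm, ← mul_assoc, ← Units.val_mul, inv_mul_cancel, Units.val_one, one_mul] at h2
    rw [det_inv']
    conv_rhs => rw [← h2]
    rw [smul_smul, inv_mul_cancel₀ (det_ne_zero A), one_smul]

variable {F p n}

lemma mem_modelSU_iff {A : GL (Fin 2) F} : A ∈ modelSU F p n ↔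
    A.val.map (iterateFrobenius F p n) = A.val.det • A.val ∧ A.val.det ^ 2 = 1 := Iff.rfl

lemma mem_modelSU {A : GL (Fin 2) F} : A ∈ modelSU F p n ↔
    (∀ i j, A.val i j ^ p ^ n = A.val.det * A.val i j) ∧ A.val.det ^ 2 = 1 := by
  rw [mem_modelSU_iff, ← Matrix.ext_iff]
  simp only [Matrix.map_apply, iterateFrobenius_def, Matrix.smul_apply, smul_eq_mul]

lemma two_ne_zero_of_mod (F : Type*) [Field F] {p n : ℕ} [Fact p.Prime] [CharP F p]
    (hn : 0 < n) (hq : p ^ n % 4 = 1) : (2 : F) ≠ 0 := by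
  intro h
  have h1 : p ∣ 2 := (CharP.cast_eq_zero_iff F p 2).mp (by exact_mod_cast h)
  have h2 : p = 2 := (Nat.prime_dvd_prime_iff_eq Fact.out Nat.prime_two).mp h1
  obtain ⟨m, rfl⟩ : ∃ m, n = m + 1 := ⟨n - 1, by omega⟩
  rw [h2, pow_succ] at hq
  omega

/-- Euler's criterion: as q + 1 is even, (q² - 1)/2 is a multiple of q - 1. With q = 4k + 1 it
equals 4k(2k + 1). -/
lemma isSquare_of_pow_eq [Finite F] (hn : 0 < n) (hq : p ^ n % 4 = 1)
    (hF : Nat.card F = (p ^ n) ^ 2) {x : F} (hx : x ^ p ^ n = x) : IsSquare x := by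
  have := Fintype.ofFinite F
  rcases eq_or_ne x 0 with rfl | h0
  · exact ⟨0, by simp⟩
  have hchar : ringChar F ≠ 2 := fun h => two_ne_zero_of_mod F hn hq (by
    have := ringChar.Nat.cast_ringChar (R := F)
    rw [h] at this
    exact_mod_cast this)
  rw [FiniteField.isSquare_iff hchar h0, ← Nat.card_eq_fintype_card, hF]
  obtain ⟨k, hk⟩ : ∃ k, p ^ n = 4 * k + 1 := ⟨p ^ n / 4, by omega⟩
  have h1 : x ^ (4 * k) = 1 := by
    rw [hk, pow_succ] at hx
    exact mul_right_cancel₀ h0 (by rw [hx, one_mul])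
  have h2 : (p ^ n) ^ 2 / 2 = 4 * k * (2 * k + 1) := by
    rw [hk]
    have : (4 * k + 1) ^ 2 = 4 * k * (2 * k + 1) * 2 + 1 := by ring
    omega
  rw [h2, pow_mul, h1, one_pow]

/-- If `a` is a nonsquare, then δ = a^((q+1)/2) satisfies δ^(q-1) = a^((q²-1)/2) = -1. -/
lemma exists_pow_eq_neg [Finite F] (hn : 0 < n) (hq : p ^ n % 4 = 1)
    (hF : Nat.card F = (p ^ n) ^ 2) : ∃ δ : F, δ ≠ 0 ∧ δ ^ p ^ n = -δ := by
  have := Fintype.ofFinite F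
  have hchar : ringChar F ≠ 2 := fun h => two_ne_zero_of_mod F hn hq (by
    have := ringChar.Nat.cast_ringChar (R := F)
    rw [h] at this
    exact_mod_cast this)
  obtain ⟨a, ha⟩ := FiniteField.exists_nonsquare hchar
  have h0 : a ≠ 0 := by rintro rfl; exact ha ⟨0, by simp⟩
  have h1 : a ^ (Fintype.card F / 2) = -1 :=
    (FiniteField.pow_dichotomy hchar h0).resolve_left fun h =>
      ha ((FiniteField.isSquare_iff hchar h0).mpr h)
  obtain ⟨k, hk⟩ : ∃ k, p ^ n = 4 * k + 1 := ⟨p ^ n / 4, by omega⟩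
  refine ⟨a ^ (2 * k + 1), pow_ne_zero _ h0, ?_⟩
  rw [← Nat.card_eq_fintype_card, hF] at h1
  have h2 : (p ^ n) ^ 2 / 2 = 4 * k * (2 * k + 1) := by
    rw [hk]
    have : (4 * k + 1) ^ 2 = 4 * k * (2 * k + 1) * 2 + 1 := by ring
    omega
  rw [h2] at h1
  rw [← pow_mul, hk, show (2 * k + 1) * (4 * k + 1) = 4 * k * (2 * k + 1) + (2 * k + 1) by ring,
    pow_add, h1, neg_one_mul]

lemma exists_sq_eq_neg_one [Finite F] (hn : 0 < n) (hq : p ^ n % 4 = 1)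
    (hF : Nat.card F = (p ^ n) ^ 2) : ∃ ι : F, ι ^ 2 = -1 ∧ ι ^ p ^ n = ι := by
  have h1 : (-1 : F) ^ p ^ n = -1 := Odd.neg_one_pow (by rw [Nat.odd_iff]; omega)
  obtain ⟨ι, hι⟩ := isSquare_of_pow_eq hn hq hF h1
  refine ⟨ι, by rw [hι, sq], ?_⟩
  obtain ⟨k, hk⟩ : ∃ k, p ^ n = 4 * k + 1 := ⟨p ^ n / 4, by omega⟩
  rw [hk, pow_succ, pow_mul, show ι ^ 4 = (ι * ι) * (ι * ι) by ring, ← hι]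
  simp

lemma trace_pow_of_mem {x : GL (Fin 2) F} (hx : x ∈ modelSU F p n) :
    x.val.trace ^ p ^ n = x.val.det * x.val.trace := by
  rw [mem_modelSU] at hx
  rw [Matrix.trace_fin_two, add_pow_char_pow, hx.1, hx.1]
  ring

lemma det_pow_of_mem (hq : p ^ n % 4 = 1) {x : GL (Fin 2) F} (hx : x ∈ modelSU F p n) :
    x.val.det ^ p ^ n = x.val.det := by
  obtain ⟨k, hk⟩ : ∃ k, p ^ n = 2 * k + 1 := ⟨p ^ n / 2, by omega⟩
  rw [hk, pow_succ, pow_mul, hx.2, one_pow, one_mul]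

/-- For a scalar c in the model, c⁴ = det² = 1, so c^q = c because q ≡ 1 mod 4; the defining
equation says c^q = c² · c, whence det = c² = 1. -/
lemma mem_detOne_of_mem_center (hq : p ^ n % 4 = 1) {x : GL (Fin 2) F} (hx : x ∈ modelSU F p n)
    (hc : x ∈ Subgroup.center (GL (Fin 2) F)) : x ∈ detOne F := by
  obtain ⟨c, hc⟩ := (mem_center_iff x).mp hc
  have hdet : x.val.det = c ^ 2 := by
    rw [Matrix.det_fin_two, hc]
    simp
    ring
  have h1 := (mem_modelSU.mp hx).1 0 0
  have h2 := hx.2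
  have h00 : x.val 0 0 = c := by rw [hc]; simp
  have hc0 : c ≠ 0 := by
    rintro rfl
    exact det_ne_zero x (by rw [hdet]; simp)
  rw [h00, hdet] at h1
  rw [hdet] at h2
  obtain ⟨k, hk⟩ : ∃ k, p ^ n = 4 * k + 1 := ⟨p ^ n / 4, by omega⟩
  rw [hk, pow_succ, pow_mul, show c ^ 4 = (c ^ 2) ^ 2 by ring, h2, one_pow] at h1
  rw [mem_detOne, hdet]
  exact (mul_right_cancel₀ hc0 h1).symm

lemma isOuter_of_le [Finite F] (hn : 0 < n) (hq : p ^ n % 4 = 1) (hF : Nat.card F = (p ^ n) ^ 2)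
    {G : Subgroup (GL (Fin 2) F)} (hG : G ≤ modelSU F p n) (hout : ¬ G ≤ detOne F) :
    IsOuter G where
  isSquare_discr x hx := by
    -- The Frobenius multiplies the trace by the determinant ±1 and fixes the determinant, so it
    -- fixes the discriminant.
    apply isSquare_of_pow_eq hn hq hF
    rw [Matrix.discr_fin_two, sub_eq_add_neg, ← neg_mul, add_pow_char_pow, mul_pow, ← pow_mul,
      mul_comm 2, pow_mul, trace_pow_of_mem (hG hx), det_pow_of_mem hq (hG hx), mul_pow,
      (hG hx).2, one_mul]
    congr 2
    have h := map_intCast (iterateFrobenius F p n) (-4)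
    rw [iterateFrobenius_def] at h
    exact_mod_cast h
  det_sq x hx := (hG hx).2
  scalar x hx hc := mem_detOne_of_mem_center hq (hG hx) hc
  not_le := hout

/-- The diagonal elements of a conjugate of a subgroup of the model are all of split type or all
of nonsplit type. -/
lemma split_or_nonsplit {g : GL (Fin 2) F} {G : Subgroup (GL (Fin 2) F)}
    (hG : G ≤ modelSU F p n) :
    (∀ x ∈ conjSub g G ⊓ diagSub F, x.val 0 0 ^ p ^ n = x.val.det * x.val 0 0) ∨
      (∀ x ∈ conjSub g G ⊓ diagSub F, x.val 0 0 ^ p ^ n = x.val.det * x.val 1 1) := by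
  let φ := iterateFrobenius F p n
  -- The matrix H = g (g^φ)⁻¹ records the effect of the conjugation on the defining equation: x H =
  -- (det x)⁻¹ H x^φ for every x in the conjugate.
  let H : GL (Fin 2) F := g * Matrix.GeneralLinearGroup.map φ g⁻¹
  have key : ∀ x ∈ conjSub g G, x.val * H.val = (x.val.det)⁻¹ • (H.val * x.val.map φ) := by
    rintro _ ⟨y, hy, rfl⟩
    obtain ⟨h1, h2⟩ := hG hy
    change (g * y * g⁻¹).val * H.val =
      ((g * y * g⁻¹).val.det)⁻¹ • (H.val * (g * y * g⁻¹).val.map φ)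
    have h3 : (g * y * g⁻¹).val.map φ = (Matrix.GeneralLinearGroup.map φ g).val * y.val.map φ *
        (Matrix.GeneralLinearGroup.map φ g⁻¹).val := by
      rw [Units.val_mul, Units.val_mul, Matrix.map_mul, Matrix.map_mul]
      rfl
    rw [det_conj, h3, h1, mul_smul_comm, smul_mul_assoc, mul_smul_comm, smul_smul,
      inv_mul_cancel₀ (det_ne_zero y), one_smul, ← Units.val_mul, ← Units.val_mul, ← Units.val_mul,
      ← Units.val_mul]
    congr 1
    simp only [H, map_inv]
    group
  have hdet : H.val.det ≠ 0 := det_ne_zero H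
  have hpow : ∀ x ∈ conjSub g G, (x.val.det)⁻¹ = x.val.det := by
    rintro _ ⟨y, hy, rfl⟩
    change ((g * y * g⁻¹).val.det)⁻¹ = (g * y * g⁻¹).val.det
    rw [det_conj]
    exact inv_eq_of_mul_eq_one_left (by rw [← sq, (hG hy).2])
  have hent : ∀ x ∈ conjSub g G ⊓ diagSub F, ∀ i, x.val i i * H.val i 0 =
      x.val.det * (H.val i 0 * x.val 0 0 ^ p ^ n) := by
    intro x hx i
    have h1 := congrArg (fun M : Matrix (Fin 2) (Fin 2) F => M i 0) (key x hx.1)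
    have h2 := hx.2.1
    have h3 := hx.2.2
    have hp : (0 : F) ^ p ^ n = 0 := zero_pow (pow_ne_zero _ (Fact.out : p.Prime).ne_zero)
    rw [hpow x hx.1] at h1
    fin_cases i <;>
      simpa [Matrix.mul_apply, Fin.sum_univ_two, h2, h3, φ, iterateFrobenius_def, hp] using h1
  have hsq : ∀ x ∈ conjSub g G, x.val.det * x.val.det = 1 := by
    intro x hx
    nth_rewrite 1 [← hpow x hx]
    exact inv_mul_cancel₀ (det_ne_zero x)
  -- Some entry of the first column of the invertible `H` is nonzero. The upper entry gives the
  -- split equation, the lower one the nonsplit equation, for all diagonal elements at once.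
  by_cases h0 : H.val 0 0 = 0
  · right
    intro x hx
    have h1 : H.val 1 0 ≠ 0 := fun h1 => hdet (by rw [Matrix.det_fin_two, h0, h1]; ring)
    apply mul_right_cancel₀ h1
    linear_combination (-x.val.det) * hent x hx 1 - H.val 1 0 * x.val 0 0 ^ p ^ n * hsq x hx.1
  · left
    intro x hx
    apply mul_right_cancel₀ h0
    linear_combination (-x.val.det) * hent x hx 0 - H.val 0 0 * x.val 0 0 ^ p ^ n * hsq x hx.1

end ModelGroup

/-! ### Coordinates adapted to two points, and stabilizers without unipotents. -/

section Frames

variable {F : Type*} [Field F]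

lemma mulVec_eq_of_conj {v w : Fin 2 → F} (h : v 0 * w 1 - w 0 * v 1 ≠ 0) (x : GL (Fin 2) F) :
    x.val *ᵥ v = ((basisGL h)⁻¹ * x * basisGL h).val 0 0 • v +
      ((basisGL h)⁻¹ * x * basisGL h).val 1 0 • w ∧
    x.val *ᵥ w = ((basisGL h)⁻¹ * x * basisGL h).val 0 1 • v +
      ((basisGL h)⁻¹ * x * basisGL h).val 1 1 • w := by
  set N := (basisGL h)⁻¹ * x * basisGL h with hN
  have h1 : x * basisGL h = basisGL h * N := by rw [hN]; group
  have h2 := congrArg Units.val h1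
  rw [Units.val_mul, Units.val_mul, coe_basisGL] at h2
  have e : ∀ i j, (x.val * !![v 0, w 0; v 1, w 1]) i j =
    (!![v 0, w 0; v 1, w 1] * N.val) i j := fun i j => by rw [h2]
  constructor <;> ext i <;> fin_cases i
  · simpa [Matrix.mul_apply, Matrix.mulVec, dotProduct, Fin.sum_univ_two, mul_comm] using e 0 0
  · simpa [Matrix.mul_apply, Matrix.mulVec, dotProduct, Fin.sum_univ_two, mul_comm] using e 1 0
  · simpa [Matrix.mul_apply, Matrix.mulVec, dotProduct, Fin.sum_univ_two, mul_comm] using e 0 1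
  · simpa [Matrix.mul_apply, Matrix.mulVec, dotProduct, Fin.sum_univ_two, mul_comm] using e 1 1

lemma exists_smul_eq_combo_left {v w : Fin 2 → F} (h : v 0 * w 1 - w 0 * v 1 ≠ 0) (a b : F) :
    (∃ c : F, a • v + b • w = c • v) ↔ b = 0 := by
  constructor
  · rintro ⟨c, hc⟩
    have h0 := congrFun hc 0
    have h1 := congrFun hc 1
    simp only [Pi.add_apply, Pi.smul_apply, smul_eq_mul] at h0 h1
    apply (mul_eq_zero.mp (?_ : b * (v 0 * w 1 - w 0 * v 1) = 0)).resolve_right h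
    linear_combination v 0 * h1 - v 1 * h0
  · rintro rfl
    exact ⟨a, by simp⟩

lemma exists_smul_eq_combo_right {v w : Fin 2 → F} (h : v 0 * w 1 - w 0 * v 1 ≠ 0) (a b : F) :
    (∃ c : F, a • v + b • w = c • w) ↔ a = 0 := by
  constructor
  · rintro ⟨c, hc⟩
    have h0 := congrFun hc 0
    have h1 := congrFun hc 1
    simp only [Pi.add_apply, Pi.smul_apply, smul_eq_mul] at h0 h1
    apply (mul_eq_zero.mp (?_ : a * (v 0 * w 1 - w 0 * v 1) = 0)).resolve_right h
    linear_combination w 1 * h0 - w 0 * h1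
  · rintro rfl
    exact ⟨b, by simp⟩

/-- A change of coordinates moving two given points to the coordinate points. -/
lemma exists_frame {P Q : ℙ F (Fin 2 → F)} (hPQ : P ≠ Q) : ∃ g : GL (Fin 2) F, ∀ x : GL (Fin 2) F,
    (x • P = P ↔ (g * x * g⁻¹).val 1 0 = 0) ∧ (x • Q = Q ↔ (g * x * g⁻¹).val 0 1 = 0) ∧
    (x • P = Q ↔ (g * x * g⁻¹).val 0 0 = 0) ∧ (x • Q = P ↔ (g * x * g⁻¹).val 1 1 = 0) := by
  induction P with
  | h v hv =>
    induction Q with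
    | h w hw =>
      have h := det_ne_zero_of_mk_ne hv hw hPQ
      refine ⟨(basisGL h)⁻¹, fun x => ?_⟩
      obtain ⟨h1, h2⟩ := mulVec_eq_of_conj h x
      rw [inv_inv, smul_mk_eq_iff, smul_mk_eq_iff, smul_mk_eq_iff, smul_mk_eq_iff, h1, h2,
        exists_smul_eq_combo_left h, exists_smul_eq_combo_left h, exists_smul_eq_combo_right h,
        exists_smul_eq_combo_right h]
      tauto

lemma eq_one_of_unipCard {G : Subgroup (GL (Fin 2) F)} {P : ℙ F (Fin 2 → F)}
    (hU : unipCard G P = 1) {x : GL (Fin 2) F} (hx : x ∈ unip G P) : x = 1 := by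
  have := (Nat.card_eq_one_iff_unique.mp hU).1
  exact congrArg Subtype.val (Subsingleton.elim (⟨x, hx⟩ : unip G P) 1)

lemma commutator_mem_unip {G : Subgroup (GL (Fin 2) F)} {P : ℙ F (Fin 2 → F)} {x y : GL (Fin 2) F}
    (hx : x ∈ fixer G P) (hy : y ∈ fixer G P) : x * y * x⁻¹ * y⁻¹ ∈ unip G P := by
  obtain ⟨hxG, hxP⟩ := mem_fixer.mp hx
  obtain ⟨hyG, hyP⟩ := mem_fixer.mp hy
  refine ⟨mul_mem (mul_mem (mul_mem hxG hyG) (inv_mem hxG)) (inv_mem hyG), ?_, ?_⟩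
  · obtain ⟨a, ha⟩ := (smul_eq_self_iff_rep x P).mp hxP
    obtain ⟨b, hb⟩ := (smul_eq_self_iff_rep y P).mp hyP
    have hinv : ∀ (z : GL (Fin 2) F) (c : F), z.val *ᵥ P.rep = c • P.rep →
        c • (z⁻¹.val *ᵥ P.rep) = P.rep := by
      intro z c hz
      rw [← Matrix.mulVec_smul, ← hz, Matrix.mulVec_mulVec, ← Units.val_mul, inv_mul_cancel,
        Units.val_one, Matrix.one_mulVec]
    have h1 := hinv x a ha
    have h2 := hinv y b hb
    have ha0 : a ≠ 0 := by
      rintro rfl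
      exact P.rep_nonzero (by rw [← h1, zero_smul])
    have hb0 : b ≠ 0 := by
      rintro rfl
      exact P.rep_nonzero (by rw [← h2, zero_smul])
    have h3 : x⁻¹.val *ᵥ P.rep = a⁻¹ • P.rep := by rw [eq_inv_smul_iff₀ ha0, h1]
    have h4 : y⁻¹.val *ᵥ P.rep = b⁻¹ • P.rep := by rw [eq_inv_smul_iff₀ hb0, h2]
    simp only [Units.val_mul, ← Matrix.mulVec_mulVec, h4, h3, ha, hb, Matrix.mulVec_smul,
      smul_smul]
    rw [show b⁻¹ * (a⁻¹ * (b * a)) = 1 by field_simp, one_smul]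
  · rw [det_mul', det_mul', det_mul', det_inv', det_inv']
    have := det_ne_zero x
    have := det_ne_zero y
    field_simp

/-- Commutators in a point stabilizer are unipotent, so without unipotents the stabilizer is
abelian. -/
lemma commute_of_fixer {G : Subgroup (GL (Fin 2) F)} {P : ℙ F (Fin 2 → F)}
    (hU : unipCard G P = 1) {x y : GL (Fin 2) F} (hx : x ∈ fixer G P) (hy : y ∈ fixer G P) :
    x * y = y * x := by
  have h := eq_one_of_unipCard hU (commutator_mem_unip hx hy)
  rw [mul_inv_eq_one, mul_inv_eq_iff_eq_mul] at h
  exact h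

variable [Finite F] {G : Subgroup (GL (Fin 2) F)}

lemma discr_ne_zero (h2 : (2 : F) ≠ 0) (hU : ∀ P, unipCard G P = 1) {x : GL (Fin 2) F}
    (hx : x ∈ G) (hc : x ∉ Subgroup.center (GL (Fin 2) F)) : x.val.discr ≠ 0 := by
  intro hd
  obtain ⟨P, hP⟩ := exists_one_fixed h2 hc hd
  obtain ⟨s, hs, u, hu, rfl⟩ := exists_scalar_mul_unip (mem_fixer.mpr ⟨hx, (hP P).mpr rfl⟩) hd
  rw [eq_one_of_unipCard (hU P) hu, mul_one] at hc
  exact hc hs.2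

/-- The element `y` fixes exactly one further point `Q`. The stabilizer of `P` commutes with `y`, so
it permutes the fixed points of `y`; as it fixes `P`, it fixes `Q`. -/
lemma exists_second_fixed (h2 : (2 : F) ≠ 0) (hU : ∀ P, unipCard G P = 1)
    (hsq : ∀ x ∈ G, IsSquare x.val.discr) {P : ℙ F (Fin 2 → F)} {y : GL (Fin 2) F}
    (hy : y ∈ fixer G P) (hc : y ∉ Subgroup.center (GL (Fin 2) F)) :
    ∃ Q, P ≠ Q ∧ (∀ R, y • R = R ↔ R = P ∨ R = Q) ∧ ∀ x ∈ fixer G P, x • Q = Q := by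
  obtain ⟨hyG, hyP⟩ := mem_fixer.mp hy
  obtain ⟨P', Q', hne, hfix⟩ := exists_two_fixed h2 (hsq y hyG) (discr_ne_zero h2 hU hyG hc)
  obtain ⟨Q, hPQ, hQ⟩ : ∃ Q, P ≠ Q ∧ (∀ R, y • R = R ↔ R = P ∨ R = Q) := by
    rcases (hfix P).mp hyP with rfl | rfl
    · exact ⟨Q', hne, hfix⟩
    · exact ⟨P', hne.symm, fun R => by rw [hfix, or_comm]⟩
  refine ⟨Q, hPQ, hQ, fun x hx => ?_⟩
  have h1 : y • (x • Q) = x • Q := by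
    rw [← mul_smul, ← commute_of_fixer (hU P) hx hy, mul_smul, (hQ Q).mpr (Or.inr rfl)]
  refine ((hQ _).mp h1).resolve_left fun h => hPQ ?_
  have h3 := (mem_fixer.mp hx).2
  exact (MulAction.injective x (h.trans h3.symm)).symm

end Frames

/-! ### Classification of the subgroups without unipotents. -/

section Semisimple

variable {F : Type*} [Field F] [Finite F] {p n : ℕ} [Fact p.Prime] [CharP F p]
variable {G : Subgroup (GL (Fin 2) F)}

omit [Finite F] in
lemma det_sq_conjSub (hG : G ≤ modelSU F p n) (g : GL (Fin 2) F) :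
    ∀ x ∈ conjSub g G, x.val.det ^ 2 = 1 := by
  rintro _ ⟨x, hx, rfl⟩
  change (g * x * g⁻¹).val.det ^ 2 = 1
  rw [det_conj, (hG hx).2]

lemma exists_kind_of_two_fixed (hq : p ^ n % 4 = 1) (hG : G ≤ modelSU F p n)
    (hout : ¬ G ≤ detOne F) {P Q : ℙ F (Fin 2 → F)} (hPQ : P ≠ Q) (hP : ∀ x ∈ G, x • P = P)
    (hQ : ∀ x ∈ G, x • Q = Q) : ∃ t, Admissible p n t ∧ IsKind p (detOne F) G t := by
  obtain ⟨g, hg⟩ := exists_frame hPQ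
  have hD : conjSub g G ≤ diagSub F := by
    rintro _ ⟨x, hx, rfl⟩
    exact ⟨(hg x).2.1.mp (hQ x hx), (hg x).1.mp (hP x hx)⟩
  have hdet := det_sq_conjSub hG g
  have hout' : ¬ conjSub g G ≤ detOne F := fun h => hout (conjSub_le_detOne_iff.mp h)
  have h := split_or_nonsplit (g := g) hG
  rw [inf_eq_left.mpr hD] at h
  obtain ⟨t, ht, hk⟩ : ∃ t, Admissible p n t ∧ IsKind p (detOne F) (conjSub g G) t := by
    rcases h with h | h
    · exact exists_kind_of_split hq hD hdet h hout'
    · exact exists_kind_of_nonsplit hq hD hdet h hout'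
  exact ⟨t, ht, hk.of_conjSub⟩

lemma exists_kind_of_fixed (hq : p ^ n % 4 = 1) (h2 : (2 : F) ≠ 0) (hG : G ≤ modelSU F p n)
    (hO : IsOuter G) (hU : ∀ P, unipCard G P = 1) {P : ℙ F (Fin 2 → F)}
    (hP : stabCard G P = projCard G) : ∃ t, Admissible p n t ∧ IsKind p (detOne F) G t := by
  have hfix : fixer G P = G := by
    refine Subgroup.eq_of_le_of_card_ge inf_le_left ?_
    rw [← numScalar_mul_stabCard, hP, numScalar_mul_projCard]
  obtain ⟨y, hy, hy'⟩ := SetLike.not_le_iff_exists.mp hO.not_le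
  have hc : y ∉ Subgroup.center (GL (Fin 2) F) := fun h => hy' (hO.scalar y hy h)
  obtain ⟨Q, hPQ, -, hQ⟩ := exists_second_fixed h2 hU hO.isSquare_discr (hfix.symm ▸ hy) hc
  rw [hfix] at hQ
  exact exists_kind_of_two_fixed hq hG hO.not_le hPQ
    (fun x hx => (mem_fixer.mp (hfix.symm ▸ hx)).2) hQ

/-- The stabilizer of `P` has index two, hence is normal, and it fixes a second point `Q`. All other
elements interchange `P` and `Q`, so `G` is monomial in the corresponding coordinates. -/
lemma exists_kind_of_half (hq : p ^ n % 4 = 1) (h2 : (2 : F) ≠ 0) (hG : G ≤ modelSU F p n)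
    (hO : IsOuter G) (hU : ∀ P, unipCard G P = 1) {P : ℙ F (Fin 2 → F)}
    (hP2 : 2 ≤ stabCard G P) (hP : 2 * stabCard G P = projCard G) :
    ∃ t, Admissible p n t ∧ IsKind p (detOne F) G t := by
  have hcard : 2 * Nat.card (fixer G P) = Nat.card G := by
    rw [← numScalar_mul_stabCard, ← numScalar_mul_projCard, ← hP]; ring
  obtain ⟨y, hy, hyc⟩ : ∃ y ∈ fixer G P, y ∉ Subgroup.center (GL (Fin 2) F) := by
    by_contra! hcon
    have h1 : fixer G P ≤ G ⊓ Subgroup.center (GL (Fin 2) F) := fun x hx =>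
      ⟨(mem_fixer.mp hx).1, hcon x hx⟩
    have h3 := Nat.le_of_dvd Nat.card_pos (Subgroup.card_dvd_of_le h1)
    rw [← numScalar_mul_stabCard] at h3
    change _ ≤ numScalar G at h3
    have := numScalar_pos G
    nlinarith
  obtain ⟨Q, hPQ, hyfix, hQ⟩ := exists_second_fixed h2 hU hO.isSquare_discr hy hyc
  have hle : fixer G P ≤ G := inf_le_left
  have hidx : ((fixer G P).subgroupOf G).index = 2 := by
    have h1 := ((fixer G P).subgroupOf G).card_mul_index
    rw [Nat.card_congr (Subgroup.subgroupOfEquivOfLe hle).toEquiv,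
      ← hcard, mul_comm 2] at h1
    exact Nat.eq_of_mul_eq_mul_left Nat.card_pos h1
  have hnorm := Subgroup.normal_of_index_eq_two hidx
  have hswap : ∀ x ∈ G, x ∉ fixer G P → x • P = Q ∧ x • Q = P := by
    intro x hx hxP
    have h1 : x⁻¹ * y * x ∈ fixer G P := by
      have := hnorm.conj_mem ⟨y, (mem_fixer.mp hy).1⟩ (Subgroup.mem_subgroupOf.mpr hy)
        (⟨x, hx⟩⁻¹ : G)
      simpa [Subgroup.mem_subgroupOf] using this
    have h3 : y • (x • P) = x • P := by
      have := (mem_fixer.mp h1).2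
      rw [mul_smul, mul_smul, inv_smul_eq_iff] at this
      exact this
    have h4 : x • P = Q := ((hyfix _).mp h3).resolve_left fun h => hxP (mem_fixer.mpr ⟨hx, h⟩)
    refine ⟨h4, ?_⟩
    have h5 := Subgroup.mul_self_mem_of_index_two hidx (⟨x, hx⟩ : G)
    rw [Subgroup.mem_subgroupOf] at h5
    have h6 : (x * x) • P = P := (mem_fixer.mp h5).2
    rwa [mul_smul, h4] at h6
  obtain ⟨g, hg⟩ := exists_frame hPQ
  have hdet := det_sq_conjSub hG g
  have hout' : ¬ conjSub g G ≤ detOne F := fun h => hO.not_le (conjSub_le_detOne_iff.mp h)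
  obtain ⟨x, hx, hxP⟩ : ∃ x ∈ G, x ∉ fixer G P := by
    by_contra! hcon
    have h1 := Nat.le_of_dvd Nat.card_pos (Subgroup.card_dvd_of_le hcon)
    have : 0 < Nat.card (fixer G P) := Nat.card_pos
    omega
  have hanti : ∀ x ∈ G, x ∉ fixer G P → IsAntidiag (g * x * g⁻¹) := fun x hx hxP =>
    ⟨(hg x).2.2.1.mp (hswap x hx hxP).1, (hg x).2.2.2.mp (hswap x hx hxP).2⟩
  obtain ⟨t, ht, hk⟩ := exists_kind_of_monomial hq hdet hout' (by
    rintro _ ⟨z, hz, rfl⟩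
    by_cases hzP : z ∈ fixer G P
    · exact Or.inl ⟨(hg z).2.1.mp (hQ z hzP), (hg z).1.mp (mem_fixer.mp hzP).2⟩
    · exact Or.inr (hanti z hz hzP)) ⟨_, conj_mem_conjSub hx, hanti x hx hxP⟩
    (split_or_nonsplit hG)
  exact ⟨t, ht, hk.of_conjSub⟩

/-- A point stabilizer of projective order `4` not contained in `SL(2,F)` is cyclic of order `8`. -/
lemma exists_trace_sq (hq : p ^ n % 4 = 1) (h2 : (2 : F) ≠ 0) (hG : G ≤ modelSU F p n)
    (hO : IsOuter G) (hU : ∀ P, unipCard G P = 1) {P : ℙ F (Fin 2 → F)}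
    (hP4 : stabCard G P = 4) (hP : ¬ fixer G P ≤ detOne F) :
    ¬ 8 ∣ p ^ n - 1 ∧ numScalar G = 2 ∧ ∃ A ∈ G, A.val.det = -1 ∧ A.val.trace ^ 2 = -2 := by
  obtain ⟨y, hy, hy'⟩ := SetLike.not_le_iff_exists.mp hP
  have hc : y ∉ Subgroup.center (GL (Fin 2) F) := fun h => hy' (hO.scalar y hy.1 h)
  obtain ⟨Q, hPQ, -, hQ⟩ := exists_second_fixed h2 hU hO.isSquare_discr hy hc
  obtain ⟨g, hg⟩ := exists_frame hPQ
  set C := conjSub g (fixer G P) with hC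
  have hCG : C ≤ conjSub g G := Subgroup.map_mono inf_le_left
  have hD : C ≤ diagSub F := by
    rintro _ ⟨x, hx, rfl⟩
    exact ⟨(hg x).2.1.mp (hQ x hx), (hg x).1.mp (mem_fixer.mp hx).2⟩
  have hdet : ∀ x ∈ C, x.val.det ^ 2 = 1 := fun x hx => det_sq_conjSub hG g x (hCG hx)
  have hout' : ¬ C ≤ detOne F := fun h => hP (conjSub_le_detOne_iff.mp h)
  have hcard : Nat.card C = numScalar G * 4 := by
    rw [hC, ← hP4, numScalar_mul_stabCard]
    exact (Nat.card_congr ((fixer G P).equivMapOfInjective _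
      (MulAut.conj g).injective).toEquiv).symm
  have hscal : ∀ x ∈ G ⊓ Subgroup.center (GL (Fin 2) F), x = 1 ∨ x = -1 := by
    intro x hx
    obtain ⟨c, hc⟩ := (mem_center_iff x).mp hx.2
    have h1 := mem_detOne.mp (hO.scalar x hx.1 hx.2)
    rw [Matrix.det_fin_two, hc] at h1
    simp only [Matrix.smul_apply, Matrix.one_apply_eq, smul_eq_mul, mul_one, ne_eq, zero_ne_one,
      one_ne_zero, not_false_eq_true, Matrix.one_apply_ne, mul_zero, sub_zero] at h1
    rcases mul_self_eq_one_iff.mp h1 with rfl | rfl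
    · left; exact Units.ext (by rw [hc]; simp)
    · right; exact Units.ext (by rw [hc]; simp)
  have hnum : numScalar G = 1 ∨ numScalar G = 2 := by
    have h1 : ((G ⊓ Subgroup.center (GL (Fin 2) F) : Subgroup _) : Set (GL (Fin 2) F)) ⊆
      {1, -1} := fun x hx => hscal x hx
    have h3 := Set.ncard_le_ncard h1 (Set.toFinite _)
    have h4 := h3.trans (Set.ncard_insert_le _ _)
    rw [Set.ncard_singleton] at h4
    have h5 := numScalar_pos G
    change numScalar G ≤ _ at h4
    omega
  have hsn : (∀ x ∈ C, x.val 0 0 ^ p ^ n = x.val.det * x.val 0 0) ∨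
      (∀ x ∈ C, x.val 0 0 ^ p ^ n = x.val.det * x.val 1 1) :=
    (split_or_nonsplit (g := g) hG).imp (fun h x hx => h x ⟨hCG hx, hD hx⟩)
      (fun h x hx => h x ⟨hCG hx, hD hx⟩)
  rcases hsn with hs | hs
  · obtain ⟨α, hα, hgen, hα', d, hd, h1, hd1, hd2, hord⟩ := split_torus hq hD hdet hs hout'
    have hdc : 2 * d = numScalar G * 4 := by rw [← hcard, ← hgen, Nat.card_zpowers, hd]
    -- A single scalar would give `d = 2`, which divides `(q - 1) / 2`. So `d = 4`, and not dividing
    -- `(q - 1) / 2` means that 8 does not divide `q - 1`.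
    have hd4 : d = 4 := by
      rcases hnum with h | h
      · exfalso
        apply hd2
        rw [h] at hdc
        have : d = 2 := by omega
        rw [this]; omega
      · omega
    subst hd4
    refine ⟨fun h => hd2 (by omega), by omega, ?_⟩
    have hα0 := hα
    obtain ⟨A, hA, rfl⟩ := hα0
    change A ∈ fixer G P at hA
    change (∀ k, (g * A * g⁻¹).val 0 0 ^ k = 1 ↔ 2 * 4 ∣ k) at hord
    change (g * A * g⁻¹) ∈ C at hα
    change (g * A * g⁻¹) ∉ detOne F at hα'
    refine ⟨A, hA.1, ?_⟩
    have hAdet : A.val.det = -1 := by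
      rw [← det_conj g]
      exact det_eq_neg_one (hdet _ hα) hα'
    refine ⟨hAdet, ?_⟩
    have htr : A.val.trace = (g * A * g⁻¹).val.trace := by
      rw [Units.val_mul, Units.val_mul, Matrix.trace_mul_cycle, ← Units.val_mul, inv_mul_cancel,
        Units.val_one, one_mul]
    have hdd := det_of_diag (hD hα)
    rw [det_conj, hAdet] at hdd
    rw [htr, Matrix.trace_fin_two]
    set l := (g * A * g⁻¹).val 0 0
    set m := (g * A * g⁻¹).val 1 1
    have hl8 : l ^ 8 = 1 := (hord 8).mpr (by norm_num)
    -- The eigenvalues satisfy l m = -1 and l⁴ = -1, so (l + m)² = l² + l⁻² - 2 = -2.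
    have hl4 : l ^ 4 = -1 := by
      have h3 : l ^ 4 ≠ 1 := fun h => by have := (hord 4).mp h; omega
      have h4 : (l ^ 4 - 1) * (l ^ 4 + 1) = 0 := by linear_combination hl8
      linear_combination (mul_eq_zero.mp h4).resolve_left (sub_ne_zero.mpr h3)
    have hl0 : l ≠ 0 := by
      intro h; rw [h] at hl4; norm_num at hl4
    apply mul_left_cancel₀ (pow_ne_zero 2 hl0)
    linear_combination hl4 - (l * m + 2 * l ^ 2 - 1) * hdd
  · exfalso
    obtain ⟨a, ha, b, hb, hgen, hord, hb', hb2, hCab, horda⟩ := nonsplit_torus hq hD hdet hs hout'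
    have hc2 : Nat.card C = 2 * orderOf a := by
      rw [card_eq_two_mul hdet hb hb', ← hgen, Nat.card_zpowers]
    rw [hcard] at hc2
    -- Order 4 is impossible because q + 1 ≡ 2 mod 4. Order 2 forces `a = -1`, a nontrivial scalar,
    -- while the orders then say that only the identity is scalar.
    have hn2 : orderOf a = 2 := by
      rcases hnum with h | h
      · omega
      · rw [h] at hc2
        have : orderOf a = 4 := by omega
        rw [this] at hord
        omega
    have hn1 : numScalar G = 1 := by omega
    have ha1 : a.val 0 0 = -1 := by
      have h3 : a.val 0 0 ^ 2 = 1 := (horda 2).mpr (by rw [hn2])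
      have h4 : a.val 0 0 ≠ 1 := fun h => by
        have := (horda 1).mp (by rw [pow_one, h])
        rw [hn2] at this
        omega
      have h5 : (a.val 0 0 - 1) * (a.val 0 0 + 1) = 0 := by linear_combination h3
      linear_combination (mul_eq_zero.mp h5).resolve_left (sub_ne_zero.mpr h4)
    have had : a ∈ detOne F := (hgen ▸ Subgroup.mem_zpowers a : a ∈ C ⊓ detOne F).2
    have had' := mem_detOne.mp had
    rw [det_of_diag (hD ha), ha1] at had'
    have ha' : a = -1 := by
      apply Units.ext
      ext i j
      fin_cases i <;> fin_cases j
      · simpa using ha1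
      · simpa using (hD ha).1
      · simpa using (hD ha).2
      · simp; linear_combination -had'
    obtain ⟨A, hA, hAa⟩ := ha
    change g * A * g⁻¹ = a at hAa
    have hA1 : A = -1 := by
      have : A = g⁻¹ * a * g := by rw [← hAa]; group
      rw [this, ha']; simp
    have hmem : (-1 : GL (Fin 2) F) ∈ G ⊓ Subgroup.center (GL (Fin 2) F) :=
      ⟨hA1 ▸ hA.1, (mem_center_iff _).mpr ⟨-1, by simp⟩⟩
    have hsub := (Nat.card_eq_one_iff_unique.mp hn1).1
    have h7 := congrArg Subtype.val (Subsingleton.elim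
      (⟨-1, hmem⟩ : ↥(G ⊓ Subgroup.center (GL (Fin 2) F))) 1)
    have h8 := congrArg (fun x : GL (Fin 2) F => x.val 0 0) h7
    simp at h8
    exact h2 (by linear_combination -h8)

omit [Finite F] in
lemma pow_four_eq {M : Matrix (Fin 2) (Fin 2) F} (hd : M.det = -1) :
    M ^ 4 = (M.trace ^ 3 + 2 * M.trace) • M + (M.trace ^ 2 + 1) • 1 := by
  have h := mul_self_eq M
  rw [hd, neg_smul, one_smul, sub_neg_eq_add] at h
  rw [show M ^ 4 = (M * M) * (M * M) by noncomm_ring, h, add_mul, mul_add, mul_add, smul_mul_smul_comm,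
    h, smul_add, smul_smul]
  simp only [mul_one, one_mul]
  generalize (1 : Matrix (Fin 2) (Fin 2) F) = I
  module

/-- The trace of an element of determinant `-1` all of whose powers of exponent `4` are scalar. -/
lemma trace_of_outside (hO : IsOuter G) (h2 : (2 : F) ≠ 0)
    (hU : ∀ P, unipCard G P = 1)
    (hS : ∀ P, stabCard G P = 1 ∨ stabCard G P = 2 ∨ stabCard G P = 3 ∨ stabCard G P = 4)
    {x : GL (Fin 2) F} (hx : x ∈ G) (hx' : x ∉ detOne F) :
    x.val.trace ^ 3 + 2 * x.val.trace = 0 := by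
  have hc : x ∉ Subgroup.center (GL (Fin 2) F) := fun h => hx' (hO.scalar x hx h)
  obtain ⟨P, Q, -, hP⟩ := exists_two_fixed h2 (hO.isSquare_discr x hx) (discr_ne_zero h2 hU hx hc)
  have hxP : x ∈ fixer G P := mem_fixer.mpr ⟨hx, (hP P).mpr (Or.inl rfl)⟩
  have h4 : x ^ 4 ∈ Subgroup.center (GL (Fin 2) F) := by
    have h := pow_stabCard_mem_center hxP
    rcases hS P with h1 | h1 | h1 | h1
    · rw [h1, pow_one] at h; exact absurd h hc
    · rw [h1] at h
      rw [show 4 = 2 * 2 by norm_num, pow_mul]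
      exact pow_mem h 2
    · exact absurd (hO.fixer_le_of_odd (by rw [h1]; decide) hxP) hx'
    · rwa [h1] at h
  obtain ⟨c, hc4⟩ := (mem_center_iff _).mp h4
  -- By `pow_four_eq` the fourth power of `x` is `(t³ + 2t) x` plus a scalar, where `t` is its
  -- trace; as `x` is not scalar, the coefficient must vanish.
  rw [Units.val_pow_eq_pow_val, pow_four_eq (det_eq_neg_one (hO.det_sq x hx) hx')] at hc4
  by_contra h0
  apply hc
  refine (mem_center_iff x).mpr ⟨(x.val.trace ^ 3 + 2 * x.val.trace)⁻¹ *
    (c - (x.val.trace ^ 2 + 1)), ?_⟩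
  rw [mul_smul, eq_inv_smul_iff₀ h0, sub_smul, ← hc4]
  abel

/-- Comparing w³ = 1 with Cayley–Hamilton for a nonscalar `w` determines the trace. In
characteristic 3 the discriminant 1 - 4 would vanish, which cannot happen without unipotents. -/
lemma trace_of_orderOf_three (hO : IsOuter G) (h2 : (2 : F) ≠ 0) (hU : ∀ P, unipCard G P = 1)
    {w : GL (Fin 2) F} (hw : w ∈ G) (hw3 : orderOf w = 3) :
    w.val.trace = -1 ∧ w.val.det = 1 ∧ (3 : F) ≠ 0 := by
  have hp3 : w ^ 3 = 1 := by rw [← hw3, pow_orderOf_eq_one]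
  have hdet : w.val.det = 1 := by
    have h1 : w.val.det ^ 3 = 1 := by rw [← det_pow', hp3]; simp
    have h3 := hO.det_sq w hw
    linear_combination h1 - w.val.det * h3
  have hc : w ∉ Subgroup.center (GL (Fin 2) F) := by
    intro h
    obtain ⟨c, hc⟩ := (mem_center_iff w).mp h
    have h1 : c * c = 1 := by
      rw [hc, Matrix.det_fin_two] at hdet
      simpa using hdet
    have h3 : w ^ 2 = 1 := Units.ext (by
      rw [Units.val_pow_eq_pow_val, hc, smul_pow, sq, h1]; simp)
    have := orderOf_dvd_of_pow_eq_one h3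
    rw [hw3] at this
    omega
  have hd := discr_ne_zero h2 hU hw hc
  have h := mul_self_eq w.val
  rw [hdet, one_smul] at h
  have h3 : (w.val.trace ^ 2 - 1) • w.val = (1 + w.val.trace) • 1 := by
    have h4 : w.val * (w.val * w.val) = 1 := by
      rw [← Units.val_mul, ← Units.val_mul, ← sq, ← pow_succ', hp3, Units.val_one]
    rw [h, mul_sub, mul_smul_comm, h, mul_one] at h4
    generalize (1 : Matrix (Fin 2) (Fin 2) F) = I at h4 ⊢
    calc _ = w.val.trace • (w.val.trace • w.val - I) - w.val + w.val.trace • I := by module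
      _ = _ := by rw [h4]; module
  have ht2 : w.val.trace ^ 2 - 1 = 0 := by
    by_contra h0
    exact hc ((mem_center_iff w).mpr ⟨(w.val.trace ^ 2 - 1)⁻¹ * (1 + w.val.trace), by
      rw [mul_smul, eq_inv_smul_iff₀ h0, h3]⟩)
  have ht : w.val.trace = -1 := by
    rw [ht2, zero_smul] at h3
    have h6 := congrArg (fun M : Matrix (Fin 2) (Fin 2) F => M 0 0) h3
    simp at h6
    linear_combination -h6
  refine ⟨ht, hdet, fun h30 => hd ?_⟩
  rw [discr_eq, ht, hdet]
  linear_combination -h30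

/-- `G` has order 48. It suffices to find in it a pair satisfying the hypotheses of
`octGroup_equiv_GL`, since the group generated by the pair has order 48 as well. -/
lemma exists_kind_of_octahedral (hn : 0 < n) (hq : p ^ n % 4 = 1) (hG : G ≤ modelSU F p n)
    (hO : IsOuter G) (hU : ∀ P, unipCard G P = 1) (h24 : projCard G = 24)
    {P : ℙ F (Fin 2 → F)} (hP4 : stabCard G P = 4) (hP : ¬ fixer G P ≤ detOne F)
    (hS : ∀ P, stabCard G P = 1 ∨ stabCard G P = 2 ∨ stabCard G P = 3 ∨ stabCard G P = 4) :
    ∃ t, Admissible p n t ∧ IsKind p (detOne F) G t := by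
  have h2 := two_ne_zero_of_mod F hn hq
  obtain ⟨h8, hnum, A, hA, hAd, hAt⟩ := exists_trace_sq hq h2 hG hO hU hP4 hP
  have hcard : Nat.card G = 48 := by rw [← numScalar_mul_projCard, hnum, h24]
  have : Fact (Nat.Prime 3) := ⟨Nat.prime_three⟩
  obtain ⟨w', hw'⟩ := exists_prime_orderOf_dvd_card' (G := G) 3 (by rw [hcard]; norm_num)
  obtain ⟨w, hw⟩ := w'
  rw [Subgroup.orderOf_mk] at hw'
  obtain ⟨hwt, hwd, h3⟩ := trace_of_orderOf_three hO h2 hU hw hw'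
  have hout : ∀ x ∈ G, x.val.det = -1 → x.val.trace ^ 3 + 2 * x.val.trace = 0 := by
    intro x hx hxd
    refine trace_of_outside hO h2 hU hS hx fun h => h2 ?_
    rw [mem_detOne, hxd] at h
    linear_combination -h
  have hinv : A⁻¹.val = A.val - A.val.trace • 1 := by
    have h1 : A.val * (A.val - A.val.trace • 1) = 1 := by
      rw [mul_sub, mul_self_eq, hAd]; simp
    calc (A⁻¹).val = (A⁻¹).val * (A.val * (A.val - A.val.trace • 1)) := by rw [h1, mul_one]
      _ = _ := by rw [← mul_assoc, ← Units.val_mul, inv_mul_cancel, Units.val_one, one_mul]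
  have hθ0 : A.val.trace ≠ 0 := by
    intro h
    rw [h] at hAt
    exact h2 (by linear_combination hAt)
  -- Let θ be the trace of `A` and b that of `A * w`; then `A⁻¹ * w` has trace b + θ. By `hout` each
  -- of b and b + θ is 0 or ±θ. If neither vanished, then b = θ and 2θ would be a root of t³ + 2t,
  -- that is, 12θ = 0.
  obtain ⟨B, hB, hBd, hBt, hBw⟩ : ∃ B ∈ G, B.val.det = -1 ∧ B.val.trace ^ 2 = -2 ∧
      (B * w).val.trace = 0 := by
    have e1 := hout (A * w) (mul_mem hA hw) (by rw [det_mul', hAd, hwd, mul_one])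
    have e2 := hout (A⁻¹ * w) (mul_mem (inv_mem hA) hw) (by
      rw [det_mul', det_inv', hAd, hwd]; norm_num)
    have e3 : (A⁻¹ * w).val.trace = (A * w).val.trace + A.val.trace := by
      rw [Units.val_mul, hinv, sub_mul, smul_mul_assoc, one_mul, Matrix.trace_sub,
        Matrix.trace_smul, hwt, Units.val_mul]
      simp
    by_cases h0 : (A * w).val.trace = 0
    · exact ⟨A, hA, hAd, hAt, h0⟩
    · refine ⟨A⁻¹, inv_mem hA, by rw [det_inv', hAd]; norm_num, ?_, ?_⟩
      · rw [hinv, Matrix.trace_sub, Matrix.trace_smul, Matrix.trace_one]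
        simp only [Fintype.card_fin, Nat.cast_ofNat, smul_eq_mul]
        linear_combination hAt
      · set b := (A * w).val.trace
        set θ := A.val.trace
        have hb : b ^ 2 = θ ^ 2 := by
          apply mul_left_cancel₀ h0
          linear_combination e1 - b * hAt
        rw [e3] at e2 ⊢
        by_contra h5
        have hb' : b = θ := by
          have h6 : (b - θ) * (b + θ) = 0 := by linear_combination hb
          exact sub_eq_zero.mp ((mul_eq_zero.mp h6).resolve_right h5)
        rw [hb'] at e2
        have h7 : (2 : F) * 2 * 3 * θ = 0 := by linear_combination -e2 + 8 * θ * hAt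
        simp [h2, h3, hθ0] at h7
  obtain ⟨h48, hiso⟩ := octGroup_equiv_GL h2 h3 hBt rfl hBd hwt hwd hBw
  have hle : octGroup B w ≤ G := by
    rw [octGroup, octQ, sup_le_iff, sup_le_iff, sup_le_iff, Subgroup.zpowers_le,
      Subgroup.zpowers_le, Subgroup.zpowers_le, Subgroup.zpowers_le]
    exact ⟨⟨⟨pow_mem hB 2, mul_mem (mul_mem hw (pow_mem hB 2)) (inv_mem hw)⟩, hw⟩, hB⟩
  have hGe : octGroup B w = G := Subgroup.eq_of_le_of_card_ge hle (by rw [h48, hcard])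
  rw [hGe] at hiso
  refine ⟨.sl23, ⟨?_, h8⟩, hiso⟩
  have hp := (Fact.out : p.Prime).two_le
  have hne : ∀ m : ℕ, (m : F) ≠ 0 → p ≠ m := by
    rintro m hm rfl
    exact hm (CharP.cast_eq_zero F p)
  have hp2 := hne 2 (by exact_mod_cast h2)
  have hp3 := hne 3 (by exact_mod_cast h3)
  have hp4 : p ≠ 4 := by rintro rfl; exact absurd (Fact.out : Nat.Prime 4) (by norm_num)
  omega

lemma exists_kind_of_semisimple (hn : 0 < n) (hq : p ^ n % 4 = 1) (hF : Nat.card F = (p ^ n) ^ 2)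
    (hG : G ≤ modelSU F p n) (hout : ¬ G ≤ detOne F) (hU : ∀ P, unipCard G P = 1) :
    ∃ t, Admissible p n t ∧ IsKind p (detOne F) G t := by
  have h2 := two_ne_zero_of_mod F hn hq
  have hO := isOuter_of_le hn hq hF hG hout
  rcases hO.semisimpleCases h2 hU with ⟨P, hP⟩ | ⟨P, hP2, hP⟩ | ⟨h24, ⟨P, hP4, hP⟩, -, hS⟩
  · exact exists_kind_of_fixed hq h2 hG hO hU hP
  · exact exists_kind_of_half hq h2 hG hO hU hP2 hP
  · exact exists_kind_of_octahedral hn hq hG hO hU h24 hP4 hP hS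

end Semisimple

/-! ### Free actions and divisibility. -/

section FreeActions

lemma card_dvd_ncard_of_free {Γ X : Type*} [Group Γ] [MulAction Γ X] (s : Set X)
    (hs : ∀ g : Γ, ∀ x ∈ s, g • x ∈ s) (hfree : ∀ g : Γ, ∀ x ∈ s, g • x = x → g = 1) :
    Nat.card Γ ∣ s.ncard := by
  let S : SubMulAction Γ X := ⟨s, fun g x hx => hs g x hx⟩
  have h : ∀ x : S, MulAction.stabilizer Γ x = ⊥ := by
    intro x
    rw [eq_bot_iff]
    intro g hg
    exact hfree g x x.2 (congrArg Subtype.val (MulAction.mem_stabilizer_iff.mp hg))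
  have e := Nat.card_congr (MulAction.selfEquivOrbitsQuotientProd h)
  rw [Nat.card_prod] at e
  exact ⟨_, e.trans (mul_comm _ _)⟩

end FreeActions

/-! ### The orbit of points fixed by unipotents. -/

section UnipotentCases

variable {F : Type*} [Field F] {G : Subgroup (GL (Fin 2) F)}

lemma sub_one_sq_of_unip {P : ℙ F (Fin 2 → F)} {x : GL (Fin 2) F} (hx : x ∈ unip G P) :
    (x.val - (1 : F) • 1) ^ 2 = 0 := by
  have h1 : x.val *ᵥ P.rep = (1 : F) • P.rep := by rw [one_smul]; exact hx.2.1
  have h2 : x.val.det = 1 ^ 2 := by rw [one_pow]; exact hx.2.2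
  exact sub_smul_sq_eq_zero (trace_of_discr_eq_zero P.rep_nonzero one_ne_zero h1 h2) h2

variable [Finite F]

lemma isPGroup_unip {p m : ℕ} (hF : Nat.card F = p ^ m) (P : ℙ F (Fin 2 → F)) :
    IsPGroup p (unip G P) := by
  intro x
  refine ⟨m, Subtype.ext (Units.ext ?_)⟩
  rw [← hF]
  simpa using pow_card_of_sq_eq_zero _ _ (sub_one_sq_of_unip x.2)

lemma three_le_unipCard {p m : ℕ} [Fact p.Prime] (hp : p ≠ 2) (hF : Nat.card F = p ^ m)
    {P : ℙ F (Fin 2 → F)} (h : unipCard G P ≠ 1) : 3 ≤ unipCard G P := by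
  obtain ⟨k, hk⟩ := (IsPGroup.iff_card).mp (isPGroup_unip (G := G) hF P)
  change unipCard G P = p ^ k at hk
  have hp3 : 3 ≤ p := by
    have := (Fact.out : p.Prime).two_le
    omega
  rcases k with _ | k
  · exact absurd hk h
  · rw [hk, pow_succ]
    have : 0 < p ^ k := by positivity
    nlinarith

lemma IsOuter.stabCard_le (hO : IsOuter G) (P : ℙ F (Fin 2 → F)) :
    stabCard G P ≤ 2 * stabCard (G ⊓ detOne F) P := by
  by_cases h : fixer G P ≤ detOne F
  · rw [hO.stabCard_inf_of_le h]; omega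
  · obtain ⟨a, ha, ha'⟩ := SetLike.not_le_iff_exists.mp h
    have h1 := card_eq_two_mul (fun x hx => hO.det_sq x (mem_fixer.mp hx).1) ha ha'
    rw [← fixer_inf_detOne, ← numScalar_mul_stabCard, ← numScalar_mul_stabCard,
      hO.numScalar_inf] at h1
    have := numScalar_pos G
    nlinarith

/-- As the stabilizer in `G ∩ SL(2,F)` has index at most 2 and there are at least 3 unipotents, each
such point contributes more than 1/2 to `IsOuter.pair_lt`; two inequivalent ones would violate it.
-/
lemma IsOuter.equiv_of_unip (hO : IsOuter G) (h2 : (2 : F) ≠ 0) {P Q : ℙ F (Fin 2 → F)}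
    (hP : 3 ≤ unipCard G P) (hQ : 3 ≤ unipCard G Q) : ∃ x ∈ G, x • P = Q := by
  by_contra! hcon
  have h := hO.pair_lt h2 hcon
  have key : ∀ R, 3 ≤ unipCard G R → (1 / 2 : ℚ) <
      ((stabCard (G ⊓ detOne F) R : ℚ) + unipCard G R - 2) / stabCard G R := by
    intro R hR
    have h0 : (0 : ℚ) < stabCard G R := by exact_mod_cast stabCard_pos G R
    have h1 : (stabCard G R : ℚ) ≤ 2 * stabCard (G ⊓ detOne F) R := by
      exact_mod_cast hO.stabCard_le R
    have h3 : (3 : ℚ) ≤ unipCard G R := by exact_mod_cast hR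
    rw [lt_div_iff₀ h0]
    linarith
  linarith [key P hP, key Q hQ]

/-- The orbit of a point fixed by a nontrivial unipotent element. -/
lemma IsOuter.unip_orbit_cases (hO : IsOuter G) (h2 : (2 : F) ≠ 0) {P : ℙ F (Fin 2 → F)}
    (h3 : ∀ R, unipCard G R ≠ 1 → 3 ≤ unipCard G R) (hP : 3 ≤ unipCard G P) {e u : ℕ}
    (he : stabCard G P = e * unipCard G P) (heQ : e ≤ unipCard G P - 1)
    (hr : Nat.card (MulAction.orbit G P) = 1 + unipCard G P * u) :
    u = 0 ∨ (u = 1 ∧ unipCard G P - 1 ≤ 2 * e) := by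
  classical
  rcases Nat.eq_zero_or_pos u with hu | hu
  · exact Or.inl hu
  right
  obtain ⟨T, hT2, hTinj, hTsurj, hsum⟩ := orbit_equation h2 G hO.isSquare_discr
  obtain ⟨R, hRT, x, hx, hxR⟩ := hTsurj P (by
    have := unipCard_le_stabCard G P; omega)
  have hRu : unipCard G R = unipCard G P := by rw [← hxR, unipCard_smul G R hx]
  have hRs : stabCard G R = stabCard G P := by rw [← hxR, stabCard_smul G R hx]
  have hepos : 0 < e := by
    have := stabCard_pos G P
    rw [he] at this
    exact Nat.pos_of_mul_pos_right this
  have hother : ∀ A ∈ T.erase R, unipCard G A = 1 := by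
    intro A hA
    by_contra hne
    obtain ⟨y, hy, hyA⟩ := hO.equiv_of_unip h2 (hRu ▸ hP) (h3 A hne)
    exact (Finset.mem_erase.mp hA).1
      (hTinj R hRT A (Finset.mem_of_mem_erase hA) y hy hyA).symm
  have hterm : ∀ A ∈ T.erase R, (1 : ℚ) + ((unipCard G A : ℚ) - 2) / stabCard G A =
      1 - 1 / stabCard G A := by
    intro A hA
    rw [hother A hA]
    push_cast
    ring
  have hhalf : ∀ A ∈ T.erase R, (1 / 2 : ℚ) ≤
      (1 : ℚ) + ((unipCard G A : ℚ) - 2) / stabCard G A := by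
    intro A hA
    have h4 : (2 : ℚ) ≤ stabCard G A := by exact_mod_cast hT2 A (Finset.mem_of_mem_erase hA)
    have h5 : (1 : ℚ) / stabCard G A ≤ 1 / 2 := one_div_le_one_div_of_le (by norm_num) h4
    rw [hterm A hA]
    linarith
  have hg := card_orbit_mul_stabCard G P
  rw [hr, he] at hg
  rw [← Finset.add_sum_erase T _ hRT, hRu, hRs, he] at hsum
  set Q := unipCard G P with hQ
  have hgQ : (projCard G : ℚ) = (1 + Q * u) * (e * Q) := by rw [← hg]; push_cast; ring
  have hQ3 : (3 : ℚ) ≤ Q := by exact_mod_cast hP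
  have he1 : (1 : ℚ) ≤ e := by exact_mod_cast hepos
  have hu1 : (1 : ℚ) ≤ u := by exact_mod_cast hu
  have hgpos : (0 : ℚ) < projCard G := by exact_mod_cast projCard_pos G
  push_cast at hsum
  -- The term of `R` exceeds 1, every other term is at least 1/2, and the total is below 2.
  have hcard : (T.erase R).card ≤ 1 := by
    by_contra hcon
    have h4 := Finset.card_nsmul_le_sum _ _ _ hhalf
    rw [nsmul_eq_mul] at h4
    have h5 : (2 : ℚ) ≤ (T.erase R).card := by exact_mod_cast (by omega : 2 ≤ (T.erase R).card)
    have h6 : (0 : ℚ) < ((Q : ℚ) - 2) / (e * Q) := by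
      apply div_pos (by linarith); positivity
    have h7 : (0 : ℚ) < 2 / projCard G := by positivity
    linarith
  have hQ0 : (Q : ℚ) ≠ 0 := by positivity
  have he0 : (e : ℚ) ≠ 0 := by positivity
  have hr0 : (1 + Q * u : ℚ) ≠ 0 := by positivity
  rcases Nat.lt_or_ge (T.erase R).card 1 with h0 | h0
  -- With no other orbit the equation makes `1 + Q * u` a divisor of 2, although `Q ≥ 3`.
  · have hempty : T.erase R = ∅ := Finset.card_eq_zero.mp (by omega)
    rw [hempty, Finset.sum_empty, add_zero, hgQ] at hsum
    exfalso
    field_simp at hsum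
    have h4 : (Q : ℚ) * (1 + Q * u) * e + (Q - 2) * (1 + Q * u) =
        2 * (Q * (1 + Q * u) * e) - 2 := by linarith
    have h5 : (1 + Q * u) * (e * Q + 2) = (1 + Q * u) * Q + 2 := by
      have : ((1 + Q * u) * (e * Q + 2) : ℚ) = (1 + Q * u) * Q + 2 := by linarith
      exact_mod_cast this
    have h6 : (1 + Q * u) ∣ 2 := by
      rw [← Nat.dvd_add_right (Dvd.intro Q rfl : (1 + Q * u) ∣ (1 + Q * u) * Q), ← h5]
      exact Dvd.intro _ rfl
    have h7 := Nat.le_of_dvd two_pos h6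
    nlinarith
  · obtain ⟨A, hA⟩ := Finset.card_eq_one.mp (le_antisymm hcard h0)
    have hAT : A ∈ T.erase R := by rw [hA]; exact Finset.mem_singleton_self A
    rw [hA, Finset.sum_singleton, hterm A hAT, hgQ] at hsum
    set a := stabCard G A with ha
    have ha0 : (a : ℚ) ≠ 0 := by
      have := stabCard_pos G A
      positivity
    have hmain : a * (1 + (Q - 2) * u) = e * (1 + Q * u) := by
      have h4 : (a * (1 + (Q - 2) * u) : ℚ) = e * (1 + Q * u) := by
        field_simp at hsum
        apply mul_left_cancel₀ hQ0
        linarith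
      have h5 : ((Q - 2 : ℕ) : ℚ) = Q - 2 := by rw [Nat.cast_sub (by omega)]; norm_num
      rw [← h5] at h4
      exact_mod_cast h4
    -- The exceptional solution has projective order 60; it is the configuration of A_5 in
    -- characteristic 3. The contributions to `IsOuter.pair_lt` are at least 4/6 and 4/5, whose sum
    -- exceeds 1.
    rcases unipotent_arith hP hepos heQ hu hmain with h | ⟨hQ3', hu3, he2, ha5⟩
    · exact h
    · exfalso
      have h4 := hO.pair_lt h2 (P := R) (Q := A) fun x hx hxA =>
        (Finset.mem_erase.mp hAT).1 (hTinj R hRT A (Finset.mem_of_mem_erase hAT) x hx hxA).symm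
      have h5 := hO.stabCard_inf_of_le (hO.fixer_le_of_odd (P := A) (by rw [← ha, ha5]; decide))
      have h6 := hO.stabCard_le R
      rw [h5, ← ha, ha5, hother A hAT, hRu, hRs, he, hQ3', he2] at h4
      rw [hRs, he, hQ3', he2] at h6
      have h7 : (3 : ℚ) ≤ stabCard (G ⊓ detOne F) R := by exact_mod_cast (by omega)
      norm_num at h4
      linarith

end UnipotentCases

/-! ### Transvections and the points (1 : 0) and (t : 1). -/

section Transvections

variable {F : Type*} [Field F]

/-- The upper triangular unipotent matrix with entry `t`. -/
def transv (t : F) : GL (Fin 2) F :=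
  ⟨!![1, t; 0, 1], !![1, -t; 0, 1], by simp [Matrix.one_fin_two], by simp [Matrix.one_fin_two]⟩

lemma coe_transv (t : F) : (transv t).val = !![1, t; 0, 1] := rfl

lemma transv_add (s t : F) : transv (s + t) = transv s * transv t := by
  apply Units.ext
  rw [Units.val_mul, coe_transv, coe_transv, coe_transv]
  simp [add_comm]

lemma transv_zero : transv (0 : F) = 1 := Units.ext (by rw [coe_transv]; simp [Matrix.one_fin_two])

lemma transv_neg (t : F) : transv (-t) = (transv t)⁻¹ := by
  rw [eq_inv_iff_mul_eq_one, ← transv_add, neg_add_cancel, transv_zero]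

lemma transv_pow (t : F) (k : ℕ) : transv t ^ k = transv (k * t) := by
  induction k with
  | zero => simp [transv_zero]
  | succ k ih => rw [pow_succ, ih, ← transv_add]; push_cast; ring_nf

lemma transv_injective : Function.Injective (transv : F → GL (Fin 2) F) := by
  intro s t h
  have := congrArg (fun x : GL (Fin 2) F => x.val 0 1) h
  simpa [coe_transv] using this

/-- The entries of the transvections in `G`. -/
def transvSet (G : Subgroup (GL (Fin 2) F)) : AddSubgroup F where
  carrier := {t | transv t ∈ G}
  zero_mem' := by change transv 0 ∈ G; rw [transv_zero]; exact one_mem G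
  add_mem' := by
    intro s t hs ht
    change transv (s + t) ∈ G
    rw [transv_add]
    exact mul_mem hs ht
  neg_mem' := by
    intro t ht
    change transv (-t) ∈ G
    rw [transv_neg]
    exact inv_mem ht

lemma mem_transvSet {G : Subgroup (GL (Fin 2) F)} {t : F} : t ∈ transvSet G ↔ transv t ∈ G := Iff.rfl

variable (F) in
/-- The point `(1 : 0)`. -/
def pt0 : ℙ F (Fin 2 → F) := Projectivization.mk F ![1, 0] fun h => one_ne_zero (congrFun h 0)

/-- The point `(t : 1)`. -/
def ptt (t : F) : ℙ F (Fin 2 → F) :=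
  Projectivization.mk F ![t, 1] fun h => one_ne_zero (congrFun h 1)

lemma smul_pt0_eq_pt0_iff (x : GL (Fin 2) F) : x • pt0 F = pt0 F ↔ x.val 1 0 = 0 := by
  rw [pt0, smul_eq_self_iff]
  constructor
  · rintro ⟨c, hc⟩
    simpa using congrFun hc 1
  · intro h
    exact ⟨x.val 0 0, by ext i; fin_cases i <;> simp [h]⟩

lemma smul_pt0_eq_ptt_iff (x : GL (Fin 2) F) (t : F) :
    x • pt0 F = ptt t ↔ x.val 0 0 = x.val 1 0 * t := by
  rw [pt0, ptt, smul_mk_eq_iff]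
  constructor
  · rintro ⟨c, hc⟩
    have h0 := congrFun hc 0
    have h1 := congrFun hc 1
    simp at h0 h1
    rw [h0, h1]
  · intro h
    exact ⟨x.val 1 0, by ext i; fin_cases i <;> simp [h]⟩

lemma smul_ptt_zero_eq_pt0_iff (x : GL (Fin 2) F) : x • ptt (0 : F) = pt0 F ↔ x.val 1 1 = 0 := by
  rw [pt0, ptt, smul_mk_eq_iff]
  constructor
  · rintro ⟨c, hc⟩
    simpa using congrFun hc 1
  · intro h
    exact ⟨x.val 0 1, by ext i; fin_cases i <;> simp [h]⟩

lemma smul_ptt_zero_eq_ptt_iff (x : GL (Fin 2) F) (t : F) :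
    x • ptt (0 : F) = ptt t ↔ x.val 0 1 = x.val 1 1 * t := by
  rw [ptt, ptt, smul_mk_eq_iff]
  constructor
  · rintro ⟨c, hc⟩
    have h0 := congrFun hc 0
    have h1 := congrFun hc 1
    simp at h0 h1
    rw [h0, h1]
  · intro h
    exact ⟨x.val 1 1, by ext i; fin_cases i <;> simp [h]⟩

lemma transv_smul_ptt_zero (t : F) : transv t • ptt (0 : F) = ptt t := by
  rw [smul_ptt_zero_eq_ptt_iff, coe_transv]
  simp

lemma ptt_ne_pt0 (t : F) : ptt t ≠ pt0 F := by
  intro h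
  rw [← transv_smul_ptt_zero, smul_ptt_zero_eq_pt0_iff, coe_transv] at h
  simp at h

lemma ptt_injective : Function.Injective (ptt : F → ℙ F (Fin 2 → F)) := by
  intro s t h
  rw [← transv_smul_ptt_zero s, smul_ptt_zero_eq_ptt_iff, coe_transv] at h
  simpa using h

lemma mem_unip_pt0 {G : Subgroup (GL (Fin 2) F)} {x : GL (Fin 2) F} :
    x ∈ unip G (pt0 F) ↔ ∃ t ∈ transvSet G, transv t = x := by
  rw [pt0, mem_unip_mk]
  constructor
  · rintro ⟨hx, hv, hd⟩
    have h0 := congrFun hv 0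
    have h1 := congrFun hv 1
    simp at h0 h1
    rw [Matrix.det_fin_two, h0, h1] at hd
    have e : transv (x.val 0 1) = x := by
      apply Units.ext
      rw [coe_transv]
      ext i j
      fin_cases i <;> fin_cases j <;> simp [h0, h1]
      linear_combination -hd
    exact ⟨x.val 0 1, by rw [mem_transvSet, e]; exact hx, e⟩
  · rintro ⟨t, ht, rfl⟩
    refine ⟨ht, ?_, by rw [coe_transv]; simp⟩
    rw [coe_transv]
    ext i
    fin_cases i <;> simp

lemma unipCard_pt0 (G : Subgroup (GL (Fin 2) F)) :
    unipCard G (pt0 F) = Nat.card (transvSet G) :=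
  (Nat.card_congr (Equiv.ofBijective (fun t : transvSet G =>
    (⟨transv t, mem_unip_pt0.mpr ⟨t, t.2, rfl⟩⟩ : unip G (pt0 F)))
    ⟨fun s t h => Subtype.ext (transv_injective (congrArg Subtype.val h)), fun x => by
      obtain ⟨t, ht, h⟩ := mem_unip_pt0.mp x.2
      exact ⟨⟨t, ht⟩, Subtype.ext h⟩⟩)).symm

lemma conj_transv {x : GL (Fin 2) F} (hx : x.val 1 0 = 0) (t : F) :
    x * transv t * x⁻¹ = transv (x.val 0 0 * (x.val 1 1)⁻¹ * t) := by
  rw [mul_inv_eq_iff_eq_mul]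
  apply Units.ext
  have hd := det_ne_zero x
  rw [Matrix.det_fin_two, hx, mul_zero, sub_zero] at hd
  have h1 := right_ne_zero_of_mul hd
  rw [Units.val_mul, Units.val_mul, coe_transv, coe_transv]
  ext i j
  fin_cases i <;> fin_cases j <;> simp [Matrix.mul_apply, Fin.sum_univ_two, hx]
  field_simp
  ring

lemma mul_mem_transvSet {G : Subgroup (GL (Fin 2) F)} {x : GL (Fin 2) F} (hxG : x ∈ G)
    (hx : x.val 1 0 = 0) {t : F} (ht : t ∈ transvSet G) :
    x.val 0 0 * (x.val 1 1)⁻¹ * t ∈ transvSet G := by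
  rw [mem_transvSet, ← conj_transv hx]
  exact mul_mem (mul_mem hxG ht) (inv_mem hxG)

/-- Multiplication makes `R` act freely on the nonzero elements of `E`. -/
lemma card_dvd_of_mul_mem [Finite F] (E : AddSubgroup F) (R : Subgroup Fˣ)
    (hR : ∀ u ∈ R, ∀ t ∈ E, (u : F) * t ∈ E) : Nat.card R ∣ Nat.card E - 1 := by
  have h := card_dvd_ncard_of_free (Γ := R) ((E : Set F) \ {0})
    (fun g x hx => ⟨hR g g.2 x hx.1, fun h => hx.2 (by
      have h' : ((g : Fˣ) : F) * x = 0 := h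
      exact (mul_eq_zero.mp h').resolve_left (g : Fˣ).ne_zero)⟩)
    (fun g x hx h => by
      have h' : ((g : Fˣ) : F) * x = x := h
      exact Subtype.ext (Units.ext (mul_right_cancel₀ hx.2 (by rw [h']; simp))))
  rwa [Set.ncard_sdiff_singleton_of_mem E.zero_mem] at h

lemma ncard_le_of_pow_eq {m : ℕ} (hm : 1 < m) (s : Set F) (hs : ∀ x ∈ s, x ^ m = x) :
    s.Finite ∧ s.ncard ≤ m := by
  classical
  let f : Polynomial F := Polynomial.X ^ m - Polynomial.X
  have hf : f ≠ 0 := FiniteField.X_pow_card_sub_X_ne_zero F hm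
  have hsub : s ⊆ (f.roots.toFinset : Set F) := by
    intro x hx
    simp only [Finset.mem_coe, Multiset.mem_toFinset, Polynomial.mem_roots hf]
    simp [f, hs x hx]
  refine ⟨(Finset.finite_toSet _).subset hsub, ?_⟩
  calc s.ncard ≤ (f.roots.toFinset : Set F).ncard := Set.ncard_le_ncard hsub (Finset.finite_toSet _)
    _ = f.roots.toFinset.card := Set.ncard_coe_finset _
    _ ≤ f.roots.card := Multiset.toFinset_card_le _
    _ ≤ f.natDegree := Polynomial.card_roots' f
    _ = m := FiniteField.X_pow_card_sub_X_natDegree_eq F hm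

end Transvections

/-! ### Triangular groups. -/

section Borel

variable {F : Type*} [Field F] [Finite F] {p n : ℕ} [Fact p.Prime] [CharP F p]
variable {G : Subgroup (GL (Fin 2) F)}

omit [Finite F] in
lemma pow_eq_of_mem_transvSet (hG : G ≤ modelSU F p n) {t : F} (ht : t ∈ transvSet G) :
    t ^ p ^ n = t := by
  have h := (mem_modelSU.mp (hG ht)).1 0 1
  rw [coe_transv] at h
  simpa using h

lemma exists_card_transvSet (hn : 0 < n) (hF : Nat.card F = (p ^ n) ^ 2)
    (hG : G ≤ modelSU F p n) {t : F} (ht : t ∈ transvSet G) (ht0 : t ≠ 0) :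
    ∃ k, 1 ≤ k ∧ k ≤ n ∧ Nat.card (transvSet G) = p ^ k := by
  rw [← pow_mul] at hF
  obtain ⟨k, hk⟩ := (IsPGroup.iff_card).mp (isPGroup_unip (G := G) hF (pt0 F))
  change unipCard G (pt0 F) = p ^ k at hk
  rw [unipCard_pt0] at hk
  have hp := (Fact.out : p.Prime).one_lt
  refine ⟨k, Nat.one_le_iff_ne_zero.mpr fun h0 => ht0 ?_, ?_, hk⟩
  · rw [h0, pow_zero] at hk
    have := (Nat.card_eq_one_iff_unique.mp hk).1
    exact congrArg Subtype.val (Subsingleton.elim (⟨t, ht⟩ : transvSet G) 0)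
  · have h := (ncard_le_of_pow_eq (Nat.one_lt_pow hn.ne' hp) (transvSet G : Set F)
      fun x hx => pow_eq_of_mem_transvSet hG hx).2
    change Nat.card (transvSet G) ≤ _ at h
    rw [hk] at h
    exact (Nat.pow_le_pow_iff_right hp).mp h

/-- The upper left entry maps `G` onto a cyclic group, generated by `ζ`, and its (q - 1)-st power is
the determinant; so the kernel consists of the transvections of `G`. The order `2 * d` of `ζ` is
prime to `p`, and a suitable power of a preimage of `ζ` generates a complement. -/
lemma exists_kind_of_borel (hn : 0 < n) (hq : p ^ n % 4 = 1) (hF : Nat.card F = (p ^ n) ^ 2)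
    (hG : G ≤ modelSU F p n) (hout : ¬ G ≤ detOne F) (hB : ∀ x ∈ G, x.val 1 0 = 0)
    (h1 : transv 1 ∈ G) : ∃ t, Admissible p n t ∧ IsKind p (detOne F) G t := by
  have hdet : ∀ x ∈ G, x.val.det = x.val 0 0 * x.val 1 1 := fun x hx => by
    rw [Matrix.det_fin_two, hB x hx, mul_zero, sub_zero]
  have h00 : ∀ x ∈ G, x.val 0 0 ≠ 0 := fun x hx =>
    left_ne_zero_of_mul (hdet x hx ▸ det_ne_zero x)
  have hpow : ∀ x ∈ G, x.val 0 0 ^ (p ^ n - 1) = x.val.det := by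
    intro x hx
    have h := (mem_modelSU.mp (hG hx)).1 0 0
    rw [show p ^ n = p ^ n - 1 + 1 by omega, pow_succ] at h
    exact mul_right_cancel₀ (h00 x hx) h
  let f : G →* F := ⟨⟨fun x => x.1.val 0 0, by simp⟩, fun x y => by
    change (x.1.val * y.1.val) 0 0 = _
    rw [Matrix.mul_apply, Fin.sum_univ_two, hB y y.2]
    simp⟩
  have hf : ∀ x : G, (f.toHomUnits x : F) = x.1.val 0 0 := fun x => rfl
  obtain ⟨⟨ζ, y, hyζ⟩, hζ⟩ := IsCyclic.exists_generator (α := f.toHomUnits.range)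
  have hζ' : ∀ x ∈ G, ∃ i : ℤ, (((ζ ^ i : Fˣ)) : F) = x.val 0 0 := by
    intro x hx
    obtain ⟨i, hi⟩ := hζ ⟨f.toHomUnits ⟨x, hx⟩, ⟨x, hx⟩, rfl⟩
    exact ⟨i, congrArg (fun z : f.toHomUnits.range => ((z : Fˣ) : F)) hi⟩
  have hy0 : (ζ : F) = y.1.val 0 0 := by rw [← hyζ, hf]
  have hy : y.1 ∉ detOne F := by
    intro hy
    rw [mem_detOne, ← hpow y y.2, ← hy0] at hy
    apply hout
    intro x hx
    obtain ⟨i, hi⟩ := hζ' x hx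
    rw [mem_detOne, ← hpow x hx, ← hi, ← Units.val_pow_eq_pow_val, ← zpow_natCast, zpow_comm,
      zpow_natCast, show ζ ^ (p ^ n - 1) = 1 from Units.ext (by simpa using hy), one_zpow,
      Units.val_one]
  have hydet := det_eq_neg_one (hG y.2).2 hy
  have h2 := two_ne_zero_of_mod F hn hq
  have hζq : (ζ : F) ^ (p ^ n - 1) = -1 := by rw [hy0, hpow y y.2, hydet]
  have hN1 : ¬ orderOf ζ ∣ p ^ n - 1 := by
    rw [orderOf_dvd_iff_pow_eq_one]
    intro h
    rw [← Units.val_pow_eq_pow_val, h, Units.val_one] at hζq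
    exact h2 (by linear_combination hζq)
  have hN2 : orderOf ζ ∣ 2 * (p ^ n - 1) := by
    rw [orderOf_dvd_iff_pow_eq_one, mul_comm, pow_mul]
    apply Units.ext
    rw [Units.val_pow_eq_pow_val, Units.val_pow_eq_pow_val, hζq]
    simp
  obtain ⟨d, hd⟩ : 2 ∣ orderOf ζ := by
    by_contra h
    exact hN1 ((Nat.Coprime.dvd_mul_left ((Nat.prime_two.coprime_iff_not_dvd.mpr h).symm)).mp hN2)
  have hdq : d ∣ p ^ n - 1 := by
    rw [hd] at hN2
    exact Nat.dvd_of_mul_dvd_mul_left two_pos hN2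
  -- For odd `d`, both 2 and `d` divide `q - 1` and are coprime, so `2 * d` would divide it, against
  -- `hN1`.
  have hdeven : Even d := by
    by_contra h
    rw [Nat.not_even_iff_odd] at h
    apply hN1
    rw [hd]
    exact Nat.Coprime.mul_dvd_of_dvd_of_dvd h.coprime_two_left (by omega) hdq
  obtain ⟨k, hk1, hkn, hk⟩ := exists_card_transvSet hn hF hG (t := 1) h1 one_ne_zero
  -- The element `y` has diagonal entries ζ and -ζ⁻¹, so conjugation by it multiplies the entry of a
  -- transvection by -ζ². Thus the group generated by ζ², of order `d`, acts on the entries.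
  have hdk : d ∣ p ^ k - 1 := by
    have h := card_dvd_of_mul_mem (transvSet G) (Subgroup.zpowers (ζ ^ 2)) (by
      intro u hu t ht
      rw [← mem_powers_iff_mem_zpowers] at hu
      obtain ⟨i, rfl⟩ := hu
      induction i with
      | zero => simpa using ht
      | succ i ih =>
        simp only [pow_succ', Units.val_mul, mul_assoc] at ih ⊢
        have h3 := mul_mem_transvSet y.2 (hB y y.2) ih
        rw [← hy0] at h3
        have h4 : (y.1.val 1 1)⁻¹ = -(ζ : F) := by
          have h5 := hdet y y.2
          rw [hydet, ← hy0] at h5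
          rw [inv_eq_iff_eq_inv, eq_comm]
          apply inv_eq_of_mul_eq_one_right
          linear_combination h5
        rw [h4] at h3
        have h6 := (transvSet G).neg_mem h3
        convert h6 using 1
        simp only [pow_zero, Units.val_one]
        ring)
    rw [Nat.card_zpowers, hk, orderOf_pow_of_dvd two_ne_zero (hd ▸ Dvd.intro d rfl), hd,
      Nat.mul_div_cancel_left d two_pos] at h
    exact h
  -- This power keeps the upper left entry, as c^|F| = c in F. Moreover `y ^ (2 * d)` is a
  -- transvection, which is killed by the exponent |F|, so `z` has order exactly `2 * d`.
  set z : GL (Fin 2) F := y.1 ^ Nat.card F with hz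
  have hzG : z ∈ G := pow_mem y.2 _
  have hzpow : ∀ i : ℤ, (z ^ i).val 0 0 = ((ζ ^ i : Fˣ) : F) := by
    have : f.toHomUnits ⟨z, hzG⟩ = ζ := by
      have := Fintype.ofFinite F
      have e : (⟨z, hzG⟩ : G) = y ^ Nat.card F := rfl
      rw [e, map_pow, hyζ]
      apply Units.ext
      rw [Units.val_pow_eq_pow_val, Nat.card_eq_fintype_card, FiniteField.pow_card]
    intro i
    rw [← this, ← map_zpow, hf]
    rfl
  have hunip : ∀ x ∈ G, x.val 0 0 = 1 → ∃ t ∈ transvSet G, transv t = x := by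
    intro x hx hx0
    have h3 := hpow x hx
    rw [hx0, one_pow, hdet x hx, hx0, one_mul] at h3
    have e : transv (x.val 0 1) = x := by
      apply Units.ext
      rw [coe_transv]
      ext i j
      fin_cases i <;> fin_cases j <;> simp [hx0, hB x hx, ← h3]
    exact ⟨_, by rw [mem_transvSet, e]; exact hx, e⟩
  have hcardF : Nat.card F = p ^ (n * 2) := by rw [hF, pow_mul]
  have htp : ∀ t : F, transv t ^ p = 1 := fun t => by
    rw [transv_pow, CharP.cast_eq_zero, zero_mul, transv_zero]
  have hzord : orderOf z = 2 * d := by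
    rw [← hd]
    apply Nat.dvd_antisymm
    · rw [orderOf_dvd_iff_pow_eq_one, hz, ← pow_mul, mul_comm, pow_mul]
      obtain ⟨t, -, ht⟩ := hunip (y.1 ^ orderOf ζ) (pow_mem y.2 _) (by
        have e : (f.toHomUnits (y ^ orderOf ζ) : F) = (y.1 ^ orderOf ζ).val 0 0 := rfl
        rw [← e, map_pow, hyζ, pow_orderOf_eq_one, Units.val_one])
      rw [← ht, hcardF, show n * 2 = (n * 2 - 1) + 1 by omega, pow_succ', pow_mul, htp, one_pow]
    · rw [orderOf_dvd_iff_pow_eq_one]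
      apply Units.ext
      have := hzpow (orderOf z)
      rw [zpow_natCast, pow_orderOf_eq_one, zpow_natCast] at this
      rw [← this]
      simp
  refine ⟨.elemAb k d, ⟨hk1, hkn, Nat.dvd_gcd hdk hdq, hdeven⟩, unip G (pt0 F),
    Subgroup.zpowers z, ⟨?_, ?_, ?_⟩, ⟨inferInstance, by rw [Nat.card_zpowers, hzord]⟩, ?_, ?_, ?_⟩
  · rw [← hk, ← unipCard_pt0]; rfl
  · intro x hx x' hx'
    obtain ⟨s, -, rfl⟩ := mem_unip_pt0.mp hx
    obtain ⟨t, -, rfl⟩ := mem_unip_pt0.mp hx'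
    rw [← transv_add, ← transv_add, add_comm]
  · intro x hx
    obtain ⟨t, -, rfl⟩ := mem_unip_pt0.mp hx
    exact htp t
  · intro x hx
    have hfin : Finite ((unip G (pt0 F) : Subgroup (GL (Fin 2) F)) : Set (GL (Fin 2) F)) :=
      inferInstance
    refine Subgroup.mem_normalizer_fintype fun u hu => ?_
    have h3 := conj_mem_unip hx hu
    rwa [(smul_pt0_eq_pt0_iff x).mpr (hB x hx)] at h3
  · rw [eq_bot_iff]
    rintro x ⟨hx, i, rfl⟩
    obtain ⟨t, -, ht⟩ := mem_unip_pt0.mp hx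
    simp only at ht
    have h3 := hzpow i
    rw [← ht, coe_transv] at h3
    have h4 : ζ ^ i = 1 := Units.ext (by simpa using h3.symm)
    rw [Subgroup.mem_bot]
    change z ^ i = 1
    rw [← orderOf_dvd_iff_zpow_eq_one, hzord, ← hd]
    exact orderOf_dvd_iff_zpow_eq_one.mpr h4
  · apply le_antisymm
    · rw [sup_le_iff, Subgroup.zpowers_le]
      exact ⟨fun x hx => hx.1, hzG⟩
    · intro x hx
      obtain ⟨i, hi⟩ := hζ' x hx
      have h3 : x * z ^ (-i) ∈ G := mul_mem hx (zpow_mem hzG _)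
      obtain ⟨t, ht, hxt⟩ := hunip _ h3 (by
        have e : ((f.toHomUnits (⟨x, hx⟩ * ⟨z, hzG⟩ ^ (-i)) : Fˣ) : F) =
          (x * z ^ (-i)).val 0 0 := rfl
        rw [← e, map_mul, Units.val_mul, hf, ← hi, map_zpow]
        have e2 : f.toHomUnits ⟨z, hzG⟩ = ζ := Units.ext (by
          rw [hf]; simpa using hzpow 1)
        rw [e2, ← Units.val_mul, ← zpow_add]
        simp)
      have h4 : x = (x * z ^ (-i)) * z ^ i := by group
      rw [h4]
      exact mul_mem (Subgroup.mem_sup_left (mem_unip_pt0.mpr ⟨t, ht, hxt⟩))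
        (Subgroup.mem_sup_right (zpow_mem (Subgroup.mem_zpowers z) i))

end Borel

/-! ### Subfields of a finite field. -/

section FixedFields

variable (F : Type*) [Field F] (p m : ℕ) [Fact p.Prime] [CharP F p]

/-- The subfield of the elements fixed by the `m`-th power of the Frobenius. -/
def fixedField : Subfield F := (iterateFrobenius F p m).eqLocusField (RingHom.id F)

variable {F p m}

lemma mem_fixedField {x : F} : x ∈ fixedField F p m ↔ x ^ p ^ m = x := by
  change iterateFrobenius F p m x = RingHom.id F x ↔ _
  rw [iterateFrobenius_def, RingHom.id_apply]

variable [Finite F]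

omit [Finite F] in
lemma card_fixedField_le (hm : 0 < m) : Nat.card (fixedField F p m) ≤ p ^ m :=
  (ncard_le_of_pow_eq (Nat.one_lt_pow hm.ne' (Fact.out : p.Prime).one_lt) (fixedField F p m : Set F)
    fun _ hx => mem_fixedField.mp hx).2

/-- Counting roots bounds the order from above. From below, p^m - 1 divides p^N - 1, so a power of a
generator of the unit group has order p^m - 1, and all its powers are fixed. -/
lemma card_fixedField {N : ℕ} (hN : Nat.card F = p ^ N) (hm : 0 < m) (h : m ∣ N) :
    Nat.card (fixedField F p m) = p ^ m := by
  apply le_antisymm (card_fixedField_le hm)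
  have hp := (Fact.out : p.Prime).one_lt
  have hpm := Nat.one_lt_pow hm.ne' hp
  obtain ⟨g, hg⟩ := IsCyclic.exists_generator (α := Fˣ)
  have hgo : orderOf g = p ^ N - 1 := by
    rw [orderOf_eq_card_of_forall_mem_zpowers hg, Nat.card_units, hN]
  obtain ⟨c, hc⟩ := Nat.pow_sub_one_dvd_pow_sub_one p h
  have hpos : 0 < p ^ N - 1 := by rw [← hgo]; exact orderOf_pos g
  have hc0 : c ≠ 0 := by rintro rfl; omega
  have hho : orderOf (g ^ c) = p ^ m - 1 := by
    rw [orderOf_pow_of_dvd hc0 (by rw [hgo, hc]; exact Dvd.intro_left _ rfl), hgo, hc,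
      Nat.mul_div_cancel _ (Nat.pos_of_ne_zero hc0)]
  have hsub : Nat.card (Subgroup.zpowers (g ^ c)) ≤ Nat.card (fixedField F p m)ˣ := by
    let f : Subgroup.zpowers (g ^ c) → fixedField F p m := fun u => ⟨(u : Fˣ), by
      rw [mem_fixedField, ← Units.val_pow_eq_pow_val]
      congr 1
      obtain ⟨u, i, rfl⟩ := u
      change ((g ^ c) ^ i) ^ p ^ m = (g ^ c) ^ i
      have h1 : (g ^ c) ^ (p ^ m - 1) = 1 := by rw [← hho, pow_orderOf_eq_one]
      rw [show p ^ m = p ^ m - 1 + 1 by omega, pow_succ, ← zpow_natCast, zpow_comm, zpow_natCast,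
        h1, one_zpow, one_mul]⟩
    have hf0 : ∀ u, f u ≠ 0 := fun u h => (u : Fˣ).ne_zero (congrArg Subtype.val h)
    refine Nat.card_le_card_of_injective (fun u => Units.mk0 (f u) (hf0 u)) fun u v h => ?_
    exact Subtype.ext (Units.ext (congrArg (fun z : (fixedField F p m)ˣ => (z.val : F)) h))
  rw [Nat.card_zpowers, hho, Nat.card_units] at hsub
  have : 0 < Nat.card (fixedField F p m) := Nat.card_pos
  omega

/-- The units of the smaller field act freely on the nonzero elements of the larger one, so p^k - 1
divides p^n - 1, and gcd(p^k - 1, p^n - 1) = p^gcd(k,n) - 1. -/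
lemma dvd_of_fixedField_le {k n N : ℕ} (hN : Nat.card F = p ^ N) (hk : 0 < k) (hn : 0 < n)
    (hkN : Nat.card (fixedField F p k) = p ^ k) (hnN : n ∣ N)
    (h : fixedField F p k ≤ fixedField F p n) : k ∣ n := by
  have hp := (Fact.out : p.Prime).one_lt
  let R : Subgroup Fˣ := (Units.map (fixedField F p k).subtype.toMonoidHom).range
  have hR : Nat.card R = p ^ k - 1 := by
    rw [← hkN, ← Nat.card_units]
    refine (Nat.card_congr (MonoidHom.ofInjective (Units.map_injective ?_)).toEquiv).symm
    exact Subtype.val_injective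
  have h1 := card_dvd_of_mul_mem (fixedField F p n).toAddSubgroup R (by
    rintro _ ⟨u, rfl⟩ t ht
    exact (fixedField F p n).mul_mem (h u.val.2) ht)
  change _ ∣ Nat.card (fixedField F p n) - 1 at h1
  rw [hR, card_fixedField hN hn hnN] at h1
  have h2 := Nat.pow_sub_one_gcd_pow_sub_one p k n
  rw [Nat.gcd_eq_left h1] at h2
  have h3 : p ^ k = p ^ Nat.gcd k n := by
    have : 0 < p ^ k := by positivity
    have : 0 < p ^ Nat.gcd k n := by positivity
    omega
  exact Nat.gcd_eq_left_iff_dvd.mp (Nat.pow_right_injective hp h3).symm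

/-- The subfield of the elements `u` with `u * E ⊆ E`. -/
def multField (E : AddSubgroup F) : Subfield F where
  carrier := {u | ∀ t ∈ E, u * t ∈ E}
  mul_mem' := fun {u v} hu hv t ht => by rw [mul_assoc]; exact hu _ (hv _ ht)
  one_mem' := fun t ht => by rwa [one_mul]
  add_mem' := fun {u v} hu hv t ht => by rw [add_mul]; exact E.add_mem (hu t ht) (hv t ht)
  zero_mem' := fun t _ => by rw [zero_mul]; exact E.zero_mem
  neg_mem' := fun {u} hu t ht => by rw [neg_mul]; exact E.neg_mem (hu t ht)
  inv_mem' := fun u hu t ht => by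
    rcases eq_or_ne u 0 with rfl | h0
    · rw [inv_zero, zero_mul]; exact E.zero_mem
    · have := Fintype.ofFinite F
      have h1 : u⁻¹ = u ^ (Fintype.card F - 2) := by
        apply inv_eq_of_mul_eq_one_right
        have hF : 1 < Fintype.card F := Fintype.one_lt_card
        rw [← pow_succ', show Fintype.card F - 2 + 1 = Fintype.card F - 1 by omega,
          FiniteField.pow_card_sub_one_eq_one u h0]
      rw [h1]
      generalize Fintype.card F - 2 = i
      induction i with
      | zero => simpa using ht
      | succ i ih => rw [pow_succ', mul_assoc]; exact hu _ ih

/-- An additive subgroup containing `1` and with many multipliers is a subfield. -/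
lemma eq_fixedField_of_multField (E : AddSubgroup F) (h1 : 1 ∈ E) (hE : Nat.card E = p ^ m)
    (hm : 0 < m) (h : Nat.card E < 2 * Nat.card (multField E)) :
    E = (fixedField F p m).toAddSubgroup ∧ Nat.card (fixedField F p m) = p ^ m := by
  have hle : (multField E).toAddSubgroup ≤ E := fun u hu => by
    have := hu 1 h1
    rwa [mul_one] at this
  have hdvd : Nat.card (multField E) ∣ Nat.card E := AddSubgroup.card_dvd_of_le hle
  -- Because `1 ∈ E`, the multiplier field is contained in `E`; its order divides that of `E` and is
  -- more than half of it.
  have hcard : Nat.card (multField E) = Nat.card E := by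
    obtain ⟨c, hc⟩ := hdvd
    have hc2 : c < 2 := by
      by_contra hcon
      have : 2 * Nat.card (multField E) ≤ Nat.card E := by
        rw [hc, mul_comm]
        exact Nat.mul_le_mul_left _ (by omega)
      omega
    have hpos : 0 < Nat.card E := Nat.card_pos
    have : c = 1 := by
      rcases c with _ | c
      · omega
      · omega
    rw [hc, this, mul_one]
  have hEq : (multField E).toAddSubgroup = E := AddSubgroup.eq_of_le_of_card_ge hle hcard.ge
  have hle2 : E ≤ (fixedField F p m).toAddSubgroup := by
    intro x hx
    have := Fintype.ofFinite (multField E)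
    rw [← hEq] at hx
    have h2 := FiniteField.pow_card (⟨x, hx⟩ : multField E)
    rw [← Nat.card_eq_fintype_card, hcard, hE] at h2
    exact mem_fixedField.mpr (congrArg Subtype.val h2)
  have h3 : E = (fixedField F p m).toAddSubgroup := by
    refine AddSubgroup.eq_of_le_of_card_ge hle2 ?_
    rw [hE]
    exact card_fixedField_le hm
  refine ⟨h3, ?_⟩
  rw [← hE]
  conv_rhs => rw [h3]
  rfl

end FixedFields

/-! ### Lower transvections and generation of SL(2). -/

section LowerTransvections

variable {F : Type*} [Field F]

/-- The lower triangular unipotent matrix with entry `s`. -/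
def lowTransv (s : F) : GL (Fin 2) F :=
  ⟨!![1, 0; s, 1], !![1, 0; -s, 1], by simp [Matrix.one_fin_two], by simp [Matrix.one_fin_two]⟩

lemma coe_lowTransv (s : F) : (lowTransv s).val = !![1, 0; s, 1] := rfl

lemma lowTransv_neg (s : F) : lowTransv (-s) = (lowTransv s)⁻¹ := by
  rw [eq_inv_iff_mul_eq_one]
  apply Units.ext
  rw [Units.val_mul, coe_lowTransv, coe_lowTransv]
  simp [Matrix.one_fin_two]

lemma lowTransv_injective : Function.Injective (lowTransv : F → GL (Fin 2) F) := by
  intro s t h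
  have := congrArg (fun x : GL (Fin 2) F => x.val 1 0) h
  simpa [coe_lowTransv] using this

lemma mem_unip_ptt_zero {G : Subgroup (GL (Fin 2) F)} {x : GL (Fin 2) F} :
    x ∈ unip G (ptt (0 : F)) ↔ ∃ s, lowTransv s ∈ G ∧ lowTransv s = x := by
  rw [ptt, mem_unip_mk]
  constructor
  · rintro ⟨hx, hv, hd⟩
    have h0 := congrFun hv 0
    have h1 := congrFun hv 1
    simp at h0 h1
    rw [Matrix.det_fin_two, h0, h1] at hd
    have e : lowTransv (x.val 1 0) = x := by
      apply Units.ext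
      rw [coe_lowTransv]
      ext i j
      fin_cases i <;> fin_cases j <;> simp [h0, h1]
      linear_combination -hd
    exact ⟨x.val 1 0, by rw [e]; exact hx, e⟩
  · rintro ⟨t, ht, rfl⟩
    refine ⟨ht, ?_, by rw [coe_lowTransv]; simp⟩
    rw [coe_lowTransv]
    ext i
    fin_cases i <;> simp

lemma unipCard_ptt_zero (G : Subgroup (GL (Fin 2) F)) :
    unipCard G (ptt (0 : F)) = {s : F | lowTransv s ∈ G}.ncard :=
  (Nat.card_congr (Equiv.ofBijective (fun t : {s : F | lowTransv s ∈ G} =>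
    (⟨lowTransv t, mem_unip_ptt_zero.mpr ⟨t, t.2, rfl⟩⟩ : unip G (ptt (0 : F))))
    ⟨fun s t h => Subtype.ext (lowTransv_injective (congrArg Subtype.val h)), fun x => by
      obtain ⟨t, ht, h⟩ := mem_unip_ptt_zero.mp x.2
      exact ⟨⟨t, ht⟩, Subtype.ext h⟩⟩)).symm

lemma eq_transv_mul {A : GL (Fin 2) F} (hd : A.val.det = 1) (hc : A.val 1 0 ≠ 0) :
    A = transv ((A.val 0 0 - 1) / A.val 1 0) * lowTransv (A.val 1 0) *
      transv ((A.val 1 1 - 1) / A.val 1 0) := by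
  rw [Matrix.det_fin_two] at hd
  apply Units.ext
  rw [Units.val_mul, Units.val_mul, coe_transv, coe_transv, coe_lowTransv]
  ext i j
  fin_cases i <;> fin_cases j <;> simp [Matrix.mul_apply, Fin.sum_univ_two]
  · field_simp; ring
  · field_simp; linear_combination -hd
  · field_simp; ring

/-- `SL(2,E)` is generated by transvections. -/
lemma mem_of_transv_mem {G : Subgroup (GL (Fin 2) F)} (E : Subfield F)
    (hu : ∀ t ∈ E, transv t ∈ G) (hl : ∀ t ∈ E, lowTransv t ∈ G) {A : GL (Fin 2) F}
    (hd : A.val.det = 1) (hA : ∀ i j, A.val i j ∈ E) : A ∈ G := by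
  have key : ∀ B : GL (Fin 2) F, B.val.det = 1 → (∀ i j, B.val i j ∈ E) → B.val 1 0 ≠ 0 →
      B ∈ G := by
    intro B hB hBE hc
    rw [eq_transv_mul hB hc]
    exact mul_mem (mul_mem (hu _ (E.div_mem (E.sub_mem (hBE _ _) E.one_mem) (hBE _ _)))
      (hl _ (hBE _ _))) (hu _ (E.div_mem (E.sub_mem (hBE _ _) E.one_mem) (hBE _ _)))
  by_cases hc : A.val 1 0 = 0
  -- The lower left entry of `A * lowTransv 1` is `A 1 1`, which is nonzero for an invertible upper
  -- triangular matrix.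
  · have h1 : A = A * lowTransv 1 * lowTransv (-1) := by rw [lowTransv_neg, mul_inv_cancel_right]
    rw [h1]
    refine mul_mem (key _ ?_ ?_ ?_) (hl _ (E.neg_mem E.one_mem))
    · rw [det_mul', hd, coe_lowTransv]; simp
    · intro i j
      rw [Units.val_mul, coe_lowTransv]
      fin_cases i <;> fin_cases j <;> simp [Matrix.mul_apply, Fin.sum_univ_two, E.add_mem, hA]
    · rw [Units.val_mul, coe_lowTransv]
      simp [Matrix.mul_apply, Fin.sum_univ_two, hc]
      rintro h
      rw [Matrix.det_fin_two, hc, h] at hd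
      simp at hd
  · exact key A hd hA hc

end LowerTransvections

/-! ### Groups whose unipotents fix the points of a subline. -/

section UnipotentClassification

variable {F : Type*} [Field F] {G : Subgroup (GL (Fin 2) F)}

lemma det_of_upper {x : GL (Fin 2) F} (hx : x.val 1 0 = 0) :
    x.val.det = x.val 0 0 * x.val 1 1 := by
  rw [Matrix.det_fin_two, hx, mul_zero, sub_zero]

/-- The group of eigenvalue ratios of a point stabilizer. -/
lemma exists_ratio_group [Finite F] (G : Subgroup (GL (Fin 2) F)) :
    ∃ R : Subgroup Fˣ, (∀ u ∈ R, ∀ t ∈ transvSet G, (u : F) * t ∈ transvSet G) ∧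
      stabCard G (pt0 F) = Nat.card R * unipCard G (pt0 F) := by
  have hup : ∀ x ∈ fixer G (pt0 F), x.val 1 0 = 0 := fun x hx =>
    (smul_pt0_eq_pt0_iff x).mp (mem_fixer.mp hx).2
  have h11 : ∀ x ∈ fixer G (pt0 F), x.val 1 1 ≠ 0 := fun x hx =>
    right_ne_zero_of_mul (det_of_upper (hup x hx) ▸ det_ne_zero x)
  let f : fixer G (pt0 F) →* F := ⟨⟨fun x => x.1.val 0 0 * (x.1.val 1 1)⁻¹, by simp⟩, fun x y => by
    change (x.1.val * y.1.val) 0 0 * ((x.1.val * y.1.val) 1 1)⁻¹ = _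
    rw [Matrix.mul_apply, Matrix.mul_apply, Fin.sum_univ_two, Fin.sum_univ_two, hup y y.2,
      hup x x.2]
    have := h11 x x.2
    have := h11 y y.2
    simp
    ring⟩
  have hf : ∀ x : fixer G (pt0 F), (f.toHomUnits x : F) = x.1.val 0 0 * (x.1.val 1 1)⁻¹ :=
    fun x => rfl
  refine ⟨f.toHomUnits.range, ?_, ?_⟩
  · rintro _ ⟨x, rfl⟩ t ht
    rw [hf]
    exact mul_mem_transvSet (mem_fixer.mp x.2).1 (hup x x.2) ht
  · have h1 := f.toHomUnits.ker.card_mul_index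
    rw [Subgroup.index_ker, ← numScalar_mul_stabCard] at h1
    have h2 : Nat.card f.toHomUnits.ker = numScalar G * unipCard G (pt0 F) := by
      rw [← card_discr_eq_zero]
      -- The discriminant of a triangular matrix is the square of the difference of its diagonal
      -- entries, so the kernel is the set counted by `card_discr_eq_zero`.
      have hiff : ∀ x : fixer G (pt0 F), x ∈ f.toHomUnits.ker ↔ x.1.val.discr = 0 := by
        intro x
        rw [MonoidHom.mem_ker, Units.ext_iff, hf, Units.val_one, mul_inv_eq_one₀ (h11 x x.2),
          discr_eq, det_of_upper (hup x x.2), Matrix.trace_fin_two,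
          show ∀ a b : F, (a + b) ^ 2 - 4 * (a * b) = (a - b) ^ 2 by intros; ring,
          sq_eq_zero_iff, sub_eq_zero]
      exact Nat.card_congr ⟨fun x => ⟨⟨x.1.1, (mem_fixer.mp x.1.2).1⟩, (mem_fixer.mp x.1.2).2,
        (hiff x.1).mp x.2⟩, fun x => ⟨⟨x.1.1, mem_fixer.mpr ⟨x.1.2, x.2.1⟩⟩,
        (hiff _).mpr x.2.2⟩, fun _ => rfl, fun _ => rfl⟩
    rw [h2] at h1
    apply Nat.eq_of_mul_eq_mul_left (numScalar_pos G)
    rw [← h1]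
    ring

/-- A nontrivial transvection fixes no point other than (1 : 0), so the transvections of `G` act
freely on the rest of the orbit. -/
lemma card_orbit_pt0 [Finite F] (G : Subgroup (GL (Fin 2) F)) :
    ∃ u, Nat.card (MulAction.orbit G (pt0 F)) = 1 + unipCard G (pt0 F) * u := by
  have h := card_dvd_ncard_of_free (Γ := unip G (pt0 F)) (MulAction.orbit G (pt0 F) \ {pt0 F})
    (fun g x hx => by
      have hg : (g : GL (Fin 2) F) • pt0 F = pt0 F := (mem_fixer.mp (unip_le_fixer G _ g.2)).2
      refine ⟨?_, fun h => hx.2 ?_⟩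
      · obtain ⟨y, rfl⟩ := hx.1
        exact ⟨⟨g, g.2.1⟩ * y, mul_smul _ _ _⟩
      · exact MulAction.injective (g : GL (Fin 2) F) ((h : (g : GL (Fin 2) F) • x = _).trans hg.symm))
    (fun g x hx h => by
      obtain ⟨t, -, ht⟩ := mem_unip_pt0.mp g.2
      have h' : (g : GL (Fin 2) F) • x = x := h
      rw [← ht] at h'
      suffices t = 0 by
        apply Subtype.ext
        rw [← ht, this, transv_zero]
        rfl
      induction x with
      | h v hv =>
        rw [smul_eq_self_iff] at h'
        obtain ⟨c, hc⟩ := h'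
        have h0 := congrFun hc 0
        have h1 := congrFun hc 1
        rw [coe_transv] at h0 h1
        replace h0 : v 0 + t * v 1 = c * v 0 := by
          simpa [Matrix.mulVec, dotProduct, Fin.sum_univ_two] using h0
        replace h1 : v 1 = c * v 1 := by
          simpa [Matrix.mulVec, dotProduct, Fin.sum_univ_two] using h1
        have hv1 : v 1 ≠ 0 := by
          intro hv1
          apply hx.2
          have hv0 : v 0 ≠ 0 := fun hv0 => hv (by ext i; fin_cases i <;> simp [hv0, hv1])
          rw [Set.mem_singleton_iff, pt0, Projectivization.mk_eq_mk_iff']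
          exact ⟨v 0, by ext i; fin_cases i <;> simp [hv1]⟩
        have hc1 : c = 1 := (mul_right_cancel₀ hv1 (by rw [one_mul]; exact h1)).symm
        rw [hc1, one_mul] at h0
        have h2 : t * v 1 = 0 := by linear_combination h0
        exact (mul_eq_zero.mp h2).resolve_right hv1)
  rw [Set.ncard_sdiff_singleton_of_mem (MulAction.mem_orbit_self _)] at h
  obtain ⟨u, hu⟩ := h
  refine ⟨u, ?_⟩
  change (MulAction.orbit G (pt0 F)).ncard = _
  change _ = unipCard G (pt0 F) * u at hu
  have hpos : 0 < (MulAction.orbit G (pt0 F)).ncard :=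
    (Set.ncard_pos (Set.toFinite _)).mpr ⟨_, MulAction.mem_orbit_self _⟩
  omega

variable [Finite F] {p n : ℕ} [Fact p.Prime] [CharP F p]

omit [Finite F] in
/-- A diagonal element normalizing `SL(2,p^k)` lies in the model over `p^k`. -/
lemma diag_mem_modelSU (hq : p ^ n % 4 = 1) {k : ℕ} (hk : k ∣ n)
    (hodd : Odd ((p ^ n - 1) / (p ^ k - 1))) {x : GL (Fin 2) F} (hx : x ∈ modelSU F p n)
    (hxd : x ∈ diagSub F) (hx2 : x.val 0 0 * (x.val 1 1)⁻¹ ∈ fixedField F p k) :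
    x ∈ modelSU F p k := by
  have hd := det_of_diag hxd
  have h0 := left_ne_zero_of_mul (hd ▸ det_ne_zero x)
  have h1 := right_ne_zero_of_mul (hd ▸ det_ne_zero x)
  obtain ⟨hm, hd2⟩ := mem_modelSU.mp hx
  have hm0 := hm 0 0
  have hkp : 0 < p ^ k := pow_pos (Fact.out : p.Prime).pos k
  have hpow : x.val 0 0 ^ (p ^ n - 1) = x.val.det := by
    rw [show p ^ n = p ^ n - 1 + 1 by omega, pow_succ] at hm0
    exact mul_right_cancel₀ h0 hm0
  obtain ⟨M, hM⟩ := Nat.pow_sub_one_dvd_pow_sub_one p hk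
  -- For `k = 0` the quotient in `hodd` is a division by zero, with value 0, which is not odd.
  have hk1 : 0 < p ^ k - 1 := by
    apply Nat.pos_of_ne_zero
    intro h
    rw [h, Nat.div_zero] at hodd
    exact absurd hodd (by decide)
  rw [hM, Nat.mul_div_cancel_left M hk1] at hodd
  have hkodd : Odd (p ^ k) := by
    rcases Nat.even_or_odd p with hp | hp
    · exfalso
      obtain ⟨c, rfl⟩ := hk
      have h3 : Even (p ^ (k * c)) := hp.pow_of_ne_zero (by
        intro h0
        rw [h0, pow_zero] at hM
        simp at hM
        rcases hM with hM | hM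
        · omega
        · rw [hM] at hodd; exact absurd hodd (by decide))
      rw [Nat.even_iff] at h3
      omega
    · exact hp.pow
  set σ := x.val 0 0 ^ (p ^ k - 1) with hσ
  have hdk : x.val.det ^ p ^ k = x.val.det := by
    obtain ⟨c, hc⟩ := hkodd
    rw [hc, pow_succ, pow_mul, hd2, one_pow, one_mul]
  have hratio : x.val 0 0 * (x.val 1 1)⁻¹ = x.val 0 0 ^ 2 * x.val.det := by
    have e : x.val.det * (x.val 0 0 * x.val 1 1) = 1 := by rw [← hd, ← sq, hd2]
    field_simp
    linear_combination -e
  -- The ratio of the diagonal entries is the square of the first entry up to the sign `det x`, so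
  -- this square is fixed by the smaller Frobenius and σ = ±1.
  have hσ2 : σ ^ 2 = 1 := by
    rw [hratio, mem_fixedField, mul_pow, hdk] at hx2
    have h3 := mul_right_cancel₀ (det_ne_zero x) hx2
    have h4 : (x.val 0 0 ^ 2) ^ (p ^ k - 1) * x.val 0 0 ^ 2 = 1 * x.val 0 0 ^ 2 := by
      rw [← pow_succ, Nat.sub_add_cancel hkp, h3, one_mul]
    have h5 := mul_right_cancel₀ (pow_ne_zero 2 h0) h4
    rw [hσ, ← pow_mul, mul_comm, pow_mul, h5]
  -- The determinant is the (q - 1)-st power of the first entry, hence an odd power of σ.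
  have hσd : σ = x.val.det := by
    obtain ⟨c, hc⟩ := hodd
    rw [← hpow, hM, pow_mul, ← hσ, hc, pow_succ, pow_mul, hσ2, one_pow, one_mul]
  have hp0 : x.val 0 0 ^ p ^ k = x.val.det * x.val 0 0 := by
    rw [← hσd, hσ, ← pow_succ, Nat.sub_add_cancel hkp]
  rw [mem_modelSU]
  refine ⟨?_, hd2⟩
  have hz : (0 : F) ^ p ^ k = 0 := zero_pow hkp.ne'
  intro i j
  fin_cases i <;> fin_cases j
  · exact hp0
  · simp [hxd.1, hz]
  · simp [hxd.2, hz]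
  · change x.val 1 1 ^ p ^ k = x.val.det * x.val 1 1
    have h3 : (x.val 0 0 * x.val 1 1) ^ p ^ k = x.val 0 0 * x.val 1 1 := by rw [← hd, hdk]
    rw [mul_pow, hp0] at h3
    have h4 : x.val.det * x.val 1 1 ^ p ^ k = x.val 1 1 := mul_left_cancel₀ h0 (by linear_combination h3)
    linear_combination x.val.det * h4 - x.val 1 1 ^ p ^ k * hd2

/-- The case where the orbit of a point fixed by a nontrivial unipotent element is a projective
line over a subfield. -/
lemma exists_eq_modelSU (hn : 0 < n) (hq : p ^ n % 4 = 1) (hF : Nat.card F = (p ^ n) ^ 2)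
    (hG : G ≤ modelSU F p n) (hout : ¬ G ≤ detOne F) (h1 : transv 1 ∈ G)
    (hpt : ptt 0 ∈ MulAction.orbit G (pt0 F))
    (hr : Nat.card (MulAction.orbit G (pt0 F)) = 1 + unipCard G (pt0 F))
    {R : Subgroup Fˣ} (hR : ∀ u ∈ R, ∀ t ∈ transvSet G, (u : F) * t ∈ transvSet G)
    (hRQ : unipCard G (pt0 F) - 1 ≤ 2 * Nat.card R) :
    ∃ k, k ∣ n ∧ Odd (n / k) ∧ G = modelSU F p k := by
  set E := transvSet G with hE
  have h2 := two_ne_zero_of_mod F hn hq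
  have hF' : Nat.card F = p ^ (n * 2) := by rw [hF, pow_mul]
  obtain ⟨k, hk1, hkn, hk⟩ := exists_card_transvSet hn hF hG (t := 1) h1 one_ne_zero
  rw [← hE] at hk
  have hQ : unipCard G (pt0 F) = p ^ k := by rw [unipCard_pt0, hk]
  rw [hQ] at hRQ hr
  -- the multiplier field
  have hmult : Nat.card R + 1 ≤ Nat.card (multField E) := by
    have h3 : Nat.card R ≤ Nat.card (multField E)ˣ := by
      refine Nat.card_le_card_of_injective (fun u : R =>
        (Units.mk0 ⟨((u : Fˣ) : F), hR u u.2⟩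
          (fun h => (u : Fˣ).ne_zero (congrArg Subtype.val h)) : (multField E)ˣ)) fun u v h => ?_
      exact Subtype.ext (Units.ext (congrArg (fun z : (multField E)ˣ => (z.val : F)) h))
    rw [Nat.card_units] at h3
    have : 0 < Nat.card (multField E) := Nat.card_pos
    omega
  obtain ⟨hEK, hKcard⟩ := eq_fixedField_of_multField E h1 hk hk1 (by
    rw [hk]
    have : 0 < p ^ k := pow_pos (Fact.out : p.Prime).pos k
    omega)
  set K := fixedField F p k with hK
  have hEmem : ∀ t, t ∈ E ↔ t ∈ K := fun t => by rw [hEK]; rfl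
  have hkdvd : k ∣ n := dvd_of_fixedField_le hF' hk1 hn hKcard (Dvd.intro 2 rfl) fun t ht =>
    mem_fixedField.mpr (pow_eq_of_mem_transvSet hG ((hEmem t).mpr ht))
  -- the orbit
  have horb : {pt0 F} ∪ ptt '' (E : Set F) = MulAction.orbit G (pt0 F) := by
    apply Set.eq_of_subset_of_ncard_le
    · rintro P (rfl | ⟨t, ht, rfl⟩)
      · exact MulAction.mem_orbit_self _
      · obtain ⟨x, hx⟩ := hpt
        refine ⟨⟨transv t, ht⟩ * x, ?_⟩
        change (⟨transv t, ht⟩ * x : G) • pt0 F = _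
        rw [mul_smul]
        change transv t • (x • pt0 F) = _
        change x • pt0 F = _ at hx
        rw [hx, transv_smul_ptt_zero]
    · change Nat.card (MulAction.orbit G (pt0 F)) ≤ _
      rw [hr, Set.ncard_union_eq, Set.ncard_singleton, Set.ncard_image_of_injective _ ptt_injective]
      · exact add_le_add le_rfl hk.ge
      · rw [Set.disjoint_singleton_left]
        rintro ⟨t, -, ht⟩
        exact ptt_ne_pt0 t ht
    · exact Set.toFinite _
  have horb0 : ∀ x ∈ G, x.val 1 0 = 0 ∨ ∃ t ∈ E, x.val 0 0 = x.val 1 0 * t := by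
    intro x hx
    have h3 : x • pt0 F ∈ MulAction.orbit G (pt0 F) := ⟨⟨x, hx⟩, rfl⟩
    rw [← horb] at h3
    rcases h3 with h3 | ⟨t, ht, h3⟩
    · exact Or.inl ((smul_pt0_eq_pt0_iff x).mp h3)
    · exact Or.inr ⟨t, ht, (smul_pt0_eq_ptt_iff x t).mp h3.symm⟩
  have horb1 : ∀ x ∈ G, x.val 1 1 = 0 ∨ ∃ t ∈ E, x.val 0 1 = x.val 1 1 * t := by
    intro x hx
    have h3 : x • ptt (0 : F) ∈ MulAction.orbit G (pt0 F) := by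
      obtain ⟨y, hy⟩ := hpt
      refine ⟨⟨x, hx⟩ * y, ?_⟩
      change (⟨x, hx⟩ * y : G) • pt0 F = _
      rw [mul_smul]
      change x • (y • pt0 F) = _
      change y • pt0 F = _ at hy
      rw [hy]
    rw [← horb] at h3
    rcases h3 with h3 | ⟨t, ht, h3⟩
    · exact Or.inl ((smul_ptt_zero_eq_pt0_iff x).mp h3)
    · exact Or.inr ⟨t, ht, (smul_ptt_zero_eq_ptt_iff x t).mp h3.symm⟩
  -- lower transvections
  have hlow : ∀ s ∈ K, lowTransv s ∈ G := by
    have hsub : {s : F | lowTransv s ∈ G} = (K : Set F) := by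
      apply Set.eq_of_subset_of_ncard_le
      · intro s hs
        rcases horb0 _ hs with h3 | ⟨t, ht, h3⟩
        · rw [coe_lowTransv] at h3
          have : s = 0 := by simpa using h3
          rw [this]
          exact K.zero_mem
        · rw [coe_lowTransv] at h3
          have h4 : s * t = 1 := by simpa using h3.symm
          rw [eq_inv_of_mul_eq_one_left h4]
          exact K.inv_mem ((hEmem t).mp ht)
      · change Nat.card K ≤ _
        obtain ⟨⟨y, hyG⟩, hy⟩ := hpt
        change y • pt0 F = _ at hy
        rw [← unipCard_ptt_zero, ← hy, unipCard_smul G _ hyG, hQ, hKcard]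
      · exact Set.toFinite _
    intro s hs
    have : s ∈ {s : F | lowTransv s ∈ G} := by rw [hsub]; exact hs
    exact this
  have hSL : ∀ A : GL (Fin 2) F, A.val.det = 1 → (∀ i j, A.val i j ∈ K) → A ∈ G := fun A hd hA =>
    mem_of_transv_mem K (fun t ht => (hEmem t).mpr ht) hlow hd hA
  have hSLk : ∀ A : GL (Fin 2) F, A.val.det = 1 → (∀ i j, A.val i j ∈ K) → A ∈ modelSU F p k := by
    intro A hd hA
    rw [mem_modelSU]
    exact ⟨fun i j => by rw [hd, one_mul]; exact mem_fixedField.mp (hA i j), by rw [hd, one_pow]⟩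
  -- decomposition of the elements of `G`
  have hdec : ∀ x ∈ G, ∃ y ∈ modelSU F p k, ∃ d ∈ G, d ∈ diagSub F ∧ x = y * d ∧
      d.val.det = x.val.det := by
    have hup : ∀ x ∈ G, x.val 1 0 = 0 → ∃ y ∈ modelSU F p k, ∃ d ∈ G, d ∈ diagSub F ∧ x = y * d ∧
        d.val.det = x.val.det := by
      intro x hx h10
      have h11 : x.val 1 1 ≠ 0 := right_ne_zero_of_mul (det_of_upper h10 ▸ det_ne_zero x)
      obtain ⟨t, ht, h3⟩ := (horb1 x hx).resolve_left h11
      have htK := (hEmem t).mp ht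
      refine ⟨transv t, hSLk _ (by rw [coe_transv]; simp) (fun i j => by
        rw [coe_transv]
        fin_cases i <;> fin_cases j <;> simp [K.one_mem, K.zero_mem, htK]),
        transv (-t) * x, mul_mem (by rw [transv_neg]; exact inv_mem ht) hx, ⟨?_, ?_⟩, ?_, ?_⟩
      · rw [Units.val_mul, coe_transv]
        simp [Matrix.mul_apply, Fin.sum_univ_two, h3]
        ring
      · rw [Units.val_mul, coe_transv]
        simp [Matrix.mul_apply, Fin.sum_univ_two, h10]
      · rw [transv_neg, mul_inv_cancel_left]
      · rw [det_mul', coe_transv]; simp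
    intro x hx
    rcases horb0 x hx with h10 | ⟨t, ht, h3⟩
    · exact hup x hx h10
    · have htK := (hEmem t).mp ht
      -- An element of SL(2,K) moving (1 : 0) to the same point as `x`, so that `w⁻¹ * x` is upper
      -- triangular.
      let w : GL (Fin 2) F := Matrix.GeneralLinearGroup.mkOfDetNeZero !![t, -1; 1, 0] (by simp)
      have hwv : w.val = !![t, -1; 1, 0] := rfl
      have hwd : w.val.det = 1 := by rw [hwv]; simp
      have hwK : ∀ i j, w.val i j ∈ K := by
        intro i j
        rw [hwv]
        fin_cases i <;> fin_cases j <;> simp [K.one_mem, K.zero_mem, htK, K.neg_mem]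
      have hwG := hSL w hwd hwK
      have hw0 : w • pt0 F = ptt t := by rw [smul_pt0_eq_ptt_iff, hwv]; simp
      have hx0 : x • pt0 F = ptt t := (smul_pt0_eq_ptt_iff x t).mpr h3
      obtain ⟨y, hy, d, hd, hdd, hxy, hdet⟩ := hup (w⁻¹ * x) (mul_mem (inv_mem hwG) hx) (by
        rw [← smul_pt0_eq_pt0_iff, mul_smul, hx0, inv_smul_eq_iff, hw0])
      refine ⟨w * y, mul_mem (hSLk w hwd hwK) hy, d, hd, hdd, ?_, ?_⟩
      · rw [mul_assoc, ← hxy, mul_inv_cancel_left]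
      · rw [hdet, det_mul', det_inv', hwd, inv_one, one_mul]
  have hratio : ∀ d ∈ G, d ∈ diagSub F → d.val 0 0 * (d.val 1 1)⁻¹ ∈ K := by
    intro d hd hdd
    have h3 := mul_mem_transvSet hd hdd.2 (t := 1) h1
    rwa [mul_one, ← hE, hEmem] at h3
  obtain ⟨x₀, hx₀, hx₀'⟩ := SetLike.not_le_iff_exists.mp hout
  have hkpos : 0 < p ^ k - 1 := by
    have := Nat.one_lt_pow (show k ≠ 0 by omega) (Fact.out : p.Prime).one_lt
    omega
  -- A diagonal element of determinant -1 has ratio -c² in `K`, with c its first entry, so c² has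
  -- order dividing p^k - 1. With an even quotient c^(q-1) would be 1, but it is the determinant.
  have hodd : Odd ((p ^ n - 1) / (p ^ k - 1)) := by
    obtain ⟨-, -, d, hd, hdd, -, hdet⟩ := hdec x₀ hx₀
    rw [det_eq_neg_one (hG hx₀).2 hx₀'] at hdet
    obtain ⟨M, hM⟩ := Nat.pow_sub_one_dvd_pow_sub_one p hkdvd
    rw [hM, Nat.mul_div_cancel_left M hkpos]
    by_contra hcon
    rw [Nat.not_odd_iff_even] at hcon
    obtain ⟨c, hc⟩ := hcon
    have h3 := (mem_modelSU.mp (hG hd)).1 0 0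
    have h0 : d.val 0 0 ≠ 0 := diag_ne_zero hdd
    rw [show p ^ n = p ^ n - 1 + 1 by omega, pow_succ] at h3
    have h4 := mul_right_cancel₀ h0 h3
    have h5 : d.val 0 0 * (d.val 1 1)⁻¹ = -(d.val 0 0 ^ 2) := by
      have e := det_of_diag hdd
      rw [hdet] at e
      have h11 := right_ne_zero_of_mul (det_of_diag hdd ▸ det_ne_zero d)
      field_simp
      linear_combination -e
    have h6 := K.neg_mem (hratio d hd hdd)
    rw [h5, neg_neg, hK, mem_fixedField] at h6
    have h7 : (d.val 0 0 ^ 2) ^ (p ^ k - 1) * d.val 0 0 ^ 2 = 1 * d.val 0 0 ^ 2 := by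
      rw [← pow_succ, show p ^ k - 1 + 1 = p ^ k by omega, h6, one_mul]
    have h8 := mul_right_cancel₀ (pow_ne_zero 2 h0) h7
    rw [hM, hc, ← two_mul, ← mul_assoc, mul_comm (p ^ k - 1), pow_mul, pow_mul, h8, one_pow,
      hdet] at h4
    exact h2 (by linear_combination h4)
  have hle : G ≤ modelSU F p k := by
    intro x hx
    obtain ⟨y, hy, d, hd, hdd, rfl, -⟩ := hdec x hx
    exact mul_mem hy (diag_mem_modelSU hq hkdvd hodd (hG hd) hdd (hratio d hd hdd))
  refine ⟨k, hkdvd, ?_, le_antisymm hle ?_⟩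
  · obtain ⟨j, rfl⟩ := hkdvd
    rw [Nat.mul_div_cancel_left j hk1]
    by_contra hcon
    rw [Nat.not_odd_iff_even] at hcon
    obtain ⟨c, hc⟩ := hcon
    obtain ⟨M, hM⟩ := Nat.pow_sub_one_dvd_pow_sub_one p (show k * 2 ∣ k * j from
      ⟨c, by rw [hc]; ring⟩)
    -- If `n / k` were even, the even number p^k + 1 would divide the odd quotient (p^n - 1)/(p^k -
    -- 1).
    have h3 : p ^ (k * 2) - 1 = (p ^ k - 1) * (p ^ k + 1) := by
      rw [pow_mul, mul_comm, ← Nat.sq_sub_sq, one_pow]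
    rw [hM, h3, mul_assoc, Nat.mul_div_cancel_left _ hkpos] at hodd
    have h4 := (Nat.odd_mul.mp hodd).1
    have h5 : ¬ Even p := fun hp => by
      have h6 : Even (p ^ (k * j)) := hp.pow_of_ne_zero (by omega)
      rw [Nat.even_iff] at h6
      omega
    have h6 : Odd (p ^ k) := (Nat.not_even_iff_odd.mp h5).pow
    rw [Nat.odd_iff] at h4 h6
    omega
  · have hdet1 : ∀ y ∈ modelSU F p k, y.val.det = 1 → y ∈ G := by
      intro y hy hyd
      refine hSL y hyd fun i j => ?_
      have := (mem_modelSU.mp hy).1 i j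
      rw [hyd, one_mul] at this
      exact mem_fixedField.mpr this
    intro y hy
    by_cases hyd : y ∈ detOne F
    · exact hdet1 y hy (mem_detOne.mp hyd)
    · have h3 := hdet1 (x₀⁻¹ * y) (mul_mem (inv_mem (hle hx₀)) hy) (by
        rw [det_mul', det_inv', det_eq_neg_one hy.2 hyd, det_eq_neg_one (hG hx₀).2 hx₀']
        norm_num)
      have h4 := mul_mem hx₀ h3
      rwa [mul_inv_cancel_left] at h4

end UnipotentClassification

/-! ### Rational coordinates and the classification inside the model. -/

section RationalFrames

variable {F : Type*} [Field F] {G : Subgroup (GL (Fin 2) F)}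

lemma eq_one_of_fix_two {P : ℙ F (Fin 2 → F)} {u : GL (Fin 2) F} (hu : u ∈ unip G P)
    {w : Fin 2 → F} (hw : w ≠ 0) (hwP : Projectivization.mk F w hw ≠ P) (h : u.val *ᵥ w = w) :
    u = 1 := by
  have hP : Projectivization.mk F P.rep P.rep_nonzero = P := P.mk_rep
  have h1 := det_ne_zero_of_mk_ne hw P.rep_nonzero (by rwa [hP])
  have h2 := eq_scalar_of_two_lines (c := 1) h1 (by rw [one_smul, h]) (by rw [one_smul, hu.2.1])
  exact Units.ext (by rw [h2, one_smul, Units.val_one])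

lemma mulVec_sub_self {P : ℙ F (Fin 2 → F)} {u : GL (Fin 2) F} (hu : u ∈ unip G P) (w : Fin 2 → F) :
    u.val *ᵥ (u.val *ᵥ w - w) = u.val *ᵥ w - w := by
  have h := sub_one_sq_of_unip hu
  rw [one_smul, sq] at h
  have h1 : (u.val - 1) *ᵥ ((u.val - 1) *ᵥ w) = 0 := by
    rw [Matrix.mulVec_mulVec, h, Matrix.zero_mulVec]
  rw [Matrix.sub_mulVec, Matrix.sub_mulVec, Matrix.one_mulVec, Matrix.one_mulVec] at h1
  exact sub_eq_zero.mp h1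

/-- Since (u - 1)² = 0, the vector (u - 1)w is fixed by u and so spans its fixed line. This makes
the line rational as soon as u and w are. -/
lemma mk_mulVec_sub_self {P : ℙ F (Fin 2 → F)} {u : GL (Fin 2) F} (hu : u ∈ unip G P) (hu1 : u ≠ 1)
    {w : Fin 2 → F} (hw : w ≠ 0) (hwP : Projectivization.mk F w hw ≠ P) :
    ∃ hv : u.val *ᵥ w - w ≠ 0, Projectivization.mk F (u.val *ᵥ w - w) hv = P := by
  refine ⟨fun h => hu1 (eq_one_of_fix_two hu hw hwP (sub_eq_zero.mp h)), ?_⟩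
  by_contra hne
  exact hu1 (eq_one_of_fix_two hu _ hne (mulVec_sub_self hu w))

lemma exists_ne_one_of_unipCard {P : ℙ F (Fin 2 → F)} (h : unipCard G P ≠ 1) :
    ∃ u ∈ unip G P, u ≠ 1 := by
  by_contra! hcon
  apply h
  rw [unipCard, (Subgroup.eq_bot_iff_forall _).mpr hcon]
  exact Subgroup.card_bot

variable {p n : ℕ} [Fact p.Prime] [CharP F p]

lemma conj_mem_modelSU {B x : GL (Fin 2) F} (hB : ∀ i j, B.val i j ^ p ^ n = B.val i j)
    (hx : x ∈ modelSU F p n) : B⁻¹ * x * B⁻¹⁻¹ ∈ modelSU F p n := by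
  let φ := iterateFrobenius F p n
  have h1 : Matrix.GeneralLinearGroup.map φ B = B := by
    apply Units.ext
    ext i j
    exact (iterateFrobenius_def p n _).trans (hB i j)
  have h2 : Matrix.GeneralLinearGroup.map φ B⁻¹ = B⁻¹ := by rw [map_inv, h1]
  refine ⟨?_, by rw [det_conj, hx.2]⟩
  rw [det_conj, inv_inv, Units.val_mul, Units.val_mul, Matrix.map_mul, Matrix.map_mul, hx.1]
  change (Matrix.GeneralLinearGroup.map φ B⁻¹).val * _ * (Matrix.GeneralLinearGroup.map φ B).val = _
  rw [h1, h2, mul_smul_comm, smul_mul_assoc]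

lemma pow_fixed_of_mem {x : GL (Fin 2) F} (hx : x ∈ modelSU F p n) (hd : x.val.det = 1) (i j : Fin 2) :
    x.val i j ^ p ^ n = x.val i j := by
  rw [(mem_modelSU.mp hx).1, hd, one_mul]

lemma pow_fixed_mulVec_sub {x : GL (Fin 2) F} (hx : x ∈ modelSU F p n) (hd : x.val.det = 1)
    {w : Fin 2 → F} (hw : ∀ i, w i ^ p ^ n = w i) (i : Fin 2) :
    (x.val *ᵥ w - w) i ^ p ^ n = (x.val *ᵥ w - w) i := by
  have h1 := pow_fixed_of_mem hx hd
  simp only [Pi.sub_apply, Matrix.mulVec, dotProduct, Fin.sum_univ_two]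
  rw [sub_pow_char_pow, add_pow_char_pow, mul_pow, mul_pow, h1, h1, hw, hw, hw]

omit [CharP F p] in
lemma exists_rational_ne (P : ℙ F (Fin 2 → F)) : ∃ (w : Fin 2 → F) (hw : w ≠ 0),
    (∀ i, w i ^ p ^ n = w i) ∧ Projectivization.mk F w hw ≠ P := by
  have hz : (0 : F) ^ p ^ n = 0 := zero_pow (pow_ne_zero _ (Fact.out : p.Prime).ne_zero)
  by_cases h : pt0 F = P
  · refine ⟨![0, 1], fun h => one_ne_zero (congrFun h 1), fun i => by fin_cases i <;> simp [hz], ?_⟩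
    rw [← h]
    exact ptt_ne_pt0 0
  · exact ⟨![1, 0], fun h => one_ne_zero (congrFun h 0), fun i => by fin_cases i <;> simp [hz], h⟩

lemma exists_rational_rep (hG : G ≤ modelSU F p n) {P : ℙ F (Fin 2 → F)} (h : unipCard G P ≠ 1) :
    ∃ (v : Fin 2 → F) (hv : v ≠ 0), (∀ i, v i ^ p ^ n = v i) ∧ Projectivization.mk F v hv = P := by
  obtain ⟨u, hu, hu1⟩ := exists_ne_one_of_unipCard h
  obtain ⟨w, hw, hwr, hwP⟩ := exists_rational_ne (p := p) (n := n) P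
  obtain ⟨hv, hvP⟩ := mk_mulVec_sub_self hu hu1 hw hwP
  exact ⟨_, hv, pow_fixed_mulVec_sub (hG hu.1) hu.2.2 hwr, hvP⟩

/-- In the basis v = (u - 1)w, w, with u a nontrivial unipotent fixing `P`, one has uv = v and uw =
v + w, so u becomes `transv 1`. The basis is fixed by the Frobenius, so the change of coordinates
preserves the model. -/
lemma exists_rational_frame (hG : G ≤ modelSU F p n) {P : ℙ F (Fin 2 → F)} (h : unipCard G P ≠ 1)
    {w : Fin 2 → F} (hw : w ≠ 0) (hwr : ∀ i, w i ^ p ^ n = w i)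
    (hwP : Projectivization.mk F w hw ≠ P) :
    ∃ g : GL (Fin 2) F, conjSub g G ≤ modelSU F p n ∧ g • P = pt0 F ∧
      g • Projectivization.mk F w hw = ptt 0 ∧ transv 1 ∈ conjSub g G := by
  obtain ⟨u, hu, hu1⟩ := exists_ne_one_of_unipCard h
  obtain ⟨hv, hvP⟩ := mk_mulVec_sub_self hu hu1 hw hwP
  have hvr := pow_fixed_mulVec_sub (hG hu.1) hu.2.2 hwr
  have huv := mulVec_sub_self hu w
  set v := u.val *ᵥ w - w with hvdef
  have hd := det_ne_zero_of_mk_ne hv hw (by rw [hvP]; exact hwP.symm)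
  refine ⟨(basisGL hd)⁻¹, ?_, ?_, ?_, ?_⟩
  · rintro _ ⟨x, hx, rfl⟩
    refine conj_mem_modelSU (fun i j => ?_) (hG hx)
    rw [coe_basisGL]
    fin_cases i <;> fin_cases j <;> simp [hvr, hwr]
  · rw [inv_smul_eq_iff, ← hvP, pt0, eq_comm, smul_mk_eq_iff]
    refine ⟨1, ?_⟩
    change _ = (1 : F) • v
    rw [coe_basisGL]
    ext i
    fin_cases i <;> simp
  · rw [inv_smul_eq_iff, ptt, eq_comm, smul_mk_eq_iff]
    exact ⟨1, by rw [coe_basisGL]; ext i; fin_cases i <;> simp⟩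
  · refine ⟨u, hu.1, ?_⟩
    apply Units.ext
    change ((basisGL hd)⁻¹ * u * (basisGL hd)⁻¹⁻¹).val = _
    rw [inv_inv, coe_transv]
    apply conj_basisGL
    · simpa using huv
    · have h1 : u.val *ᵥ w = v + w := by rw [hvdef]; abel
      simpa using h1

variable [Finite F]

/-- The classification of the subgroups of the model not contained in `SL(2,F)`. -/
theorem exists_kind_or_eq_modelSU (hn : 0 < n) (hq : p ^ n % 4 = 1)
    (hF : Nat.card F = (p ^ n) ^ 2) (hG : G ≤ modelSU F p n) (hout : ¬ G ≤ detOne F) :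
    (∃ t, Admissible p n t ∧ IsKind p (detOne F) G t) ∨
      ∃ k, k ∣ n ∧ Odd (n / k) ∧ ∃ g, conjSub g G = modelSU F p k := by
  by_cases hU : ∀ P, unipCard G P = 1
  · exact Or.inl (exists_kind_of_semisimple hn hq hF hG hout hU)
  obtain ⟨P, hP⟩ := not_forall.mp hU
  by_cases hfix : ∀ x ∈ G, x • P = P
  · left
    obtain ⟨w, hw, hwr, hwP⟩ := exists_rational_ne (p := p) (n := n) P
    obtain ⟨g, hgG, hgP, -, hg1⟩ := exists_rational_frame hG hP hw hwr hwP
    obtain ⟨t, ht, hk⟩ := exists_kind_of_borel hn hq hF hgG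
      (fun h => hout (conjSub_le_detOne_iff.mp h)) (by
        rintro _ ⟨x, hx, rfl⟩
        change (g * x * g⁻¹).val 1 0 = 0
        rw [← smul_pt0_eq_pt0_iff, ← hgP, mul_smul, mul_smul, inv_smul_smul, hfix x hx]) hg1
    exact ⟨t, ht, hk.of_conjSub⟩
  · right
    push Not at hfix
    obtain ⟨x, hx, hxP⟩ := hfix
    -- The moved point is fixed by unipotents as well, hence rational; both points of the orbit can
    -- become coordinate points.
    obtain ⟨w, hw, hwr, hwP⟩ := exists_rational_rep hG (P := x • P) (by rwa [unipCard_smul G P hx])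
    obtain ⟨g, hgG, hgP, hgw, hg1⟩ := exists_rational_frame hG hP hw hwr (hwP ▸ hxP)
    rw [hwP] at hgw
    have hgout : ¬ conjSub g G ≤ detOne F := fun h => hout (conjSub_le_detOne_iff.mp h)
    have hpt : ptt 0 ∈ MulAction.orbit (conjSub g G) (pt0 F) := by
      refine ⟨⟨g * x * g⁻¹, conj_mem_conjSub hx⟩, ?_⟩
      change (g * x * g⁻¹) • pt0 F = _
      rw [← hgP, mul_smul, mul_smul, inv_smul_smul, hgw]
    have h2 := two_ne_zero_of_mod F hn hq
    have hO := isOuter_of_le hn hq hF hgG hgout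
    have hF' : Nat.card F = p ^ (n * 2) := by rw [hF, pow_mul]
    have hp2 : p ≠ 2 := by
      rintro rfl
      exact h2 (by exact_mod_cast CharP.cast_eq_zero F 2)
    have h3 : ∀ R, unipCard (conjSub g G) R ≠ 1 → 3 ≤ unipCard (conjSub g G) R := fun R hR =>
      three_le_unipCard hp2 hF' hR
    have hQ : 3 ≤ unipCard (conjSub g G) (pt0 F) := h3 _ fun h => by
      have h4 := eq_one_of_unipCard h (mem_unip_pt0.mpr ⟨1, hg1, rfl⟩)
      rw [← transv_zero] at h4
      exact one_ne_zero (transv_injective h4)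
    obtain ⟨R, hR, hstab⟩ := exists_ratio_group (conjSub g G)
    obtain ⟨u, hu⟩ := card_orbit_pt0 (conjSub g G)
    have hRQ : Nat.card R ≤ unipCard (conjSub g G) (pt0 F) - 1 := by
      have h4 := card_dvd_of_mul_mem _ R hR
      rw [← unipCard_pt0] at h4
      exact Nat.le_of_dvd (by omega) h4
    rcases hO.unip_orbit_cases h2 h3 hQ hstab hRQ hu with h0 | ⟨h4, h5⟩
    · exfalso
      rw [h0, mul_zero, add_zero] at hu
      have h6 := (Nat.card_eq_one_iff_unique.mp hu).1
      have h7 := Subsingleton.elim (⟨ptt 0, hpt⟩ : MulAction.orbit (conjSub g G) (pt0 F))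
        ⟨pt0 F, MulAction.mem_orbit_self _⟩
      exact ptt_ne_pt0 0 (congrArg Subtype.val h7)
    · rw [h4, mul_one] at hu
      obtain ⟨k, hk1, hk2, hk3⟩ := exists_eq_modelSU hn hq hF hgG hgout hg1 hpt hu hR h5
      exact ⟨k, hk1, hk2, g, hk3⟩

end RationalFrames

/-! ### Block matrices and the embedding of GL(2) into GL(3). -/

section BlockMatrices

variable {F : Type*} [Field F]

/-- The block diagonal matrix with blocks `B` and `1`. -/
def blk (B : Matrix (Fin 2) (Fin 2) F) : Matrix (Fin 3) (Fin 3) F :=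
  !![B 0 0, B 0 1, 0; B 1 0, B 1 1, 0; 0, 0, 1]

lemma blk_one : blk (1 : Matrix (Fin 2) (Fin 2) F) = 1 := by
  ext i j
  fin_cases i <;> fin_cases j <;> simp [blk]

lemma blk_mul (A B : Matrix (Fin 2) (Fin 2) F) : blk (A * B) = blk A * blk B := by
  ext i j
  fin_cases i <;> fin_cases j <;>
    simp [blk, Matrix.mul_apply, Fin.sum_univ_two, Fin.sum_univ_three]

lemma blk_injective : Function.Injective (blk : Matrix (Fin 2) (Fin 2) F → _) := by
  intro A B h
  ext i j
  have e := fun i j => congrArg (fun M : Matrix (Fin 3) (Fin 3) F => M i j) h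
  fin_cases i <;> fin_cases j
  · simpa [blk] using e 0 0
  · simpa [blk] using e 0 1
  · simpa [blk] using e 1 0
  · simpa [blk] using e 1 1

lemma det_blk (B : Matrix (Fin 2) (Fin 2) F) : (blk B).det = B.det := by
  rw [Matrix.det_fin_three, Matrix.det_fin_two]
  simp [blk]

variable (F) in
/-- The embedding `B ↦ diag(B, 1)`. -/
def blkGL : GL (Fin 2) F →* GL (Fin 3) F := Units.map ⟨⟨blk, blk_one⟩, blk_mul⟩

lemma blkGL_injective : Function.Injective (blkGL F) := fun A B h =>
  Units.ext (blk_injective (congrArg Units.val h))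

lemma eq_of_mk_eq {A B : GL (Fin 3) F}
    (h : Matrix.ProjGenLinGroup.mk A = Matrix.ProjGenLinGroup.mk B) :
    ∃ c : F, c ≠ 0 ∧ B.val = c • A.val := by
  obtain ⟨u, rfl⟩ := Matrix.ProjGenLinGroup.mk_eq_mk_iff.mp h
  refine ⟨u, u.ne_zero, ?_⟩
  rw [Units.val_mul]
  change A.val * Matrix.scalar (Fin 3) (u : F) = _
  rw [Matrix.scalar_apply, ← Matrix.smul_one_eq_diagonal, mul_smul_comm, mul_one]

end BlockMatrices

/-! ### From the Hermitian group to the model. -/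

section Transfer

variable {F : Type*} [Field F] {p n : ℕ} [Fact p.Prime] [CharP F p]

/-- The invertible matrices preserving the binary Hermitian form `X^(q+1) - Y^(q+1)`. -/
def preservesForm (p n : ℕ) [Fact p.Prime] [CharP F p] (B : Matrix (Fin 2) (Fin 2) F) : Prop :=
  Bᵀ * !![1, 0; 0, -1] * B.map (iterateFrobenius F p n) = !![1, 0; 0, -1]

lemma blkGL_mem_GU3 (B : GL (Fin 2) F) :
    blkGL F B ∈ GU3 F p n ↔ preservesForm p n B.val := by
  change (blk B.val)ᵀ * gram F * (blk B.val).map (iterateFrobenius F p n) = gram F ↔ _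
  rw [preservesForm]
  constructor
  · intro h
    have e := fun i j => congrArg (fun M : Matrix (Fin 3) (Fin 3) F => M i j) h
    ext i j
    fin_cases i <;> fin_cases j
    · simpa [blk, gram, Matrix.mul_apply, Fin.sum_univ_three, Fin.sum_univ_two,
        Matrix.diagonal_apply] using e 0 0
    · simpa [blk, gram, Matrix.mul_apply, Fin.sum_univ_three, Fin.sum_univ_two,
        Matrix.diagonal_apply] using e 0 1
    · simpa [blk, gram, Matrix.mul_apply, Fin.sum_univ_three, Fin.sum_univ_two,
        Matrix.diagonal_apply] using e 1 0
    · simpa [blk, gram, Matrix.mul_apply, Fin.sum_univ_three, Fin.sum_univ_two,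
        Matrix.diagonal_apply] using e 1 1
  · intro h
    have e := fun i j => congrArg (fun M : Matrix (Fin 2) (Fin 2) F => M i j) h
    have e00 := e 0 0
    have e01 := e 0 1
    have e10 := e 1 0
    have e11 := e 1 1
    simp [Matrix.mul_apply, Fin.sum_univ_two] at e00 e01 e10 e11
    ext i j
    fin_cases i <;> fin_cases j <;>
      simp [blk, gram, Matrix.mul_apply, Fin.sum_univ_three, Matrix.diagonal_apply, e00, e01, e10,
        e11]

lemma mk_blkGL_mem_stabilizer (B : GL (Fin 2) F) : Matrix.ProjGenLinGroup.mk (blkGL F B) ∈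
    MulAction.stabilizer PGL(3, F) (ptP F) := by
  rw [MulAction.mem_stabilizer_iff, ptP, Projectivization.PGL.mk_smul_mk,
    Projectivization.mk_eq_mk_iff']
  refine ⟨1, ?_⟩
  change _ = (blk B.val) *ᵥ Pi.single 2 1
  ext i
  fin_cases i <;> simp [blk]

/-- The elements of `M_q` are block diagonal. -/
lemma exists_blkGL {A : GL (Fin 3) F} (h : Matrix.ProjGenLinGroup.mk A ∈ Mq F p n)
    (h22 : A 2 2 = 1) : ∃ B : GL (Fin 2) F, blkGL F B = A ∧ preservesForm p n B.val := by
  obtain ⟨⟨A', hA', hAA⟩, hst⟩ := h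
  have hv := mulVec_of_stab hst h22
  obtain ⟨c, hc0, hc⟩ := eq_of_mk_eq hAA
  set φ := iterateFrobenius F p n
  -- A priori the normalized representative preserves the form only up to the factor `c * φ c`. The
  -- last diagonal entry shows that the factor is 1, and the rest of the last row of `A` vanishes.
  have hU : A.valᵀ * gram F * A.val.map φ = (c * φ c) • gram F := by
    rw [hc]
    have e : (c • A'.val).map φ = φ c • A'.val.map φ := by
      ext i j; simp
    rw [e, Matrix.transpose_smul, smul_mul_assoc, smul_mul_assoc, mul_smul_comm, smul_smul, hA']
  have h02 : A.val 0 2 = 0 := by simpa using congrFun hv 0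
  have h12 : A.val 1 2 = 0 := by simpa using congrFun hv 1
  have h22' : A.val 2 2 = 1 := h22
  have e := fun i j => congrArg (fun M : Matrix (Fin 3) (Fin 3) F => M i j) hU
  have e22 := e 2 2
  have e20 := e 2 0
  have e21 := e 2 1
  simp [gram, Matrix.mul_apply, Fin.sum_univ_three, Matrix.diagonal_apply, h02, h12, h22'] at e22 e20 e21
  have hGU : A ∈ GU3 F p n := by
    change A.valᵀ * gram F * A.val.map φ = gram F
    rw [hU, ← e22, one_smul]
  have hblk : A.val = blk !![A.val 0 0, A.val 0 1; A.val 1 0, A.val 1 1] := by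
    ext i j
    fin_cases i <;> fin_cases j <;> simp [blk, h02, h12, h22', e20, e21]
  have hdet : Matrix.det !![A.val 0 0, A.val 0 1; A.val 1 0, A.val 1 1] ≠ 0 := by
    rw [← det_blk, ← hblk]
    exact ((Matrix.isUnit_iff_isUnit_det _).mp A.isUnit).ne_zero
  have hB : blkGL F (Matrix.GeneralLinearGroup.mkOfDetNeZero _ hdet) = A :=
    Units.ext hblk.symm
  refine ⟨_, hB, ?_⟩
  rw [← blkGL_mem_GU3, hB]
  exact hGU

/-- The base change between the two models. -/
def baseChange {δ : F} (h2 : (2 : F) ≠ 0) (hδ : δ ≠ 0) : GL (Fin 2) F :=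
  Matrix.GeneralLinearGroup.mkOfDetNeZero !![1, -δ; 1, δ] (by
    rw [Matrix.det_fin_two_of]
    intro h
    have h3 : 2 * δ = 0 := by linear_combination h
    simp [h2, hδ] at h3)

/-- The Frobenius sends C = `baseChange` to SC, where S interchanges the coordinates, and diag(1,-1)
S is the alternating matrix J, for which Bᵀ J B = det B • J. So B = C A C⁻¹ preserves the form
exactly when B^φ = det B • S B S⁻¹, and undoing the conjugation this says A^φ = det A • A. -/
lemma preservesForm_conj_iff {δ : F} (h2 : (2 : F) ≠ 0) (hδ : δ ≠ 0) (hδq : δ ^ p ^ n = -δ)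
    {A : GL (Fin 2) F} (hA : A.val.det ^ 2 = 1) :
    preservesForm p n (baseChange h2 hδ * A * (baseChange h2 hδ)⁻¹).val ↔ A ∈ modelSU F p n := by
  set C := baseChange h2 hδ with hC
  set φ := iterateFrobenius F p n
  let S : GL (Fin 2) F := ⟨!![0, 1; 1, 0], !![0, 1; 1, 0], by simp [Matrix.one_fin_two],
    by simp [Matrix.one_fin_two]⟩
  have hCφ : Matrix.GeneralLinearGroup.map φ C = S * C := by
    apply Units.ext
    change (!![1, -δ; 1, δ] : Matrix (Fin 2) (Fin 2) F).map φ =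
      !![0, 1; 1, 0] * (!![1, -δ; 1, δ] : Matrix (Fin 2) (Fin 2) F)
    have hφ : φ δ = -δ := (iterateFrobenius_def p n δ).trans hδq
    ext i j
    fin_cases i <;> fin_cases j <;> simp [hφ]
  obtain ⟨B, hB⟩ : ∃ B, B = C * A * C⁻¹ := ⟨_, rfl⟩
  rw [← hB]
  have hBd : B.val.det = A.val.det := by rw [hB, det_conj]
  have hBφ : B.val.map φ = (S * C).val * A.val.map φ * (S * C)⁻¹.val := by
    rw [hB, Units.val_mul, Units.val_mul, Matrix.map_mul, Matrix.map_mul, ← hCφ, ← map_inv]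
    rfl
  have hW : B.valᵀ * !![0, 1; -1, 0] * B.val = B.val.det • !![0, 1; -1, 0] := by
    rw [Matrix.det_fin_two]
    ext i j
    fin_cases i <;> fin_cases j <;> simp [Matrix.mul_apply, Fin.sum_univ_two] <;> ring
  have hDS : (!![1, 0; 0, -1] : Matrix (Fin 2) (Fin 2) F) * S.val = !![0, 1; -1, 0] := by
    change (!![1, 0; 0, -1] : Matrix (Fin 2) (Fin 2) F) * !![0, 1; 1, 0] = _
    simp
  have hWS : (!![0, 1; -1, 0] : Matrix (Fin 2) (Fin 2) F) * S⁻¹.val = !![1, 0; 0, -1] := by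
    change (!![0, 1; -1, 0] : Matrix (Fin 2) (Fin 2) F) * !![0, 1; 1, 0] = _
    simp
  have hkey : B.valᵀ * !![1, 0; 0, -1] * (A.val.det • (S * B * S⁻¹).val) = !![1, 0; 0, -1] := by
    rw [Units.val_mul, Units.val_mul, mul_smul_comm, ← mul_assoc, ← mul_assoc, mul_assoc _ _ S.val,
      hDS, hW, smul_mul_assoc, hWS, smul_smul, hBd, ← sq, hA, one_smul]
  have hSB : (S * B * S⁻¹).val = (S * C).val * A.val * (S * C)⁻¹.val := by
    rw [← Units.val_mul, ← Units.val_mul]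
    congr 1
    rw [hB]
    group
  have hunit : IsUnit (B.valᵀ * !![1, 0; 0, -1]) := by
    rw [Matrix.isUnit_iff_isUnit_det, Matrix.det_mul, Matrix.det_transpose, isUnit_iff_ne_zero]
    exact mul_ne_zero (det_ne_zero B) (by simp)
  rw [preservesForm, hBφ, mem_modelSU_iff]
  nth_rewrite 2 [← hkey]
  rw [hunit.mul_right_inj, hSB, ← smul_mul_assoc, ← mul_smul_comm, (S * C)⁻¹.isUnit.mul_left_inj,
    (S * C).isUnit.mul_right_inj]
  exact ⟨fun h => ⟨h, hA⟩, fun h => h.1⟩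

/-- The embedding of `GL(2,F)` into `PGL(3,F)` carrying the model to `SU^±(2,q)`. -/
def toPGL3 (C : GL (Fin 2) F) : GL (Fin 2) F →* PGL(3, F) :=
  (Matrix.ProjGenLinGroup.mk.comp (blkGL F)).comp (MulAut.conj C).toMonoidHom

lemma toPGL3_apply (C A : GL (Fin 2) F) :
    toPGL3 C A = Matrix.ProjGenLinGroup.mk (blkGL F (C * A * C⁻¹)) := rfl

lemma blkGL_eq_of_mk_eq {A B : GL (Fin 3) F}
    (h : Matrix.ProjGenLinGroup.mk A = Matrix.ProjGenLinGroup.mk B) (hA : A 2 2 = 1)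
    (hB : B 2 2 = 1) : A = B := by
  obtain ⟨c, -, hc⟩ := eq_of_mk_eq h
  have h1 : B.val 2 2 = c * A.val 2 2 := by rw [hc]; simp
  change B.val 2 2 = 1 at hB
  change A.val 2 2 = 1 at hA
  rw [hA, hB, mul_one] at h1
  exact Units.ext (by rw [hc, ← h1, one_smul])

lemma toPGL3_injective (C : GL (Fin 2) F) : Function.Injective (toPGL3 C) := by
  intro A B h
  rw [toPGL3_apply, toPGL3_apply] at h
  have h1 := blkGL_injective (blkGL_eq_of_mk_eq h rfl rfl)
  exact mul_left_cancel (mul_right_cancel h1)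

lemma det_blkGL_conj (C A : GL (Fin 2) F) :
    ((Matrix.GeneralLinearGroup.det (blkGL F (C * A * C⁻¹)) : Fˣ) : F) = A.val.det := by
  change (blk (C * A * C⁻¹).val).det = _
  rw [det_blk, det_conj]

lemma modelSU_map_toPGL3 {δ : F} (h2 : (2 : F) ≠ 0) (hδ : δ ≠ 0) (hδq : δ ^ p ^ n = -δ) :
    (modelSU F p n).map (toPGL3 (baseChange h2 hδ)) = SUpm F p n ∧
      (modelSU F p n ⊓ detOne F).map (toPGL3 (baseChange h2 hδ)) = SUone F p n := by
  set C := baseChange h2 hδ with hC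
  have hfwd : ∀ A ∈ modelSU F p n, toPGL3 C A ∈ Mq F p n := fun A hA =>
    ⟨⟨_, (blkGL_mem_GU3 _).mpr ((preservesForm_conj_iff h2 hδ hδq hA.2).mpr hA), rfl⟩,
      mk_blkGL_mem_stabilizer _⟩
  have hback : ∀ M : GL (Fin 3) F, Matrix.ProjGenLinGroup.mk M ∈ Mq F p n → M 2 2 = 1 →
      ((Matrix.GeneralLinearGroup.det M : Fˣ) : F) ^ 2 = 1 →
      ∃ A ∈ modelSU F p n, blkGL F (C * A * C⁻¹) = M := by
    intro M hM h22 hdet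
    obtain ⟨B, hB, hBf⟩ := exists_blkGL hM h22
    have e : C * (C⁻¹ * B * C) * C⁻¹ = B := by group
    refine ⟨C⁻¹ * B * C, ?_, by rw [e, hB]⟩
    rw [← e] at hBf hB
    rw [← hB, det_blkGL_conj] at hdet
    exact (preservesForm_conj_iff h2 hδ hδq hdet).mp hBf
  constructor
  · ext g
    rw [mem_SUpm]
    constructor
    · rintro ⟨A, hA, rfl⟩
      refine ⟨hfwd A hA, blkGL F (C * A * C⁻¹), rfl, rfl, ?_⟩
      rw [Units.ext_iff, Units.ext_iff, det_blkGL_conj]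
      exact mul_self_eq_one_iff.mp (by rw [← sq, hA.2])
    · rintro ⟨hg, M, rfl, h22, hdet⟩
      obtain ⟨A, hA, hAM⟩ := hback M hg h22 (by
        rcases hdet with h | h <;> rw [h] <;> simp)
      exact ⟨A, hA, by rw [toPGL3_apply, hAM]⟩
  · ext g
    rw [mem_SUone]
    constructor
    · rintro ⟨A, hA, rfl⟩
      refine ⟨hfwd A hA.1, blkGL F (C * A * C⁻¹), rfl, rfl, ?_⟩
      rw [Units.ext_iff, det_blkGL_conj]
      exact mem_detOne.mp hA.2
    · rintro ⟨hg, M, rfl, h22, hdet⟩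
      obtain ⟨A, hA, hAM⟩ := hback M hg h22 (by rw [hdet]; simp)
      refine ⟨A, ⟨hA, ?_⟩, by rw [toPGL3_apply, hAM]⟩
      rw [← hAM, Units.ext_iff, det_blkGL_conj] at hdet
      exact mem_detOne.mpr hdet

end Transfer

/-! ### Independence of the field, the structure of SU^±(2,q), and the classification. -/

section Isomorphisms

variable {F : Type*} [Field F] {p n : ℕ} [Fact p.Prime] [CharP F p]

lemma exists_ringHom_range [Finite F] {K : Type*} [Field K] [Finite K] {L : Subfield F}
    (h : Nat.card K = Nat.card L) : ∃ σ : K →+* F, ∀ x, x ∈ L ↔ ∃ y, σ y = x := by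
  have := Fintype.ofFinite K
  have := Fintype.ofFinite L
  rw [Nat.card_eq_fintype_card, Nat.card_eq_fintype_card] at h
  let e := FiniteField.ringEquivOfCardEq h
  refine ⟨L.subtype.comp e.toRingHom, fun x => ⟨fun hx => ⟨e.symm ⟨x, hx⟩, ?_⟩, ?_⟩⟩
  · change ((e (e.symm ⟨x, hx⟩) : L) : F) = x
    rw [e.apply_symm_apply]
  · rintro ⟨y, rfl⟩
    exact (e y).2

lemma exists_lift_GL {K : Type*} [Field K] {σ : K →+* F} {A : GL (Fin 2) F}
    (h : ∀ i j, ∃ y, σ y = A.val i j) : ∃ B : GL (Fin 2) K, Matrix.GeneralLinearGroup.map σ B = A := by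
  choose f hf using h
  have hA : (Matrix.of f).map σ = A.val := by
    ext i j
    exact hf i j
  have hd : (Matrix.of f).det ≠ 0 := by
    intro h0
    apply det_ne_zero A
    rw [← hA, ← RingHom.mapMatrix_apply, ← RingHom.map_det, h0, map_zero]
  exact ⟨Matrix.GeneralLinearGroup.mkOfDetNeZero _ hd, Units.ext hA⟩

lemma map_GL_injective {K : Type*} [Field K] (σ : K →+* F) :
    Function.Injective (Matrix.GeneralLinearGroup.map (n := Fin 2) σ) := by
  intro A B h
  apply Units.ext
  ext i j
  exact σ.injective (congrArg (fun x : GL (Fin 2) F => x.val i j) h)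

lemma det_map_GL {K : Type*} [Field K] (σ : K →+* F) (A : GL (Fin 2) K) :
    (Matrix.GeneralLinearGroup.map σ A).val.det = σ A.val.det :=
  (RingHom.map_det σ A.val).symm

lemma map_mem_modelSU_iff {K : Type*} [Field K] [CharP K p] {σ : K →+* F} {A : GL (Fin 2) K} :
    Matrix.GeneralLinearGroup.map σ A ∈ modelSU F p n ↔ A ∈ modelSU K p n := by
  rw [mem_modelSU, mem_modelSU, det_map_GL]
  have h : ∀ i j, (Matrix.GeneralLinearGroup.map σ A).val i j = σ (A.val i j) := fun i j => rfl
  simp only [h, ← map_pow, ← map_mul]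
  constructor
  · rintro ⟨h1, h2⟩
    exact ⟨fun i j => σ.injective (h1 i j), σ.injective (by rw [h2, map_one])⟩
  · rintro ⟨h1, h2⟩
    exact ⟨fun i j => by rw [h1], by rw [h2, map_one]⟩

/-- Applying the Frobenius twice multiplies the entries by det² = 1. -/
lemma mem_fixedField_of_mem_modelSU {k : ℕ} (hk : p ^ k % 4 = 1) {A : GL (Fin 2) F}
    (hA : A ∈ modelSU F p k) (i j : Fin 2) : A.val i j ∈ fixedField F p (2 * k) := by
  have h := (mem_modelSU.mp hA).1 i j
  rw [mem_fixedField, mul_comm, pow_mul, sq, pow_mul, h, mul_pow, h, det_pow_of_mem hk hA,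
    ← mul_assoc, ← sq, hA.2, one_mul]

/-- The models over `F` and over the field with `p^(2k)` elements are isomorphic. -/
lemma nonempty_modelSU_equiv [Finite F] {N k : ℕ} (hN : Nat.card F = p ^ N) (hk0 : 0 < k)
    (hkN : 2 * k ∣ N) (hk : p ^ k % 4 = 1) :
    Nonempty (modelSU F p k ≃* modelSU (GaloisField p (2 * k)) p k) := by
  obtain ⟨σ, hσ⟩ := exists_ringHom_range (K := GaloisField p (2 * k)) (L := fixedField F p (2 * k))
    (by rw [GaloisField.card p _ (by omega), card_fixedField hN (by omega) hkN])
  have e : (modelSU (GaloisField p (2 * k)) p k).map (Matrix.GeneralLinearGroup.map σ) =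
      modelSU F p k := by
    ext A
    constructor
    · rintro ⟨B, hB, rfl⟩
      exact map_mem_modelSU_iff.mpr hB
    · intro hA
      obtain ⟨B, rfl⟩ := exists_lift_GL (σ := σ) fun i j =>
        (hσ _).mp (mem_fixedField_of_mem_modelSU hk hA i j)
      exact ⟨B, map_mem_modelSU_iff.mp hA, rfl⟩
  rw [← e]
  exact ⟨((modelSU (GaloisField p (2 * k)) p k).equivMapOfInjective _ (map_GL_injective σ)).symm⟩

lemma nonempty_SUpm_equiv [Finite F] (hn : 0 < n) (hq : p ^ n % 4 = 1)
    (hF : Nat.card F = (p ^ n) ^ 2) : Nonempty (modelSU F p n ≃* SUpm F p n) := by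
  obtain ⟨δ, hδ, hδq⟩ := exists_pow_eq_neg hn hq hF
  rw [← (modelSU_map_toPGL3 (two_ne_zero_of_mod F hn hq) hδ hδq).1]
  exact ⟨(modelSU F p n).equivMapOfInjective _ (toPGL3_injective _)⟩

lemma nonempty_equiv_SUpm_galoisField [Finite F] {N k : ℕ} (hN : Nat.card F = p ^ N) (hk0 : 0 < k)
    (hkN : 2 * k ∣ N) (hk : p ^ k % 4 = 1) :
    Nonempty (modelSU F p k ≃* SUpm (GaloisField p (2 * k)) p k) := by
  obtain ⟨e1⟩ := nonempty_modelSU_equiv hN hk0 hkN hk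
  obtain ⟨e2⟩ := nonempty_SUpm_equiv (F := GaloisField p (2 * k)) hk0 hk
    (by rw [GaloisField.card p _ (by omega), mul_comm, pow_mul])
  exact ⟨e1.trans e2⟩

lemma nonempty_SUone_equiv [Finite F] (hn : 0 < n) (hq : p ^ n % 4 = 1)
    (hF : Nat.card F = (p ^ n) ^ 2) :
    Nonempty (SUone F p n ≃* Matrix.SpecialLinearGroup (Fin 2) (GaloisField p n)) := by
  obtain ⟨δ, hδ, hδq⟩ := exists_pow_eq_neg hn hq hF
  rw [← (modelSU_map_toPGL3 (two_ne_zero_of_mod F hn hq) hδ hδq).2]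
  have hF' : Nat.card F = p ^ (n * 2) := by rw [hF, pow_mul]
  obtain ⟨σ, hσ⟩ := exists_ringHom_range (K := GaloisField p n) (L := fixedField F p n)
    (by rw [GaloisField.card p _ hn.ne', card_fixedField hF' hn (Dvd.intro _ rfl)])
  let f : Matrix.SpecialLinearGroup (Fin 2) (GaloisField p n) →* GL (Fin 2) F :=
    (Matrix.GeneralLinearGroup.map σ).comp Matrix.SpecialLinearGroup.toGL
  have hf : Function.Injective f :=
    (map_GL_injective σ).comp Matrix.SpecialLinearGroup.toGL_injective
  have hdet : ∀ A, (f A).val.det = 1 := fun A => by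
    change (Matrix.GeneralLinearGroup.map σ (Matrix.SpecialLinearGroup.toGL A)).val.det = 1
    rw [det_map_GL]
    change σ A.val.det = 1
    rw [A.2, map_one]
  have hr : f.range = modelSU F p n ⊓ detOne F := by
    ext A
    constructor
    · rintro ⟨B, rfl⟩
      refine ⟨mem_modelSU.mpr ⟨fun i j => ?_, by rw [hdet, one_pow]⟩, mem_detOne.mpr (hdet B)⟩
      rw [hdet, one_mul]
      exact mem_fixedField.mp ((hσ _).mpr ⟨_, rfl⟩)
    · rintro ⟨hA, hd⟩
      replace hd : A.val.det = 1 := mem_detOne.mp hd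
      replace hA : A ∈ modelSU F p n := hA
      obtain ⟨B, rfl⟩ := exists_lift_GL (σ := σ) (A := A) fun i j =>
        (hσ _).mp (mem_fixedField.mpr (pow_fixed_of_mem hA hd i j))
      rw [det_map_GL] at hd
      exact ⟨⟨B.val, σ.injective (by rw [hd, map_one])⟩, Units.ext rfl⟩
  rw [← hr]
  exact ⟨((MonoidHom.ofInjective hf).trans
    (f.range.equivMapOfInjective _ (toPGL3_injective _))).symm⟩

lemma isSemidirect_of_involution {X : Type*} [Group X] {N M : Subgroup X} {b : X} (hNM : N ≤ M)
    (hM : M ≤ Subgroup.normalizer (N : Set X)) (hb : b ∈ M) (hbN : b ∉ N) (hb2 : b ^ 2 = 1)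
    (hmul : ∀ x ∈ M, x ∉ N → x * b ∈ N) :
    Nat.card (Subgroup.zpowers b) = 2 ∧ IsSemidirect N (Subgroup.zpowers b) M := by
  have ho : orderOf b = 2 := orderOf_eq_prime hb2 fun h => hbN (h ▸ one_mem N)
  have hinv : b * b = 1 := by rw [← sq, hb2]
  refine ⟨by rw [Nat.card_zpowers, ho], hM, ?_, ?_⟩
  · rw [eq_bot_iff]
    rintro x ⟨hx, hxb⟩
    obtain ⟨i, rfl⟩ := hxb
    have hb2' : b ^ (2 : ℤ) = 1 := by exact_mod_cast hb2
    rcases Int.even_or_odd' i with ⟨j, rfl | rfl⟩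
    · simp [zpow_mul, hb2']
    · refine absurd ?_ hbN
      simpa [zpow_add, zpow_mul, hb2'] using hx
  · apply le_antisymm
    · rw [sup_le_iff, Subgroup.zpowers_le]
      exact ⟨hNM, hb⟩
    · intro x hx
      by_cases hxN : x ∈ N
      · exact Subgroup.mem_sup_left hxN
      · have e : x = x * b * b := by rw [mul_assoc, hinv, mul_one]
        rw [e]
        exact mul_mem (Subgroup.mem_sup_left (hmul x hx hxN))
          (Subgroup.mem_sup_right (Subgroup.mem_zpowers b))

lemma exists_isSemidirect_SUpm [Finite F] (hn : 0 < n) (hq : p ^ n % 4 = 1)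
    (hF : Nat.card F = (p ^ n) ^ 2) :
    ∃ B : Subgroup PGL(3, F), Nat.card B = 2 ∧ IsSemidirect (SUone F p n) B (SUpm F p n) := by
  obtain ⟨δ, hδ, hδq⟩ := exists_pow_eq_neg hn hq hF
  have h2 := two_ne_zero_of_mod F hn hq
  obtain ⟨e1, e2⟩ := modelSU_map_toPGL3 h2 hδ hδq
  have hδ' : (δ⁻¹) ^ p ^ n = -δ⁻¹ := by rw [inv_pow, hδq, inv_neg]
  have hz : (0 : F) ^ p ^ n = 0 := zero_pow (pow_ne_zero _ (Fact.out : p.Prime).ne_zero)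
  -- An antidiagonal involution of determinant -1; it lies in the model because δ and δ⁻¹ are both
  -- negated by the Frobenius.
  let b : GL (Fin 2) F := ⟨!![0, δ; δ⁻¹, 0], !![0, δ; δ⁻¹, 0],
    by simp [hδ, Matrix.one_fin_two], by simp [hδ, Matrix.one_fin_two]⟩
  have hbv : b.val = !![0, δ; δ⁻¹, 0] := rfl
  have hbd : b.val.det = -1 := by rw [hbv]; simp [hδ]
  have hb : b ∈ modelSU F p n := by
    rw [mem_modelSU, hbd]
    refine ⟨fun i j => ?_, by norm_num⟩
    rw [hbv]
    fin_cases i <;> fin_cases j <;> simp [hz, hδq, hδ']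
  have hbN : b ∉ detOne F := by
    rw [mem_detOne, hbd]
    intro h
    exact h2 (by linear_combination -h)
  have hb2 : b ^ 2 = 1 := Units.ext (by
    rw [sq, Units.val_mul, hbv]
    simp [hδ, Matrix.one_fin_two])
  obtain ⟨h3, h4⟩ := isSemidirect_of_involution (N := modelSU F p n ⊓ detOne F)
    (M := modelSU F p n) inf_le_left (by
      intro x hx
      rw [Subgroup.mem_normalizer_iff]
      intro y
      rw [Subgroup.mem_inf, Subgroup.mem_inf]
      constructor
      · rintro ⟨h5, h6⟩
        exact ⟨mul_mem (mul_mem hx h5) (inv_mem hx), conj_mem_detOne h6⟩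
      · rintro ⟨h5, h6⟩
        have e : y = x⁻¹ * (x * y * x⁻¹) * x⁻¹⁻¹ := by group
        rw [e]
        exact ⟨mul_mem (mul_mem (inv_mem hx) h5) (inv_mem (inv_mem hx)), conj_mem_detOne h6⟩) hb
    (fun h => hbN h.2) hb2
    (fun x hx hxN => ⟨mul_mem hx hb, mul_mem_detOne hx.2 hb.2 (fun h => hxN ⟨hx, h⟩) hbN⟩)
  have h5 := h4.map _ (toPGL3_injective (baseChange h2 hδ))
  rw [e1, e2] at h5
  refine ⟨_, ?_, h5⟩
  exact (Nat.card_congr ((Subgroup.zpowers b).equivMapOfInjective _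
    (toPGL3_injective _)).toEquiv).symm.trans h3

lemma map_toPGL3_inf {δ : F} (h2 : (2 : F) ≠ 0) (hδ : δ ≠ 0) (hδq : δ ^ p ^ n = -δ)
    {G : Subgroup (GL (Fin 2) F)} (hG : G ≤ modelSU F p n) :
    G.map (toPGL3 (baseChange h2 hδ)) ⊓ (detOne F).map (toPGL3 (baseChange h2 hδ)) =
      G.map (toPGL3 (baseChange h2 hδ)) ⊓ SUone F p n := by
  rw [← (modelSU_map_toPGL3 h2 hδ hδq).2, ← Subgroup.map_inf_eq _ _ _ (toPGL3_injective _),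
    ← Subgroup.map_inf_eq _ _ _ (toPGL3_injective _), ← inf_assoc, inf_eq_left.mpr hG]

lemma hasKind_map_toPGL3 {δ : F} (h2 : (2 : F) ≠ 0) (hδ : δ ≠ 0) (hδq : δ ^ p ^ n = -δ)
    {G : Subgroup (GL (Fin 2) F)} (hG : G ≤ modelSU F p n) {t : GroupKind}
    (h : IsKind p (detOne F) G t) : HasKind F p n (G.map (toPGL3 (baseChange h2 hδ))) t := by
  rw [hasKind_iff]
  exact (h.map _ (toPGL3_injective _)).congr (map_toPGL3_inf h2 hδ hδq hG)

lemma map_toPGL3_le_SUone_iff {δ : F} (h2 : (2 : F) ≠ 0) (hδ : δ ≠ 0) (hδq : δ ^ p ^ n = -δ)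
    {G : Subgroup (GL (Fin 2) F)} (hG : G ≤ modelSU F p n) :
    G.map (toPGL3 (baseChange h2 hδ)) ≤ SUone F p n ↔ G ≤ detOne F := by
  rw [← (modelSU_map_toPGL3 h2 hδ hδq).2, Subgroup.map_le_map_iff_of_injective (toPGL3_injective _),
    le_inf_iff]
  exact and_iff_right hG

omit [Fact p.Prime] in
-- An odd number is congruent modulo 4 to each of its odd powers.
lemma pow_mod_four_of_odd {k : ℕ} (hq : p ^ n % 4 = 1) (hk : k ∣ n) (hodd : Odd (n / k)) :
    p ^ k % 4 = 1 := by
  obtain ⟨m, rfl⟩ := hk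
  rcases k.eq_zero_or_pos with rfl | hk0
  · simp
  rw [Nat.mul_div_cancel_left _ hk0] at hodd
  obtain ⟨j, rfl⟩ := hodd
  rw [pow_mul, Nat.pow_mod, pow_succ, pow_mul] at hq
  have h4 : p ^ k % 4 < 4 := Nat.mod_lt _ (by norm_num)
  interval_cases h : p ^ k % 4
  · simp at hq
  · rfl
  · norm_num [Nat.mul_mod, Nat.pow_mod] at hq
    omega
  · norm_num [Nat.mul_mod, Nat.pow_mod] at hq

/-- Every subgroup of `SU^±(2,q)` not contained in `H` is in the list. -/
theorem exists_hasKind [Finite F] (hn : 0 < n) (hq : p ^ n % 4 = 1)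
    (hF : Nat.card F = (p ^ n) ^ 2) {G : Subgroup PGL(3, F)} (hG : G ≤ SUpm F p n)
    (hout : ¬ G ≤ SUone F p n) : ∃ t, Admissible p n t ∧ HasKind F p n G t := by
  obtain ⟨δ, hδ, hδq⟩ := exists_pow_eq_neg hn hq hF
  have h2 := two_ne_zero_of_mod F hn hq
  obtain ⟨e1, -⟩ := modelSU_map_toPGL3 h2 hδ hδq
  obtain ⟨K, hK, rfl⟩ : ∃ K ≤ modelSU F p n, K.map (toPGL3 (baseChange h2 hδ)) = G := by
    refine ⟨G.comap (toPGL3 (baseChange h2 hδ)), fun x hx => ?_, Subgroup.map_comap_eq_self ?_⟩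
    · obtain ⟨y, hy, hyx⟩ := e1.symm ▸ hG hx
      rwa [← toPGL3_injective _ hyx]
    · exact hG.trans (e1 ▸ Subgroup.map_le_range _ _)
  rw [map_toPGL3_le_SUone_iff h2 hδ hδq hK] at hout
  rcases exists_kind_or_eq_modelSU hn hq hF hK hout with ⟨t, ht, hk⟩ | ⟨k, hk, hodd, g, hg⟩
  · exact ⟨t, ht, hasKind_map_toPGL3 h2 hδ hδq hK hk⟩
  · refine ⟨.su k, ⟨hk, hodd⟩, hasKind_map_toPGL3 h2 hδ hδq hK (IsKind.of_conjSub (g := g) ?_)⟩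
    rw [hg]
    have hF' : Nat.card F = p ^ (n * 2) := by rw [hF, pow_mul]
    exact nonempty_equiv_SUpm_galoisField hF' (Nat.pos_of_dvd_of_pos hk hn)
      (by rw [mul_comm]; exact Nat.mul_dvd_mul_right hk 2) (pow_mod_four_of_odd hq hk hodd)

end Isomorphisms

/-! ### Explicit diagonal and antidiagonal matrices. -/

section Monomial

variable {F : Type*} [Field F]

/-- The diagonal matrix with entries `a`, `b`. -/
def dg (a b : Fˣ) : GL (Fin 2) F :=
  ⟨!![(a : F), 0; 0, (b : F)], !![((a⁻¹ : Fˣ) : F), 0; 0, ((b⁻¹ : Fˣ) : F)],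
    by simp [Matrix.one_fin_two], by simp [Matrix.one_fin_two]⟩

/-- The antidiagonal matrix with entries `a`, `b`. -/
def adg (a b : Fˣ) : GL (Fin 2) F :=
  ⟨!![0, (a : F); (b : F), 0], !![0, ((b⁻¹ : Fˣ) : F); ((a⁻¹ : Fˣ) : F), 0],
    by simp [Matrix.one_fin_two], by simp [Matrix.one_fin_two]⟩

lemma coe_dg (a b : Fˣ) : (dg a b).val = !![(a : F), 0; 0, (b : F)] := rfl

lemma coe_adg (a b : Fˣ) : (adg a b).val = !![0, (a : F); (b : F), 0] := rfl

lemma dg_mem_diagSub (a b : Fˣ) : dg a b ∈ diagSub F := mem_diagSub.mpr ⟨rfl, rfl⟩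

lemma isAntidiag_adg (a b : Fˣ) : IsAntidiag (adg a b) := ⟨rfl, rfl⟩

lemma det_dg (a b : Fˣ) : (dg a b).val.det = a * b := by
  rw [coe_dg, Matrix.det_fin_two_of, mul_zero, sub_zero]

lemma det_adg (a b : Fˣ) : (adg a b).val.det = -(a * b) := by
  rw [coe_adg, Matrix.det_fin_two_of, mul_zero, zero_sub]

lemma dg_one : dg (1 : Fˣ) 1 = 1 := Units.ext (by rw [coe_dg]; simp [Matrix.one_fin_two])

lemma dg_mul (a b c d : Fˣ) : dg a b * dg c d = dg (a * c) (b * d) :=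
  Units.ext (by rw [Units.val_mul, coe_dg, coe_dg, coe_dg]; simp)

lemma dg_pow (a b : Fˣ) (k : ℕ) : dg a b ^ k = dg (a ^ k) (b ^ k) := by
  induction k with
  | zero => simp [dg_one]
  | succ k ih => rw [pow_succ, ih, dg_mul, ← pow_succ, ← pow_succ]

lemma dg_inv (a b : Fˣ) : (dg a b)⁻¹ = dg a⁻¹ b⁻¹ := by
  rw [inv_eq_iff_mul_eq_one, dg_mul, mul_inv_cancel, mul_inv_cancel, dg_one]

lemma dg_neg (a b : Fˣ) : dg (-a) (-b) = -dg a b :=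
  Units.ext (by rw [Units.val_neg, coe_dg, coe_dg]; simp)

lemma dg_inj {a b c d : Fˣ} : dg a b = dg c d ↔ a = c ∧ b = d := by
  constructor
  · intro h
    exact ⟨Units.ext (congrArg (fun x : GL (Fin 2) F => x.val 0 0) h),
      Units.ext (congrArg (fun x : GL (Fin 2) F => x.val 1 1) h)⟩
  · rintro ⟨rfl, rfl⟩
    rfl

lemma orderOf_dg {a b : Fˣ} (h : b ^ orderOf a = 1) : orderOf (dg a b) = orderOf a := by
  apply Nat.dvd_antisymm
  · rw [orderOf_dvd_iff_pow_eq_one, dg_pow, pow_orderOf_eq_one, h, dg_one]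
  · have h1 := pow_orderOf_eq_one (dg a b)
    rw [dg_pow, ← dg_one, dg_inj] at h1
    exact orderOf_dvd_of_pow_eq_one h1.1

lemma orderOf_dg_inv (a : Fˣ) : orderOf (dg a a⁻¹) = orderOf a :=
  orderOf_dg (by rw [inv_pow, pow_orderOf_eq_one, inv_one])

lemma orderOf_dg_neg_inv {a : Fˣ} (h : Even (orderOf a)) : orderOf (dg a (-a⁻¹)) = orderOf a :=
  orderOf_dg (by rw [h.neg_pow, inv_pow, pow_orderOf_eq_one, inv_one])

lemma dg_inv_mem_detOne (a : Fˣ) : dg a a⁻¹ ∈ detOne F := by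
  rw [mem_detOne, det_dg, Units.mul_inv]

lemma det_dg_neg_inv (a : Fˣ) : (dg a (-a⁻¹)).val.det = -1 := by
  rw [det_dg, Units.val_neg, mul_neg, Units.mul_inv]

lemma dg_one_neg_one_sq : dg (1 : Fˣ) (-1) ^ 2 = 1 := by
  rw [dg_pow, one_pow, neg_one_sq, dg_one]

lemma commute_dg (a b c d : Fˣ) : Commute (dg a b) (dg c d) :=
  diag_commute (dg_mem_diagSub _ _) (dg_mem_diagSub _ _)

lemma zpowers_dg_le (a b : Fˣ) : Subgroup.zpowers (dg a b) ≤ diagSub F :=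
  Subgroup.zpowers_le.mpr (dg_mem_diagSub a b)

lemma adg_notMem_zpowers (a b c d : Fˣ) : adg a b ∉ Subgroup.zpowers (dg c d) := fun h =>
  (isAntidiag_adg a b).not_mem_diagSub (zpowers_dg_le c d h)

lemma notMem_detOne (h2 : (2 : F) ≠ 0) {x : GL (Fin 2) F} (hx : x.val.det = -1) :
    x ∉ detOne F := by
  rw [mem_detOne, hx]
  intro h
  exact h2 (by linear_combination -h)

lemma notMem_zpowers_of_det (h2 : (2 : F) ≠ 0) {a x : GL (Fin 2) F} (ha : a ∈ detOne F)
    (hx : x.val.det = -1) : x ∉ Subgroup.zpowers a := fun h =>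
  notMem_detOne h2 hx (Subgroup.zpowers_le.mpr ha h)

end Monomial

/-! ### Orders of units and the action of the Frobenius. -/

section Orders

variable {F : Type*} [Field F]

lemma exists_unit_orderOf [Finite F] {d : ℕ} (h : d ∣ Nat.card F - 1) : ∃ a : Fˣ, orderOf a = d := by
  obtain ⟨g, hg⟩ := IsCyclic.exists_ofOrder_eq_natCard (α := Fˣ)
  rw [Nat.card_units] at hg
  obtain ⟨c, hc⟩ := h
  have hpos : 0 < Nat.card F - 1 := by rw [← hg]; exact orderOf_pos g
  have hc0 : c ≠ 0 := by rintro rfl; omega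
  refine ⟨g ^ c, ?_⟩
  rw [orderOf_pow_of_dvd hc0 (by rw [hg, hc]; exact Dvd.intro_left _ rfl), hg, hc,
    Nat.mul_div_cancel _ (Nat.pos_of_ne_zero hc0)]

lemma pow_eq_self_of_orderOf {a : Fˣ} {q : ℕ} (hq : 0 < q) (h : orderOf a ∣ q - 1) :
    (a : F) ^ q = a := by
  have h1 := orderOf_dvd_iff_pow_eq_one.mp h
  rw [← Units.val_pow_eq_pow_val, show q = q - 1 + 1 by omega, pow_succ, h1, one_mul]

lemma pow_eq_inv_of_orderOf {a : Fˣ} {q : ℕ} (h : orderOf a ∣ q + 1) :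
    (a : F) ^ q = ((a⁻¹ : Fˣ) : F) := by
  have h1 := orderOf_dvd_iff_pow_eq_one.mp h
  rw [← Units.val_pow_eq_pow_val]
  congr 1
  rw [eq_inv_iff_mul_eq_one, ← pow_succ, h1]

lemma pow_half_of_orderOf {a : Fˣ} {d : ℕ} (hd : 0 < d) (ha : orderOf a = 2 * d) : a ^ d = -1 := by
  have h1 := pow_orderOf_eq_one a
  rw [ha, mul_comm, pow_mul, sq, Units.ext_iff, Units.val_mul, Units.val_one,
    mul_self_eq_one_iff] at h1
  rcases h1 with h1 | h1
  · exact absurd (Units.ext h1) (pow_ne_one_of_lt_orderOf hd.ne' (by omega))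
  · exact Units.ext h1

/-- The hypotheses say that q - 1 = dc with c odd; since a^d = -1, also a^(q-1) = -1. -/
lemma pow_eq_neg_of_orderOf {a : Fˣ} {q d : ℕ} (hq : 1 < q) (hd : d ∣ q - 1)
    (hd2 : ¬ d ∣ (q - 1) / 2) (ha : orderOf a = 2 * d) : (a : F) ^ q = -a := by
  obtain ⟨c, hc⟩ := hd
  have hd0 : 0 < d := Nat.pos_of_ne_zero (by rintro rfl; omega)
  have hodd : Odd c := by
    rw [← Nat.not_even_iff_odd]
    rintro ⟨j, rfl⟩
    apply hd2
    rw [hc, ← two_mul, mul_left_comm, Nat.mul_div_cancel_left _ two_pos]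
    exact Dvd.intro _ rfl
  rw [← Units.val_pow_eq_pow_val, show q = d * c + 1 by omega, pow_succ, pow_mul,
    pow_half_of_orderOf hd0 ha, hodd.neg_one_pow]
  simp

end Orders

/-! ### Membership of monomial matrices in the model and its conjugates. -/

section Occurrence

variable (F : Type*) [Field F] (p n : ℕ) [Fact p.Prime] [CharP F p]

/-- The type occurs among the subgroups of the model not contained in `detOne F`. -/
def OccursOutside (t : GroupKind) : Prop :=
  ∃ G ≤ modelSU F p n, ¬ G ≤ detOne F ∧ IsKind p (detOne F) G t

variable {F p n}

lemma occursOutside_of_conj (g : GL (Fin 2) F) {G : Subgroup (GL (Fin 2) F)}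
    (hG : G ≤ conjSub g⁻¹ (modelSU F p n)) (hout : ¬ G ≤ detOne F) {t : GroupKind}
    (h : IsKind p (detOne F) G t) : OccursOutside F p n t := by
  refine ⟨conjSub g G, ?_, by rwa [conjSub_le_detOne_iff], IsKind.of_conjSub (g := g⁻¹) ?_⟩
  · intro x hx
    rw [mem_conjSub] at hx
    have h1 := hG hx
    rw [mem_conjSub] at h1
    have e : g⁻¹⁻¹ * (g⁻¹ * x * g) * g⁻¹ = x := by group
    rwa [e] at h1
  · rwa [conjSub_conjSub, inv_mul_cancel, conjSub_one]

/-- A conjugate of the model in which the Frobenius acts as conjugation by the antidiagonal. -/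
lemma exists_nonsplit_frame {δ : F} (h2 : (2 : F) ≠ 0) (hδ : δ ≠ 0) (hδq : δ ^ p ^ n = -δ) :
    ∃ g : GL (Fin 2) F,
      (∀ a b : Fˣ, (a : F) ^ p ^ n = a * b * b → (b : F) ^ p ^ n = a * b * a →
        ((a : F) * b) ^ 2 = 1 → dg a b ∈ conjSub g⁻¹ (modelSU F p n)) ∧
      ∀ a b : Fˣ, (a : F) ^ p ^ n = -(a * b) * b → (b : F) ^ p ^ n = -(a * b) * a →
        ((a : F) * b) ^ 2 = 1 → adg a b ∈ conjSub g⁻¹ (modelSU F p n) := by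
  set φ := iterateFrobenius F p n with hφ
  have hdet : (!![δ, -δ; 1, 1] : Matrix (Fin 2) (Fin 2) F).det ≠ 0 := by
    rw [Matrix.det_fin_two_of]
    intro h
    have h3 : 2 * δ = 0 := by linear_combination h
    simp [h2, hδ] at h3
  let g : GL (Fin 2) F := Matrix.GeneralLinearGroup.mkOfDetNeZero _ hdet
  let S : Matrix (Fin 2) (Fin 2) F := !![0, 1; 1, 0]
  have hS : S * S = 1 := by simp [S, Matrix.one_fin_two]
  -- The columns (δ, 1) and (-δ, 1) of `g` are interchanged by the Frobenius.
  have hg : g.val.map φ = g.val * S := by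
    change (!![δ, -δ; 1, 1] : Matrix (Fin 2) (Fin 2) F).map φ = !![δ, -δ; 1, 1] * S
    have hd : φ δ = -δ := by rw [hφ, iterateFrobenius_def, hδq]
    ext i j
    fin_cases i <;> fin_cases j <;> simp [S, hd]
  have hgi : g⁻¹.val.map φ = S * g⁻¹.val := by
    have h1 : g.val.map φ * g⁻¹.val.map φ = 1 := by
      rw [← Matrix.map_mul, ← Units.val_mul, mul_inv_cancel]; simp
    have h3 : S * g⁻¹.val * (g.val * S) = 1 := by
      rw [mul_assoc, ← mul_assoc g⁻¹.val, ← Units.val_mul, inv_mul_cancel, Units.val_one, one_mul, hS]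
    calc _ = S * g⁻¹.val * (g.val * S) * g⁻¹.val.map φ := by rw [h3, one_mul]
      _ = _ := by rw [← hg, mul_assoc, h1, mul_one]
  -- After conjugation by `g` the equation of the model becomes S x^φ S = det x • x.
  have key : ∀ x : GL (Fin 2) F, S * x.val.map φ * S = x.val.det • x.val → x.val.det ^ 2 = 1 →
      x ∈ conjSub g⁻¹ (modelSU F p n) := by
    intro x hx hx2
    rw [mem_conjSub, inv_inv, mem_modelSU_iff, det_conj]
    refine ⟨?_, hx2⟩
    rw [Units.val_mul, Units.val_mul, Matrix.map_mul, Matrix.map_mul, ← hφ, hg, hgi]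
    calc _ = g.val * (S * x.val.map φ * S) * g⁻¹.val := by simp only [mul_assoc]
      _ = _ := by rw [hx, mul_smul_comm, smul_mul_assoc]
  refine ⟨g, fun a b ha hb hab => key _ ?_ (by rw [det_dg, hab]),
    fun a b ha hb hab => key _ ?_ (by rw [det_adg, neg_sq, hab])⟩
  · have ha' : φ a = a * b * b := by rw [hφ, iterateFrobenius_def, ha]
    have hb' : φ b = a * b * a := by rw [hφ, iterateFrobenius_def, hb]
    rw [det_dg, coe_dg]
    ext i j
    fin_cases i <;> fin_cases j <;> simp [S, Matrix.mul_apply, Matrix.vecMul, dotProduct, Fin.sum_univ_two, ha', hb']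
  · have ha' : φ a = -(a * b) * b := by rw [hφ, iterateFrobenius_def, ha]
    have hb' : φ b = -(a * b) * a := by rw [hφ, iterateFrobenius_def, hb]
    rw [det_adg, coe_adg]
    ext i j
    fin_cases i <;> fin_cases j <;> simp [S, Matrix.mul_apply, Matrix.vecMul, dotProduct, Fin.sum_univ_two, ha', hb']

lemma dg_mem_modelSU {a b : Fˣ} (ha : (a : F) ^ p ^ n = a * b * a)
    (hb : (b : F) ^ p ^ n = a * b * b) (h : ((a : F) * b) ^ 2 = 1) : dg a b ∈ modelSU F p n := by
  have hz : (0 : F) ^ p ^ n = 0 := zero_pow (pow_ne_zero _ (Fact.out : p.Prime).ne_zero)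
  rw [mem_modelSU, det_dg]
  refine ⟨fun i j => ?_, h⟩
  rw [coe_dg]
  fin_cases i <;> fin_cases j <;> simp [hz, ha, hb]

lemma adg_mem_modelSU {a b : Fˣ} (ha : (a : F) ^ p ^ n = -(a * b) * a)
    (hb : (b : F) ^ p ^ n = -(a * b) * b) (h : ((a : F) * b) ^ 2 = 1) :
    adg a b ∈ modelSU F p n := by
  have hz : (0 : F) ^ p ^ n = 0 := zero_pow (pow_ne_zero _ (Fact.out : p.Prime).ne_zero)
  rw [mem_modelSU, det_adg]
  refine ⟨fun i j => ?_, by rw [neg_sq, h]⟩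
  rw [coe_adg]
  fin_cases i <;> fin_cases j <;> simp [hz, ha, hb]

end Occurrence

/-! ### Occurrence of the cyclic, abelian, dihedral and dicyclic types. -/

section MonomialOccurrence

variable {F : Type*} [Field F] [Finite F] {p n : ℕ}

omit [Field F] [Finite F] in
lemma card_sub_one (hF : Nat.card F = (p ^ n) ^ 2) :
    Nat.card F - 1 = (p ^ n + 1) * (p ^ n - 1) := by
  rw [hF]
  simpa using Nat.sq_sub_sq (p ^ n) 1

/-- As q + 1 is even, 2d divides (q + 1)(q - 1) = |F| - 1. -/
lemma exists_orderOf_of_dvd_sub (hq : p ^ n % 4 = 1) (hF : Nat.card F = (p ^ n) ^ 2) {d : ℕ}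
    (h : d ∣ p ^ n - 1) : ∃ a : Fˣ, orderOf a = 2 * d :=
  exists_unit_orderOf (by rw [card_sub_one hF]; exact mul_dvd_mul (by omega) h)

lemma exists_orderOf_of_dvd_add (hF : Nat.card F = (p ^ n) ^ 2) {d : ℕ}
    (h : d ∣ p ^ n + 1) : ∃ a : Fˣ, orderOf a = d :=
  exists_unit_orderOf (by rw [card_sub_one hF]; exact Dvd.dvd.mul_right h _)

variable [Fact p.Prime] [CharP F p]

omit [Finite F] in
lemma notLe_detOne (h2 : (2 : F) ≠ 0) {G : Subgroup (GL (Fin 2) F)} {x : GL (Fin 2) F}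
    (hx : x ∈ G) (hd : x.val.det = -1) : ¬ G ≤ detOne F := fun h => notMem_detOne h2 hd (h hx)

lemma exists_split_involution (hn : 0 < n) (hq : p ^ n % 4 = 1) (hF : Nat.card F = (p ^ n) ^ 2) :
    ∃ a b : Fˣ, adg a b ∈ modelSU F p n ∧ (adg a b).val.det = -1 ∧ adg a b ^ 2 = 1 := by
  obtain ⟨δ, hδ, hδq⟩ := exists_pow_eq_neg hn hq hF
  let u := Units.mk0 δ hδ
  have hu : (u : F) ^ p ^ n = -u := hδq
  have h1 : (u : F) * ((u⁻¹ : Fˣ) : F) = 1 := Units.mul_inv u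
  have hd : (adg u u⁻¹).val.det = -1 := by rw [det_adg, h1]
  refine ⟨u, u⁻¹, adg_mem_modelSU ?_ ?_ ?_, hd, sq_eq_of_antidiag (isAntidiag_adg _ _) hd⟩
  · rw [h1, hu, neg_one_mul]
  · rw [h1, Units.val_inv_eq_inv_val, inv_pow, hu, inv_neg, neg_one_mul]
  · rw [h1, one_pow]

omit [Finite F] in
lemma dg_inv_mem_modelSU {a : Fˣ} (ha : (a : F) ^ p ^ n = a) : dg a a⁻¹ ∈ modelSU F p n := by
  apply dg_mem_modelSU
  · rw [Units.mul_inv, one_mul, ha]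
  · rw [Units.mul_inv, one_mul, Units.val_inv_eq_inv_val, inv_pow, ha]
  · rw [Units.mul_inv, one_pow]

omit [Finite F] in
lemma dg_neg_inv_mem_modelSU {a : Fˣ} (hq : p ^ n % 4 = 1) (ha : (a : F) ^ p ^ n = -a) :
    dg a (-a⁻¹) ∈ modelSU F p n := by
  have hodd : Odd (p ^ n) := by rw [Nat.odd_iff]; omega
  have h1 : (a : F) * ((-a⁻¹ : Fˣ) : F) = -1 := by rw [Units.val_neg, mul_neg, Units.mul_inv]
  apply dg_mem_modelSU
  · rw [h1, ha, neg_one_mul]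
  · rw [h1, Units.val_neg, Units.val_inv_eq_inv_val, hodd.neg_pow, inv_pow, ha, inv_neg,
      neg_one_mul]
  · rw [h1]; norm_num

lemma occursOutside_two (hn : 0 < n) (hq : p ^ n % 4 = 1) (hF : Nat.card F = (p ^ n) ^ 2) :
    OccursOutside F p n .two := by
  have h2 := two_ne_zero_of_mod F hn hq
  obtain ⟨a, b, hx, hd, hsq⟩ := exists_split_involution hn hq hF
  refine ⟨Subgroup.zpowers (adg a b), Subgroup.zpowers_le.mpr hx,
    notLe_detOne h2 (Subgroup.mem_zpowers _) hd, inferInstance, ?_⟩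
  rw [Nat.card_zpowers]
  exact orderOf_eq_prime hsq fun h => notMem_detOne h2 hd (h ▸ one_mem _)

lemma occursOutside_cyclic_split (hn : 0 < n) (hq : p ^ n % 4 = 1) (hF : Nat.card F = (p ^ n) ^ 2)
    {d : ℕ} (hd : d ∣ p ^ n - 1) (hd2 : ¬ d ∣ (p ^ n - 1) / 2) :
    OccursOutside F p n (.cyclic d) := by
  have h2 := two_ne_zero_of_mod F hn hq
  have hq1 := Nat.one_lt_pow hn.ne' (Fact.out : p.Prime).one_lt
  obtain ⟨a, ha⟩ := exists_orderOf_of_dvd_sub hq hF hd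
  refine ⟨Subgroup.zpowers (dg a (-a⁻¹)), Subgroup.zpowers_le.mpr (dg_neg_inv_mem_modelSU hq
    (pow_eq_neg_of_orderOf hq1 hd hd2 ha)),
    notLe_detOne h2 (Subgroup.mem_zpowers _) (det_dg_neg_inv a), inferInstance, ?_⟩
  rw [Nat.card_zpowers, orderOf_dg_neg_inv (by rw [ha]; exact even_two_mul d), ha]

/-- The torus of order `2(q+1)` and antidiagonal elements of determinant `1` and `-1`. -/
lemma exists_nonsplit_frame' (hn : 0 < n) (hq : p ^ n % 4 = 1) (hF : Nat.card F = (p ^ n) ^ 2) :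
    ∃ g : GL (Fin 2) F, (∀ a : Fˣ, orderOf a ∣ p ^ n + 1 → dg a a⁻¹ ∈ conjSub g⁻¹ (modelSU F p n)) ∧
      dg 1 (-1) ∈ conjSub g⁻¹ (modelSU F p n) ∧
      ∃ i : Fˣ, (i : F) ^ 2 = -1 ∧ adg i i ∈ conjSub g⁻¹ (modelSU F p n) ∧
        adg i (-i) ∈ conjSub g⁻¹ (modelSU F p n) := by
  have h2 := two_ne_zero_of_mod F hn hq
  have hodd : Odd (p ^ n) := by rw [Nat.odd_iff]; omega
  obtain ⟨δ, hδ, hδq⟩ := exists_pow_eq_neg hn hq hF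
  obtain ⟨ι, hι, hιq⟩ := exists_sq_eq_neg_one hn hq hF
  have hι0 : ι ≠ 0 := by
    rintro rfl
    norm_num at hι
  obtain ⟨g, h1, h3⟩ := exists_nonsplit_frame h2 hδ hδq
  refine ⟨g, fun a ha => h1 _ _ ?_ ?_ ?_, h1 _ _ ?_ ?_ ?_, Units.mk0 ι hι0, hι, h3 _ _ ?_ ?_ ?_,
    h3 _ _ ?_ ?_ ?_⟩
  · rw [Units.mul_inv, one_mul, pow_eq_inv_of_orderOf ha]
  · rw [Units.mul_inv, one_mul, Units.val_inv_eq_inv_val, inv_pow, pow_eq_inv_of_orderOf ha,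
      Units.val_inv_eq_inv_val, inv_inv]
  · rw [Units.mul_inv, one_pow]
  · simp
  · simp [hodd.neg_one_pow]
  · simp
  · rw [Units.val_mk0, hιq]
    linear_combination ι * hι
  · rw [Units.val_mk0, hιq]
    linear_combination ι * hι
  · rw [Units.val_mk0]
    linear_combination (ι ^ 2 - 1) * hι
  · rw [Units.val_neg, Units.val_mk0, hιq]
    linear_combination ι * hι
  · rw [Units.val_neg, Units.val_mk0, hodd.neg_pow, hιq]
    linear_combination -ι * hι
  · rw [Units.val_neg, Units.val_mk0]
    linear_combination (ι ^ 2 - 1) * hι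

/-- Both types come from one group, generated by an element of order d in the nonsplit torus of
determinant 1 and the commuting involution diag(1,-1); for odd d it is cyclic. -/
lemma occursOutside_abelian (hn : 0 < n) (hq : p ^ n % 4 = 1) (hF : Nat.card F = (p ^ n) ^ 2)
    {d : ℕ} (hd : d ∣ p ^ n + 1) :
    OccursOutside F p n (.abelian d) ∧ (Odd d → OccursOutside F p n (.cyclic d)) := by
  have h2 := two_ne_zero_of_mod F hn hq
  obtain ⟨a, ha⟩ := exists_orderOf_of_dvd_add hF hd
  have hd0 : 0 < d := Nat.pos_of_dvd_of_pos hd (Nat.succ_pos _)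
  have hao : orderOf (dg a a⁻¹) = d := by rw [orderOf_dg_inv, ha]
  obtain ⟨g, h1, hb, -⟩ := exists_nonsplit_frame' hn hq hF
  have hdet : (dg 1 (-1) : GL (Fin 2) F).val.det = -1 := by rw [det_dg]; simp
  have hle : Subgroup.zpowers (dg a a⁻¹) ⊔ Subgroup.zpowers (dg 1 (-1)) ≤
      conjSub g⁻¹ (modelSU F p n) :=
    sup_le (Subgroup.zpowers_le.mpr (h1 a (ha ▸ hd))) (Subgroup.zpowers_le.mpr hb)
  have hout := notLe_detOne h2 (Subgroup.mem_sup_right (S := Subgroup.zpowers (dg a a⁻¹))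
    (Subgroup.mem_zpowers (dg 1 (-1)))) hdet
  have hba := notMem_zpowers_of_det h2 (dg_inv_mem_detOne a) hdet
  exact ⟨occursOutside_of_conj g hle hout
    (isKind_abelian hd0 hao hba dg_one_neg_one_sq (commute_dg _ _ _ _)), fun hodd =>
    occursOutside_of_conj g hle hout (isCyclic_of_odd hodd hao hba dg_one_neg_one_sq
      (commute_dg _ _ _ _))⟩

omit [Finite F] in
lemma occursOutside_dihedral_of_mem (h2 : (2 : F) ≠ 0) (g : GL (Fin 2) F) {a u v : Fˣ} {d : ℕ}
    (hd : 0 < d) (ha : orderOf a = d) (hag : dg a a⁻¹ ∈ conjSub g⁻¹ (modelSU F p n))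
    (hug : adg u v ∈ conjSub g⁻¹ (modelSU F p n)) (hu : (adg u v).val.det = -1) :
    OccursOutside F p n (.dihedral d) :=
  occursOutside_of_conj g (G := Subgroup.zpowers (dg a a⁻¹) ⊔ Subgroup.zpowers (adg u v))
    (sup_le (Subgroup.zpowers_le.mpr hag) (Subgroup.zpowers_le.mpr hug))
    (notLe_detOne h2 (Subgroup.mem_sup_right (Subgroup.mem_zpowers _)) hu)
    (isKind_dihedral hd (by rw [orderOf_dg_inv, ha]) (adg_notMem_zpowers _ _ _ _)
      (sq_eq_of_antidiag (isAntidiag_adg _ _) hu)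
      (antidiag_conj (isAntidiag_adg _ _) (dg_mem_diagSub _ _)
        (mem_detOne.mp (dg_inv_mem_detOne a))))

lemma occursOutside_dihedral (hn : 0 < n) (hq : p ^ n % 4 = 1) (hF : Nat.card F = (p ^ n) ^ 2)
    {d : ℕ} (hd : d ∣ p ^ n - 1 ∨ d ∣ p ^ n + 1) : OccursOutside F p n (.dihedral d) := by
  have h2 := two_ne_zero_of_mod F hn hq
  have hq1 := Nat.one_lt_pow hn.ne' (Fact.out : p.Prime).one_lt
  rcases hd with hd | hd
  · obtain ⟨a, ha⟩ := exists_unit_orderOf (F := F) (d := d)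
      (by rw [card_sub_one hF]; exact Dvd.dvd.mul_left hd _)
    obtain ⟨u, v, hx, hu, -⟩ := exists_split_involution hn hq hF
    refine occursOutside_dihedral_of_mem h2 1 (Nat.pos_of_dvd_of_pos hd (by omega)) ha ?_ ?_ hu
    · rw [inv_one, conjSub_one]
      exact dg_inv_mem_modelSU (pow_eq_self_of_orderOf (by omega) (ha ▸ hd))
    · rwa [inv_one, conjSub_one]
  · obtain ⟨a, ha⟩ := exists_orderOf_of_dvd_add hF hd
    obtain ⟨g, h1, -, i, hi, -, hg⟩ := exists_nonsplit_frame' hn hq hF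
    refine occursOutside_dihedral_of_mem h2 g (Nat.pos_of_dvd_of_pos hd (by omega)) ha
      (h1 a (ha ▸ hd)) hg ?_
    rw [det_adg, Units.val_neg]
    linear_combination hi

lemma occursOutside_hatDic (hn : 0 < n) (hq : p ^ n % 4 = 1) (hF : Nat.card F = (p ^ n) ^ 2)
    {m : ℕ} (hm : m ∣ (p ^ n - 1) / 2) (hm2 : ¬ m ∣ (p ^ n - 1) / 4) :
    OccursOutside F p n (.hatDic m) := by
  have h2 := two_ne_zero_of_mod F hn hq
  have hq1 := Nat.one_lt_pow hn.ne' (Fact.out : p.Prime).one_lt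
  have hm0 : 0 < m := Nat.pos_of_dvd_of_pos hm (by omega)
  have hd : 2 * m ∣ p ^ n - 1 := by
    rw [show p ^ n - 1 = 2 * ((p ^ n - 1) / 2) by omega]
    exact mul_dvd_mul_left 2 hm
  -- As 4 divides `q - 1`, this is the hypothesis on `m` doubled; it makes a unit of order `4 * m`
  -- negated by the Frobenius.
  have hd2 : ¬ 2 * m ∣ (p ^ n - 1) / 2 := by
    rw [show (p ^ n - 1) / 2 = 2 * ((p ^ n - 1) / 4) by omega]
    exact fun h => hm2 (Nat.dvd_of_mul_dvd_mul_left two_pos h)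
  obtain ⟨a, ha⟩ := exists_orderOf_of_dvd_sub hq hF hd
  have hα := dg_neg_inv_mem_modelSU hq (pow_eq_neg_of_orderOf hq1 hd hd2 ha)
  have hdet := det_dg_neg_inv a
  have hεdet : (adg (1 : Fˣ) (-1)).val.det = 1 := by rw [det_adg]; simp
  have hε : adg (1 : Fˣ) (-1) ∈ modelSU F p n := by
    apply adg_mem_modelSU
    · simp
    · simp [Odd.neg_one_pow (show Odd (p ^ n) by rw [Nat.odd_iff]; omega)]
    · simp
  have hpow : dg a (-a⁻¹) ^ (2 * m) = -1 := by
    have h3 := pow_half_of_orderOf (by omega) ha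
    rw [dg_pow, (even_two_mul m).neg_pow, inv_pow, h3, inv_neg, inv_one, dg_neg, dg_one]
  refine ⟨Subgroup.zpowers (dg a (-a⁻¹)) ⊔ Subgroup.zpowers (adg 1 (-1)),
    sup_le (Subgroup.zpowers_le.mpr hα) (Subgroup.zpowers_le.mpr hε),
    notLe_detOne h2 (Subgroup.mem_sup_left (Subgroup.mem_zpowers _)) hdet,
    isKind_hatDic hm0 ?_ (notMem_detOne h2 hdet) ?_ (mem_detOne.mpr hεdet)
      (adg_notMem_zpowers _ _ _ _) ?_ ?_⟩
  · rw [orderOf_dg_neg_inv (by rw [ha]; exact even_two_mul _), ha]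
    ring
  · rw [mem_detOne, det_pow', hdet]
    norm_num
  · rw [hpow, sq_eq_of_antidiag' (isAntidiag_adg _ _) hεdet]
  · have hanti : IsAntidiag (adg (1 : Fˣ) (-1))⁻¹ := ⟨rfl, rfl⟩
    have h3 := antidiag_conj' hanti (dg_mem_diagSub a (-a⁻¹)) hdet
    rw [inv_inv] at h3
    rw [h3]
    have h4 : dg a (-a⁻¹) ^ (2 * m - 1) * dg a (-a⁻¹) = -1 := by
      rw [← pow_succ, Nat.sub_add_cancel (by omega), hpow]
    rw [eq_mul_inv_of_mul_eq h4, neg_one_mul]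

lemma occursOutside_dicSemi (hn : 0 < n) (hq : p ^ n % 4 = 1) (hF : Nat.card F = (p ^ n) ^ 2)
    {m : ℕ} (hm : m ∣ (p ^ n + 1) / 2) : OccursOutside F p n (.dicSemi m) := by
  have h2 := two_ne_zero_of_mod F hn hq
  have hm0 : 0 < m := Nat.pos_of_dvd_of_pos hm (by omega)
  have hd : 2 * m ∣ p ^ n + 1 := by
    rw [show p ^ n + 1 = 2 * ((p ^ n + 1) / 2) by omega]
    exact mul_dvd_mul_left 2 hm
  obtain ⟨a, ha⟩ := exists_orderOf_of_dvd_add hF hd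
  obtain ⟨g, h1, hb, i, hi, hε, -⟩ := exists_nonsplit_frame' hn hq hF
  have hεdet : (adg i i).val.det = 1 := by
    rw [det_adg]
    linear_combination -hi
  have hdet : (dg 1 (-1) : GL (Fin 2) F).val.det = -1 := by rw [det_dg]; simp
  have hpow : dg a a⁻¹ ^ m = -1 := by
    have h3 := pow_half_of_orderOf hm0 ha
    rw [dg_pow, inv_pow, h3, inv_neg, inv_one, dg_neg, dg_one]
  refine occursOutside_of_conj g
    (G := (Subgroup.zpowers (dg a a⁻¹) ⊔ Subgroup.zpowers (adg i i)) ⊔ Subgroup.zpowers (dg 1 (-1)))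
    (sup_le (sup_le (Subgroup.zpowers_le.mpr (h1 a (ha ▸ hd))) (Subgroup.zpowers_le.mpr hε))
      (Subgroup.zpowers_le.mpr hb))
    (notLe_detOne h2 (Subgroup.mem_sup_right (Subgroup.mem_zpowers _)) hdet)
    (isKind_dicSemi hm0 (by rw [orderOf_dg_inv, ha]) (dg_inv_mem_detOne a) (mem_detOne.mpr hεdet)
      (adg_notMem_zpowers _ _ _ _) ?_ (antidiag_conj (isAntidiag_adg _ _) (dg_mem_diagSub _ _)
        (mem_detOne.mp (dg_inv_mem_detOne a))) (notMem_detOne h2 hdet) dg_one_neg_one_sq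
      (commute_dg _ _ _ _) ?_)
  · rw [hpow, sq_eq_of_antidiag' (isAntidiag_adg _ _) hεdet]
  · rw [hpow, mul_inv_eq_iff_eq_mul]
    apply Units.ext
    rw [Units.val_mul, Units.val_mul, Units.val_mul, Units.val_neg, coe_dg, coe_adg]
    ext j k
    fin_cases j <;> fin_cases k <;> simp

end MonomialOccurrence

/-! ### Occurrence of GL(2,3). -/

section OctahedralOccurrence

variable {F : Type*} [Field F] [Finite F] {p n : ℕ} [Fact p.Prime] [CharP F p]

/-- A square root of `-2` outside the field with `p^n` elements. -/
lemma exists_sq_eq_neg_two (hn : 0 < n) (hq : p ^ n % 4 = 1) (hF : Nat.card F = (p ^ n) ^ 2)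
    (h8 : ¬ 8 ∣ p ^ n - 1) : ∃ θ : F, θ ^ 2 = -2 ∧ θ ^ p ^ n = -θ := by
  have h2 := two_ne_zero_of_mod F hn hq
  have h2q : (-2 : F) ^ p ^ n = -2 := by
    have h3 : ((2 : ℕ) : F) ^ p ^ n = 2 := by
      rw [← iterateFrobenius_def, map_natCast, Nat.cast_ofNat]
    rw [(show Odd (p ^ n) by rw [Nat.odd_iff]; omega).neg_pow]
    exact congrArg _ (by exact_mod_cast h3)
  obtain ⟨θ, hθ⟩ := isSquare_of_pow_eq hn hq hF h2q
  obtain ⟨ι, hι, hιq⟩ := exists_sq_eq_neg_one hn hq hF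
  refine ⟨θ, by rw [hθ, sq], ?_⟩
  have h4 : (θ ^ p ^ n) ^ 2 = θ ^ 2 := by
    rw [← pow_mul, mul_comm, pow_mul, sq θ, ← hθ, h2q]
  rcases sq_eq_sq_iff_eq_or_eq_neg.mp h4 with h5 | h5
  · exfalso
    have hθ0 : θ ≠ 0 := by
      rintro rfl
      apply h2
      linear_combination -hθ
    -- If θ were fixed by the Frobenius, so would be ζ. But ζ² = -ι, so ζ has order 8 and 8 would
    -- divide q - 1.
    set ζ := (1 + ι) * θ⁻¹ with hζ
    have hζ2 : ζ ^ 2 = -ι := by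
      have h6 : ζ * θ = 1 + ι := by rw [hζ, mul_assoc, inv_mul_cancel₀ hθ0, mul_one]
      have h7 : ζ ^ 2 * (-2) = (1 + ι) ^ 2 := by rw [hθ, ← h6]; ring
      apply mul_right_cancel₀ (neg_ne_zero.mpr h2)
      linear_combination h7 + hι
    have hζq : ζ ^ p ^ n = ζ := by
      have h6 : (1 + ι) ^ p ^ n = 1 + ι := by rw [add_pow_char_pow, one_pow, hιq]
      rw [hζ, mul_pow, inv_pow, h5, h6]
    have hζ4 : ζ ^ 4 = -1 := by
      rw [show ζ ^ 4 = (ζ ^ 2) ^ 2 by ring, hζ2, neg_sq, hι]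
    have hζ0 : ζ ≠ 0 := by
      intro h
      rw [h] at hζ4
      norm_num at hζ4
    have ho : orderOf ζ = 2 ^ 3 := by
      apply orderOf_eq_prime_pow
      · rw [show 2 ^ 2 = 4 by norm_num, hζ4]
        intro h
        exact h2 (by linear_combination -h)
      · rw [show ζ ^ 2 ^ (2 + 1) = (ζ ^ 4) ^ 2 by ring, hζ4, neg_one_sq]
    apply h8
    rw [show 8 = 2 ^ 3 by norm_num, ← ho, orderOf_dvd_iff_pow_eq_one]
    apply mul_right_cancel₀ hζ0
    rw [← pow_succ, Nat.sub_add_cancel (by omega), hζq, one_mul]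
  · exact h5

lemma occursOutside_sl23 (hn : 0 < n) (hq : p ^ n % 4 = 1) (hF : Nat.card F = (p ^ n) ^ 2)
    (hp5 : 5 ≤ p) (h8 : ¬ 8 ∣ p ^ n - 1) : OccursOutside F p n .sl23 := by
  have h2 := two_ne_zero_of_mod F hn hq
  have hodd : Odd (p ^ n) := by rw [Nat.odd_iff]; omega
  have h3 : (3 : F) ≠ 0 := by
    intro h
    have h4 : p ∣ 3 := (CharP.cast_eq_zero_iff F p 3).mp (by exact_mod_cast h)
    have := Nat.le_of_dvd (by norm_num) h4
    omega
  have h2q : (2 : F) ^ p ^ n = 2 := by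
    have h3 : ((2 : ℕ) : F) ^ p ^ n = 2 := by
      rw [← iterateFrobenius_def, map_natCast, Nat.cast_ofNat]
    exact_mod_cast h3
  have hz : (0 : F) ^ p ^ n = 0 := zero_pow (by omega)
  obtain ⟨θ, hθ, hθq⟩ := exists_sq_eq_neg_two hn hq hF h8
  obtain ⟨ι, hι, hιq⟩ := exists_sq_eq_neg_one hn hq hF
  -- The two matrices are chosen with traces θ and -1 and with product of trace 0, as
  -- `octGroup_equiv_GL` requires. The entries of the first are multiples of θ negated by the
  -- Frobenius, those of the second are fixed by it.
  have hAd : (!![0, -θ / 2; θ, θ] : Matrix (Fin 2) (Fin 2) F).det = -1 := by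
    rw [Matrix.det_fin_two_of]
    field_simp
    linear_combination hθ
  have hwd : (!![0, (1 + ι) / 2; ι - 1, -1] : Matrix (Fin 2) (Fin 2) F).det = 1 := by
    rw [Matrix.det_fin_two_of]
    field_simp
    linear_combination -hι
  let A : GL (Fin 2) F := Matrix.GeneralLinearGroup.mkOfDetNeZero _ (by rw [hAd]; norm_num)
  let w : GL (Fin 2) F := Matrix.GeneralLinearGroup.mkOfDetNeZero _ (by rw [hwd]; norm_num)
  have hAv : A.val = !![0, -θ / 2; θ, θ] := rfl
  have hwv : w.val = !![0, (1 + ι) / 2; ι - 1, -1] := rfl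
  rw [← hAv] at hAd
  rw [← hwv] at hwd
  have hA : A ∈ modelSU F p n := by
    rw [mem_modelSU, hAd]
    refine ⟨fun i j => ?_, by norm_num⟩
    rw [hAv]
    fin_cases i <;> fin_cases j <;> simp [hz, hθq, div_pow, hodd.neg_pow, h2q, neg_div]
  have hw : w ∈ modelSU F p n := by
    rw [mem_modelSU, hwd]
    refine ⟨fun i j => ?_, by norm_num⟩
    rw [hwv]
    have h6 : (1 + ι) ^ p ^ n = 1 + ι := by rw [add_pow_char_pow, one_pow, hιq]
    have h7 : (ι - 1) ^ p ^ n = ι - 1 := by rw [sub_pow_char_pow, one_pow, hιq]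
    fin_cases i <;> fin_cases j <;> simp [hz, div_pow, h2q, h6, h7, hodd.neg_one_pow]
  have hx : w * A ^ 2 * w⁻¹ ∈ modelSU F p n := mul_mem (mul_mem hw (pow_mem hA 2)) (inv_mem hw)
  refine ⟨octGroup A w, sup_le (sup_le (sup_le (Subgroup.zpowers_le.mpr (pow_mem hA 2))
    (Subgroup.zpowers_le.mpr hx)) (Subgroup.zpowers_le.mpr hw)) (Subgroup.zpowers_le.mpr hA),
    notLe_detOne h2 (Subgroup.mem_sup_right (Subgroup.mem_zpowers A)) hAd,
    (octGroup_equiv_GL h2 h3 hθ ?_ hAd ?_ hwd ?_).2⟩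
  · rw [hAv, Matrix.trace_fin_two_of, zero_add]
  · rw [hwv, Matrix.trace_fin_two_of, zero_add]
  · rw [Units.val_mul, hAv, hwv, Matrix.trace_fin_two]
    simp [Matrix.mul_apply, Fin.sum_univ_two]
    field_simp
    ring

end OctahedralOccurrence

/-! ### Occurrence of SU^± over subfields. -/

section SubfieldOccurrence

variable {F : Type*} [Field F] [Finite F] {p n : ℕ} [Fact p.Prime] [CharP F p]

omit [Finite F] in
-- The p^k-Frobenius multiplies entries by the determinant, and its square fixes them; so an odd
-- iterate acts on them as it does.
lemma modelSU_le_modelSU {k : ℕ} (hk : k ∣ n) (hodd : Odd (n / k)) (hk4 : p ^ k % 4 = 1) :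
    modelSU F p k ≤ modelSU F p n := by
  obtain ⟨m, rfl⟩ := hk
  rcases k.eq_zero_or_pos with rfl | hk0
  · simp
  rw [Nat.mul_div_cancel_left _ hk0] at hodd
  obtain ⟨j, rfl⟩ := hodd
  intro A hA
  have hd := det_pow_of_mem hk4 hA
  obtain ⟨h1, h2⟩ := mem_modelSU.mp hA
  refine mem_modelSU.mpr ⟨fun i l => ?_, h2⟩
  have h3 : ∀ t : ℕ, A.val i l ^ p ^ (k * (2 * t)) = A.val i l := by
    intro t
    induction t with
    | zero => simp
    | succ t ih =>
      rw [show k * (2 * (t + 1)) = k * (2 * t) + k + k by ring, pow_add, pow_add, pow_mul, pow_mul,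
        ih, h1, mul_pow, hd, h1, ← mul_assoc, ← sq, h2, one_mul]
  rw [show k * (2 * j + 1) = k * (2 * j) + k by ring, pow_add, pow_mul, h3, h1]

lemma occursOutside_su (hn : 0 < n) (hq : p ^ n % 4 = 1) (hF : Nat.card F = (p ^ n) ^ 2) {k : ℕ}
    (hk : k ∣ n) (hodd : Odd (n / k)) : OccursOutside F p n (.su k) := by
  have h2 := two_ne_zero_of_mod F hn hq
  have hk4 := pow_mod_four_of_odd hq hk hodd
  have hk0 := Nat.pos_of_dvd_of_pos hk hn
  have hF' : Nat.card F = p ^ (n * 2) := by rw [hF, pow_mul]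
  have hk1 := Nat.one_lt_pow hk0.ne' (Fact.out : p.Prime).one_lt
  -- A unit of order 2(p^k - 1) is negated by the p^k-Frobenius; it yields a diagonal element of
  -- determinant -1 in the smaller model.
  obtain ⟨a, ha⟩ := exists_orderOf_of_dvd_sub hq hF (Nat.pow_sub_one_dvd_pow_sub_one p hk)
  refine ⟨modelSU F p k, modelSU_le_modelSU hk hodd hk4, notLe_detOne h2 (dg_neg_inv_mem_modelSU hk4
    (pow_eq_neg_of_orderOf hk1 dvd_rfl (fun h => ?_) ha)) (det_dg_neg_inv a),
    nonempty_equiv_SUpm_galoisField hF' hk0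
      (by rw [mul_comm]; exact Nat.mul_dvd_mul_right hk 2) hk4⟩
  have := Nat.le_of_dvd (by omega) h
  omega

end SubfieldOccurrence

/-! ### Occurrence of the groups E ⋊ C. -/

section AffineOccurrence

variable {F : Type*} [Field F]

/-- The group of transvections with entries in `E`. -/
def transvGroup (E : AddSubgroup F) : Subgroup (GL (Fin 2) F) where
  carrier := transv '' E
  one_mem' := ⟨0, E.zero_mem, transv_zero⟩
  mul_mem' := by
    rintro _ _ ⟨s, hs, rfl⟩ ⟨t, ht, rfl⟩
    exact ⟨s + t, E.add_mem hs ht, transv_add s t⟩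
  inv_mem' := by
    rintro _ ⟨s, hs, rfl⟩
    exact ⟨-s, E.neg_mem hs, transv_neg s⟩

lemma card_transvGroup (E : AddSubgroup F) : Nat.card (transvGroup E) = Nat.card E :=
  (Nat.card_image_of_injective transv_injective (E : Set F))

lemma dg_mul_transv (a b : Fˣ) (t : F) :
    dg a b * transv t * (dg a b)⁻¹ = transv (((a * b⁻¹ : Fˣ) : F) * t) := by
  rw [mul_inv_eq_iff_eq_mul]
  apply Units.ext
  rw [Units.val_mul, Units.val_mul, coe_dg, coe_transv, coe_transv]
  ext i j
  fin_cases i <;> fin_cases j <;> simp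
  rw [mul_assoc, mul_assoc, mul_comm t, inv_mul_cancel_left₀ b.ne_zero]

variable {p : ℕ} [Fact p.Prime] [CharP F p]

lemma isKind_elemAb {N : Subgroup (GL (Fin 2) F)} {E : AddSubgroup F} {k d : ℕ}
    (hE : Nat.card E = p ^ k) {a b : Fˣ} (hab : orderOf (dg a b) = 2 * d)
    (h : ∀ t ∈ E, ((a * b⁻¹ : Fˣ) : F) * t ∈ E)
    (h' : ∀ t ∈ E, ((a⁻¹ * b : Fˣ) : F) * t ∈ E) :
    IsKind p N (transvGroup E ⊔ Subgroup.zpowers (dg a b)) (.elemAb k d) := by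
  refine ⟨transvGroup E, Subgroup.zpowers (dg a b), ⟨by rw [card_transvGroup, hE], ?_, ?_⟩,
    ⟨inferInstance, by rw [Nat.card_zpowers, hab]⟩, ?_, ?_, rfl⟩
  · rintro _ ⟨s, -, rfl⟩ _ ⟨t, -, rfl⟩
    rw [← transv_add, add_comm, transv_add]
  · rintro _ ⟨s, -, rfl⟩
    rw [transv_pow, CharP.cast_eq_zero, zero_mul, transv_zero]
  · refine sup_le Subgroup.le_normalizer (Subgroup.zpowers_le.mpr ?_)
    rw [Subgroup.mem_normalizer_iff]
    intro x
    constructor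
    · rintro ⟨t, ht, rfl⟩
      rw [dg_mul_transv]
      exact ⟨_, h t ht, rfl⟩
    · rintro ⟨t, ht, hx⟩
      have e : x = (dg a b)⁻¹ * transv t * (dg a b)⁻¹⁻¹ := by rw [hx]; group
      rw [e, dg_inv, dg_mul_transv, inv_inv]
      exact ⟨_, h' t ht, rfl⟩
  · rw [eq_bot_iff]
    rintro _ ⟨⟨t, -, rfl⟩, ht⟩
    have h1 := (mem_diagSub.mp (zpowers_dg_le a b ht)).1
    rw [coe_transv] at h1
    have h2 : t = 0 := by simpa using h1
    rw [h2, transv_zero]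
    exact one_mem _

/-- Vector spaces over a subfield, inside a larger subfield. -/
lemma exists_addSubgroup_of_subfield [Finite F] {L M : Subfield F} (hLM : L ≤ M) {r j : ℕ}
    (hL : 1 < Nat.card L) (hM : Nat.card M = Nat.card L ^ r) (hj : j ≤ r) :
    ∃ E : AddSubgroup F, E ≤ M.toAddSubgroup ∧ (∀ u ∈ L, ∀ t ∈ E, u * t ∈ E) ∧
      Nat.card E = Nat.card L ^ j := by
  let V : Submodule L F :=
    { carrier := M
      add_mem' := M.add_mem
      zero_mem' := M.zero_mem
      smul_mem' := fun c x hx => M.mul_mem (hLM c.2) hx }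
  -- The group sought is the `L`-span of the first `j` vectors of a basis of `M` over `L`.
  have hV : Module.finrank L V = r := by
    have := Fintype.ofFinite L
    have := Fintype.ofFinite V
    have h1 := Module.card_eq_pow_finrank (K := L) (V := V)
    rw [← Nat.card_eq_fintype_card, ← Nat.card_eq_fintype_card] at h1
    exact Nat.pow_right_injective hL (h1.symm.trans hM)
  let B := Module.finBasisOfFinrankEq L V hV
  let f : (Fin j → L) →ₗ[L] F :=
    V.subtype ∘ₗ Fintype.linearCombination L fun i => B (Fin.castLE hj i)
  have hf : Function.Injective f := by
    apply V.subtype_injective.comp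
    exact linearIndependent_iff_injective_fintypeLinearCombination.mp
      (B.linearIndependent.comp _ (Fin.castLE_injective hj))
  refine ⟨(LinearMap.range f).toAddSubgroup, ?_, ?_, ?_⟩
  · rintro _ ⟨c, rfl⟩
    exact (Fintype.linearCombination L (fun i => B (Fin.castLE hj i)) c).2
  · rintro u hu _ ⟨c, rfl⟩
    exact ⟨(⟨u, hu⟩ : L) • c, map_smul f _ _⟩
  · change Nat.card (LinearMap.range f) = _
    rw [← Nat.card_congr (LinearEquiv.ofInjective f hf).toEquiv]
    rw [Nat.card_fun, Nat.card_fin]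

/-- Take L with p^gcd(k,n) elements and E an L-subspace of F_q with p^k elements. Units of order
dividing d lie in L because gcd(p^k - 1, p^n - 1) = p^gcd(k,n) - 1. -/
lemma exists_addSubgroup_of_orderOf [Finite F] {n k d : ℕ} (hn : 0 < n) (hk : 1 ≤ k) (hkn : k ≤ n)
    (hF : Nat.card F = (p ^ n) ^ 2) (hd : d ∣ Nat.gcd (p ^ k - 1) (p ^ n - 1)) :
    ∃ (L : Subfield F) (E : AddSubgroup F), E ≤ (fixedField F p n).toAddSubgroup ∧
      (∀ u ∈ L, ∀ t ∈ E, u * t ∈ E) ∧ Nat.card E = p ^ k ∧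
      ∀ u : Fˣ, orderOf u ∣ d → (u : F) ∈ L := by
  have hF' : Nat.card F = p ^ (n * 2) := by rw [hF, pow_mul]
  have hp := (Fact.out : p.Prime).one_lt
  have hs : 0 < Nat.gcd k n := Nat.gcd_pos_of_pos_left _ hk
  obtain ⟨r, hr⟩ := Nat.gcd_dvd_right k n
  obtain ⟨j, hj⟩ := Nat.gcd_dvd_left k n
  have hL : Nat.card (fixedField F p (Nat.gcd k n)) = p ^ Nat.gcd k n :=
    card_fixedField hF' hs ((Nat.gcd_dvd_right k n).trans (Dvd.intro _ rfl))
  have hLM : fixedField F p (Nat.gcd k n) ≤ fixedField F p n := by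
    intro x hx
    rw [mem_fixedField] at hx ⊢
    have h4 : ∀ t : ℕ, x ^ p ^ (Nat.gcd k n * t) = x := by
      intro t
      induction t with
      | zero => simp
      | succ t ih => rw [mul_add, mul_one, pow_add, pow_mul, ih, hx]
    have h5 := h4 r
    rwa [← hr] at h5
  have hM : Nat.card (fixedField F p n) = Nat.card (fixedField F p (Nat.gcd k n)) ^ r := by
    rw [hL, card_fixedField hF' hn (Dvd.intro _ rfl), ← pow_mul, ← hr]
  have hjr : j ≤ r := by
    apply Nat.le_of_mul_le_mul_left _ hs
    rwa [← hr, ← hj]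
  obtain ⟨E, h1, h2, h3⟩ := exists_addSubgroup_of_subfield hLM
    (by rw [hL]; exact Nat.one_lt_pow hs.ne' hp) hM hjr
  refine ⟨_, E, h1, h2, by rw [h3, hL, ← pow_mul, ← hj], fun u hu => mem_fixedField.mpr ?_⟩
  apply pow_eq_self_of_orderOf (by positivity)
  rw [← Nat.pow_sub_one_gcd_pow_sub_one]
  exact hu.trans hd

lemma transv_mem_modelSU {n : ℕ} {t : F} (ht : t ^ p ^ n = t) : transv t ∈ modelSU F p n := by
  have hz : (0 : F) ^ p ^ n = 0 := zero_pow (pow_ne_zero _ (Fact.out : p.Prime).ne_zero)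
  have hd : (transv t).val.det = 1 := by rw [coe_transv]; simp
  rw [mem_modelSU, hd]
  refine ⟨fun i j => ?_, one_pow 2⟩
  rw [coe_transv]
  fin_cases i <;> fin_cases j <;> simp [hz, ht]

lemma exists_isKind_elemAb [Finite F] {n k d : ℕ} (hn : 0 < n) (hk : 1 ≤ k) (hkn : k ≤ n)
    (hF : Nat.card F = (p ^ n) ^ 2) (hd : d ∣ Nat.gcd (p ^ k - 1) (p ^ n - 1)) {a b : Fˣ}
    (hab : orderOf (dg a b) = 2 * d) (hab2 : (a * b⁻¹) ^ d = 1) (h : dg a b ∈ modelSU F p n) :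
    ∃ G ≤ modelSU F p n, dg a b ∈ G ∧ IsKind p (detOne F) G (.elemAb k d) := by
  obtain ⟨L, E, h1, h2, h3, h4⟩ := exists_addSubgroup_of_orderOf hn hk hkn hF hd
  refine ⟨transvGroup E ⊔ Subgroup.zpowers (dg a b), sup_le ?_ (Subgroup.zpowers_le.mpr h),
    Subgroup.mem_sup_right (Subgroup.mem_zpowers _), isKind_elemAb h3 hab
      (h2 _ (h4 _ (orderOf_dvd_of_pow_eq_one hab2))) (h2 _ (h4 _ ?_))⟩
  · rintro _ ⟨t, ht, rfl⟩
    exact transv_mem_modelSU (mem_fixedField.mp (h1 ht))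
  · apply orderOf_dvd_of_pow_eq_one
    rw [show a⁻¹ * b = (a * b⁻¹)⁻¹ by rw [mul_inv, inv_inv], inv_pow, hab2, inv_one]

/-- Let `a` have order 2d. If d does not divide (q - 1)/2, then a^q = -a, and diag(a, -a⁻¹) is a
complement outside SL(2,F); its ratio -a² has d-th power 1 because d is even. If d divides (q -
1)/2, then `a` lies in F_q, and diag(a, a⁻¹) serves, inside SL(2,F). -/
lemma exists_elemAb [Finite F] {n k d : ℕ} (hn : 0 < n) (hq : p ^ n % 4 = 1)
    (hF : Nat.card F = (p ^ n) ^ 2) (hk : 1 ≤ k) (hkn : k ≤ n)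
    (hd : d ∣ Nat.gcd (p ^ k - 1) (p ^ n - 1)) (hde : Even d) :
    (∃ G ≤ modelSU F p n, IsKind p (detOne F) G (.elemAb k d)) ∧
      (¬ d ∣ (p ^ n - 1) / 2 → OccursOutside F p n (.elemAb k d)) := by
  have h2 := two_ne_zero_of_mod F hn hq
  have hq1 := Nat.one_lt_pow hn.ne' (Fact.out : p.Prime).one_lt
  have hdn : d ∣ p ^ n - 1 := hd.trans (Nat.gcd_dvd_right _ _)
  have hd0 : 0 < d := Nat.pos_of_dvd_of_pos hdn (by omega)
  obtain ⟨a, ha⟩ := exists_orderOf_of_dvd_sub hq hF hdn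
  have ha2 : (a * a) ^ d = 1 := by rw [← sq, ← pow_mul, ← ha, pow_orderOf_eq_one]
  have houtside : ¬ d ∣ (p ^ n - 1) / 2 → OccursOutside F p n (.elemAb k d) := by
    intro hd2
    obtain ⟨G, hG, haG, h⟩ := exists_isKind_elemAb (a := a) (b := -a⁻¹) hn hk hkn hF hd
      (by rw [orderOf_dg_neg_inv (by rw [ha]; exact even_two_mul d), ha])
      (by rw [inv_neg, inv_inv, mul_neg, hde.neg_pow, ha2])
      (dg_neg_inv_mem_modelSU hq (pow_eq_neg_of_orderOf hq1 hdn hd2 ha))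
    exact ⟨G, hG, notLe_detOne h2 haG (det_dg_neg_inv a), h⟩
  refine ⟨?_, houtside⟩
  by_cases hd2 : d ∣ (p ^ n - 1) / 2
  · obtain ⟨G, hG, -, h⟩ := exists_isKind_elemAb (a := a) (b := a⁻¹) hn hk hkn hF hd
      (by rw [orderOf_dg_inv, ha]) (by rw [inv_inv, ha2])
      (dg_inv_mem_modelSU (pow_eq_self_of_orderOf (by omega) (by
        rw [ha, show p ^ n - 1 = 2 * ((p ^ n - 1) / 2) by omega]
        exact mul_dvd_mul_left 2 hd2)))
    exact ⟨G, hG, h⟩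
  · obtain ⟨G, hG, -, h⟩ := houtside hd2
    exact ⟨G, hG, h⟩

end AffineOccurrence

/-! ### Occurrence of all admissible types in the model. -/

section Occurrence

variable {F : Type*} [Field F] [Finite F] {p n : ℕ} [Fact p.Prime] [CharP F p]

/-- Every type occurs outside `detOne F`, up to the stated exception. -/
theorem occursOutside_of_admissible (hn : 0 < n) (hq : p ^ n % 4 = 1)
    (hF : Nat.card F = (p ^ n) ^ 2) {t : GroupKind} (ht : Admissible p n t)
    (h : ∀ k d : ℕ, t = GroupKind.elemAb k d → ¬ d ∣ (p ^ n - 1) / 2) :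
    OccursOutside F p n t := by
  cases t with
  | two => exact occursOutside_two hn hq hF
  | sl23 => exact occursOutside_sl23 hn hq hF ht.1 ht.2
  | cyclic d =>
    rcases ht.2 with ⟨h1, h2⟩ | ⟨h1, h2⟩
    · exact occursOutside_cyclic_split hn hq hF h1 h2
    · exact (occursOutside_abelian hn hq hF h1).2 h2
  | abelian d => exact (occursOutside_abelian hn hq hF ht.1).1
  | dihedral d => exact occursOutside_dihedral hn hq hF ht
  | hatDic m => exact occursOutside_hatDic hn hq hF ht.1 ht.2
  | dicSemi m => exact occursOutside_dicSemi hn hq hF ht.2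
  | elemAb k d =>
    obtain ⟨h1, h2, h3, h4⟩ := ht
    exact (exists_elemAb hn hq hF h1 h2 h3 h4).2 (h k d rfl)
  | su k => exact occursOutside_su hn hq hF ht.1 ht.2

theorem exists_isKind_of_admissible (hn : 0 < n) (hq : p ^ n % 4 = 1)
    (hF : Nat.card F = (p ^ n) ^ 2) {t : GroupKind} (ht : Admissible p n t) :
    ∃ G ≤ modelSU F p n, IsKind p (detOne F) G t := by
  by_cases h : ∃ k d : ℕ, t = GroupKind.elemAb k d
  · obtain ⟨k, d, rfl⟩ := h
    obtain ⟨h1, h2, h3, h4⟩ := ht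
    exact (exists_elemAb hn hq hF h1 h2 h3 h4).1
  · obtain ⟨G, hG, -, h⟩ := occursOutside_of_admissible hn hq hF ht
      fun k d hkd => absurd ⟨k, d, hkd⟩ h
    exact ⟨G, hG, h⟩

end Occurrence

end HermitianSU

/-! ### The theorem for SU^±(2,q) inside PGL(3,F). -/

theorem mainTheorem1 (p n : ℕ) [Fact p.Prime] (hn : 0 < n) (hq : p ^ n % 4 = 1)
    (F : Type*) [Field F] [CharP F p] (hF : Nat.card F = (p ^ n) ^ 2) :
    -- `H ≅ SL(2,q)` and `SU^±(2,q) = H ⋊ C_2`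
    (Nonempty (SUone F p n ≃* Matrix.SpecialLinearGroup (Fin 2) (GaloisField p n)) ∧
      ∃ B : Subgroup PGL(3, F), Nat.card B = 2 ∧ IsSemidirect (SUone F p n) B (SUpm F p n)) ∧
    -- every subgroup of `SU^±(2,q)` is in the list
    (∀ G : Subgroup PGL(3, F), G ≤ SUpm F p n →
      G ≤ SUone F p n ∨ ∃ t : GroupKind, Admissible p n t ∧ HasKind F p n G t) ∧
    -- every type in the list occurs among the subgroups of `SU^±(2,q)`
    (∀ t : GroupKind, Admissible p n t →
      ∃ G : Subgroup PGL(3, F), G ≤ SUpm F p n ∧ HasKind F p n G t) ∧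
    -- and it occurs outside `H`, except for `E_{p^k} ⋊ C_{2d}` with `d ∣ (q - 1) / 2`
    (∀ t : GroupKind, Admissible p n t →
      (∀ k d : ℕ, t = GroupKind.elemAb k d → ¬ d ∣ (p ^ n - 1) / 2) →
      ∃ G : Subgroup PGL(3, F), G ≤ SUpm F p n ∧ ¬ G ≤ SUone F p n ∧ HasKind F p n G t) := by
  have : Finite F := Nat.finite_of_card_ne_zero (by
    rw [hF]
    exact pow_ne_zero _ (pow_ne_zero _ (Fact.out : p.Prime).ne_zero))
  obtain ⟨δ, hδ, hδq⟩ := exists_pow_eq_neg hn hq hF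
  have h2 := two_ne_zero_of_mod F hn hq
  obtain ⟨e1, -⟩ := modelSU_map_toPGL3 h2 hδ hδq
  refine ⟨⟨nonempty_SUone_equiv hn hq hF, exists_isSemidirect_SUpm hn hq hF⟩, fun G hG => ?_,
    fun t ht => ?_, fun t ht h => ?_⟩
  · by_cases hout : G ≤ SUone F p n
    · exact Or.inl hout
    · exact Or.inr (exists_hasKind hn hq hF hG hout)
  · obtain ⟨G, hG, hk⟩ := exists_isKind_of_admissible hn hq hF ht
    exact ⟨_, e1 ▸ Subgroup.map_mono hG, hasKind_map_toPGL3 h2 hδ hδq hG hk⟩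
  · obtain ⟨G, hG, hout, hk⟩ := occursOutside_of_admissible hn hq hF ht h
    exact ⟨_, e1 ▸ Subgroup.map_mono hG, by rwa [map_toPGL3_le_SUone_iff h2 hδ hδq hG],
      hasKind_map_toPGL3 h2 hδ hδq hG hk⟩
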